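/- **Proposition ($\mathtt F_0,\mathtt F_1$ via hypergeometric series).** *The functions $\mathtt F_g$.* Let $E_2,E_4,E_6$ be the Eisenstein series and $\eta=q^{1/24}\prod_{m\ge1}(1-q^m)$. For $g\in\{0,1\}$ and $n\ge1$ consider $q$-series $$Z_{g;n}(q)=P_{g,n}(E_2,E_4,E_6)\,\frac{q^{n/2}}{\eta(q)^{12n}},\qquad P_{g,n}\in\mathbb Q[E_2,E_4,E_6]\ \text{of weight } 2g+6n-2,$$ with $Z_{0;1}=q^{1/2}E_4/\eta^{12}$, which satisfy the holomorphic anomaly equation $$\frac{\partial Z_{g;n}}{\partial E_2}=\frac1{24}\sum_{g'+g''=g}\ \sum_{s=1}^{n-1}s(n-s)Z_{g';s}Z_{g'';n-s}+\frac{n(n+1)}{24}Z_{g-1;n}\qquad(Z_{-1;n}=0)$$ and the gap conditions: if $\tilde Z_{h;n}$ is defined by $Z_{g;n}(q)=\sum_{k\mid n}k^{2g-3}\sum_{h=0}^g C(h,g-h)\tilde Z_{h;n/k}(q^k)$, where $\big(\tfrac{\sin(t/2)}{t/2}\big)^{2h-2}=\sum_k C(h,k)t^{2k}$, then $\tilde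 Z_{h;n}$ has no terms of degree less than $n$ in $q$ for $n\ge2$, and $\tilde Z_{h;1}$ has no terms of degree less than $h$. Put $\mathtt F_g(q,p)=\sum_{n\ge1}Z_{g;n}(q)p^n$. *The hypergeometric series.* Let $$c(n,m)=\frac{\Gamma(1+6n)}{\Gamma(1+3n)\Gamma(1+2n)\Gamma(1+n-m)\Gamma(1+m)^2\Gamma(1-m)},$$ $w_0(x,y,\rho_1,\rho_2)=\sum_{n,m\ge0}c(n+\rho_1,m+\rho_2)x^{n+\rho_1}y^{m+\rho_2}$ and $w_0(x,y)=w_0(x,y,0,0)$. All $\rho$-derivatives below are taken at $\rho_1=\rho_2=0$; they are polynomials in $\log x,\log y$ with coefficients in $\mathbb C[[x,y]]$. Let $2\pi\sqrt{-1}\,t_i=\partial_{\rho_i}w_0/w_0$, $q=e^{2\pi\sqrt{-1}t_1}\in x\,\mathbb C[[x,y]]$, $p=e^{2\pi\sqrt{-1}t_2}\in y\,\mathbb C[[x,y]]$. For a series $f(q,p)$ let $f_{>0}$ be the sum of its terms of positive degree in $p$. All identities are identities of formal power series. Then: 1. The mirror map $(x,y)\mapsto(q,p)$ has a unique formal inverse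 without constant terms; it is of the form $x=x(q)$, $y=y(q,p)$, and $x(q)(1-432x(q))=1/j(q)$, where $1/j=\eta^{24}/E_4^3$. The series $w_0(x,y)$ does not depend on $y$, and $w_0(x(q),y(q,p))=E_4(q)^{1/4}$. 2. The $Z_{g;n}$ with $g\in\{0,1\}$, $n\ge1$ exist. For every such solution (which is therefore unique): (a) the logarithms cancel in $$h(x,y)=\frac{\partial_{\rho_1}\partial_{\rho_2}w_0}{w_0}-\frac{\partial_{\rho_1}w_0}{w_0}\,\frac{\partial_{\rho_2}w_0}{w_0}\in\mathbb C[[x,y]],\qquad\text{and}\qquad \frac1{2\pi\sqrt{-1}}\frac{\partial\mathtt F_0}{\partial t_2}=p\,\frac{\partial \mathtt F_0}{\partial p}=-\,h\big(x(q),y(q,p)\big)_{>0};$$ (b) $$\mathtt F_1(q,p)=\Big(\frac12\log\Big\{\big[(1-432x(1-y))(1-y)\big]^{-\frac16}\,\frac{1}{2\pi\sqrt{-1}\,p}\frac{\partial y}{\partial t_2}\Big\}\Big|_{x=x(q),\,y=y(q,p)}\Big)_{>0},\qquad \frac{1}{2\pi\sqrt{-1}\,p}\frac{\partial y}{\partial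 t_2}=\frac{\partial y}{\partial p};$$ that is, $\mathtt F_1=\tfrac12\log\{[(1-432x(1-y))(1-y)]^{-1/6}\,\partial y/\partial t_2\}$ up to terms that, apart from $\tfrac12\log(2\pi\sqrt{-1}\,p)$, do not depend on $p$. In particular the coefficients of $p^n$, $n\ge1$, of this expression satisfy the holomorphic anomaly equation at genus one. 3. With $\theta_x=x\partial_x$, $\theta_y=y\partial_y$, the series $w_0$, $\partial_{\rho_1}w_0$, $\partial_{\rho_2}w_0$ and $(2\partial_{\rho_1}\partial_{\rho_2}+\partial_{\rho_1}^2)w_0$ are annihilated by $$\theta_x(\theta_x-\theta_y)-12x(6\theta_x+1)(6\theta_x+5)\quad\text{and}\quad\theta_y^2+y\,\theta_y(\theta_x-\theta_y),$$ and $dis_0=(1-432x(1-y))(1-y)$ is a component of the discriminant of this system: for $xy\ne0$, the characteristic variety of the system (the common zeros of the principal symbols of all operators $\sum a_{kl}(x,y)\theta_x^k\theta_y^l$, $a_{kl}\in\mathbb C[x,y]$, in the left ideal generated by these two) contains a nonzero covector over $(x,y)$ if and only if $(1-432x)\,dis_0(x,y)=0$. -/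

import Mathlib

noncomputable section

namespace HalfK3

/-! ### Formal power series -/

/-- Formal power series in two variables over `ℂ`: in `(x, y)` on the hypergeometric side, in
`(q, p)` on the enumerative side. The variable with index `0` is `x`, resp. `q`; the variable
with index `1` is `y`, resp. `p`. -/
abbrev Series2 : Type := MvPowerSeries (Fin 2) ℂ

/-- A power series in the first variable alone, seen as a series in two variables. -/
def inFirst (f : PowerSeries ℂ) : Series2 :=
  PowerSeries.subst (MvPowerSeries.X 0 : Series2) f

/-- `exp f`, for `f` without constant term. -/
def fexp (f : Series2) : Series2 := PowerSeries.subst f (PowerSeries.exp ℂ)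

/-- `log f`, for `f` with constant term `1`. -/
def flog (f : Series2) : Series2 := PowerSeries.subst (f - 1) (PowerSeries.log ℂ)

/-- `f ^ r`, for `f` with constant term `1` (binomial series in `f - 1`). -/
def fpow (f : Series2) (r : ℂ) : Series2 :=
  PowerSeries.subst (f - 1) (PowerSeries.binomialSeries ℂ r)

/-- The part of a series in `(q, p)` consisting of the terms of positive degree in `p`. -/
def posPart (f : Series2) : Series2 :=
  fun e => if e 1 = 0 then 0 else MvPowerSeries.coeff e f

/-! ### Eisenstein series, the eta product and `1 / j` as `q`-series -/

/-- `E₂ = 1 - 24 ∑ σ₁(n) qⁿ`. -/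
def E2 : PowerSeries ℚ :=
  PowerSeries.mk fun n => if n = 0 then 1 else -24 * (ArithmeticFunction.sigma 1 n : ℚ)

/-- `E₄ = 1 + 240 ∑ σ₃(n) qⁿ`. -/
def E4 : PowerSeries ℚ :=
  PowerSeries.mk fun n => if n = 0 then 1 else 240 * (ArithmeticFunction.sigma 3 n : ℚ)

/-- `E₆ = 1 - 504 ∑ σ₅(n) qⁿ`. -/
def E6 : PowerSeries ℚ :=
  PowerSeries.mk fun n => if n = 0 then 1 else -504 * (ArithmeticFunction.sigma 5 n : ℚ)

/-- `∏_{m ≥ 1} (1 - q ^ m) = q ^ (-1/24) η(q)`; the factors with `m > n` do not contribute to the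
coefficient of `q ^ n`. -/
def etaProd : PowerSeries ℚ :=
  PowerSeries.mk fun n =>
    PowerSeries.coeff n (∏ m ∈ Finset.Icc 1 n, (1 - (PowerSeries.X : PowerSeries ℚ) ^ m))

/-- `1 / j(q) = η(q) ^ 24 / E₄(q) ^ 3 = q - 744 q ^ 2 + ⋯`. -/
def jInv : PowerSeries ℚ := PowerSeries.X * etaProd ^ 24 * (E4 ^ 3)⁻¹

/-- A rational `q`-series with its coefficients regarded as complex numbers. -/
def toComplex (f : PowerSeries ℚ) : PowerSeries ℂ := PowerSeries.map (algebraMap ℚ ℂ) f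

/-! ### The holomorphic anomaly equation for the functions `Z_{g;n}` -/

/-- The value `P(E₂, E₄, E₆)` of a polynomial, as a `q`-series. -/
def evalE (P : MvPolynomial (Fin 3) ℚ) : PowerSeries ℚ :=
  MvPolynomial.aeval ![E2, E4, E6] P

/-- `sin(t/2) / (t/2)`. -/
def sincHalf : PowerSeries ℚ :=
  PowerSeries.mk fun n => PowerSeries.coeff (n + 1) (PowerSeries.sin ℚ) * (1 / 2) ^ n

/-- The numbers `C(h, k)` given by `(sin(t/2) / (t/2)) ^ (2 h - 2) = ∑_k C(h, k) t ^ (2 k)`. -/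
def gvCoeff (h k : ℕ) : ℚ :=
  PowerSeries.coeff (2 * k) (sincHalf ^ (2 * h) * (sincHalf⁻¹) ^ 2)

/-- The multiple cover formula of Gopakumar and Vafa, up to genus `G`, relating `Z_{g;n}` to the
generating functions `B_{h;n}` of BPS numbers:
`Z_{g;n}(q) = ∑_{k ∣ n} k ^ (2g-3) ∑_{h ≤ g} C(h, g-h) B_{h;n/k}(q ^ k)`. -/
def IsBPS (G : ℕ) (Z B : ℕ → ℕ → PowerSeries ℚ) : Prop :=
  ∀ g ≤ G, ∀ n ≥ 1, Z g n = ∑ k ∈ n.divisors, ((k : ℚ) ^ (2 * (g : ℤ) - 3)) •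
    ∑ h ∈ Finset.range (g + 1), gvCoeff h (g - h) •
      PowerSeries.subst ((PowerSeries.X : PowerSeries ℚ) ^ k) (B h (n / k))

/-- The vanishing (gap) conditions on BPS numbers up to genus `G`: for `n ≥ 2` the series
`B_{h;n}` has no term of degree `< n`, and `B_{h;1}` has no term of degree `< h`. -/
def HasGap (G : ℕ) (B : ℕ → ℕ → PowerSeries ℚ) : Prop :=
  (∀ h ≤ G, ∀ n ≥ 2, ∀ d < n, PowerSeries.coeff d (B h n) = 0) ∧
  (∀ h ≤ G, ∀ d < h, PowerSeries.coeff d (B h 1) = 0)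

/-- `Z g n` (`g ≤ G`, `n ≥ 1`) is the solution up to genus `G` of the holomorphic anomaly equation
with the gap conditions. Here `P g n` is the polynomial `P_{g,n}` in
`Z_{g;n} = P_{g,n}(E₂,E₄,E₆) q^{n/2} / η^{12n} = P_{g,n}(E₂,E₄,E₆) / ∏ (1 - q^m)^{12n}`, and
`∂ Z_{g;n} / ∂ E₂` is the derivative of `P_{g,n}` in its first variable, evaluated, divided by
`∏ (1 - q^m)^{12n}`. -/
structure IsAnomalySolutionWith (G : ℕ) (P : ℕ → ℕ → MvPolynomial (Fin 3) ℚ)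
    (Z : ℕ → ℕ → PowerSeries ℚ) : Prop where
  weight : ∀ g ≤ G, ∀ n ≥ 1,
    MvPolynomial.IsWeightedHomogeneous ![2, 4, 6] (P g n) (2 * g + 6 * n - 2)
  form : ∀ g ≤ G, ∀ n ≥ 1, Z g n = evalE (P g n) * (etaProd⁻¹) ^ (12 * n)
  initial : Z 0 1 = E4 * (etaProd⁻¹) ^ 12
  anomaly : ∀ g ≤ G, ∀ n ≥ 1,
    evalE (MvPolynomial.pderiv 0 (P g n)) * (etaProd⁻¹) ^ (12 * n) =
      (1 / 24 : ℚ) • (∑ a ∈ Finset.HasAntidiagonal.antidiagonal g, ∑ s ∈ Finset.Ico 1 n,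
        (s * (n - s) : ℕ) • (Z a.1 s * Z a.2 (n - s))) +
      ((n * (n + 1) : ℚ) / 24) • (if g = 0 then 0 else Z (g - 1) n)
  gap : ∃ B, IsBPS G Z B ∧ HasGap G B

/-- `Z` solves the holomorphic anomaly equation with the gap conditions up to genus `G`. -/
def IsAnomalySolution (G : ℕ) (Z : ℕ → ℕ → PowerSeries ℚ) : Prop :=
  ∃ P, IsAnomalySolutionWith G P Z

/-- `F_g(q, p) = ∑_{n ≥ 1} Z_{g;n}(q) p ^ n`. -/
def genF (Z : ℕ → ℕ → PowerSeries ℚ) (g : ℕ) : Series2 :=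
  fun e => if e 1 = 0 then 0 else ((PowerSeries.coeff (e 0) (Z g (e 1)) : ℚ) : ℂ)

/-! ### The hypergeometric series -/

/-- `c(n, m)` for complex arguments. Since `(Complex.Gamma s)⁻¹ = 0` at the poles of `Γ`,
the expression `(Complex.Gamma s)⁻¹` is the entire function `1 / Γ(s)`. -/
def c (n m : ℂ) : ℂ :=
  Complex.Gamma (1 + 6 * n) * (Complex.Gamma (1 + 3 * n))⁻¹ * (Complex.Gamma (1 + 2 * n))⁻¹ *
    (Complex.Gamma (1 + n - m))⁻¹ * ((Complex.Gamma (1 + m))⁻¹) ^ 2 * (Complex.Gamma (1 - m))⁻¹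

/-- `∑_{n,m} (∂_{ρ₁}^i ∂_{ρ₂}^j c(n + ρ₁, m + ρ₂)) |_{ρ = 0} x ^ n y ^ m`. -/
def jet (i j : ℕ) : Series2 :=
  fun e => iteratedDeriv i (fun r₁ : ℂ =>
    iteratedDeriv j (fun r₂ : ℂ => c ((e 0 : ℂ) + r₁) ((e 1 : ℂ) + r₂)) 0) 0

/-- `w₀(x, y) = ∑ c(n, m) x ^ n y ^ m`. -/
def w0 : Series2 := jet 0 0

/-- Polynomials in `log x` (the variable `MvPolynomial.X 0`) and `log y` (the variable
`MvPolynomial.X 1`) over the power series in `x` and `y`. -/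
abbrev LogSeries : Type := MvPolynomial (Fin 2) Series2

/-- `∂_{ρ₁}^i ∂_{ρ₂}^j w₀(x, y, ρ₁, ρ₂) |_{ρ = 0}`, where
`w₀(x, y, ρ₁, ρ₂) = x ^ ρ₁ y ^ ρ₂ ∑ c(n + ρ₁, m + ρ₂) x ^ n y ^ m`, by the Leibniz rule:
`x ^ ρ₁ y ^ ρ₂ = exp (ρ₁ log x + ρ₂ log y)`, so that each derivative of this factor in `ρ₁`,
`ρ₂` produces a factor `log x`, `log y`. -/
def dw (i j : ℕ) : LogSeries :=
  ∑ k ∈ Finset.range (i + 1), ∑ l ∈ Finset.range (j + 1),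
    (i.choose k * j.choose l) •
      (MvPolynomial.C (jet (i - k) (j - l)) * MvPolynomial.X 0 ^ k * MvPolynomial.X 1 ^ l)

/-- `2 π √-1 t₁ = ∂_{ρ₁} w₀ / w₀`. -/
def logT1 : LogSeries := MvPolynomial.C w0⁻¹ * dw 1 0

/-- `2 π √-1 t₂ = ∂_{ρ₂} w₀ / w₀`. -/
def logT2 : LogSeries := MvPolynomial.C w0⁻¹ * dw 0 1

/-- `q = exp (2 π √-1 t₁)` as a series in `x, y`: since `2 π √-1 t₁ = log x + jet 1 0 / w₀`
(see `logT1_eq`), it is `x · exp (jet 1 0 / w₀)`. -/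
def qSeries : Series2 := MvPowerSeries.X 0 * fexp (w0⁻¹ * jet 1 0)

/-- `p = exp (2 π √-1 t₂)` as a series in `x, y`, see `logT2_eq`. -/
def pSeries : Series2 := MvPowerSeries.X 1 * fexp (w0⁻¹ * jet 0 1)

/-- `f(x, y)` for series `x, y` without constant terms. -/
def comp (f x y : Series2) : Series2 := MvPowerSeries.subst ![x, y] f

/-- `x = x(q, p)`, `y = y(q, p)` is the inverse of `q = q(x, y)`, `p = p(x, y)`. -/
def IsInverseMirrorMap (x y : Series2) : Prop :=
  MvPowerSeries.constantCoeff x = 0 ∧ MvPowerSeries.constantCoeff y = 0 ∧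
    comp qSeries x y = MvPowerSeries.X 0 ∧ comp pSeries x y = MvPowerSeries.X 1

/-- `dis₀ = (1 - 432 x (1 - y)) (1 - y)`, in any commutative ring. -/
def dis0 {R : Type*} [CommRing R] (x y : R) : R := (1 - 432 * x * (1 - y)) * (1 - y)

theorem constantCoeff_w0 : MvPowerSeries.constantCoeff w0 = 1 := by
  rw [← MvPowerSeries.coeff_zero_eq_constantCoeff_apply]
  change jet 0 0 0 = 1
  simp [jet, c]

theorem w0_inv_mul : w0⁻¹ * w0 = 1 :=
  MvPowerSeries.inv_mul_cancel _ (by rw [constantCoeff_w0]; exact one_ne_zero)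

theorem logT1_eq : logT1 = MvPolynomial.X 0 + MvPolynomial.C (w0⁻¹ * jet 1 0) := by
  have h : dw 1 0 = MvPolynomial.C (jet 1 0) + MvPolynomial.C w0 * MvPolynomial.X 0 := by
    simp [dw, Finset.sum_range_succ, w0]
  have h2 : (MvPolynomial.C w0⁻¹ * MvPolynomial.C w0 : LogSeries) = 1 := by
    rw [← MvPolynomial.C_mul, w0_inv_mul, MvPolynomial.C_1]
  rw [logT1, h, mul_add, ← mul_assoc, h2, one_mul, ← MvPolynomial.C_mul, add_comm]

theorem logT2_eq : logT2 = MvPolynomial.X 1 + MvPolynomial.C (w0⁻¹ * jet 0 1) := by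
  have h : dw 0 1 = MvPolynomial.C (jet 0 1) + MvPolynomial.C w0 * MvPolynomial.X 1 := by
    simp [dw, Finset.sum_range_succ, w0]
  have h2 : (MvPolynomial.C w0⁻¹ * MvPolynomial.C w0 : LogSeries) = 1 := by
    rw [← MvPolynomial.C_mul, w0_inv_mul, MvPolynomial.C_1]
  rw [logT2, h, mul_add, ← mul_assoc, h2, one_mul, ← MvPolynomial.C_mul, add_comm]

/-! ### The hypergeometric system, its characteristic variety and its discriminant -/

/-- `θ₀ = x ∂_x` and `θ₁ = y ∂_y` on logarithmic series: on the coefficients it is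
`x_i ∂ / ∂ x_i`, and `θ_i (log x_i) = 1`. -/
def theta (i : Fin 2) (F : LogSeries) : LogSeries :=
  (∑ k ∈ F.support, MvPolynomial.monomial k
    (MvPowerSeries.X i * MvPowerSeries.pderiv ℂ i (F.coeff k))) + MvPolynomial.pderiv i F

/-- Linear differential operators `∑ a_{kl}(x, y) θ_x ^ k θ_y ^ l` with polynomial coefficients
written on the left, recorded by the polynomial `∑ a_{kl} X₀ ^ k X₁ ^ l`. (The product of these
polynomials is not the composition of operators.) -/
abbrev DiffOp : Type := MvPolynomial (Fin 2) (MvPolynomial (Fin 2) ℂ)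

/-- The action of a differential operator on logarithmic series. -/
def DiffOp.act (D : DiffOp) (F : LogSeries) : LogSeries :=
  ∑ k ∈ D.support, MvPolynomial.C ((MvPolynomial.coeff k D : MvPolynomial (Fin 2) ℂ) : Series2) *
    (theta 0)^[k 0] ((theta 1)^[k 1] F)

/-- `θ_x (θ_x - θ_y) - 12 x (6 θ_x + 1) (6 θ_x + 5)`. -/
def opX : DiffOp :=
  MvPolynomial.X 0 * (MvPolynomial.X 0 - MvPolynomial.X 1) -
    MvPolynomial.C (12 * MvPolynomial.X 0) *
      (6 * MvPolynomial.X 0 + 1) * (6 * MvPolynomial.X 0 + 5)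

/-- `θ_y ^ 2 + y θ_y (θ_x - θ_y)`. -/
def opY : DiffOp :=
  MvPolynomial.X 1 ^ 2 + MvPolynomial.C (MvPolynomial.X 1) *
    MvPolynomial.X 1 * (MvPolynomial.X 0 - MvPolynomial.X 1)

/-- The left ideal generated by `opX` and `opY`: the operators `A ∘ opX + B ∘ opY`. -/
def InIdeal (D : DiffOp) : Prop :=
  ∃ A B : DiffOp, ∀ F : LogSeries, D.act F = A.act (opX.act F) + B.act (opY.act F)

/-- The principal symbol of `D` at the point `z = (x, y)` and the covector
`v₀ dx / x + v₁ dy / y`. -/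
def DiffOp.symbol (D : DiffOp) (z v : Fin 2 → ℂ) : ℂ :=
  MvPolynomial.eval v (MvPolynomial.map (MvPolynomial.eval z)
    (MvPolynomial.homogeneousComponent D.totalDegree D))

/-- `(z, v)`, with `z` in the torus `x y ≠ 0`, lies on the characteristic variety of the system
`opX f = opY f = 0`: the principal symbols of all operators of the left ideal vanish there. -/
def InCharVariety (z v : Fin 2 → ℂ) : Prop :=
  ∀ D : DiffOp, InIdeal D → D.symbol z v = 0

/-- The discriminant in the torus `x y ≠ 0`: the points over which the characteristic variety
contains a nonzero covector. -/
def discriminantLocus : Set (Fin 2 → ℂ) :=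
  {z | z 0 ≠ 0 ∧ z 1 ≠ 0 ∧ ∃ v : Fin 2 → ℂ, v ≠ 0 ∧ InCharVariety z v}

end HalfK3

end

noncomputable section

namespace HalfK3

/-! The anomaly equation is solved in closed form over ℚ[E₂, E₄, E₆], before any q appears, and the
answer is then identified with the hypergeometric series.

Consider the pencil of elliptic curves with invariants E₄ and E₆ + 864 Δ X. Its Picard–Fuchs
equation does not contain E₂; only the initial values of the solution `period` do. Hence ∂/∂E₂ of
the period solves the same equation and equals u · period / 12, where u · period is the solution
found by reduction of order (`delE2_period`). Let t be the coordinate with θ_X log t = period, and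
let f and F₀ be given by θ_t f = -u and θ_t F₀ = f. At fixed X all derivatives in E₂ are explicit,
and passing to fixed t turns -f²/24 into (θ_t F₀)²/24, the anomaly equation in genus zero
(`delE2_potT_zero`). Genus one works in the same way for F₁ = -(log D)/12 - (log (t/X))/2 - (log
period)/2 with D the normalised discriminant of the pencil (`delE2_potT_one`). The substitution of
the Eisenstein series and t = p / ∏ (1 - q^m)^12 gives a candidate solution `zPot`.

On the hypergeometric side, 1/Γ(1 - m) = 0 for m ≥ 1 makes w₀ a function w(x) of x alone. The series
θ_y ∂_{ρ₂} w₀ + w₀, without its logarithm, satisfies a first order transport equation and is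
therefore w(x(1 - y)) (`thetaP_jet_zero_one`). Ramanujan's identities, proved by Sturm's bound, give
w(x(q)) = E₄^(1/4) for 864 x = 1 - E₆/E₄^(3/2) (`pull_wSeries`). With y = E₄^(3/2) (1 - 432 x) X,
the series E₄^(1/4) · period and w(x(1 - y)) solve one second order equation with the same initial
terms, so they agree (`evalV_period`). This yields the inverse of the mirror map, identifies u with
a difference of values of log q(x, y), and then gives the formulas for F₀ and F₁ by comparing
derivatives along p.

For the gap conditions, the coefficients of ∂_{ρ₂} w₀ vanish for m > n and sum to zero over m.
Consequently the series involved have p-degree at most their q-degree, except for log(1 - y), which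
differs from log(1 - p) by such a series (`logQ_sub_mem`). So the terms of q-degree less than n in
the coefficient of p^n are those of Li₃(p) and -log(1 - p)/12, which is what the gap conditions
prescribe (`exists_gap`, `hasLowTerms_of_gap`). Two solutions differ by forms whose derivative in E₂
vanishes; these are modular of weight 2g + 6n - 2 and vanish to order n, hence are zero by Sturm's
bound (`eq_zPot_of_anomaly`).

For the discriminant, the two operators satisfy (opY - y θ_y) opX = opX opY. This lifts the only
syzygy of their coprime symbols, so the two symbols alone cut out the characteristic variety
(`map_symbol_eq_zero`), and solving two quadratic equations finishes the proof. -/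

/-! ### Chain rules for substitution of power series. -/

open MvPowerSeries in
theorem coeff_subst_trunc {σ τ R : Type*} [Finite σ] [Finite τ] [CommRing R]
    {a : σ → MvPowerSeries τ R} (ha : ∀ s, constantCoeff (a s) = 0) (f : MvPowerSeries σ R)
    {e : τ →₀ ℕ} {k : ℕ} (hk : e.degree < k) :
    coeff e (f.subst a) = coeff e ((f.truncTotal k : MvPowerSeries σ R).subst a) := by
  have := truncTotal_subst_eq_truncTotal_truncTotal_subst (f := f) (k := k) ha
  have := congrArg (MvPolynomial.coeff e) this
  rwa [coeff_truncTotal _ hk, coeff_truncTotal _ hk] at this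

open MvPowerSeries in
theorem pderiv_subst_coe {σ τ R : Type*} [Fintype σ] [Finite τ] [CommRing R]
    {a : σ → MvPowerSeries τ R} (ha : ∀ s, constantCoeff (a s) = 0) (f : MvPolynomial σ R) (i : τ) :
    pderiv R i ((f : MvPowerSeries σ R).subst a) =
      ∑ s, (pderiv R s (f : MvPowerSeries σ R)).subst a * pderiv R i (a s) := by
  have hs := hasSubst_of_constantCoeff_zero ha
  simp only [pderiv_coe, subst_coe]
  induction f using MvPolynomial.induction_on with
  | C r => simp [MvPolynomial.algHom_C]
  | add f g hf hg =>
    simp only [map_add, hf, hg, add_mul, Finset.sum_add_distrib]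
  | mul_X f n hf =>
    classical
    simp only [map_mul, Derivation.leibniz, hf, MvPolynomial.aeval_X, MvPolynomial.pderiv_X,
      smul_eq_mul, map_add, add_mul, Finset.sum_add_distrib, Finset.mul_sum]
    congr 1
    · rw [Finset.sum_eq_single n]
      · simp
      · intro b _ hb
        rw [Pi.single_eq_of_ne (Ne.symm hb)]; simp
      · simp
    · exact Finset.sum_congr rfl fun s _ => by ring

-- A given coefficient of either side involves only a truncation of the outer series, so the chain
-- rule for polynomials is enough.
open MvPowerSeries in
theorem pderiv_subst {σ τ R : Type*} [Fintype σ] [Finite τ] [CommRing R]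
    {a : σ → MvPowerSeries τ R} (ha : ∀ s, constantCoeff (a s) = 0) (f : MvPowerSeries σ R) (i : τ) :
    pderiv R i (f.subst a) = ∑ s, (pderiv R s f).subst a * pderiv R i (a s) := by
  classical
  ext e
  -- The derivative on the left reads a coefficient of degree `e.degree + 1`, and truncating below
  -- `k` leaves the partial derivatives of `f` unchanged through degree `e.degree`.
  set k := e.degree + 2 with hk
  have h1 : (e + Finsupp.single i 1).degree < k := by simp [hk]
  rw [coeff_pderiv, coeff_subst_trunc ha f h1, ← coeff_pderiv, pderiv_subst_coe ha, map_sum,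
    map_sum]
  refine Finset.sum_congr rfl fun s _ => ?_
  rw [coeff_mul, coeff_mul]
  refine Finset.sum_congr rfl fun p hp => ?_
  have hp' : p.1.degree < e.degree + 1 := by
    rw [← Finset.HasAntidiagonal.mem_antidiagonal.mp hp]; simp
  congr 1
  rw [coeff_subst_trunc ha _ hp', coeff_subst_trunc ha (pderiv R s f) hp']
  congr 3
  ext d
  rw [coeff_truncTotal_eq_ite, coeff_truncTotal_eq_ite]
  split_ifs with h
  · rw [coeff_pderiv, coeff_pderiv, MvPolynomial.coeff_coe, coeff_truncTotal]
    simp [hk]; omega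
  · rfl

theorem pderiv_powerSeries_subst {τ R : Type*} [Finite τ] [CommRing R]
    {a : MvPowerSeries τ R} (ha : MvPowerSeries.constantCoeff a = 0) (f : PowerSeries R) (i : τ) :
    MvPowerSeries.pderiv R i (f.subst a) =
      (PowerSeries.derivative R f).subst a * MvPowerSeries.pderiv R i a := by
  rw [PowerSeries.subst, pderiv_subst (fun _ => ha)]
  simp [PowerSeries.subst, PowerSeries.derivative]

/-! ### Series in two variables -/

theorem hasSubst_pair {x y : Series2} (hx : MvPowerSeries.constantCoeff x = 0)
    (hy : MvPowerSeries.constantCoeff y = 0) : MvPowerSeries.HasSubst ![x, y] :=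
  MvPowerSeries.hasSubst_of_constantCoeff_zero (by intro s; fin_cases s <;> simp [hx, hy])

/-- Substitution of two series without constant term, as an algebra homomorphism. -/
def compHom (x y : Series2) (hx : MvPowerSeries.constantCoeff x = 0)
    (hy : MvPowerSeries.constantCoeff y = 0) : Series2 →ₐ[ℂ] Series2 :=
  MvPowerSeries.substAlgHom (hasSubst_pair hx hy)

section compHom
variable {x y : Series2} (hx : MvPowerSeries.constantCoeff x = 0)
    (hy : MvPowerSeries.constantCoeff y = 0)

theorem compHom_apply (f : Series2) : compHom x y hx hy f = comp f x y := by
  rw [compHom, MvPowerSeries.substAlgHom_apply]; rfl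

theorem compHom_X0 : compHom x y hx hy (MvPowerSeries.X 0) = x := by
  rw [compHom, MvPowerSeries.substAlgHom_X]; simp

theorem compHom_X1 : compHom x y hx hy (MvPowerSeries.X 1) = y := by
  rw [compHom, MvPowerSeries.substAlgHom_X]; simp

theorem constantCoeff_compHom (f : Series2) :
    MvPowerSeries.constantCoeff (compHom x y hx hy f) = MvPowerSeries.constantCoeff f := by
  have h := coeff_subst_trunc (a := ![x, y])
    (by intro s; fin_cases s <;> simp [hx, hy]) f (e := 0) (k := 1) (by simp)
  rw [compHom_apply, comp, ← MvPowerSeries.coeff_zero_eq_constantCoeff_apply, h]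
  have h2 : f.truncTotal 1 = MvPolynomial.C (MvPowerSeries.constantCoeff f) := by
    ext d
    rw [MvPowerSeries.coeff_truncTotal_eq_ite, MvPolynomial.coeff_C]
    by_cases hd : d = 0
    · subst hd; simp
    · rw [if_neg, if_neg (Ne.symm hd)]
      have := (Finsupp.degree_eq_zero_iff d).not.mpr hd
      omega
  rw [h2, MvPolynomial.coe_C, MvPowerSeries.subst_C]
  simp

theorem compHom_subst {a : Series2} (ha : MvPowerSeries.constantCoeff a = 0) (f : PowerSeries ℂ) :
    compHom x y hx hy (PowerSeries.subst a f) = PowerSeries.subst (compHom x y hx hy a) f := by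
  simp only [compHom_apply, comp, PowerSeries.subst]
  rw [MvPowerSeries.subst_comp_subst_apply (PowerSeries.HasSubst.of_constantCoeff_zero ha).const
    (hasSubst_pair hx hy)]

theorem pderiv_compHom (f : Series2) (i : Fin 2) :
    MvPowerSeries.pderiv ℂ i (compHom x y hx hy f) =
      compHom x y hx hy (MvPowerSeries.pderiv ℂ 0 f) * MvPowerSeries.pderiv ℂ i x +
      compHom x y hx hy (MvPowerSeries.pderiv ℂ 1 f) * MvPowerSeries.pderiv ℂ i y := by
  simp only [compHom_apply, comp]
  rw [pderiv_subst (by intro s; fin_cases s <;> simp [hx, hy]), Fin.sum_univ_two]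
  simp
end compHom

theorem constantCoeff_powerSeries_subst {τ R : Type*} [CommRing R]
    {a : MvPowerSeries τ R} (ha : MvPowerSeries.constantCoeff a = 0) (f : PowerSeries R) :
    MvPowerSeries.constantCoeff (f.subst a) = PowerSeries.constantCoeff f := by
  have hs := PowerSeries.HasSubst.of_constantCoeff_zero ha
  have h : MvPowerSeries.constantCoeff
      ((f - PowerSeries.C (PowerSeries.constantCoeff f)).subst a) = 0 :=
    PowerSeries.constantCoeff_subst_eq_zero ha _ (by simp)
  rw [PowerSeries.subst_sub hs, PowerSeries.subst_C, map_sub, sub_eq_zero] at h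
  simpa using h

theorem one_add_X_mul_derivative_log :
    (1 + PowerSeries.X) * PowerSeries.derivative ℂ (PowerSeries.log ℂ) = 1 := by
  rw [PowerSeries.deriv_log]
  ext n
  cases n with
  | zero => simp [add_mul]
  | succ n =>
    rw [add_mul, one_mul, map_add, PowerSeries.coeff_succ_X_mul, PowerSeries.coeff_mk,
      PowerSeries.coeff_mk, PowerSeries.coeff_one]
    simp [pow_succ]

/-- Coefficientwise this is (n + 1) binom(r, n + 1) = (r - n) binom(r, n), which comes from the
recursion of the falling factorials. -/
theorem one_add_X_mul_derivative_binomialSeries (r : ℂ) :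
    (1 + PowerSeries.X) * PowerSeries.derivative ℂ (PowerSeries.binomialSeries ℂ r) =
      PowerSeries.C r * PowerSeries.binomialSeries ℂ r := by
  ext n
  have key : ∀ n : ℕ, ((n : ℂ) + 1) * Ring.choose r (n + 1) = (r - n) * Ring.choose r n := by
    intro n
    have h1 := Ring.descPochhammer_eq_factorial_smul_choose r (n + 1)
    have h2 := Ring.descPochhammer_eq_factorial_smul_choose r n
    rw [descPochhammer_succ_right, Polynomial.smeval_mul, h2, Nat.factorial_succ] at h1
    simp only [nsmul_eq_mul, Polynomial.smeval_sub, Polynomial.smeval_X, pow_one,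
      Polynomial.smeval_natCast, pow_zero, mul_one] at h1
    have h3 : ((n.factorial : ℕ) : ℂ) ≠ 0 := by exact_mod_cast n.factorial_ne_zero
    apply mul_left_cancel₀ h3
    push_cast at h1
    linear_combination -h1
  cases n with
  | zero =>
    rw [add_mul, one_mul, map_add, PowerSeries.coeff_zero_X_mul, PowerSeries.coeff_C_mul,
      PowerSeries.coeff_derivative]
    simp only [PowerSeries.binomialSeries_coeff, smul_eq_mul, mul_one]
    have h1 := key 0
    push_cast at h1 ⊢
    linear_combination h1
  | succ n =>
    rw [add_mul, one_mul, map_add, PowerSeries.coeff_succ_X_mul, PowerSeries.coeff_C_mul,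
      PowerSeries.coeff_derivative, PowerSeries.coeff_derivative]
    simp only [PowerSeries.binomialSeries_coeff, smul_eq_mul, mul_one]
    have h1 := key (n + 1)
    push_cast at h1 ⊢
    linear_combination h1

section expLog
variable {τ : Type*} [Finite τ] {a : MvPowerSeries τ ℂ}

theorem pderiv_subst_exp (ha : MvPowerSeries.constantCoeff a = 0) (i : τ) :
    MvPowerSeries.pderiv ℂ i ((PowerSeries.exp ℂ).subst a) =
      (PowerSeries.exp ℂ).subst a * MvPowerSeries.pderiv ℂ i a := by
  rw [pderiv_powerSeries_subst ha, PowerSeries.derivative_exp]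

/-- The rule d log a = da / a, with the denominator cleared so that later comparisons are ring
identities. -/
theorem mul_pderiv_subst_log (ha : MvPowerSeries.constantCoeff a = 1) (i : τ) :
    a * MvPowerSeries.pderiv ℂ i ((PowerSeries.log ℂ).subst (a - 1)) =
      MvPowerSeries.pderiv ℂ i a := by
  have h0 : MvPowerSeries.constantCoeff (a - 1) = 0 := by simp [ha]
  have hs := PowerSeries.HasSubst.of_constantCoeff_zero h0
  have h := congrArg (PowerSeries.subst (a - 1)) one_add_X_mul_derivative_log
  rw [PowerSeries.subst_mul hs, PowerSeries.subst_add hs, PowerSeries.subst_X hs,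
    ← PowerSeries.coe_substAlgHom hs, map_one, PowerSeries.coe_substAlgHom hs] at h
  rw [pderiv_powerSeries_subst h0, map_sub, MvPowerSeries.pderiv_one, sub_zero]
  linear_combination MvPowerSeries.pderiv ℂ i a * h

theorem mul_pderiv_subst_binomialSeries (ha : MvPowerSeries.constantCoeff a = 1) (r : ℂ) (i : τ) :
    a * MvPowerSeries.pderiv ℂ i ((PowerSeries.binomialSeries ℂ r).subst (a - 1)) =
      r • ((PowerSeries.binomialSeries ℂ r).subst (a - 1) * MvPowerSeries.pderiv ℂ i a) := by
  have h0 : MvPowerSeries.constantCoeff (a - 1) = 0 := by simp [ha]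
  have hs := PowerSeries.HasSubst.of_constantCoeff_zero h0
  have h := congrArg (PowerSeries.subst (a - 1)) (one_add_X_mul_derivative_binomialSeries r)
  rw [PowerSeries.subst_mul hs, PowerSeries.subst_add hs, PowerSeries.subst_X hs,
    PowerSeries.subst_mul hs, PowerSeries.subst_C,
    ← PowerSeries.coe_substAlgHom hs, map_one, PowerSeries.coe_substAlgHom hs] at h
  rw [pderiv_powerSeries_subst h0, map_sub, MvPowerSeries.pderiv_one, sub_zero,
    MvPowerSeries.smul_eq_C_mul]
  linear_combination MvPowerSeries.pderiv ℂ i a * h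
end expLog

theorem constantCoeff_fexp {a : Series2} (ha : MvPowerSeries.constantCoeff a = 0) :
    MvPowerSeries.constantCoeff (fexp a) = 1 := by
  simp [fexp, constantCoeff_powerSeries_subst ha]

theorem constantCoeff_flog {a : Series2} (ha : MvPowerSeries.constantCoeff a = 1) :
    MvPowerSeries.constantCoeff (flog a) = 0 := by
  rw [flog, constantCoeff_powerSeries_subst (by simp [ha])]; simp

theorem constantCoeff_fpow {a : Series2} (ha : MvPowerSeries.constantCoeff a = 1) (r : ℂ) :
    MvPowerSeries.constantCoeff (fpow a r) = 1 := by
  rw [fpow, constantCoeff_powerSeries_subst (by simp [ha])]; simp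

/-! ### Series in the first variable -/

/-- `inFirst` as an algebra homomorphism. -/
def inFirstHom : PowerSeries ℂ →ₐ[ℂ] Series2 :=
  PowerSeries.substAlgHom (PowerSeries.HasSubst.X 0)

theorem inFirstHom_apply (f : PowerSeries ℂ) : inFirstHom f = inFirst f := by
  rw [inFirstHom, PowerSeries.coe_substAlgHom]; rfl

theorem coeff_inFirst (f : PowerSeries ℂ) (e : Fin 2 →₀ ℕ) :
    MvPowerSeries.coeff e (inFirst f) = if e 1 = 0 then PowerSeries.coeff (e 0) f else 0 := by
  rw [inFirst, PowerSeries.coeff_subst_single]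
  by_cases h : e 1 = 0
  · have : e = Finsupp.single 0 (e 0) := by
      ext i; fin_cases i <;> simp [h]
    rw [if_pos this, if_pos h]
  · rw [if_neg h, if_neg]
    intro h2; apply h; rw [h2]; simp

theorem constantCoeff_inFirst (f : PowerSeries ℂ) :
    MvPowerSeries.constantCoeff (inFirst f) = PowerSeries.constantCoeff f := by
  rw [← MvPowerSeries.coeff_zero_eq_constantCoeff_apply, coeff_inFirst]; simp

theorem inFirst_X : inFirst PowerSeries.X = MvPowerSeries.X 0 := by
  rw [inFirst, PowerSeries.subst_X (PowerSeries.HasSubst.X 0)]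

theorem pderiv_one_inFirst (f : PowerSeries ℂ) :
    MvPowerSeries.pderiv ℂ 1 (inFirst f) = 0 := by
  rw [inFirst, pderiv_powerSeries_subst (by simp), MvPowerSeries.pderiv_X_of_ne (by simp), mul_zero]

theorem inFirst_subst {x : PowerSeries ℂ} (hx : PowerSeries.constantCoeff x = 0)
    (f : PowerSeries ℂ) : inFirst (f.subst x) = f.subst (inFirst x) := by
  rw [inFirst, inFirst, PowerSeries.subst_comp_subst_apply
    (PowerSeries.HasSubst.of_constantCoeff_zero' hx) (PowerSeries.HasSubst.X 0)]

theorem compHom_inFirst {x y : Series2} (hx : MvPowerSeries.constantCoeff x = 0)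
    (hy : MvPowerSeries.constantCoeff y = 0) (f : PowerSeries ℂ) :
    compHom x y hx hy (inFirst f) = f.subst x := by
  rw [inFirst, compHom_subst _ _ (by simp), compHom_X0]

/-- Restriction of a series to `p = 0`. -/
def restrictHom : Series2 →ₐ[ℂ] PowerSeries ℂ :=
  MvPowerSeries.substAlgHom (a := ![PowerSeries.X, 0])
    (MvPowerSeries.hasSubst_of_constantCoeff_zero (by
      intro s; fin_cases s
      · exact PowerSeries.constantCoeff_X
      · exact map_zero _))

theorem coeff_restrictHom (f : Series2) (n : ℕ) :
    PowerSeries.coeff n (restrictHom f) = MvPowerSeries.coeff (Finsupp.single 0 n) f := by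
  rw [restrictHom, MvPowerSeries.substAlgHom_apply]
  rw [PowerSeries.coeff, MvPowerSeries.coeff_subst
    (MvPowerSeries.hasSubst_of_constantCoeff_zero (by
      intro s; fin_cases s
      · exact PowerSeries.constantCoeff_X
      · exact map_zero _))]
  rw [finsum_eq_single _ (Finsupp.single 0 n)]
  · rw [Finsupp.prod_fintype _ _ (by simp)]
    have := PowerSeries.coeff_X_pow (R := ℂ) n n
    rw [PowerSeries.coeff] at this
    simp [this]
  · intro d hd
    rw [Finsupp.prod_fintype _ _ (by simp), Fin.prod_univ_two]
    by_cases h1 : d 1 = 0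
    · have h0 : n ≠ d 0 := by
        intro h; apply hd; ext i; fin_cases i <;> simp [h, h1]
      have := PowerSeries.coeff_X_pow (R := ℂ) n (d 0)
      rw [PowerSeries.coeff, if_neg h0] at this
      simp [h1, this]
    · simp [h1]

theorem restrictHom_inFirst (f : PowerSeries ℂ) : restrictHom (inFirst f) = f := by
  ext n; simp [coeff_restrictHom, coeff_inFirst]

theorem restrictHom_X1 : restrictHom (MvPowerSeries.X 1) = 0 := by
  ext n
  rw [coeff_restrictHom, MvPowerSeries.coeff_X, if_neg, map_zero]
  intro h
  have := DFunLike.congr_fun h 1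
  simp at this

theorem constantCoeff_restrictHom (f : Series2) :
    PowerSeries.constantCoeff (restrictHom f) = MvPowerSeries.constantCoeff f := by
  rw [← PowerSeries.coeff_zero_eq_constantCoeff_apply, coeff_restrictHom]; simp

theorem coeff_restrictHom_of_eq_zero (f : Series2) {e : Fin 2 →₀ ℕ} (he : e 1 = 0) :
    MvPowerSeries.coeff e f = PowerSeries.coeff (e 0) (restrictHom f) := by
  rw [coeff_restrictHom]
  congr 2
  ext i; fin_cases i <;> simp [he]

/-- Used to peel off powers of the second variable one at a time in the uniqueness arguments. -/
theorem X1_dvd_iff {f : Series2} : MvPowerSeries.X 1 ∣ f ↔ restrictHom f = 0 := by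
  constructor
  · rintro ⟨g, rfl⟩; rw [map_mul, restrictHom_X1, zero_mul]
  · intro h
    rw [MvPowerSeries.X_dvd_iff]
    intro m hm
    rw [coeff_restrictHom_of_eq_zero f hm, h, map_zero]

theorem restrictHom_subst {a : Series2} (ha : MvPowerSeries.constantCoeff a = 0)
    (f : PowerSeries ℂ) : restrictHom (f.subst a) = f.subst (restrictHom a) := by
  simp only [restrictHom, MvPowerSeries.substAlgHom_apply, PowerSeries.subst]
  rw [MvPowerSeries.subst_comp_subst_apply (PowerSeries.HasSubst.of_constantCoeff_zero ha).const
    (MvPowerSeries.hasSubst_of_constantCoeff_zero (by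
      intro s; fin_cases s
      · exact PowerSeries.constantCoeff_X
      · exact map_zero _))]

/-- The derivation `p ∂ / ∂p`. -/
def thetaP : Derivation ℂ Series2 Series2 := (MvPowerSeries.X 1 : Series2) • MvPowerSeries.pderiv ℂ 1

theorem thetaP_apply (f : Series2) :
    thetaP f = MvPowerSeries.X 1 * MvPowerSeries.pderiv ℂ 1 f := rfl

theorem thetaP_inFirst (f : PowerSeries ℂ) : thetaP (inFirst f) = 0 := by
  rw [thetaP_apply, pderiv_one_inFirst, mul_zero]

theorem thetaP_X1 : thetaP (MvPowerSeries.X 1) = MvPowerSeries.X 1 := by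
  rw [thetaP_apply, MvPowerSeries.pderiv_X_self, mul_one]

theorem coeff_thetaP (f : Series2) (e : Fin 2 →₀ ℕ) :
    MvPowerSeries.coeff e (thetaP f) = e 1 * MvPowerSeries.coeff e f := by
  rw [thetaP_apply]
  by_cases he : e 1 = 0
  · rw [coeff_restrictHom_of_eq_zero _ he, map_mul, restrictHom_X1, he]; simp
  · have h1 : e = Finsupp.single 1 1 + (e - Finsupp.single 1 1) := by
      rw [add_comm]; refine (tsub_add_cancel_of_le ?_).symm
      rw [Finsupp.single_le_iff]; omega
    have h2 : MvPowerSeries.coeff e (MvPowerSeries.X 1 * MvPowerSeries.pderiv ℂ 1 f) =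
        MvPowerSeries.coeff (e - Finsupp.single 1 1) (MvPowerSeries.pderiv ℂ 1 f) := by
      conv_lhs => rw [h1]
      rw [MvPowerSeries.X, MvPowerSeries.coeff_add_monomial_mul, one_mul]
    rw [h2, MvPowerSeries.coeff_pderiv, add_comm _ (Finsupp.single 1 1), ← h1, mul_comm]
    congr 1
    have : (e - Finsupp.single 1 1 : Fin 2 →₀ ℕ) 1 + 1 = e 1 := by
      simp; omega
    exact_mod_cast this

theorem restrictHom_thetaP (f : Series2) : restrictHom (thetaP f) = 0 := by
  rw [thetaP_apply, map_mul, restrictHom_X1, zero_mul]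

/-- The operator p ∂/∂p multiplies the coefficient of p^m by m, so it loses only the part with m =
0. Most identities in two variables below are proved by comparing this derivative and the
restriction to p = 0. -/
theorem eq_of_thetaP_eq {f g : Series2} (h : thetaP f = thetaP g)
    (h0 : restrictHom f = restrictHom g) : f = g := by
  ext e
  by_cases he : e 1 = 0
  · rw [coeff_restrictHom_of_eq_zero _ he, h0, ← coeff_restrictHom_of_eq_zero _ he]
  · have := congrArg (MvPowerSeries.coeff e) h
    rw [coeff_thetaP, coeff_thetaP] at this
    exact mul_left_cancel₀ (by exact_mod_cast he) this

/-- A solution of `p ∂f/∂p = f` is linear in `p`. -/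
theorem eq_X1_mul_of_thetaP_eq_self {f : Series2} (h : thetaP f = f) {c : PowerSeries ℂ}
    {g : Series2} (hg : f = MvPowerSeries.X 1 * g) (hc : restrictHom g = c) :
    f = MvPowerSeries.X 1 * inFirst c := by
  have hX : (MvPowerSeries.X 1 : Series2) ≠ 0 := by
    intro h; have := congrArg (MvPowerSeries.coeff (Finsupp.single 1 1)) h
    simp at this
  have h2 : thetaP g = 0 := by
    rw [hg, Derivation.leibniz, thetaP_X1, smul_eq_mul, smul_eq_mul, mul_comm g] at h
    have : (MvPowerSeries.X 1 : Series2) * thetaP g = 0 := by linear_combination h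
    exact (mul_eq_zero.mp this).resolve_left hX
  rw [hg, eq_of_thetaP_eq (f := g) (g := inFirst c) (by rw [h2, thetaP_inFirst])
    (by rw [hc, restrictHom_inFirst])]

theorem posPart_eq (f : Series2) : posPart f = f - inFirst (restrictHom f) := by
  ext e
  rw [map_sub, coeff_inFirst]
  change (if e 1 = 0 then 0 else MvPowerSeries.coeff e f) = _
  split_ifs with h
  · rw [coeff_restrictHom_of_eq_zero _ h, sub_self]
  · rw [sub_zero]

theorem thetaP_posPart (f : Series2) : thetaP (posPart f) = thetaP f := by
  rw [posPart_eq, map_sub, thetaP_inFirst, sub_zero]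

theorem restrictHom_posPart (f : Series2) : restrictHom (posPart f) = 0 := by
  rw [posPart_eq, map_sub, restrictHom_inFirst, sub_self]

theorem mul_thetaP_flog {a : Series2} (ha : MvPowerSeries.constantCoeff a = 1) :
    a * thetaP (flog a) = thetaP a := by
  rw [thetaP_apply, thetaP_apply, flog, ← mul_pderiv_subst_log ha]; ring

theorem thetaP_fexp {a : Series2} (ha : MvPowerSeries.constantCoeff a = 0) :
    thetaP (fexp a) = fexp a * thetaP a := by
  rw [thetaP_apply, thetaP_apply, fexp, pderiv_subst_exp ha]; ring

theorem mul_thetaP_fpow {a : Series2} (ha : MvPowerSeries.constantCoeff a = 1) (r : ℂ) :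
    a * thetaP (fpow a r) = r • (fpow a r * thetaP a) := by
  rw [thetaP_apply, thetaP_apply, fpow, mul_left_comm, mul_pderiv_subst_binomialSeries ha,
    mul_smul_comm]
  congr 1; ring

theorem thetaP_subst {a : Series2} (ha : MvPowerSeries.constantCoeff a = 0) (f : PowerSeries ℂ) :
    thetaP (f.subst a) = (PowerSeries.derivative ℂ f).subst a * thetaP a := by
  rw [thetaP_apply, thetaP_apply, pderiv_powerSeries_subst ha]; ring

/-! ### Coefficientwise derivations of power series -/

section coeffwise
variable {R : Type*} [CommRing R] [Algebra ℚ R]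

/-- A derivation of the coefficients, applied coefficientwise to power series. -/
def coeffD (d : Derivation ℚ R R) : Derivation ℚ (PowerSeries R) (PowerSeries R) where
  toFun f := PowerSeries.mk fun n => d (PowerSeries.coeff n f)
  map_add' f g := by ext n; simp
  map_smul' r f := by ext n; simp
  map_one_eq_zero' := by
    ext n
    by_cases h : n = 0 <;> simp [PowerSeries.coeff_one, h]
  leibniz' f g := by
    ext n
    simp only [LinearMap.coe_mk, AddHom.coe_mk, PowerSeries.coeff_mk, PowerSeries.coeff_mul, map_sum,
      Derivation.leibniz, smul_eq_mul, map_add, Finset.sum_add_distrib]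
    congr 1
    rw [← Finset.Nat.sum_antidiagonal_swap]
    rfl

variable (d : Derivation ℚ R R)

theorem coeff_coeffD (f : PowerSeries R) (n : ℕ) :
    PowerSeries.coeff n (coeffD d f) = d (PowerSeries.coeff n f) :=
  PowerSeries.coeff_mk n fun n => d (PowerSeries.coeff n f)

theorem constantCoeff_coeffD (f : PowerSeries R) :
    PowerSeries.constantCoeff (coeffD d f) = d (PowerSeries.constantCoeff f) := by
  rw [← PowerSeries.coeff_zero_eq_constantCoeff_apply, coeff_coeffD]; simp

theorem coeffD_C (r : R) : coeffD d (PowerSeries.C r) = PowerSeries.C (d r) := by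
  ext n
  rw [coeff_coeffD, PowerSeries.coeff_C, PowerSeries.coeff_C]
  split_ifs <;> simp

theorem coeffD_X : coeffD d PowerSeries.X = 0 := by
  ext n
  rw [coeff_coeffD, PowerSeries.coeff_X]
  split_ifs <;> simp

theorem coeffD_derivative (f : PowerSeries R) :
    coeffD d (PowerSeries.derivative R f) = PowerSeries.derivative R (coeffD d f) := by
  ext n
  rw [coeff_coeffD, PowerSeries.coeff_derivative, PowerSeries.coeff_derivative, coeff_coeffD,
    Derivation.leibniz]
  have : d ((n : R) + 1) = 0 := by
    rw [map_add, d.map_one_eq_zero, d.map_natCast, add_zero]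
  rw [this, smul_zero, zero_add, smul_eq_mul, mul_comm]

/-- Chain rule for a derivation that moves the coefficients of the outer series as well as the inner
series. -/
theorem coeffD_subst {T : PowerSeries R} (hT : PowerSeries.constantCoeff T = 0)
    (P : PowerSeries R) :
    coeffD d (P.subst T) =
      (coeffD d P).subst T + (PowerSeries.derivative R P).subst T * coeffD d T := by
  have hs := PowerSeries.HasSubst.of_constantCoeff_zero' hT
  -- The defect of the chain rule is a derivation along the substitution. It kills `X` and the
  -- constants, hence polynomials, and the tail of `P` contributes a multiple of `T ^ (n + 1)`,
  -- which is invisible in degree `n`.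
  set E : PowerSeries R → PowerSeries R := fun P => coeffD d (P.subst T) -
    ((coeffD d P).subst T + (PowerSeries.derivative R P).subst T * coeffD d T) with hE
  have hmul : ∀ f g, E (f * g) = E f * g.subst T + f.subst T * E g := by
    intro f g
    simp only [hE, PowerSeries.subst_mul hs, Derivation.leibniz, smul_eq_mul,
      PowerSeries.subst_add hs]
    ring
  have hadd : ∀ f g, E (f + g) = E f + E g := by
    intro f g
    simp only [hE, PowerSeries.subst_add hs, map_add]
    ring
  have hX : E PowerSeries.X = 0 := by
    simp only [hE, PowerSeries.subst_X hs, coeffD_X, PowerSeries.derivative_X]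
    rw [← PowerSeries.coe_substAlgHom hs, map_zero, map_one]; ring
  have hC : ∀ r, E (PowerSeries.C r) = 0 := by
    intro r
    simp only [hE, PowerSeries.subst_C, coeffD_C, PowerSeries.derivative_C]
    rw [← PowerSeries.coe_substAlgHom hs, map_zero]
    change coeffD d (PowerSeries.C r) - (PowerSeries.C (d r) + _) = 0
    rw [coeffD_C]; ring
  have hXn : ∀ n : ℕ, E (PowerSeries.X ^ n) = 0 := by
    intro n
    induction n with
    | zero => rw [pow_zero, ← map_one PowerSeries.C, hC]
    | succ n ih => rw [pow_succ, hmul, ih, hX]; ring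
  have hpoly : ∀ p : Polynomial R, E p = 0 := by
    intro p
    induction p using Polynomial.induction_on' with
    | add p q hp hq => rw [Polynomial.coe_add, hadd, hp, hq, add_zero]
    | monomial n r =>
      rw [← Polynomial.C_mul_X_pow_eq_monomial, Polynomial.coe_mul, Polynomial.coe_C,
        Polynomial.coe_pow, Polynomial.coe_X, hmul, hC, hXn]; ring
  have hz : E P = 0 := by
    ext n
    rw [PowerSeries.eq_X_pow_mul_shift_add_trunc (n + 1) P, hadd, hmul, hpoly, hXn,
      PowerSeries.subst_pow hs, PowerSeries.subst_X hs]
    have : PowerSeries.X ^ (n + 1) ∣ T ^ (n + 1) :=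
      pow_dvd_pow_of_dvd (PowerSeries.X_dvd_iff.mpr hT) _
    rw [zero_mul, zero_add, add_zero, map_zero]
    exact PowerSeries.X_pow_dvd_iff.mp (this.mul_right _) n (Nat.lt_succ_self n)
  exact sub_eq_zero.mp hz

/-- The antiderivative without constant term. -/
def integral (f : PowerSeries R) : PowerSeries R :=
  PowerSeries.mk fun n => ((n : ℚ)⁻¹) • PowerSeries.coeff (n - 1) f

theorem derivative_integral (f : PowerSeries R) : PowerSeries.derivative R (integral f) = f := by
  ext n
  rw [PowerSeries.coeff_derivative, integral, PowerSeries.coeff_mk, Nat.add_sub_cancel]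
  have h : ((n + 1 : ℕ) : ℚ) ≠ 0 := by exact_mod_cast n.succ_ne_zero
  have h2 : ((n : R) + 1) = algebraMap ℚ R ((n + 1 : ℕ) : ℚ) := by simp
  rw [h2, mul_comm, ← Algebra.smul_def, smul_smul, mul_inv_cancel₀ h, one_smul]

theorem constantCoeff_integral (f : PowerSeries R) :
    PowerSeries.constantCoeff (integral f) = 0 := by
  rw [← PowerSeries.coeff_zero_eq_constantCoeff_apply, integral, PowerSeries.coeff_mk]; simp

theorem ext_of_X_mul_derivative {f g : PowerSeries R}
    (h : PowerSeries.X * PowerSeries.derivative R f = PowerSeries.X * PowerSeries.derivative R g)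
    (h0 : PowerSeries.constantCoeff f = PowerSeries.constantCoeff g) : f = g := by
  ext n
  cases n with
  | zero => simpa using h0
  | succ n =>
    have := congrArg (PowerSeries.coeff (n + 1)) h
    rw [PowerSeries.coeff_succ_X_mul, PowerSeries.coeff_succ_X_mul, PowerSeries.coeff_derivative,
      PowerSeries.coeff_derivative] at this
    have h2 : ((n : R) + 1) = algebraMap ℚ R ((n + 1 : ℕ) : ℚ) := by simp
    have h3 : IsUnit ((n : R) + 1) := by
      rw [h2]; exact (IsUnit.mk0 _ (by exact_mod_cast n.succ_ne_zero)).map _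
    exact h3.mul_right_cancel this

end coeffwise

/-- The series `(f - f(0)) / X`. -/
def shift {R : Type*} [CommRing R] (f : PowerSeries R) : PowerSeries R := PowerSeries.mk fun n => PowerSeries.coeff (n + 1) f

theorem X_mul_shift {R : Type*} [CommRing R] (f : PowerSeries R) :
    PowerSeries.X * shift f = f - PowerSeries.C (PowerSeries.constantCoeff f) := by
  ext n
  cases n with
  | zero => simp
  | succ n => rw [PowerSeries.coeff_succ_X_mul, shift, PowerSeries.coeff_mk]; simp

/-! ### The universal solution -/

/-- The polynomial ring in `E₂, E₄, E₆`. -/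
abbrev QMod : Type := MvPolynomial (Fin 3) ℚ

/-- The derivation `∂ / ∂E₂`. -/
def delE2 : Derivation ℚ QMod QMod := MvPolynomial.pderiv 0

/-- The Euler derivation for the weights `2, 4, 6`. -/
def euler : Derivation ℚ QMod QMod := MvPolynomial.mkDerivation ℚ
  ![2 * MvPolynomial.X 0, 4 * MvPolynomial.X 1, 6 * MvPolynomial.X 2]

/-- Monomials are eigenvectors of the Euler derivation. Weighted homogeneity can therefore be read
off from an eigenvalue equation, and such equations pass through differential equations. -/
theorem coeff_euler (P : QMod) (m : Fin 3 →₀ ℕ) :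
    MvPolynomial.coeff m (euler P) =
      (Finsupp.weight (![2, 4, 6] : Fin 3 → ℕ) m : ℚ) * MvPolynomial.coeff m P := by
  induction P using MvPolynomial.induction_on' with
  | add p q hp hq => simp [hp, hq, mul_add]
  | monomial s a =>
    have h : euler (MvPolynomial.monomial s a) =
        MvPolynomial.monomial s ((Finsupp.weight (![2, 4, 6] : Fin 3 → ℕ) s : ℚ) * a) := by
      rw [euler, MvPolynomial.mkDerivation_monomial, Finsupp.sum_fintype _ _ (by simp)]
      have key : ∀ (i : Fin 3) (k : ℕ), MvPolynomial.monomial (s - Finsupp.single i 1) (s i : ℚ) •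
          ((k : QMod) * MvPolynomial.X i) = MvPolynomial.monomial s ((s i * k : ℕ) : ℚ) := by
        intro i k
        have hk : (k : QMod) = MvPolynomial.C (k : ℚ) := by simp
        rw [hk, MvPolynomial.X, MvPolynomial.C_mul_monomial, smul_eq_mul,
          MvPolynomial.monomial_mul]
        by_cases hi : s i = 0
        · simp [hi]
        · rw [tsub_add_cancel_of_le (by rw [Finsupp.single_le_iff]; omega)]
          push_cast; simp
      have h0 := key 0 2
      have h1 := key 1 4
      have h2 := key 2 6
      rw [Fin.sum_univ_three]
      simp only [Matrix.cons_val_zero, Matrix.cons_val_one, Matrix.cons_val]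
      push_cast at h0 h1 h2
      rw [h0, h1, h2, ← map_add, ← map_add, MvPolynomial.smul_monomial, Finsupp.weight_apply,
        Finsupp.sum_fintype _ _ (by simp), Fin.sum_univ_three]
      congr 1
      simp
      ring
    rw [h, MvPolynomial.coeff_monomial, MvPolynomial.coeff_monomial]
    split_ifs with h <;> simp [h]

theorem isWeightedHomogeneous_of_euler {P : QMod} {k : ℕ} (h : euler P = (k : QMod) * P) :
    MvPolynomial.IsWeightedHomogeneous (![2, 4, 6] : Fin 3 → ℕ) P k := by
  intro m hm
  have := congrArg (MvPolynomial.coeff m) h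
  have hk : (k : QMod) = MvPolynomial.C (k : ℚ) := by simp
  rw [coeff_euler, hk, MvPolynomial.coeff_C_mul] at this
  exact_mod_cast mul_right_cancel₀ hm this

section

open PowerSeries (X C constantCoeff)

/-- The discriminant form `(E₄³ - E₆²) / 1728`, as a polynomial. -/
def disc : QMod :=
  MvPolynomial.C (1 / 1728) * (MvPolynomial.X 1 ^ 3 - MvPolynomial.X 2 ^ 2)

/-- The coefficients of the series `period`. -/
def periodCoeff : ℕ → QMod
  | 0 => 1
  | 1 => -MvPolynomial.C (1 / 12) *
      (MvPolynomial.X 0 * MvPolynomial.X 1 - MvPolynomial.X 2)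
  | k + 2 => MvPolynomial.C (1 / (((k : ℚ) + 2) * (k + 1))) *
      (((k : QMod) + 1) ^ 2 * MvPolynomial.X 2 * periodCoeff (k + 1) +
        (432 * (k : QMod) * ((k : QMod) + 1) + 60) * disc * periodCoeff k)

theorem periodCoeff_rec (k : ℕ) : ((k : QMod) + 2) * ((k : QMod) + 1) * periodCoeff (k + 2) =
    ((k : QMod) + 1) ^ 2 * MvPolynomial.X 2 * periodCoeff (k + 1) +
        (432 * (k : QMod) * ((k : QMod) + 1) + 60) * disc * periodCoeff k := by
  rw [periodCoeff]
  have h : ((k : QMod) + 2) * ((k : QMod) + 1) * MvPolynomial.C (1 / (((k : ℚ) + 2) * (k + 1))) = 1 := by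
    have h1 : ((k : QMod) + 2) * ((k : QMod) + 1) = MvPolynomial.C (((k : ℚ) + 2) * (k + 1)) := by
      simp only [map_mul, map_add, map_natCast, map_ofNat, map_one]
    have h2 : ((k : ℚ) + 2) * (k + 1) ≠ 0 := by positivity
    rw [h1, ← map_mul, mul_one_div, div_self h2, map_one]
  rw [← mul_assoc, h, one_mul]

/-- The normalised period of the elliptic curve `y² = 4 x³ - ⋯` with invariants `E₄` and
`E₆ + 864 Δ X`. -/
def period : PowerSeries QMod := PowerSeries.mk periodCoeff

/-- The discriminant of the curve with invariants `E₄` and `E₆ + 864 Δ X`, divided by `Δ`. -/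
def curveDisc : PowerSeries QMod :=
  1 - C (MvPolynomial.X 2) * X - C (432 * disc) * X ^ 2

theorem constantCoeff_period : constantCoeff period = 1 := by
  rw [← PowerSeries.coeff_zero_eq_constantCoeff_apply, period, PowerSeries.coeff_mk, periodCoeff]

theorem constantCoeff_curveDisc : constantCoeff curveDisc = 1 := by
  simp [curveDisc]

local notation "∂" => PowerSeries.derivative QMod

theorem coeff_X_mul_derivative {R : Type*} [CommRing R] (f : PowerSeries R) (k : ℕ) :
    PowerSeries.coeff k (X * PowerSeries.derivative R f) = k * PowerSeries.coeff k f := by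
  cases k with
  | zero => simp
  | succ k => rw [PowerSeries.coeff_succ_X_mul, PowerSeries.coeff_derivative]; push_cast; ring

/-- The Picard–Fuchs operator as a three-term recursion. The factor (k + 2)(k + 1) at the top
coefficient never vanishes, so a solution is determined by its first two coefficients. -/
theorem coeff_picardFuchs (f : PowerSeries QMod) (k : ℕ) :
    PowerSeries.coeff k (∂ (curveDisc * ∂ f)) =
      ((k : QMod) + 2) * ((k : QMod) + 1) * PowerSeries.coeff (k + 2) f -
      ((k : QMod) + 1) ^ 2 * MvPolynomial.X 2 * PowerSeries.coeff (k + 1) f -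
      432 * (k : QMod) * ((k : QMod) + 1) * disc * PowerSeries.coeff k f := by
  have h : curveDisc * ∂ f = ∂ f - C (MvPolynomial.X 2) * (X * ∂ f) -
      C (432 * disc) * (X * (X * ∂ f)) := by
    rw [curveDisc]; ring
  rw [PowerSeries.coeff_derivative, h, map_sub, map_sub, PowerSeries.coeff_C_mul,
    PowerSeries.coeff_C_mul, PowerSeries.coeff_succ_X_mul, PowerSeries.coeff_succ_X_mul,
    coeff_X_mul_derivative, PowerSeries.coeff_derivative, PowerSeries.coeff_derivative]
  push_cast
  ring

theorem period_ode : ∂ (curveDisc * ∂ period) = C (60 * disc) * period := by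
  ext1 k
  rw [coeff_picardFuchs, PowerSeries.coeff_C_mul]
  simp only [period, PowerSeries.coeff_mk]
  linear_combination periodCoeff_rec k

theorem eq_zero_of_picardFuchs {f : PowerSeries QMod}
    (h : ∂ (curveDisc * ∂ f) = C (60 * disc) * f)
    (h0 : PowerSeries.coeff 0 f = 0) (h1 : PowerSeries.coeff 1 f = 0) : f = 0 := by
  have key : ∀ k, PowerSeries.coeff k f = 0 ∧ PowerSeries.coeff (k + 1) f = 0 := by
    intro k
    induction k with
    | zero => exact ⟨h0, h1⟩
    | succ k ih =>
      refine ⟨ih.2, ?_⟩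
      have := congrArg (PowerSeries.coeff k) h
      rw [coeff_picardFuchs, PowerSeries.coeff_C_mul, ih.1, ih.2] at this
      have h2 : ((k : QMod) + 2) * ((k : QMod) + 1) ≠ 0 := by
        have : ((k : QMod) + 2) * ((k : QMod) + 1) = (((k + 2) * (k + 1) : ℕ) : QMod) := by push_cast; ring
        rw [this]; exact Nat.cast_ne_zero.mpr (by positivity)
      exact (mul_eq_zero.mp (by linear_combination this)).resolve_left h2
  ext1 k; rw [(key k).1, map_zero]

/-- The inverses of `period` and `curveDisc`. -/
def periodInv : PowerSeries QMod := PowerSeries.invOfUnit period 1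
def curveDiscInv : PowerSeries QMod := PowerSeries.invOfUnit curveDisc 1

theorem period_mul_inv : period * periodInv = 1 :=
  PowerSeries.mul_invOfUnit _ _ (by simp [constantCoeff_period])
theorem curveDisc_mul_inv : curveDisc * curveDiscInv = 1 :=
  PowerSeries.mul_invOfUnit _ _ (by simp [constantCoeff_curveDisc])

/-- The logarithm of `q̃ / q`. -/
def uSeries : PowerSeries QMod :=
  integral (-C (MvPolynomial.X 1) * periodInv ^ 2 * curveDiscInv)
/-- The logarithm of `tSeries / X`. -/
def ellSeries : PowerSeries QMod := integral (shift period)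
/-- The coordinate `t` as a series in the coordinate of the curve. -/
def tSeries : PowerSeries QMod := X * (PowerSeries.exp QMod).subst ellSeries
/-- The first derivative of the genus zero potential. -/
def fSeries : PowerSeries QMod := -integral (shift uSeries * period)
/-- The genus zero potential. -/
def pot0 : PowerSeries QMod := integral (shift fSeries * period)
/-- The logarithms of `curveDisc` and `period`. -/
def logCurveDisc : PowerSeries QMod := integral (∂ curveDisc * curveDiscInv)
def logPeriod : PowerSeries QMod := integral (∂ period * periodInv)
/-- The genus one potential. -/
def pot1 : PowerSeries QMod := C (MvPolynomial.C (-1 / 12)) * logCurveDisc -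
  C (MvPolynomial.C (1 / 2)) * ellSeries - C (MvPolynomial.C (1 / 2)) * logPeriod

/-- The Wronskian form of reduction of order: the product of `curveDisc`, `period`² and the
derivative of `uSeries` is constant in `X`, so `uSeries * period` is a second solution of the
Picard–Fuchs equation. -/
theorem u_ode : ∂ uSeries * period ^ 2 * curveDisc = -C (MvPolynomial.X 1) := by
  rw [uSeries, derivative_integral]
  linear_combination (-C (MvPolynomial.X 1) * (period * periodInv + 1) *
    curveDisc * curveDiscInv) * period_mul_inv - C (MvPolynomial.X 1) * curveDisc_mul_inv

theorem constantCoeff_u : constantCoeff uSeries = 0 := constantCoeff_integral _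
theorem constantCoeff_ell : constantCoeff ellSeries = 0 := constantCoeff_integral _
theorem constantCoeff_f : constantCoeff fSeries = 0 := by
  rw [fSeries, map_neg, constantCoeff_integral, neg_zero]
theorem constantCoeff_pot0 : constantCoeff pot0 = 0 := constantCoeff_integral _
theorem constantCoeff_logCurveDisc : constantCoeff logCurveDisc = 0 := constantCoeff_integral _
theorem constantCoeff_logPeriod : constantCoeff logPeriod = 0 := constantCoeff_integral _
theorem constantCoeff_pot1 : constantCoeff pot1 = 0 := by
  simp [pot1, constantCoeff_logCurveDisc, constantCoeff_logPeriod, constantCoeff_ell]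
theorem constantCoeff_tSeries : constantCoeff tSeries = 0 := by simp [tSeries]

theorem ell_ode : X * ∂ ellSeries = period - 1 := by
  rw [ellSeries, derivative_integral, X_mul_shift, constantCoeff_period, map_one]

theorem f_ode : X * ∂ fSeries = -(uSeries * period) := by
  rw [fSeries, map_neg, derivative_integral, mul_neg, ← mul_assoc, X_mul_shift, constantCoeff_u,
    map_zero, sub_zero]

theorem pot0_ode : X * ∂ pot0 = fSeries * period := by
  rw [pot0, derivative_integral, ← mul_assoc, X_mul_shift, constantCoeff_f, map_zero, sub_zero]

theorem logCurveDisc_ode : ∂ logCurveDisc * curveDisc = ∂ curveDisc := by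
  rw [logCurveDisc, derivative_integral]
  linear_combination ∂ curveDisc * curveDisc_mul_inv

theorem logPeriod_ode : ∂ logPeriod * period = ∂ period := by
  rw [logPeriod, derivative_integral]
  linear_combination ∂ period * period_mul_inv

theorem hasSubst_ell : PowerSeries.HasSubst ellSeries :=
  PowerSeries.HasSubst.of_constantCoeff_zero' constantCoeff_ell

/-- Hence θ_X = period · θ_t, the rule that transports every statement between the two coordinates.
-/
theorem t_ode : X * ∂ tSeries = period * tSeries := by
  have h : ∂ ((PowerSeries.exp QMod).subst ellSeries) =
      (PowerSeries.exp QMod).subst ellSeries * ∂ ellSeries := by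
    rw [PowerSeries.derivative_subst hasSubst_ell, PowerSeries.derivative_exp]
  rw [tSeries, Derivation.leibniz, h, PowerSeries.derivative_X, smul_eq_mul, smul_eq_mul]
  linear_combination X * (PowerSeries.exp QMod).subst ellSeries * ell_ode

theorem coeffD_t (d : Derivation ℚ QMod QMod) :
    coeffD d tSeries = tSeries * coeffD d ellSeries := by
  have h : coeffD d ((PowerSeries.exp QMod).subst ellSeries) =
      (PowerSeries.exp QMod).subst ellSeries * coeffD d ellSeries := by
    rw [coeffD_subst _ constantCoeff_ell, PowerSeries.derivative_exp]
    have : coeffD d (PowerSeries.exp QMod) = 0 := by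
      ext1 n
      rw [coeff_coeffD, PowerSeries.coeff_exp, d.map_algebraMap, map_zero]
    rw [this, ← PowerSeries.coe_substAlgHom hasSubst_ell, map_zero, zero_add]
  rw [tSeries, Derivation.leibniz, h, coeffD_X, smul_zero, add_zero, smul_eq_mul]
  ring

theorem coeff_one_t : PowerSeries.coeff 1 tSeries = 1 := by
  rw [tSeries, show (1 : ℕ) = 0 + 1 from rfl, PowerSeries.coeff_succ_X_mul,
    PowerSeries.coeff_zero_eq_constantCoeff_apply]
  have := constantCoeff_powerSeries_subst (a := ellSeries) constantCoeff_ell (PowerSeries.exp QMod)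
  rw [PowerSeries.constantCoeff_exp] at this
  exact this

theorem ne_zero_of_constantCoeff {R : Type*} [CommRing R] [Nontrivial R] {f : PowerSeries R}
    (h : constantCoeff f = 1) : f ≠ 0 := by
  rintro rfl; simp at h

/-! ### The derivative in `E₂` -/

theorem delE2_disc : delE2 disc = 0 := by
  simp [delE2, disc, MvPolynomial.pderiv_X]

theorem coeffD_delE2_curveDisc : coeffD delE2 curveDisc = 0 := by
  have h : coeffD delE2 (X : PowerSeries QMod) = 0 := coeffD_X _
  have h2 : delE2 (MvPolynomial.X 2) = 0 := by simp [delE2, MvPolynomial.pderiv_X]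
  have h3 : delE2 (432 * disc) = 0 := by
    rw [Derivation.leibniz, delE2_disc, show (432 : QMod) = ((432 : ℕ) : QMod) by norm_num,
      Derivation.map_natCast]; simp
  rw [curveDisc, map_sub, map_sub, Derivation.map_one_eq_zero, Derivation.leibniz,
    Derivation.leibniz, Derivation.leibniz_pow, coeffD_C, coeffD_C, h, h2, h3]
  simp

theorem coeff_one_u : PowerSeries.coeff 1 uSeries = -MvPolynomial.X 1 := by
  have h := congrArg (PowerSeries.coeff 0) u_ode
  rw [PowerSeries.coeff_zero_eq_constantCoeff_apply, map_mul, map_mul, map_pow,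
    constantCoeff_period, constantCoeff_curveDisc, ← PowerSeries.coeff_zero_eq_constantCoeff_apply,
    PowerSeries.coeff_derivative] at h
  simpa using h

/-- The Picard–Fuchs equation is free of E₂, so the derivative of the period in E₂ is again a
solution, as is `uSeries * period`. Both sides start with 0 and have coefficient -E₄/12 at `X`. -/
theorem delE2_period : coeffD delE2 period = C (MvPolynomial.C (1 / 12)) * (uSeries * period) := by
  have hB := period_ode
  have hu := u_ode
  have hQ := coeffD_delE2_curveDisc
  have hP : period ≠ 0 := ne_zero_of_constantCoeff constantCoeff_period
  rw [← sub_eq_zero]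
  apply eq_zero_of_picardFuchs
  · have e1 := congrArg (coeffD delE2) hB
    have hC : coeffD delE2 (C (60 * disc)) = 0 := by
      rw [coeffD_C, Derivation.leibniz, delE2_disc, show (60 : QMod) = ((60 : ℕ) : QMod) by norm_num,
        Derivation.map_natCast]; simp
    rw [coeffD_derivative, Derivation.leibniz, hQ, coeffD_derivative, Derivation.leibniz, hC] at e1
    simp only [smul_eq_mul, mul_zero, add_zero] at e1
    -- After multiplication by `period`, this combines the derivative of `u_ode` with the equation
    -- of the period.
    have e2 : ∂ (curveDisc * ∂ (uSeries * period)) = C (60 * disc) * (uSeries * period) := by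
      have hu' := congrArg ∂ hu
      rw [map_neg, PowerSeries.derivative_C, neg_zero] at hu'
      simp only [Derivation.leibniz, smul_eq_mul, Derivation.leibniz_pow, map_add] at hu' hB ⊢
      apply mul_left_cancel₀ hP
      simp only [nsmul_eq_mul, Nat.add_one_sub_one, pow_one] at hu'
      push_cast at hu'
      linear_combination hu' + period * uSeries * hB
    have e3 : ∂ (C (MvPolynomial.C (1 / 12)) : PowerSeries QMod) = 0 := PowerSeries.derivative_C
    rw [map_sub, Derivation.leibniz (∂) (C (MvPolynomial.C (1 / 12))) (uSeries * period), e3,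
      smul_zero, add_zero, smul_eq_mul, mul_sub, map_sub, e1,
      mul_left_comm curveDisc, Derivation.leibniz (∂) (C (MvPolynomial.C (1 / 12))), e3, e2]
    simp only [smul_eq_mul, mul_zero, add_zero]
    ring
  · rw [map_sub, coeff_coeffD]
    simp [constantCoeff_period, constantCoeff_u]
  · rw [map_sub, coeff_coeffD, PowerSeries.coeff_C_mul, PowerSeries.coeff_mul,
      Finset.Nat.antidiagonal_succ]
    simp [coeff_one_u, constantCoeff_u, constantCoeff_period]
    rw [period, PowerSeries.coeff_mk, periodCoeff]
    simp [delE2, Derivation.leibniz, MvPolynomial.pderiv_X]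

end

section

open PowerSeries (X C constantCoeff)
local notation "∂" => PowerSeries.derivative QMod
local notation "δ" => coeffD delE2
local notation "ε" => coeffD euler

theorem derivative_rat_mul (r : ℚ) (f : PowerSeries QMod) :
    ∂ (C (MvPolynomial.C r) * f) = C (MvPolynomial.C r) * ∂ f := by
  rw [Derivation.leibniz, PowerSeries.derivative_C]; simp

theorem coeffD_rat_mul (d : Derivation ℚ QMod QMod) (r : ℚ) (f : PowerSeries QMod) :
    coeffD d (C (MvPolynomial.C r) * f) = C (MvPolynomial.C r) * coeffD d f := by
  have : d (MvPolynomial.C r) = 0 := d.map_algebraMap r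
  rw [Derivation.leibniz, coeffD_C, this]; simp

theorem ext_of_derivative {f g : PowerSeries QMod} (h : ∂ f = ∂ g)
    (h0 : constantCoeff f = constantCoeff g) : f = g :=
  ext_of_X_mul_derivative (by rw [h]) h0

theorem period_ne_zero : period ≠ 0 := ne_zero_of_constantCoeff constantCoeff_period
theorem curveDisc_ne_zero : curveDisc ≠ 0 := ne_zero_of_constantCoeff constantCoeff_curveDisc

theorem rat_eq (a b : ℚ) : (C (MvPolynomial.C (a * b)) : PowerSeries QMod) =
    C (MvPolynomial.C a) * C (MvPolynomial.C b) := by simp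

/-- Rational constants in `QMod⟦X⟧`. -/
theorem rat_C_ofNat (n : ℕ) : (C (MvPolynomial.C (n : ℚ)) : PowerSeries QMod) = n := by simp

/-- Applying ∂/∂E₂ to `u_ode` gives δ(u') = -u u'/6, which is the derivative of -u²/12. -/
theorem delE2_u : δ uSeries = -(C (MvPolynomial.C (1 / 12)) * uSeries ^ 2) := by
  apply ext_of_derivative
  · have h := congrArg δ u_ode
    rw [Derivation.leibniz, Derivation.leibniz, Derivation.leibniz_pow, delE2_period,
      coeffD_delE2_curveDisc, map_neg, coeffD_C, coeffD_derivative] at h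
    have h4 : delE2 (MvPolynomial.X 1) = 0 := by simp [delE2, MvPolynomial.pderiv_X]
    rw [h4] at h
    simp only [smul_eq_mul, nsmul_eq_mul, mul_zero, map_zero, neg_zero, zero_add,
      Nat.add_one_sub_one, pow_one] at h
    rw [map_neg, derivative_rat_mul, Derivation.leibniz_pow]
    simp only [smul_eq_mul, nsmul_eq_mul, Nat.add_one_sub_one, pow_one]
    apply mul_left_cancel₀ (mul_ne_zero curveDisc_ne_zero (pow_ne_zero 2 period_ne_zero))
    push_cast at h ⊢
    linear_combination h
  · rw [constantCoeff_coeffD]; simp [constantCoeff_u]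

theorem delE2_ell : δ ellSeries = -(C (MvPolynomial.C (1 / 12)) * fSeries) := by
  apply ext_of_X_mul_derivative
  · have h := congrArg δ ell_ode
    rw [Derivation.leibniz, coeffD_X, coeffD_derivative, map_sub, delE2_period,
      Derivation.map_one_eq_zero, smul_zero, add_zero, smul_eq_mul, sub_zero] at h
    rw [h, map_neg, derivative_rat_mul]
    linear_combination C (MvPolynomial.C (1 / 12)) * f_ode
  · rw [constantCoeff_coeffD]; simp [constantCoeff_ell, constantCoeff_f]

/-- The contributions of δu = -u²/12 and δ period = u · period/12 to δ(u · period) cancel. -/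
theorem delE2_f : δ fSeries = 0 := by
  apply ext_of_X_mul_derivative
  · have h := congrArg δ f_ode
    rw [Derivation.leibniz, coeffD_X, coeffD_derivative, map_neg, Derivation.leibniz, delE2_period,
      delE2_u] at h
    simp only [smul_eq_mul, mul_zero, add_zero] at h
    rw [h, map_zero]; ring
  · rw [constantCoeff_coeffD]; simp [constantCoeff_f]

theorem rat_mul_eq (a b : ℚ) (n : ℕ) (h : a * n = b) :
    (C (MvPolynomial.C a) : PowerSeries QMod) * (n : PowerSeries QMod) = C (MvPolynomial.C b) := by
  rw [← h, rat_eq, rat_C_ofNat]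

/-- Since f is free of E₂, only the period is differentiated, and f u · period/12 = -f θf/12 =
-θ(f²)/24. -/
theorem delE2_pot0 : δ pot0 = -(C (MvPolynomial.C (1 / 24)) * fSeries ^ 2) := by
  apply ext_of_X_mul_derivative
  · have h := congrArg δ pot0_ode
    rw [Derivation.leibniz, coeffD_X, coeffD_derivative, Derivation.leibniz, delE2_period,
      delE2_f] at h
    simp only [smul_eq_mul, mul_zero, add_zero] at h
    rw [h, map_neg, derivative_rat_mul, Derivation.leibniz_pow]
    simp only [smul_eq_mul, nsmul_eq_mul, Nat.add_one_sub_one, pow_one]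
    have h2 := rat_mul_eq (1 / 24) (1 / 12) 2 (by norm_num)
    push_cast at h2 ⊢
    linear_combination C (MvPolynomial.C (1 / 12)) * fSeries * f_ode +
      X * fSeries * ∂ fSeries * h2
  · rw [constantCoeff_coeffD]; simp [constantCoeff_pot0, constantCoeff_f]

theorem delE2_logCurveDisc : δ logCurveDisc = 0 := by
  apply ext_of_derivative
  · have h := congrArg δ logCurveDisc_ode
    rw [Derivation.leibniz, coeffD_derivative, coeffD_derivative, coeffD_delE2_curveDisc] at h
    simp only [smul_eq_mul, mul_zero, zero_add, map_zero] at h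
    rw [map_zero]
    exact (mul_eq_zero.mp h).resolve_left curveDisc_ne_zero
  · rw [constantCoeff_coeffD]; simp [constantCoeff_logCurveDisc]

theorem delE2_logPeriod : δ logPeriod = C (MvPolynomial.C (1 / 12)) * uSeries := by
  apply ext_of_derivative
  · have h := congrArg δ logPeriod_ode
    rw [Derivation.leibniz, coeffD_derivative, coeffD_derivative, delE2_period, derivative_rat_mul,
      Derivation.leibniz] at h
    simp only [smul_eq_mul] at h
    apply mul_left_cancel₀ period_ne_zero
    rw [derivative_rat_mul]
    linear_combination h - C (MvPolynomial.C (1 / 12)) * uSeries * logPeriod_ode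
  · rw [constantCoeff_coeffD]; simp [constantCoeff_logPeriod, constantCoeff_u]

/-- The discriminant is free of E₂; the logarithms of t/X and of the period contribute f/24 and
-u/24. -/
theorem delE2_pot1 : δ pot1 = C (MvPolynomial.C (1 / 24)) * (fSeries - uSeries) := by
  rw [pot1, map_sub, map_sub, coeffD_rat_mul, coeffD_rat_mul, coeffD_rat_mul, delE2_logCurveDisc,
    delE2_ell, delE2_logPeriod]
  have h2 := rat_eq (1 / 2) (1 / 12)
  norm_num at h2 ⊢
  linear_combination (uSeries - fSeries) * h2

/-! ### The Euler operator -/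

theorem euler_X (i : Fin 3) :
    euler (MvPolynomial.X i) = (![2, 4, 6] i : QMod) * MvPolynomial.X i := by
  have := coeff_euler (MvPolynomial.X i)
  ext m
  rw [this]
  have h : (![2, 4, 6] i : QMod) = MvPolynomial.C ((![2, 4, 6] : Fin 3 → ℕ) i : ℚ) := by
    fin_cases i <;> simp [← map_ofNat (MvPolynomial.C (σ := Fin 3) (R := ℚ))]
  rw [h, MvPolynomial.coeff_C_mul, MvPolynomial.coeff_X]
  split_ifs with hm
  · rw [← hm, Finsupp.weight_single]; simp
  · simp

theorem euler_disc : euler disc = 12 * disc := by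
  have h : euler (MvPolynomial.C (1 / 1728)) = 0 := euler.map_algebraMap _
  rw [disc, Derivation.leibniz, h, map_sub, Derivation.leibniz_pow, Derivation.leibniz_pow,
    euler_X, euler_X]
  simp
  ring

theorem euler_natCast_mul (n : ℕ) (f : QMod) : euler ((n : QMod) * f) = n * euler f := by
  rw [Derivation.leibniz, Derivation.map_natCast]; simp

/-- The recursion for the coefficients is homogeneous when `X` is given weight -6, so the
coefficient of `X ^ k` has weight 6k. -/
theorem euler_period : ε period = 6 * (X * ∂ period) := by
  have key : ∀ k, euler (periodCoeff k) = 6 * (k : QMod) * periodCoeff k ∧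
      euler (periodCoeff (k + 1)) = 6 * ((k : QMod) + 1) * periodCoeff (k + 1) := by
    intro k
    induction k with
    | zero =>
      refine ⟨by simp [periodCoeff], ?_⟩
      have h : euler (-MvPolynomial.C (1 / 12)) = 0 := by
        rw [← map_neg]; exact euler.map_algebraMap _
      rw [periodCoeff, Derivation.leibniz, h, map_sub, Derivation.leibniz, euler_X, euler_X,
        euler_X]
      simp
      ring
    | succ k ih =>
      refine ⟨by push_cast; exact ih.2, ?_⟩
      have hr := congrArg euler (periodCoeff_rec k)
      rw [show ((k : QMod) + 2) * ((k : QMod) + 1) = (((k + 2) * (k + 1) : ℕ) : QMod) by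
          push_cast; ring, map_add, euler_natCast_mul,
        show ((k : QMod) + 1) ^ 2 * MvPolynomial.X 2 * periodCoeff (k + 1) =
          (((k + 1) ^ 2 : ℕ) : QMod) * (MvPolynomial.X 2 * periodCoeff (k + 1)) by
          push_cast; ring,
        show (432 * (k : QMod) * ((k : QMod) + 1) + 60) * disc * periodCoeff k =
          ((432 * k * (k + 1) + 60 : ℕ) : QMod) * (disc * periodCoeff k) by push_cast; ring,
        euler_natCast_mul, euler_natCast_mul, Derivation.leibniz, Derivation.leibniz, ih.1, ih.2,
        euler_X, euler_disc] at hr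
      have h2 : ((k : QMod) + 2) * ((k : QMod) + 1) ≠ 0 := by
        have : ((k : QMod) + 2) * ((k : QMod) + 1) = (((k + 2) * (k + 1) : ℕ) : QMod) := by
          push_cast; ring
        rw [this]; exact Nat.cast_ne_zero.mpr (by positivity)
      apply mul_left_cancel₀ h2
      simp only [Matrix.cons_val, smul_eq_mul] at hr
      push_cast at hr ⊢
      linear_combination hr - 6 * ((k : QMod) + 2) * periodCoeff_rec k
  ext1 k
  have h6 : (6 : PowerSeries QMod) = C 6 := (map_ofNat _ 6).symm
  rw [coeff_coeffD, h6, PowerSeries.coeff_C_mul, coeff_X_mul_derivative, period,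
    PowerSeries.coeff_mk, (key k).1]
  ring

theorem euler_curveDisc : ε curveDisc = 6 * (X * ∂ curveDisc) := by
  have h : euler (432 * disc) = 12 * (432 * disc) := by
    have := euler_natCast_mul 432 disc
    push_cast at this
    rw [this, euler_disc]; ring
  have h2 : (C (12 * (432 * disc)) : PowerSeries QMod) = 12 * C (432 * disc) := by
    rw [map_mul, map_ofNat]
  have h3 : (C (6 * MvPolynomial.X 2) : PowerSeries QMod) = 6 * C (MvPolynomial.X 2) := by
    rw [map_mul, map_ofNat]
  rw [curveDisc]
  simp only [map_sub, Derivation.map_one_eq_zero, Derivation.leibniz,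
    Derivation.leibniz_pow, coeffD_C, coeffD_X, h, euler_X, PowerSeries.derivative_C,
    PowerSeries.derivative_X, Matrix.cons_val, h2, h3]
  simp only [smul_eq_mul, nsmul_eq_mul]
  push_cast
  ring

theorem derivative_six_mul (f : PowerSeries QMod) : ∂ (6 * f) = 6 * ∂ f := by
  have h6 : (6 : PowerSeries QMod) = ((6 : ℕ) : PowerSeries QMod) := by norm_num
  rw [Derivation.leibniz, h6, Derivation.map_natCast]; simp

theorem derivative_two_mul (f : PowerSeries QMod) : ∂ (2 * f) = 2 * ∂ f := by
  have h6 : (2 : PowerSeries QMod) = ((2 : ℕ) : PowerSeries QMod) := by norm_num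
  rw [Derivation.leibniz, h6, Derivation.map_natCast]; simp

/-- The right-hand side of `u_ode` has weight 4, whereas differentiating once in `X` costs 6. This
produces the shift by -2, which survives as the weight 6n - 2 in genus zero. -/
theorem euler_u : ε uSeries = 6 * (X * ∂ uSeries) - 2 * uSeries := by
  apply ext_of_derivative
  · have h := congrArg ε u_ode
    have h' := congrArg ∂ u_ode
    have h4 : (C (4 * MvPolynomial.X 1) : PowerSeries QMod) = 4 * C (MvPolynomial.X 1) := by
      rw [map_mul, map_ofNat]
    simp only [Derivation.leibniz, Derivation.leibniz_pow, euler_period, euler_curveDisc,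
      map_neg, coeffD_C, coeffD_derivative, euler_X, Matrix.cons_val, h4,
      PowerSeries.derivative_C, smul_eq_mul, nsmul_eq_mul, Nat.add_one_sub_one, pow_one] at h h'
    push_cast at h h'
    apply mul_left_cancel₀ (mul_ne_zero curveDisc_ne_zero (pow_ne_zero 2 period_ne_zero))
    rw [map_sub, derivative_six_mul, derivative_two_mul, Derivation.leibniz,
      PowerSeries.derivative_X]
    simp only [smul_eq_mul]
    linear_combination h - 6 * X * h' - 4 * u_ode
  · rw [constantCoeff_coeffD]; simp [constantCoeff_u]

theorem euler_ell : ε ellSeries = 6 * (X * ∂ ellSeries) := by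
  apply ext_of_X_mul_derivative
  · have h := congrArg ε ell_ode
    rw [Derivation.leibniz, coeffD_X, coeffD_derivative, map_sub, euler_period,
      Derivation.map_one_eq_zero, smul_zero, add_zero, smul_eq_mul, sub_zero] at h
    rw [h, derivative_six_mul, ell_ode, map_sub, Derivation.map_one_eq_zero]
    ring
  · rw [constantCoeff_coeffD]; simp [constantCoeff_ell]

/-- Multiplication by `period` and integration of dX/X respect the grading, so the shift -2 passes
from u to f and from f to the potential. -/
theorem euler_of_ode {g f : PowerSeries QMod} (hg : constantCoeff g = 0)
    (hf : ε f = 6 * (X * ∂ f) - 2 * f) (h : X * ∂ g = f * period) :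
    ε g = 6 * (X * ∂ g) - 2 * g := by
  apply ext_of_X_mul_derivative
  · have h1 := congrArg ε h
    rw [Derivation.leibniz, coeffD_X, coeffD_derivative, Derivation.leibniz, hf,
      euler_period] at h1
    simp only [smul_eq_mul, mul_zero, add_zero] at h1
    rw [h1, map_sub, derivative_six_mul, derivative_two_mul, h, Derivation.leibniz]
    simp only [smul_eq_mul]
    linear_combination 2 * h
  · rw [constantCoeff_coeffD]; simp [hg]

theorem euler_f : ε fSeries = 6 * (X * ∂ fSeries) - 2 * fSeries := by
  apply euler_of_ode constantCoeff_f (f := -uSeries)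
  · rw [map_neg, map_neg, euler_u]; ring
  · rw [f_ode]; ring

theorem euler_pot0 : ε pot0 = 6 * (X * ∂ pot0) - 2 * pot0 :=
  euler_of_ode constantCoeff_pot0 euler_f pot0_ode

theorem euler_of_log_ode {l f : PowerSeries QMod} (hl : constantCoeff l = 0) (hf0 : f ≠ 0)
    (hf : ε f = 6 * (X * ∂ f)) (h : ∂ l * f = ∂ f) : ε l = 6 * (X * ∂ l) := by
  apply ext_of_derivative
  · have h1 := congrArg ε h
    have h2 := congrArg ∂ h
    rw [Derivation.leibniz, coeffD_derivative, coeffD_derivative, hf, derivative_six_mul] at h1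
    rw [derivative_six_mul]
    simp only [Derivation.leibniz, PowerSeries.derivative_X, smul_eq_mul] at h1 h2 ⊢
    apply mul_left_cancel₀ hf0
    linear_combination h1 - 6 * X * h2 - 6 * h
  · rw [constantCoeff_coeffD]; simp [hl]

theorem euler_pot1 : ε pot1 = 6 * (X * ∂ pot1) := by
  rw [pot1]
  simp only [map_sub, coeffD_rat_mul, derivative_rat_mul]
  rw [euler_of_log_ode constantCoeff_logCurveDisc curveDisc_ne_zero euler_curveDisc
    logCurveDisc_ode, euler_of_log_ode constantCoeff_logPeriod period_ne_zero euler_period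
    logPeriod_ode, euler_ell]
  ring

/-! ### The potentials in the coordinate `t` -/

theorem isUnit_coeff_one_t : IsUnit (PowerSeries.coeff 1 tSeries) := by
  rw [coeff_one_t]; exact isUnit_one

/-- The inverse series of `tSeries`. -/
def tInv : PowerSeries QMod := PowerSeries.substInvOfIsUnit tSeries isUnit_coeff_one_t

theorem hasSubst_t : PowerSeries.HasSubst tSeries :=
  PowerSeries.HasSubst.of_constantCoeff_zero' constantCoeff_tSeries

theorem tInv_subst_t : tInv.subst tSeries = X :=
  PowerSeries.subst_substInvOfIsUnit_left _ constantCoeff_tSeries isUnit_coeff_one_t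

theorem t_subst_tInv : tSeries.subst tInv = X :=
  PowerSeries.subst_substInvOfIsUnit_right _ constantCoeff_tSeries isUnit_coeff_one_t

theorem constantCoeff_tInv : constantCoeff tInv = 0 :=
  PowerSeries.constantCoeff_substInvOfIsUnit tSeries isUnit_coeff_one_t

theorem hasSubst_tInv : PowerSeries.HasSubst tInv :=
  PowerSeries.HasSubst.of_constantCoeff_zero' constantCoeff_tInv

theorem subst_tInv_subst_t (f : PowerSeries QMod) : PowerSeries.subst tSeries (f.subst tInv : PowerSeries QMod) = f := by
  rw [PowerSeries.subst_comp_subst_apply hasSubst_tInv hasSubst_t, tInv_subst_t]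
  exact PowerSeries.X_subst f

theorem subst_t_subst_tInv (f : PowerSeries QMod) : PowerSeries.subst tInv (f.subst tSeries : PowerSeries QMod) = f := by
  rw [PowerSeries.subst_comp_subst_apply hasSubst_t hasSubst_tInv, t_subst_tInv]
  exact PowerSeries.X_subst f

theorem subst_t_injective {f g : PowerSeries QMod} (h : f.subst tSeries = g.subst tSeries) :
    f = g := by
  rw [← subst_t_subst_tInv f, h, subst_t_subst_tInv]

/-- The potentials of genus zero and one in the coordinate `t`. -/
def potT : ℕ → PowerSeries QMod
  | 0 => pot0.subst tInv
  | 1 => pot1.subst tInv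
  | _ => 0

theorem potT_zero_subst_t : (potT 0).subst tSeries = pot0 := subst_tInv_subst_t _
theorem potT_one_subst_t : (potT 1).subst tSeries = pot1 := subst_tInv_subst_t _

theorem subst_t_mul (f g : PowerSeries QMod) :
    (f * g).subst tSeries = f.subst tSeries * g.subst tSeries :=
  PowerSeries.subst_mul hasSubst_t _ _
theorem subst_t_add (f g : PowerSeries QMod) :
    (f + g).subst tSeries = f.subst tSeries + g.subst tSeries :=
  PowerSeries.subst_add hasSubst_t _ _
theorem subst_t_sub (f g : PowerSeries QMod) :
    (f - g).subst tSeries = f.subst tSeries - g.subst tSeries := by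
  rw [← PowerSeries.coe_substAlgHom hasSubst_t, map_sub]
theorem subst_t_rat_mul (r : ℚ) (g : PowerSeries QMod) :
    (C (MvPolynomial.C r) * g).subst tSeries = C (MvPolynomial.C r) * g.subst tSeries := by
  rw [subst_t_mul, ← PowerSeries.coe_substAlgHom hasSubst_t]
  congr 1
  exact (PowerSeries.substAlgHom hasSubst_t).commutes (MvPolynomial.C r)
theorem subst_t_natCast_mul (r : ℕ) (g : PowerSeries QMod) :
    ((r : PowerSeries QMod) * g).subst tSeries = (r : PowerSeries QMod) * g.subst tSeries := by
  rw [subst_t_mul, ← PowerSeries.coe_substAlgHom hasSubst_t, map_natCast]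

theorem theta_subst_t (P : PowerSeries QMod) :
    X * ∂ (P.subst tSeries) = (X * ∂ P).subst tSeries * period := by
  rw [PowerSeries.derivative_subst hasSubst_t, subst_t_mul, PowerSeries.subst_X hasSubst_t]
  linear_combination (∂ P).subst tSeries * t_ode

/-- A derivation of the coefficients at fixed `X` differs from the one at fixed t by θ_t P times the
derivative of log t. -/
theorem coeffD_subst_t (d : Derivation ℚ QMod QMod) (P : PowerSeries QMod) :
    coeffD d (P.subst tSeries) = (coeffD d P).subst tSeries +
      (X * ∂ P).subst tSeries * coeffD d ellSeries := by
  rw [coeffD_subst d constantCoeff_tSeries, coeffD_t, subst_t_mul, PowerSeries.subst_X hasSubst_t]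
  ring

theorem theta_potT_zero : (X * ∂ (potT 0)).subst tSeries = fSeries := by
  have h := theta_subst_t (potT 0)
  rw [potT_zero_subst_t, pot0_ode] at h
  exact (mul_right_cancel₀ period_ne_zero h).symm

/-- So -u is the second logarithmic derivative of the genus zero potential. It is the quantity later
matched with a difference of values of log q. -/
theorem theta_theta_potT_zero : (X * ∂ (X * ∂ (potT 0))).subst tSeries = -uSeries := by
  have h := theta_subst_t (X * ∂ (potT 0))
  rw [theta_potT_zero, f_ode, ← neg_mul] at h
  exact (mul_right_cancel₀ period_ne_zero h).symm

theorem euler_potT_zero : ε (potT 0) = 6 * (X * ∂ (potT 0)) - 2 * potT 0 := by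
  apply subst_t_injective
  have h := coeffD_subst_t euler (potT 0)
  have h6 := subst_t_natCast_mul 6 (X * ∂ (potT 0))
  have h2 := subst_t_natCast_mul 2 (potT 0)
  push_cast at h6 h2
  rw [potT_zero_subst_t, euler_ell, theta_potT_zero, ell_ode, euler_pot0, pot0_ode] at h
  rw [subst_t_sub, h6, h2, theta_potT_zero, potT_zero_subst_t]
  linear_combination -h

theorem euler_potT_one : ε (potT 1) = 6 * (X * ∂ (potT 1)) := by
  apply subst_t_injective
  have h := coeffD_subst_t euler (potT 1)
  have h6 := subst_t_natCast_mul 6 (X * ∂ (potT 1))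
  have h3 := theta_subst_t (potT 1)
  push_cast at h6
  rw [potT_one_subst_t, euler_ell, ell_ode, euler_pot1] at h
  rw [potT_one_subst_t] at h3
  rw [h6]
  linear_combination -h + 6 * h3

/-- The passage from fixed `X` to fixed t adds f · f/12 to -f²/24, leaving f²/24 with f = θ_t F₀.
This is the generating function of the genus zero anomaly equations. -/
theorem delE2_potT_zero :
    δ (potT 0) = C (MvPolynomial.C (1 / 24)) * (X * ∂ (potT 0)) ^ 2 := by
  apply subst_t_injective
  have h := coeffD_subst_t delE2 (potT 0)
  rw [potT_zero_subst_t, delE2_ell, theta_potT_zero, delE2_pot0] at h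
  rw [subst_t_rat_mul, pow_two, subst_t_mul, theta_potT_zero]
  have h2 := rat_mul_eq (1 / 24) (1 / 12) 2 (by norm_num)
  push_cast at h2
  linear_combination -h - fSeries ^ 2 * h2

/-- The change of coordinate adds f θ_t F₁/12 to (f - u)/24. The factor 1/12 is twice 1/24, for the
two splittings of genus one, and -u = θ_t² F₀ accounts for the factor n(n + 1). -/
theorem delE2_potT_one :
    δ (potT 1) = C (MvPolynomial.C (1 / 12)) * ((X * ∂ (potT 0)) * (X * ∂ (potT 1))) +
      C (MvPolynomial.C (1 / 24)) * (X * ∂ (X * ∂ (potT 0)) + X * ∂ (potT 0)) := by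
  apply subst_t_injective
  have h := coeffD_subst_t delE2 (potT 1)
  rw [potT_one_subst_t, delE2_ell, delE2_pot1] at h
  rw [subst_t_add, subst_t_rat_mul, subst_t_mul, subst_t_rat_mul, subst_t_add, theta_potT_zero,
    theta_theta_potT_zero]
  linear_combination -h

theorem constantCoeff_potT (g : ℕ) : constantCoeff (potT g) = 0 := by
  have key (f : PowerSeries QMod) (hf : constantCoeff f = 0) : constantCoeff (f.subst tInv) = 0 := by
    have := constantCoeff_powerSeries_subst (a := tInv) constantCoeff_tInv f
    rw [hf] at this
    exact this
  match g with
  | 0 => exact key _ constantCoeff_pot0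
  | 1 => exact key _ constantCoeff_pot1
  | _ + 2 => simp [potT]

/-- The polynomials `P_{g,n}` solving the anomaly equation. -/
def potCoeff (g n : ℕ) : QMod := PowerSeries.coeff n (potT g)

theorem euler_potCoeff_zero (n : ℕ) :
    euler (potCoeff 0 n) = 6 * (n : QMod) * potCoeff 0 n - 2 * potCoeff 0 n := by
  have h := congrArg (PowerSeries.coeff n) euler_potT_zero
  rw [coeff_coeffD, map_sub, ← map_ofNat C 6, ← map_ofNat C 2, PowerSeries.coeff_C_mul,
    PowerSeries.coeff_C_mul, coeff_X_mul_derivative] at h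
  rw [potCoeff, h]; ring

theorem euler_potCoeff_one (n : ℕ) : euler (potCoeff 1 n) = 6 * (n : QMod) * potCoeff 1 n := by
  have h := congrArg (PowerSeries.coeff n) euler_potT_one
  rw [coeff_coeffD, ← map_ofNat C 6, PowerSeries.coeff_C_mul, coeff_X_mul_derivative] at h
  rw [potCoeff, h]; ring

theorem isWeightedHomogeneous_potCoeff (g : ℕ) (hg : g ≤ 1) (n : ℕ) (hn : 1 ≤ n) :
    MvPolynomial.IsWeightedHomogeneous ![2, 4, 6] (potCoeff g n) (2 * g + 6 * n - 2) := by
  apply isWeightedHomogeneous_of_euler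
  interval_cases g
  · rw [euler_potCoeff_zero, Nat.cast_sub (by omega)]
    push_cast; ring
  · rw [euler_potCoeff_one, show 2 * 1 + 6 * n - 2 = 6 * n by omega]
    push_cast; ring

theorem potCoeff_zero_right (g : ℕ) : potCoeff g 0 = 0 := by
  rw [potCoeff, PowerSeries.coeff_zero_eq_constantCoeff_apply, constantCoeff_potT]

theorem sum_antidiagonal_potCoeff (F : ℕ → ℕ → QMod) (n : ℕ) (h1 : F 0 n = 0) (h2 : F n 0 = 0) :
    ∑ a ∈ Finset.HasAntidiagonal.antidiagonal n, F a.1 a.2 = ∑ s ∈ Finset.Ico 1 n, F s (n - s) := by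
  rw [Finset.Nat.sum_antidiagonal_eq_sum_range_succ F, Finset.sum_range_succ, Nat.sub_self, h2,
    add_zero]
  cases n with
  | zero => simp
  | succ n => rw [Finset.range_eq_Ico, Finset.sum_eq_sum_Ico_succ_bot (by omega), Nat.sub_zero, h1,
      zero_add]

theorem delE2_potCoeff_zero (n : ℕ) : delE2 (potCoeff 0 n) = MvPolynomial.C (1 / 24) *
    ∑ s ∈ Finset.Ico 1 n, (s : QMod) * ((n - s : ℕ) : QMod) * (potCoeff 0 s * potCoeff 0 (n - s)) := by
  have h := congrArg (PowerSeries.coeff n) delE2_potT_zero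
  rw [coeff_coeffD, PowerSeries.coeff_C_mul, pow_two, PowerSeries.coeff_mul] at h
  rw [potCoeff, h]
  congr 1
  rw [sum_antidiagonal_potCoeff (fun a b => PowerSeries.coeff a (X * ∂ (potT 0)) *
    PowerSeries.coeff b (X * ∂ (potT 0))) n (by simp) (by simp)]
  refine Finset.sum_congr rfl fun s hs => ?_
  rw [coeff_X_mul_derivative, coeff_X_mul_derivative]
  simp only [potCoeff]
  ring

theorem delE2_potCoeff_one (n : ℕ) : delE2 (potCoeff 1 n) = MvPolynomial.C (1 / 12) *
      (∑ s ∈ Finset.Ico 1 n,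
        (s : QMod) * ((n - s : ℕ) : QMod) * (potCoeff 0 s * potCoeff 1 (n - s))) +
      MvPolynomial.C (1 / 24) * ((n : QMod) * ((n : QMod) + 1) * potCoeff 0 n) := by
  have h := congrArg (PowerSeries.coeff n) delE2_potT_one
  rw [coeff_coeffD, map_add, PowerSeries.coeff_C_mul, PowerSeries.coeff_C_mul,
    PowerSeries.coeff_mul, map_add, coeff_X_mul_derivative, coeff_X_mul_derivative] at h
  rw [potCoeff, h]
  congr 2
  · rw [sum_antidiagonal_potCoeff (fun a b => PowerSeries.coeff a (X * ∂ (potT 0)) *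
      PowerSeries.coeff b (X * ∂ (potT 1))) n (by simp) (by simp)]
    refine Finset.sum_congr rfl fun s hs => ?_
    rw [coeff_X_mul_derivative, coeff_X_mul_derivative]
    simp only [potCoeff]
    ring
  · simp only [potCoeff]
    ring

/-- The linear coefficients of u, f and the potential are -E₄, E₄ and E₄, and t begins with `X`. -/
theorem potCoeff_zero_one : potCoeff 0 1 = MvPolynomial.X 1 := by
  have hf : PowerSeries.coeff 1 fSeries = MvPolynomial.X 1 := by
    have h := congrArg (PowerSeries.coeff 1) f_ode
    rw [coeff_X_mul_derivative, map_neg, PowerSeries.coeff_mul] at h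
    simpa [Finset.Nat.antidiagonal_succ, constantCoeff_u, coeff_one_u, constantCoeff_period] using h
  have h := congrArg (PowerSeries.coeff 1) potT_zero_subst_t
  have hp : PowerSeries.coeff 1 pot0 = MvPolynomial.X 1 := by
    have h := congrArg (PowerSeries.coeff 1) pot0_ode
    rw [coeff_X_mul_derivative, PowerSeries.coeff_mul] at h
    simpa [Finset.Nat.antidiagonal_succ, constantCoeff_f, hf, constantCoeff_period] using h
  have h2 := congrArg (PowerSeries.coeff 0) (PowerSeries.derivative_subst hasSubst_t (f := potT 0))
  rw [potT_zero_subst_t, PowerSeries.coeff_derivative, PowerSeries.coeff_mul] at h2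
  have h3 := constantCoeff_powerSeries_subst (a := tSeries) constantCoeff_tSeries (∂ (potT 0))
  have h4 : PowerSeries.coeff 0 ((∂ (potT 0)).subst tSeries) = potCoeff 0 1 := by
    rw [PowerSeries.coeff_zero_eq_constantCoeff_apply]
    refine Eq.trans h3 ?_
    rw [← PowerSeries.coeff_zero_eq_constantCoeff_apply, PowerSeries.coeff_derivative]
    simp [potCoeff]
  rw [Finset.Nat.antidiagonal_zero, Finset.sum_singleton] at h2
  rw [h4, PowerSeries.coeff_derivative, zero_add, coeff_one_t, hp] at h2
  simpa using h2.symm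

end

/-! ### Power series as Fourier expansions on the upper half plane. -/

section

open UpperHalfPlane (ofComplex upperHalfPlaneSet)
open Function.Periodic (qParam)
open scoped UpperHalfPlane Manifold ModularForm MatrixGroups

/-- The series `f` is the `q`-expansion of the function `F` on the upper half plane. -/
def HasQ (f : PowerSeries ℂ) (F : ℍ → ℂ) : Prop :=
  ∀ τ : ℍ, HasSum (fun m : ℕ => PowerSeries.coeff m f • qParam (1 : ℝ) τ ^ m) (F τ)

namespace HasQ

variable {f g : PowerSeries ℂ} {F G : ℍ → ℂ}

theorem add (hf : HasQ f F) (hg : HasQ g G) : HasQ (f + g) (F + G) := fun τ => by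
  simpa [add_mul] using (hf τ).add (hg τ)

theorem smul (r : ℂ) (hf : HasQ f F) : HasQ (r • f) (r • F) := fun τ => by
  simpa [mul_assoc] using (hf τ).mul_left r

theorem sub (hf : HasQ f F) (hg : HasQ g G) : HasQ (f - g) (F - G) := fun τ => by
  simpa [sub_mul] using (hf τ).sub (hg τ)

theorem const (r : ℂ) : HasQ (PowerSeries.C r) (fun _ => r) := fun τ => by
  convert hasSum_ite_eq 0 r using 2 with m
  rw [PowerSeries.coeff_C]
  split_ifs with h
  · simp [h]
  · simp

theorem mul (hf : HasQ f F) (hg : HasQ g G) : HasQ (f * g) (F * G) := fun τ => by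
  have h1 := (hf τ).summable.norm
  have h2 := (hg τ).summable.norm
  have h3 := (summable_norm_sum_mul_antidiagonal_of_summable_norm h1 h2).of_norm
  have h4 := tsum_mul_tsum_eq_tsum_sum_antidiagonal_of_summable_norm h1 h2
  rw [(hf τ).tsum_eq, (hg τ).tsum_eq] at h4
  rw [Pi.mul_apply, h4]
  convert! h3.hasSum using 2 with m
  rw [PowerSeries.coeff_mul, smul_eq_mul, Finset.sum_mul]
  refine Finset.sum_congr rfl fun a ha => ?_
  rw [← Finset.HasAntidiagonal.mem_antidiagonal.mp ha, pow_add, smul_eq_mul, smul_eq_mul]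
  ring

theorem pow (hf : HasQ f F) (n : ℕ) : HasQ (f ^ n) (F ^ n) := by
  induction n with
  | zero => simpa using! const 1
  | succ n ih => rw [pow_succ, pow_succ]; exact ih.mul hf

theorem aeval {σ : Type*} (P : MvPolynomial σ ℚ) {e : σ → PowerSeries ℂ} {E : σ → ℍ → ℂ}
    (h : ∀ i, HasQ (e i) (E i)) :
    HasQ (MvPolynomial.aeval e P) (fun τ => MvPolynomial.aeval (fun i => E i τ) P) := by
  induction P using MvPolynomial.induction_on with
  | C r =>
    have h := const (r : ℂ)
    rw [← eq_ratCast (algebraMap ℚ ℂ) r] at h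
    simp only [MvPolynomial.aeval_C, PowerSeries.algebraMap_apply]
    exact h
  | add p q hp hq => simpa using! hp.add hq
  | mul_X p i hp => simpa using! hp.mul (h i)

/-- The sum of a `q`-series in the unit disc. -/
def disc (f : PowerSeries ℂ) (q : ℂ) : ℂ := ∑' m : ℕ, PowerSeries.coeff m f * q ^ m

/-- Every nonzero point of the unit disc is e^(2πiτ) for some τ in the upper half plane, so
convergence on the half plane is convergence on the whole disc. -/
theorem hasSum_disc (hf : HasQ f F) {q : ℂ} (hq : ‖q‖ < 1) :
    HasSum (fun m : ℕ => PowerSeries.coeff m f * q ^ m) (disc f q) := by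
  apply Summable.hasSum
  rcases eq_or_ne q 0 with rfl | hq0
  · apply summable_of_ne_finset_zero (s := {0})
    intro m hm
    simp at hm
    simp [hm]
  · have h1 := Function.Periodic.im_invQParam_pos_of_norm_lt_one one_pos hq hq0
    have := (hf ⟨Function.Periodic.invQParam 1 q, h1⟩).summable
    have h2 := Function.Periodic.qParam_right_inv one_ne_zero hq0
    change Summable fun m : ℕ => PowerSeries.coeff m f •
      qParam (1 : ℝ) (Function.Periodic.invQParam 1 q) ^ m at this
    rw [h2] at this
    exact this

theorem hasFPowerSeriesOnBall (hf : HasQ f F) :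
    HasFPowerSeriesOnBall (disc f) (.ofScalars ℂ fun m => PowerSeries.coeff m f) 0 1 := by
  constructor
  · refine le_of_forall_lt_imp_le_of_dense fun r hr => ?_
    lift r to NNReal using hr.ne_top
    apply FormalMultilinearSeries.le_radius_of_summable
    simpa [smul_eq_mul, norm_mul, mul_comm, mul_left_comm, mul_assoc] using
        (hasSum_disc hf (q := r) (by simpa using hr)).summable.norm
  · simp
  · intro y hy
    rw [← ENNReal.coe_one, Metric.eball_coe, NNReal.coe_one, mem_ball_zero_iff] at hy
    simpa [mul_comm] using hasSum_disc hf hy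

theorem eq_disc (hf : HasQ f F) (τ : ℍ) : F τ = disc f (qParam 1 τ) :=
  (hf τ).unique (hasSum_disc hf (Function.Periodic.norm_qParam_lt_one one_pos τ.im_pos))

theorem differentiableOn_disc (hf : HasQ f F) : DifferentiableOn ℂ (disc f) (Metric.ball 0 1) := by
  have := hf.hasFPowerSeriesOnBall.differentiableOn
  rwa [← ENNReal.coe_one, Metric.eball_coe] at this

/-- The sums agree on the punctured disc, hence near 0 by continuity, and an analytic function has
only one power series. -/
theorem unique (hf : HasQ f F) (hg : HasQ g F) : f = g := by
  have h : ∀ᶠ q in nhds (0 : ℂ), disc f q = disc g q := by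
    have hc : ∀ᶠ q in nhdsWithin (0 : ℂ) {0}ᶜ, disc f q = disc g q := by
      filter_upwards [self_mem_nhdsWithin, nhdsWithin_le_nhds (Metric.ball_mem_nhds (0 : ℂ) one_pos)]
        with q hq0 hq
      have hq : ‖q‖ < 1 := by simpa using hq
      have h1 := Function.Periodic.im_invQParam_pos_of_norm_lt_one one_pos hq hq0
      have h2 := Function.Periodic.qParam_right_inv (h := 1) one_ne_zero hq0
      have e1 := eq_disc hf ⟨Function.Periodic.invQParam 1 q, h1⟩
      have e2 := eq_disc hg ⟨Function.Periodic.invQParam 1 q, h1⟩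
      change _ = disc f (qParam (1 : ℝ) (Function.Periodic.invQParam 1 q)) at e1
      change _ = disc g (qParam (1 : ℝ) (Function.Periodic.invQParam 1 q)) at e2
      rw [h2] at e1 e2
      rw [← e1, ← e2]
    exact (hf.hasFPowerSeriesOnBall.hasFPowerSeriesAt.continuousAt.eventuallyEq_nhds_iff_eventuallyEq_nhdsNE
      hg.hasFPowerSeriesOnBall.hasFPowerSeriesAt.continuousAt).mp hc
  have h3 := (hf.hasFPowerSeriesOnBall.hasFPowerSeriesAt.congr h).eq_formalMultilinearSeries
    hg.hasFPowerSeriesOnBall.hasFPowerSeriesAt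
  ext n
  simpa using congrArg (FormalMultilinearSeries.coeff · n) h3

theorem iteratedDeriv_disc (hf : HasQ f F) (n : ℕ) :
    (n.factorial : ℂ)⁻¹ * iteratedDeriv n (disc f) 0 = PowerSeries.coeff n f := by
  have h1 := hf.hasFPowerSeriesOnBall.hasFPowerSeriesAt
  have h2 := h1.analyticAt.hasFPowerSeriesAt
  have := congrArg (FormalMultilinearSeries.coeff · n) (h1.eq_formalMultilinearSeries h2)
  simp at this
  rw [this]; ring

theorem hasDerivAt_comp (hf : HasQ f F) (τ : ℍ) :
    HasDerivAt (F ∘ ofComplex)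
      (deriv (disc f) (qParam 1 τ) * (2 * Real.pi * Complex.I * qParam 1 τ)) τ := by
  have hq : ‖qParam 1 τ‖ < 1 := Function.Periodic.norm_qParam_lt_one one_pos τ.im_pos
  have h1 : HasDerivAt (disc f) (deriv (disc f) (qParam 1 τ)) (qParam 1 τ) :=
    ((hf.differentiableOn_disc).differentiableAt
      (Metric.isOpen_ball.mem_nhds (by simpa using hq))).hasDerivAt
  have h2 : HasDerivAt (fun z : ℂ => qParam (1 : ℝ) z)
      (2 * Real.pi * Complex.I * qParam 1 τ) (τ : ℂ) := by
    have h3 : HasDerivAt (fun z : ℂ => 2 * Real.pi * Complex.I * z) (2 * Real.pi * Complex.I)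
      (τ : ℂ) := by simpa using (hasDerivAt_id (τ : ℂ)).const_mul (2 * Real.pi * Complex.I)
    have h4 := h3.cexp
    simp only [qParam, Complex.ofReal_one, div_one]
    convert! h4 using 1
    ring
  refine (h1.comp (τ : ℂ) h2).congr_of_eventuallyEq ?_
  filter_upwards [UpperHalfPlane.isOpen_upperHalfPlaneSet.mem_nhds τ.im_pos] with z hz
  rw [Function.comp_apply, UpperHalfPlane.ofComplex_apply_of_im_pos hz, eq_disc hf]
  rfl

theorem mdifferentiable (hf : HasQ f F) : MDiff F := by
  intro τ
  exact UpperHalfPlane.mdifferentiableAt_iff.mpr (hf.hasDerivAt_comp τ).differentiableAt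

/-- By the chain rule, (2πi)⁻¹ d/dτ is q d/dq; the Taylor series of the derivative on the disc
supplies the coefficients. -/
theorem derivative (hf : HasQ f F) :
    HasQ (PowerSeries.X * PowerSeries.derivative ℂ f) (Derivative.normalizedDerivOfComplex F) := by
  intro τ
  have hq : ‖qParam 1 τ‖ < 1 := Function.Periodic.norm_qParam_lt_one one_pos τ.im_pos
  have h1 := Complex.hasSum_taylorSeries_on_ball
    ((hf.differentiableOn_disc).deriv Metric.isOpen_ball) (z := qParam 1 τ) (by simpa using hq)
  have h2 : Derivative.normalizedDerivOfComplex F τ =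
      qParam 1 τ * deriv (disc f) (qParam 1 τ) := by
    rw [Derivative.normalizedDerivOfComplex, (hf.hasDerivAt_comp τ).deriv]
    have : 2 * (Real.pi : ℂ) * Complex.I ≠ 0 := Complex.two_pi_I_ne_zero
    field
  rw [h2]
  rw [← hasSum_nat_add_iff' 1]
  convert! h1.mul_left (qParam 1 τ) using 1
  · ext n
    rw [coeff_X_mul_derivative, ← hf.iteratedDeriv_disc, Nat.factorial_succ, iteratedDeriv_succ']
    have : (n.factorial : ℂ) ≠ 0 := by exact_mod_cast n.factorial_ne_zero
    have h3 : (n : ℂ) + 1 ≠ 0 := by exact_mod_cast n.succ_ne_zero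
    simp only [smul_eq_mul, sub_zero]
    push_cast
    field
  · simp

theorem slash_T (hf : HasQ f F) (k : ℤ) : F ∣[k] ModularGroup.T = F := by
  ext τ
  rw [ModularForm.SL_slash_apply, eq_disc hf, eq_disc hf]
  have : qParam (1 : ℝ) (ModularGroup.T • τ : ℍ) = qParam (1 : ℝ) τ := by
    rw [UpperHalfPlane.modular_T_smul]
    simp only [qParam, UpperHalfPlane.coe_vadd, Complex.ofReal_one, div_one, mul_add, mul_one,
      Complex.exp_add, Complex.exp_two_pi_mul_I, one_mul]
  rw [this, ModularGroup.denom_apply]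
  simp [ModularGroup.T]

/-- A `q`-series that transforms under `S` is a modular form. -/
def toModularForm (hf : HasQ f F) (k : ℤ) (hS : F ∣[k] ModularGroup.S = F) : ModularForm 𝒮ℒ k where
  toFun := F
  slash_action_eq' := by
    rintro _ ⟨γ, rfl⟩
    exact SlashInvariantForm.slash_action_generators_SL2Z hS (hf.slash_T k) γ
  holo' := hf.mdifferentiable
  bdd_at_cusps' := by
    intro c hc
    rw [OnePoint.isBoundedAt_iff_forall_SL2Z hc]
    intro γ _
    have := SlashInvariantForm.slash_action_generators_SL2Z hS (hf.slash_T k) γ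
    rw [this]
    exact UpperHalfPlane.isBoundedAtImInfty_of_hasSum_qExpansion one_pos hf

/-- The Sturm bound for `q`-series. -/
theorem eq_zero_of_coeff_eq_zero (hf : HasQ f F) {k : ℕ} (hS : F ∣[(k : ℤ)] ModularGroup.S = F)
    (h : ∀ d ≤ k / 12, PowerSeries.coeff d f = 0) : f = 0 := by
  have h1 : ∀ m, PowerSeries.coeff m f =
      PowerSeries.coeff m (UpperHalfPlane.qExpansion 1 (hf.toModularForm k hS)) := fun m =>
    ModularFormClass.qExpansion_coeff_unique one_pos one_mem_strictPeriods_SL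
      (f := hf.toModularForm k hS) hf m
  have h2 : f = UpperHalfPlane.qExpansion 1 (hf.toModularForm k hS) := PowerSeries.ext h1
  have h3 : hf.toModularForm k hS = 0 := by
    apply ModularForm.sturm_bound_levelOne_nat
    rw [← h2]
    by_contra hlt
    have := PowerSeries.nat_le_order f (k / 12 + 1) fun d hd => h d (by omega)
    exact hlt (lt_of_lt_of_le (by exact_mod_cast Nat.lt_succ_self _) this)
  have h4 : F = fun _ => 0 := by
    have := congrArg (fun f : ModularForm 𝒮ℒ k => (f : ℍ → ℂ)) h3
    exact this
  rw [h4] at hf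
  exact hf.unique (by simpa using const 0)

end HasQ

end

/-! ### Transformation of the Eisenstein series under τ ↦ -1/τ. -/

section

open UpperHalfPlane (ofComplex upperHalfPlaneSet)
open Function.Periodic (qParam)
open scoped UpperHalfPlane Manifold ModularForm MatrixGroups
open Derivative (normalizedDerivOfComplex)

theorem coeff_toComplex (f : PowerSeries ℚ) (n : ℕ) :
    PowerSeries.coeff n (toComplex f) = ((PowerSeries.coeff n f : ℚ) : ℂ) := by
  rw [toComplex, PowerSeries.coeff_map, eq_ratCast]

theorem toComplex_injective : Function.Injective toComplex := by
  intro f g h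
  ext n
  have := congrArg (PowerSeries.coeff n) h
  rw [coeff_toComplex, coeff_toComplex] at this
  exact_mod_cast this

theorem toComplex_derivative (f : PowerSeries ℚ) :
    toComplex (PowerSeries.derivative ℚ f) = PowerSeries.derivative ℂ (toComplex f) := by
  ext n
  rw [coeff_toComplex, PowerSeries.coeff_derivative, PowerSeries.coeff_derivative, coeff_toComplex]
  push_cast
  rfl

/-- The complex valued functions `E₂`, `E₄`, `E₆` on the upper half plane. -/
def eis : Fin 3 → ℍ → ℂ := ![EisensteinSeries.E2, ModularForm.E₄, ModularForm.E₆]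

theorem hasQ_E2 : HasQ (toComplex E2) (eis 0) := fun τ => by
  have h := EisensteinSeries.hasSum_qExpansion_E2 (z := τ)
  convert! h using 2 with m
  rw [coeff_toComplex, E2, PowerSeries.coeff_mk]
  simp only [qParam, Complex.ofReal_one, div_one]
  congr 1
  split_ifs <;> simp

theorem hasQ_E4 : HasQ (toComplex E4) (eis 1) := fun τ => by
  have h := ModularForm.hasSum_qExpansion ModularForm.E₄ one_pos one_mem_strictPeriods_SL τ
  convert! h using 2 with m
  rw [coeff_toComplex, E4, PowerSeries.coeff_mk, EisensteinSeries.E_qExpansion_coeff _ ⟨2, rfl⟩,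
    show bernoulli 4 = -1 / 30 by decide +kernel]
  congr 1
  split_ifs
  · simp
  · push_cast; norm_num

theorem hasQ_E6 : HasQ (toComplex E6) (eis 2) := fun τ => by
  have h := ModularForm.hasSum_qExpansion ModularForm.E₆ one_pos one_mem_strictPeriods_SL τ
  convert! h using 2 with m
  rw [coeff_toComplex, E6, PowerSeries.coeff_mk, EisensteinSeries.E_qExpansion_coeff _ ⟨3, rfl⟩,
    show bernoulli 6 = 1 / 42 by decide +kernel]
  congr 1
  split_ifs
  · simp
  · push_cast; norm_num

theorem hasQ_eis (i : Fin 3) : HasQ (toComplex (![E2, E4, E6] i)) (eis i) := by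
  fin_cases i
  exacts [hasQ_E2, hasQ_E4, hasQ_E6]

theorem slash_S_iff {F : ℍ → ℂ} {k : ℕ} :
    F ∣[(k : ℤ)] ModularGroup.S = F ↔ ∀ τ : ℍ, F (ModularGroup.S • τ) = (τ : ℂ) ^ k * F τ := by
  have key (τ : ℍ) : (F ∣[(k : ℤ)] ModularGroup.S) τ = F (ModularGroup.S • τ) / (τ : ℂ) ^ k := by
    rw [ModularForm.SL_slash_apply, ModularGroup.denom_S, zpow_neg, zpow_natCast]; rfl
  have h0 (τ : ℍ) : (τ : ℂ) ^ k ≠ 0 := pow_ne_zero _ (UpperHalfPlane.ne_zero τ)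
  rw [funext_iff]
  refine forall_congr' fun τ => ?_
  rw [key, div_eq_iff (h0 τ), mul_comm]

theorem eis_one_S (τ : ℍ) : eis 1 (ModularGroup.S • τ) = (τ : ℂ) ^ 4 * eis 1 τ := by
  refine slash_S_iff.mp ?_ τ
  exact SlashInvariantForm.slash_action_eqn ModularForm.E₄ _ ⟨ModularGroup.S, rfl⟩

theorem eis_two_S (τ : ℍ) : eis 2 (ModularGroup.S • τ) = (τ : ℂ) ^ 6 * eis 2 τ := by
  refine slash_S_iff.mp ?_ τ
  exact SlashInvariantForm.slash_action_eqn ModularForm.E₆ _ ⟨ModularGroup.S, rfl⟩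

/-- The constant `6 / (π i)`. -/
def quasiConst : ℂ := 6 / (Real.pi * Complex.I)

theorem quasiConst_ne_zero : quasiConst ≠ 0 := by simp [quasiConst, Real.pi_ne_zero]

theorem eis_zero_slash_S :
    eis 0 ∣[(2 : ℤ)] ModularGroup.S = fun τ => eis 0 τ + quasiConst / τ := by
  ext τ
  have h := congrFun (EisensteinSeries.E2_slash_action ModularGroup.S) τ
  change (EisensteinSeries.E2 ∣[(2 : ℤ)] ModularGroup.S) τ = EisensteinSeries.E2 τ + _
  rw [h]
  simp only [Pi.sub_apply, Pi.smul_apply, EisensteinSeries.D2_S, riemannZeta_two, smul_eq_mul,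
    quasiConst]
  have h0 : (τ : ℂ) ≠ 0 := UpperHalfPlane.ne_zero τ
  have h1 : (Real.pi : ℂ) ≠ 0 := by exact_mod_cast Real.pi_ne_zero
  have h2 := Complex.I_sq
  field_simp
  linear_combination (-6 : ℂ) * h2

theorem eis_zero_S (τ : ℍ) :
    eis 0 (ModularGroup.S • τ) = (τ : ℂ) ^ 2 * (eis 0 τ + quasiConst / τ) := by
  have h := congrFun eis_zero_slash_S τ
  have h0 : (τ : ℂ) ≠ 0 := UpperHalfPlane.ne_zero τ
  rw [ModularForm.SL_slash_apply, ModularGroup.denom_S] at h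
  rw [← h, zpow_neg]
  field

theorem mdiff_eis (i : Fin 3) : MDiff (eis i) := (hasQ_eis i).mdifferentiable

/-- The rule for differentiating a slashed function is applied to E₂ | S = E₂ + κ/τ with κ =
`quasiConst`, for which (2πi)⁻¹ = κ/12. -/
theorem deriv_eis_zero_S (τ : ℍ) :
    normalizedDerivOfComplex (eis 0) (ModularGroup.S • τ) = (τ : ℂ) ^ 4 *
      (normalizedDerivOfComplex (eis 0) τ + quasiConst / 6 * eis 0 τ / τ +
        quasiConst ^ 2 / 12 / τ ^ 2) := by
  have h0 : (τ : ℂ) ≠ 0 := UpperHalfPlane.ne_zero τ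
  have hpi : (Real.pi : ℂ) ≠ 0 := by exact_mod_cast Real.pi_ne_zero
  have h := congrFun (Derivative.normalizedDerivOfComplex_SL_slash (k := 2) (mdiff_eis 0)
    (γ := ModularGroup.S)) τ
  rw [eis_zero_slash_S] at h
  have hd : normalizedDerivOfComplex (fun τ => eis 0 τ + quasiConst / τ) τ =
      normalizedDerivOfComplex (eis 0) τ + (2 * Real.pi * Complex.I)⁻¹ *
        (-quasiConst / τ ^ 2) := by
    rw [normalizedDerivOfComplex, normalizedDerivOfComplex, ← mul_add]
    congr 1
    have h1 := (UpperHalfPlane.mdifferentiableAt_iff.mp (mdiff_eis 0 τ)).hasDerivAt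
    have h2 : HasDerivAt (fun z : ℂ => quasiConst / z) (-quasiConst / τ ^ 2) τ := by
      convert! (hasDerivAt_const (τ : ℂ) quasiConst).div (hasDerivAt_id (τ : ℂ)) h0 using 1
      simp
    refine ((h1.add h2).congr_of_eventuallyEq ?_).deriv
    filter_upwards [UpperHalfPlane.isOpen_upperHalfPlaneSet.mem_nhds τ.im_pos] with z hz
    simp [UpperHalfPlane.ofComplex_apply_of_im_pos hz]
  rw [hd, Pi.sub_apply, ModularForm.SL_slash_apply, ModularGroup.denom_S] at h
  have h3 : ((ModularGroup.S 1 0 : ℤ) : ℂ) = 1 := by simp [ModularGroup.S]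
  rw [h3, show (2 : ℤ) + 2 = 4 by norm_num, zpow_neg] at h
  have h4 : normalizedDerivOfComplex (eis 0) (ModularGroup.S • τ) = (τ : ℂ) ^ 4 *
      (normalizedDerivOfComplex (eis 0) (ModularGroup.S • τ) * ((τ : ℂ) ^ (4 : ℤ))⁻¹) := by
    field_simp
  rw [h4]
  congr 1
  have h5 : quasiConst * (Real.pi * Complex.I) = 6 := by
    rw [quasiConst]; field_simp
  have hI := Complex.I_ne_zero
  push_cast at h
  have h6 : quasiConst / 6 = (Real.pi * Complex.I)⁻¹ := by
    rw [quasiConst]; field_simp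
  have h7 : (2 * Real.pi * Complex.I)⁻¹ = quasiConst / 12 := by
    rw [quasiConst]; field_simp; norm_num
  rw [h7] at h
  linear_combination -h

/-! ### Ramanujan's identities -/

theorem constantCoeff_E2 : PowerSeries.constantCoeff E2 = 1 := by
  rw [← PowerSeries.coeff_zero_eq_constantCoeff_apply, E2, PowerSeries.coeff_mk]; simp
theorem constantCoeff_E4 : PowerSeries.constantCoeff E4 = 1 := by
  rw [← PowerSeries.coeff_zero_eq_constantCoeff_apply, E4, PowerSeries.coeff_mk]; simp
theorem constantCoeff_E6 : PowerSeries.constantCoeff E6 = 1 := by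
  rw [← PowerSeries.coeff_zero_eq_constantCoeff_apply, E6, PowerSeries.coeff_mk]; simp

/-- Vanishing of a rational `q`-series that is a modular form of small weight without constant
term. -/
theorem eq_zero_of_modular {f : PowerSeries ℚ} {F : ℍ → ℂ} (hf : HasQ (toComplex f) F) {k : ℕ}
    (hS : ∀ τ : ℍ, F (ModularGroup.S • τ) = (τ : ℂ) ^ k * F τ)
    (h : ∀ d ≤ k / 12, PowerSeries.coeff d f = 0) : f = 0 := by
  apply toComplex_injective
  rw [hf.eq_zero_of_coeff_eq_zero (slash_S_iff.mpr hS)]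
  · simp [toComplex]
  · intro d hd
    rw [coeff_toComplex, h d hd, Rat.cast_zero]

/-- The terms in κ/τ produced by the derivative of E₂ and by E₂²/12 cancel, so the difference of the
two sides is modular of weight 4. Its constant term is zero, and Sturm's bound makes it vanish. -/
theorem ramanujan_E2 : PowerSeries.X * PowerSeries.derivative ℚ E2 =
    PowerSeries.C (1 / 12) * (E2 ^ 2 - E4) := by
  rw [← sub_eq_zero]
  apply eq_zero_of_modular (k := 4)
    (F := normalizedDerivOfComplex (eis 0) - (1 / 12 : ℂ) • (eis 0 ^ 2 - eis 1))
  · have := hasQ_E2.derivative.sub (((hasQ_E2.pow 2).sub hasQ_E4).smul (1 / 12))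
    convert this using 1
    simp only [toComplex, map_sub, map_mul, map_pow, PowerSeries.map_X, PowerSeries.map_C,
      PowerSeries.smul_eq_C_mul]
    have h := toComplex_derivative E2
    rw [toComplex, toComplex] at h
    rw [h]
    simp
  · intro τ
    simp only [Pi.sub_apply, Pi.smul_apply, Pi.pow_apply, smul_eq_mul, deriv_eis_zero_S,
      eis_zero_S, eis_one_S]
    have h0 : (τ : ℂ) ≠ 0 := UpperHalfPlane.ne_zero τ
    field
  · intro d hd
    obtain rfl : d = 0 := by omega
    simp [constantCoeff_E2, constantCoeff_E4]

theorem serre_S {k : ℕ} {F : ℍ → ℂ} (hF : MDiff F)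
    (h : ∀ τ : ℍ, F (ModularGroup.S • τ) = (τ : ℂ) ^ k * F τ) (τ : ℍ) :
    (normalizedDerivOfComplex F - (k / 12 : ℂ) • (eis 0 * F)) (ModularGroup.S • τ) =
      (τ : ℂ) ^ (k + 2) * (normalizedDerivOfComplex F - (k / 12 : ℂ) • (eis 0 * F)) τ := by
  have h1 := Derivative.serreDerivative_slash_invariant hF (slash_S_iff.mpr h)
  have h2 := (slash_S_iff (k := k + 2)).mp (by push_cast; exact h1) τ
  have h3 (τ : ℍ) : (normalizedDerivOfComplex F - (k / 12 : ℂ) • (eis 0 * F)) τ =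
      Derivative.serreDerivative (k : ℤ) F τ := by
    rw [Derivative.serreDerivative_apply]
    simp [eis]
    ring
  rw [h3, h3]
  exact h2

/-- The Serre derivative of E₄ has weight 6 and constant term -1/3; adding E₆/3 gives a form without
constant term. -/
theorem ramanujan_E4 : PowerSeries.X * PowerSeries.derivative ℚ E4 =
    PowerSeries.C (1 / 3) * (E2 * E4 - E6) := by
  rw [← sub_eq_zero]
  apply eq_zero_of_modular (k := 6)
    (F := (normalizedDerivOfComplex (eis 1) - ((4 : ℕ) / 12 : ℂ) • (eis 0 * eis 1)) +
      (1 / 3 : ℂ) • eis 2)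
  · have := (hasQ_E4.derivative.sub ((hasQ_E2.mul hasQ_E4).smul ((4 : ℕ) / 12))).add
      (hasQ_E6.smul (1 / 3))
    convert this using 1
    simp only [toComplex, map_sub, map_mul, PowerSeries.map_X, PowerSeries.map_C,
      PowerSeries.smul_eq_C_mul]
    have h := toComplex_derivative E4
    rw [toComplex, toComplex] at h
    rw [h]
    norm_num
    ring
  · intro τ
    rw [Pi.add_apply, serre_S (mdiff_eis 1) eis_one_S, Pi.add_apply, Pi.smul_apply, Pi.smul_apply,
      eis_two_S, smul_eq_mul, smul_eq_mul]
    ring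
  · intro d hd
    obtain rfl : d = 0 := by omega
    simp [constantCoeff_E2, constantCoeff_E4, constantCoeff_E6]

/-- The same argument in weight 8, with E₄²/2 compensating the Serre derivative of E₆. -/
theorem ramanujan_E6 : PowerSeries.X * PowerSeries.derivative ℚ E6 =
    PowerSeries.C (1 / 2) * (E2 * E6 - E4 ^ 2) := by
  rw [← sub_eq_zero]
  apply eq_zero_of_modular (k := 8)
    (F := (normalizedDerivOfComplex (eis 2) - ((6 : ℕ) / 12 : ℂ) • (eis 0 * eis 2)) +
      (1 / 2 : ℂ) • eis 1 ^ 2)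
  · have := (hasQ_E6.derivative.sub ((hasQ_E2.mul hasQ_E6).smul ((6 : ℕ) / 12))).add
      ((hasQ_E4.pow 2).smul (1 / 2))
    convert this using 1
    simp only [toComplex, map_sub, map_mul, map_pow, PowerSeries.map_X, PowerSeries.map_C,
      PowerSeries.smul_eq_C_mul]
    have h := toComplex_derivative E6
    rw [toComplex, toComplex] at h
    rw [h]
    norm_num
    ring
  · intro τ
    rw [Pi.add_apply, serre_S (mdiff_eis 2) eis_two_S, Pi.add_apply, Pi.smul_apply, Pi.smul_apply,
      Pi.pow_apply, Pi.pow_apply, eis_one_S, smul_eq_mul, smul_eq_mul]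
    ring
  · intro d hd
    obtain rfl : d = 0 := by omega
    simp [constantCoeff_E2, constantCoeff_E4, constantCoeff_E6]

end

section

open Function.Periodic (qParam)
open scoped UpperHalfPlane Manifold ModularForm MatrixGroups
open Derivative (normalizedDerivOfComplex)

/-! ### The eta product -/

/-- The finite products `∏_{m ≤ N} (1 - q ^ m)`. -/
def etaFin (N : ℕ) : PowerSeries ℚ :=
  ∏ m ∈ Finset.Icc 1 N, (1 - (PowerSeries.X : PowerSeries ℚ) ^ m)

theorem coeff_etaFin {n N : ℕ} (h : n ≤ N) :
    PowerSeries.coeff n (etaFin N) = PowerSeries.coeff n etaProd := by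
  induction N, h using Nat.le_induction with
  | base => rw [etaProd, PowerSeries.coeff_mk]; rfl
  | succ N hN ih =>
    rw [← ih, etaFin, Finset.prod_Icc_succ_top (by omega), mul_sub, mul_one, map_sub,
      PowerSeries.coeff_mul_X_pow', if_neg (by omega), sub_zero]
    rfl

/-- `X ^ m / (1 - X ^ m)`. -/
def geomMul (m : ℕ) : PowerSeries ℚ := PowerSeries.mk fun n => if n ≠ 0 ∧ m ∣ n then 1 else 0

theorem one_sub_mul_geomMul {m : ℕ} (hm : 1 ≤ m) :
    (1 - (PowerSeries.X : PowerSeries ℚ) ^ m) * geomMul m = PowerSeries.X ^ m := by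
  ext n
  rw [sub_mul, one_mul, map_sub, mul_comm, PowerSeries.coeff_mul_X_pow', PowerSeries.coeff_X_pow,
    geomMul, PowerSeries.coeff_mk]
  split_ifs with h1 h2 h3 h3
  · subst h3
    simp
  · rw [PowerSeries.coeff_mk, if_pos, sub_self]
    exact ⟨by omega, Nat.dvd_sub h1.2 dvd_rfl⟩
  · exact absurd (Nat.le_of_dvd (Nat.pos_of_ne_zero h1.1) h1.2) h2
  · exact absurd (Nat.le_of_dvd (Nat.pos_of_ne_zero h1.1) h1.2) h2
  · rename_i h3
    subst h3
    exact absurd ⟨by omega, dvd_rfl⟩ h1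
  · rw [PowerSeries.coeff_mk, if_neg, sub_self]
    rintro ⟨h4, h5⟩
    exact h1 ⟨by omega, (Nat.dvd_sub_iff_left (by omega) dvd_rfl).mp h5⟩
  · rename_i h3
    omega
  · simp

theorem theta_etaFin (N : ℕ) : PowerSeries.X * PowerSeries.derivative ℚ (etaFin N) =
    -(etaFin N * ∑ m ∈ Finset.Icc 1 N, (m : ℚ) • geomMul m) := by
  induction N with
  | zero => simp [etaFin]
  | succ N ih =>
    have h1 : etaFin (N + 1) = etaFin N * (1 - PowerSeries.X ^ (N + 1)) := by
      rw [etaFin, Finset.prod_Icc_succ_top (by omega)]; rfl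
    have h2 := one_sub_mul_geomMul (m := N + 1) (by omega)
    have h3 : PowerSeries.X * PowerSeries.derivative ℚ
        (1 - (PowerSeries.X : PowerSeries ℚ) ^ (N + 1)) =
        -((N + 1 : ℕ) : PowerSeries ℚ) * PowerSeries.X ^ (N + 1) := by
      rw [map_sub, Derivation.map_one_eq_zero, Derivation.leibniz_pow, PowerSeries.derivative_X]
      simp only [smul_eq_mul, nsmul_eq_mul, Nat.add_sub_cancel]
      ring
    rw [Finset.sum_Icc_succ_top (by omega), h1, Derivation.leibniz, smul_eq_mul, smul_eq_mul,
      PowerSeries.smul_eq_C_mul, map_natCast]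
    linear_combination etaFin N * h3 + (1 - PowerSeries.X ^ (N + 1)) * ih +
      etaFin N * ((N + 1 : ℕ) : PowerSeries ℚ) * h2

/-- The logarithmic derivative of the product is -∑ m X^m/(1 - X^m), whose coefficient at n ≥ 1 is
-σ₁(n), that is, the coefficient of (E₂ - 1)/24. A coefficient of degree n sees only the factors
with m ≤ n. -/
theorem theta_etaProd : PowerSeries.X * PowerSeries.derivative ℚ etaProd =
    PowerSeries.C (1 / 24) * (etaProd * (E2 - 1)) := by
  ext n
  have h := congrArg (PowerSeries.coeff n) (theta_etaFin n)
  rw [coeff_X_mul_derivative, coeff_etaFin le_rfl, map_neg, PowerSeries.coeff_mul] at h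
  rw [coeff_X_mul_derivative, h, PowerSeries.coeff_C_mul, PowerSeries.coeff_mul,
    ← Finset.sum_neg_distrib, Finset.mul_sum]
  refine Finset.sum_congr rfl fun a ha => ?_
  have ha : a.1 + a.2 = n := Finset.HasAntidiagonal.mem_antidiagonal.mp ha
  rw [coeff_etaFin (by omega)]
  have h2 : PowerSeries.coeff a.2 (∑ m ∈ Finset.Icc 1 n, (m : ℚ) • geomMul m) =
      -(1 / 24) * PowerSeries.coeff a.2 (E2 - 1) := by
    rw [map_sum, map_sub, E2, PowerSeries.coeff_mk, PowerSeries.coeff_one]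
    by_cases h0 : a.2 = 0
    · rw [h0]; simp [geomMul]
    · rw [if_neg h0, if_neg h0, ArithmeticFunction.sigma_one_apply]
      have h3 : ∀ m : ℕ, PowerSeries.coeff a.2 ((m : ℚ) • geomMul m) = if m ∣ a.2 then (m : ℚ) else 0 := by
        intro m
        simp [geomMul, h0]
      simp only [h3]
      rw [← Finset.sum_filter]
      have h4 : (Finset.Icc 1 n).filter (fun m => m ∣ a.2) = a.2.divisors := by
        ext m
        simp only [Finset.mem_filter, Finset.mem_Icc, Nat.mem_divisors]
        constructor
        · rintro ⟨_, h⟩; exact ⟨h, h0⟩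
        · rintro ⟨h, _⟩
          have := Nat.le_of_dvd (Nat.pos_of_ne_zero h0) h
          have := Nat.pos_of_dvd_of_pos h (Nat.pos_of_ne_zero h0)
          exact ⟨by omega, h⟩
      rw [h4]
      push_cast
      ring
  rw [h2]; ring

theorem constantCoeff_etaProd : PowerSeries.constantCoeff etaProd = 1 := by
  rw [← PowerSeries.coeff_zero_eq_constantCoeff_apply, ← coeff_etaFin le_rfl]
  simp [etaFin]

/-- In degree n the equation reads (n - 1) c_n = lower terms, because `a` has constant term 1. Only
the coefficient of degree 1 is free. -/
theorem eq_of_theta_sub_eq {f g a : PowerSeries ℚ} (ha : PowerSeries.constantCoeff a = 1)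
    (hf : PowerSeries.X * PowerSeries.derivative ℚ f = a * f)
    (hg : PowerSeries.X * PowerSeries.derivative ℚ g = a * g)
    (h1 : PowerSeries.coeff 1 f = PowerSeries.coeff 1 g) : f = g := by
  rw [← sub_eq_zero]
  have h : PowerSeries.X * PowerSeries.derivative ℚ (f - g) = a * (f - g) := by
    rw [map_sub]; linear_combination hf - hg
  have h1 : PowerSeries.coeff 1 (f - g) = 0 := by rw [map_sub, h1, sub_self]
  generalize f - g = u at h h1
  ext n
  induction n using Nat.strong_induction_on with
  | _ n ih =>
    have h2 := congrArg (PowerSeries.coeff n) h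
    rw [coeff_X_mul_derivative, PowerSeries.coeff_mul, Finset.sum_eq_single (0, n)] at h2
    · rw [PowerSeries.coeff_zero_eq_constantCoeff_apply, ha, one_mul] at h2
      by_cases hn : n = 1
      · rw [hn, h1, map_zero]
      · have : (n : ℚ) - 1 ≠ 0 := by
          rw [sub_ne_zero]; exact_mod_cast hn
        apply mul_left_cancel₀ this
        rw [map_zero]
        linear_combination h2
    · rintro ⟨i, j⟩ hij hne
      have hij : i + j = n := Finset.HasAntidiagonal.mem_antidiagonal.mp hij
      have : j < n := by
        rcases Nat.eq_zero_or_pos i with rfl | hi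
        · exact absurd (by simp at hij; simp [hij]) hne
        · omega
      rw [ih j this]; simp
    · intro h3
      exact absurd (Finset.HasAntidiagonal.mem_antidiagonal.mpr (by simp)) h3

/-- Both sides have logarithmic derivative E₂ and begin with 1728 q, where 1728 = 3 · 240 + 2 · 504.
-/
theorem delta_identity : PowerSeries.C 1728 * (PowerSeries.X * etaProd ^ 24) = E4 ^ 3 - E6 ^ 2 := by
  apply eq_of_theta_sub_eq constantCoeff_E2
  · rw [Derivation.leibniz, Derivation.leibniz, Derivation.leibniz_pow, PowerSeries.derivative_X,
      PowerSeries.derivative_C]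
    simp only [smul_eq_mul, nsmul_eq_mul]
    have h : (PowerSeries.C (1 / 24) : PowerSeries ℚ) * 24 = 1 := by
      rw [← map_ofNat PowerSeries.C 24, ← map_mul]; norm_num
    push_cast
    linear_combination 24 * PowerSeries.C 1728 * PowerSeries.X * etaProd ^ 23 * theta_etaProd +
      PowerSeries.C 1728 * PowerSeries.X * etaProd ^ 24 * (E2 - 1) * h
  · rw [map_sub, Derivation.leibniz_pow, Derivation.leibniz_pow]
    simp only [smul_eq_mul, nsmul_eq_mul]
    have h : (PowerSeries.C (1 / 3) : PowerSeries ℚ) * 3 = 1 := by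
      rw [← map_ofNat PowerSeries.C 3, ← map_mul]; norm_num
    have h2 : (PowerSeries.C (1 / 2) : PowerSeries ℚ) * 2 = 1 := by
      rw [← map_ofNat PowerSeries.C 2, ← map_mul]; norm_num
    push_cast
    linear_combination 3 * E4 ^ 2 * ramanujan_E4 - 2 * E6 * ramanujan_E6 +
      E4 ^ 2 * (E2 * E4 - E6) * h - E6 * (E2 * E6 - E4 ^ 2) * h2
  · have e4 : PowerSeries.coeff 1 E4 = 240 := by rw [E4, PowerSeries.coeff_mk]; simp
    have e6 : PowerSeries.coeff 1 E6 = -504 := by rw [E6, PowerSeries.coeff_mk]; simp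
    have h0 : PowerSeries.constantCoeff (etaProd ^ 24) = 1 := by
      rw [map_pow, constantCoeff_etaProd, one_pow]
    rw [PowerSeries.coeff_C_mul, show (1 : ℕ) = 0 + 1 from rfl, PowerSeries.coeff_succ_X_mul,
      PowerSeries.coeff_zero_eq_constantCoeff_apply, h0]
    simp [pow_succ, PowerSeries.coeff_mul, Finset.Nat.antidiagonal_succ, e4, e6, constantCoeff_E4,
      constantCoeff_E6]
    norm_num

/-! ### Quasimodular forms -/

theorem toComplex_evalE (P : QMod) :
    toComplex (evalE P) = MvPolynomial.aeval (fun i => toComplex (![E2, E4, E6] i)) P := by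
  rw [evalE]
  induction P using MvPolynomial.induction_on with
  | C r => simp [toComplex, PowerSeries.algebraMap_apply]
  | add p q hp hq => rw [map_add, map_add, ← hp, ← hq]; simp [toComplex]
  | mul_X p i hp => rw [map_mul, map_mul, ← hp]; simp [toComplex]

theorem hasQ_evalE (P : QMod) :
    HasQ (toComplex (evalE P)) (fun τ => MvPolynomial.aeval (fun i => eis i τ) P) := by
  rw [toComplex_evalE]
  exact HasQ.aeval P hasQ_eis

theorem aeval_scale {A : Type*} [CommRing A] [Algebra ℚ A] {P : QMod} {w : Fin 3 → ℕ} {k : ℕ}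
    (hP : MvPolynomial.IsWeightedHomogeneous w P k) (t : A) (v : Fin 3 → A) :
    MvPolynomial.aeval (fun i => t ^ w i * v i) P = t ^ k * MvPolynomial.aeval v P := by
  rw [MvPolynomial.aeval_def, MvPolynomial.aeval_def, MvPolynomial.eval₂_eq',
    MvPolynomial.eval₂_eq', Finset.mul_sum]
  refine Finset.sum_congr rfl fun d hd => ?_
  have h := hP (MvPolynomial.mem_support_iff.mp hd)
  rw [← h, Finsupp.weight_apply, Finsupp.sum_fintype _ _ (by simp), ← Finset.prod_pow_eq_pow_sum]
  simp only [mul_pow, Finset.prod_mul_distrib, ← pow_mul, smul_eq_mul, mul_comm]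
  ring

theorem aeval_eis_S {P : QMod} {k : ℕ}
    (hP : MvPolynomial.IsWeightedHomogeneous ![2, 4, 6] P k) (τ : ℍ) :
    MvPolynomial.aeval (fun i => eis i (ModularGroup.S • τ)) P =
      (τ : ℂ) ^ k * MvPolynomial.aeval ![eis 0 τ + quasiConst / τ, eis 1 τ, eis 2 τ] P := by
  rw [← aeval_scale hP]
  congr 2
  ext i
  fin_cases i
  exacts [eis_zero_S τ, eis_one_S τ, eis_two_S τ]

theorem eis_vadd (i : Fin 3) (n : ℕ) (τ : ℍ) : eis i ((n : ℝ) +ᵥ τ) = eis i τ := by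
  induction n with
  | zero => simp
  | succ n ih =>
    have h := congrFun ((hasQ_eis i).slash_T 0) ((n : ℝ) +ᵥ τ)
    rw [ModularForm.SL_slash_apply, neg_zero, zpow_zero, mul_one,
      UpperHalfPlane.modular_T_smul] at h
    rw [← ih, ← h, vadd_vadd]
    congr 2
    push_cast; ring

/-- Polynomials in `E₂` with coefficients in the values of `E₄` and `E₆` at `τ`. -/
def polyE2 (τ : ℍ) (P : QMod) : Polynomial ℂ :=
  MvPolynomial.aeval ![Polynomial.X, Polynomial.C (eis 1 τ), Polynomial.C (eis 2 τ)] P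

theorem eval_polyE2 (τ : ℍ) (P : QMod) (x : ℂ) :
    (polyE2 τ P).eval x = MvPolynomial.aeval ![x, eis 1 τ, eis 2 τ] P := by
  rw [polyE2]
  induction P using MvPolynomial.induction_on with
  | C r => simp
  | add p q hp hq => simp [hp, hq]
  | mul_X p i hp =>
    rw [map_mul, map_mul, Polynomial.eval_mul, hp]
    congr 1
    fin_cases i <;> simp

theorem derivative_polyE2 (τ : ℍ) (P : QMod) :
    Polynomial.derivative (polyE2 τ P) = polyE2 τ (MvPolynomial.pderiv 0 P) := by
  simp only [polyE2]
  induction P using MvPolynomial.induction_on with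
  | C r => simp
  | add p q hp hq => simp [hp, hq]
  | mul_X p i hp =>
    rw [map_mul, Polynomial.derivative_mul, hp, Derivation.leibniz, map_add, smul_eq_mul,
      smul_eq_mul, map_mul, map_mul]
    fin_cases i <;> simp [MvPolynomial.pderiv_X] <;> ring

/-- The function `E₂` is transcendental over the modular forms. -/
theorem polyE2_eq_zero {P : QMod} {k : ℕ}
    (hP : MvPolynomial.IsWeightedHomogeneous ![2, 4, 6] P k) (h : evalE P = 0) (τ : ℍ) :
    polyE2 τ P = 0 := by
  have hz : ∀ τ : ℍ, MvPolynomial.aeval (fun i => eis i τ) P = 0 := by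
    intro τ
    have h1 := hasQ_evalE P
    rw [h] at h1
    have h2 := (h1 τ)
    simp only [toComplex, map_zero, zero_smul] at h2
    exact h2.unique hasSum_zero
  -- The transformation under S is applied at τ + n. The Eisenstein series do not change under the
  -- translation, but the correction κ/(τ + n) does, which produces infinitely many roots of one
  -- polynomial.
  have hroot : ∀ n : ℕ, (polyE2 τ P).IsRoot (eis 0 τ + quasiConst / ((τ : ℂ) + n)) := by
    intro n
    have h1 := aeval_eis_S hP ((n : ℝ) +ᵥ τ)
    rw [hz, eis_vadd, eis_vadd, eis_vadd] at h1
    have h2 := (mul_eq_zero.mp h1.symm).resolve_left (pow_ne_zero _ (UpperHalfPlane.ne_zero _))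
    rw [Polynomial.IsRoot, eval_polyE2, ← h2]
    congr 3
    rw [UpperHalfPlane.coe_vadd]
    push_cast
    ring
  apply Polynomial.eq_zero_of_infinite_isRoot
  refine Set.infinite_of_injective_forall_mem
    (f := fun n : ℕ => eis 0 τ + quasiConst / ((τ : ℂ) + n)) ?_ hroot
  have hne : ∀ n : ℕ, (τ : ℂ) + n ≠ 0 := by
    intro n
    have := UpperHalfPlane.ne_zero ((n : ℝ) +ᵥ τ)
    rw [UpperHalfPlane.coe_vadd] at this
    push_cast at this
    rwa [add_comm]
  intro m n hmn
  have h1 : quasiConst / ((τ : ℂ) + m) = quasiConst / ((τ : ℂ) + n) := add_left_cancel hmn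
  rw [div_eq_div_iff (hne m) (hne n)] at h1
  have h2 := add_left_cancel (mul_left_cancel₀ quasiConst_ne_zero h1)
  exact_mod_cast h2.symm

/-- A quasimodular form whose derivative in `E₂` vanishes is determined by finitely many of its
Fourier coefficients. -/
theorem evalE_eq_zero {P : QMod} {k l : ℕ}
    (hP : MvPolynomial.IsWeightedHomogeneous ![2, 4, 6] P k)
    (hl : MvPolynomial.IsWeightedHomogeneous ![2, 4, 6] (MvPolynomial.pderiv 0 P) l)
    (h : evalE (MvPolynomial.pderiv 0 P) = 0)
    (hc : ∀ d ≤ k / 12, PowerSeries.coeff d (evalE P) = 0) : evalE P = 0 := by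
  refine eq_zero_of_modular (hasQ_evalE P) (k := k) ?_ hc
  intro τ
  rw [aeval_eis_S hP]
  congr 1
  -- At each τ the polynomial is constant in the E₂-variable, so the correction κ/τ is invisible and
  -- the form is truly modular.
  have h0 : Polynomial.derivative (polyE2 τ P) = 0 := by
    rw [derivative_polyE2, polyE2_eq_zero hl h]
  have h1 := Polynomial.eq_C_of_derivative_eq_zero h0
  have h2 (x : ℂ) : MvPolynomial.aeval ![x, eis 1 τ, eis 2 τ] P = (polyE2 τ P).coeff 0 := by
    rw [← eval_polyE2, h1]; simp
  have h3 : (fun i => eis i τ) = ![eis 0 τ, eis 1 τ, eis 2 τ] := by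
    ext i; fin_cases i <;> rfl
  rw [h3, h2, h2]

end

/-! ### The coefficients of the hypergeometric series -/

/-- The half plane on which the coefficients `c(s, σ)` are regular. -/
def regularPlane : Set ℂ := {s | -1 / 6 < s.re}

theorem isOpen_regularPlane : IsOpen regularPlane :=
  isOpen_lt continuous_const Complex.continuous_re

theorem natCast_mem_regularPlane (n : ℕ) : (n : ℂ) ∈ regularPlane := by
  have : (0 : ℝ) ≤ n := n.cast_nonneg
  simp only [regularPlane, Set.mem_ofPred_eq, Complex.natCast_re]
  linarith

theorem add_one_mem_regularPlane {s : ℂ} (hs : s ∈ regularPlane) : s + 1 ∈ regularPlane := by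
  simp only [regularPlane, Set.mem_ofPred_eq, Complex.add_re, Complex.one_re] at hs ⊢
  linarith

theorem Gamma_inv_step (s : ℂ) : (Complex.Gamma s)⁻¹ = s * (Complex.Gamma (s + 1))⁻¹ :=
  Complex.one_div_Gamma_eq_self_mul_one_div_Gamma_add_one s

/-- The functional equation of Γ. Six factors from Γ(1 + 6s) meet five from the denominators, and 8
· 3 / 2 = 12 remains together with (6s + 1)(6s + 5). The condition Re s > -1/6 avoids the poles. -/
theorem c_step_x {s : ℂ} (hs : s ∈ regularPlane) (σ : ℂ) :
    (s + 1) * (s + 1 - σ) * c (s + 1) σ = 12 * (6 * s + 1) * (6 * s + 5) * c s σ := by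
  have h1 (k : ℕ) (hk : 1 ≤ k) : (6 * s + k) ≠ 0 := by
    intro h
    have := congrArg Complex.re h
    simp [regularPlane] at this hs
    have : (1 : ℝ) ≤ k := by exact_mod_cast hk
    linarith
  have g6 : Complex.Gamma (1 + 6 * (s + 1)) = (6 * s + 6) * (6 * s + 5) * (6 * s + 4) *
      (6 * s + 3) * (6 * s + 2) * (6 * s + 1) * Complex.Gamma (1 + 6 * s) := by
    rw [show 1 + 6 * (s + 1) = (6 * s + 6) + 1 by ring, Complex.Gamma_add_one _ (by simpa using h1 6 (by norm_num)),
      show 6 * s + 6 = (6 * s + 5) + 1 by ring, Complex.Gamma_add_one _ (by simpa using h1 5 (by norm_num)),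
      show 6 * s + 5 = (6 * s + 4) + 1 by ring, Complex.Gamma_add_one _ (by simpa using h1 4 (by norm_num)),
      show 6 * s + 4 = (6 * s + 3) + 1 by ring, Complex.Gamma_add_one _ (by simpa using h1 3 (by norm_num)),
      show 6 * s + 3 = (6 * s + 2) + 1 by ring, Complex.Gamma_add_one _ (by simpa using h1 2 (by norm_num)),
      show 6 * s + 2 = (6 * s + 1) + 1 by ring,
      Complex.Gamma_add_one _ (by simpa using h1 1 (by norm_num)), add_comm 1 (6 * s)]
    ring
  have g3 : (Complex.Gamma (1 + 3 * s))⁻¹ = (1 + 3 * s) * (2 + 3 * s) * (3 + 3 * s) *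
      (Complex.Gamma (1 + 3 * (s + 1)))⁻¹ := by
    rw [Gamma_inv_step (1 + 3 * s), Gamma_inv_step (1 + 3 * s + 1),
      Gamma_inv_step (1 + 3 * s + 1 + 1),
      show 1 + 3 * (s + 1) = 1 + 3 * s + 1 + 1 + 1 by ring]
    ring
  have g2 : (Complex.Gamma (1 + 2 * s))⁻¹ = (1 + 2 * s) * (2 + 2 * s) *
      (Complex.Gamma (1 + 2 * (s + 1)))⁻¹ := by
    rw [Gamma_inv_step (1 + 2 * s), Gamma_inv_step (1 + 2 * s + 1),
      show 1 + 2 * (s + 1) = 1 + 2 * s + 1 + 1 by ring]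
    ring
  have g1 : (Complex.Gamma (1 + s - σ))⁻¹ = (1 + s - σ) * (Complex.Gamma (1 + (s + 1) - σ))⁻¹ := by
    rw [Gamma_inv_step (1 + s - σ), show 1 + (s + 1) - σ = 1 + s - σ + 1 by ring]
  rw [c, c, g6, g3, g2, g1]
  ring

/-- Only the entire function 1/Γ is shifted here, so no restriction on the arguments is needed. -/
theorem c_step_y (s σ : ℂ) :
    (σ + 1) ^ 2 * c s (σ + 1) = -(σ * (s - σ)) * c s σ := by
  have g1 : (Complex.Gamma (1 + s - (σ + 1)))⁻¹ = (s - σ) * (Complex.Gamma (1 + s - σ))⁻¹ := by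
    rw [show 1 + s - (σ + 1) = s - σ by ring, Gamma_inv_step (s - σ),
      show s - σ + 1 = 1 + s - σ by ring]
  have g2 : (Complex.Gamma (1 + σ))⁻¹ = (1 + σ) * (Complex.Gamma (1 + (σ + 1)))⁻¹ := by
    rw [Gamma_inv_step (1 + σ), add_assoc]
  have g3 : (Complex.Gamma (1 - (σ + 1)))⁻¹ = -σ * (Complex.Gamma (1 - σ))⁻¹ := by
    rw [show 1 - (σ + 1) = -σ by ring, Gamma_inv_step (-σ), neg_add_eq_sub]
  rw [c, c, g1, g2, g3]
  ring

/-- The factor of `c` independent of the second argument. -/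
def gammaQuot (s : ℂ) : ℂ :=
  Complex.Gamma (1 + 6 * s) * (Complex.Gamma (1 + 3 * s))⁻¹ * (Complex.Gamma (1 + 2 * s))⁻¹

/-- The entire function `1 / Γ`. -/
def gammaInv (s : ℂ) : ℂ := (Complex.Gamma s)⁻¹

theorem differentiable_gammaInv : Differentiable ℂ gammaInv := Complex.differentiable_one_div_Gamma

theorem differentiable_deriv_gammaInv : Differentiable ℂ (deriv gammaInv) := by
  have := differentiable_gammaInv.differentiableOn (s := Set.univ)
  exact differentiableOn_univ.mp (this.deriv isOpen_univ)

theorem differentiableAt_gammaQuot {s : ℂ} (hs : s ∈ regularPlane) :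
    DifferentiableAt ℂ gammaQuot s := by
  have h6 : DifferentiableAt ℂ (fun s => Complex.Gamma (1 + 6 * s)) s := by
    have h : DifferentiableAt ℂ Complex.Gamma (1 + 6 * s) := by
      apply Complex.differentiableAt_Gamma
      intro m h
      have := congrArg Complex.re h
      simp [regularPlane] at this hs
      have : (0 : ℝ) ≤ m := m.cast_nonneg
      linarith
    exact h.comp s (by fun_prop)
  have h3 : DifferentiableAt ℂ (fun s => gammaInv (1 + 3 * s)) s :=
    (differentiable_gammaInv _).comp s (by fun_prop)
  have h2 : DifferentiableAt ℂ (fun s => gammaInv (1 + 2 * s)) s :=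
    (differentiable_gammaInv _).comp s (by fun_prop)
  exact (h6.mul h3).mul h2

/-- The factor of `c` independent of the first argument. -/
def gammaFactor (σ : ℂ) : ℂ := gammaInv (1 + σ) ^ 2 * gammaInv (1 - σ)

theorem c_eq (s σ : ℂ) : c s σ = gammaQuot s * (gammaInv (1 + s - σ) * gammaFactor σ) := by
  simp only [c, gammaQuot, gammaInv, gammaFactor]; ring

theorem differentiable_gammaFactor : Differentiable ℂ gammaFactor := by
  have h1 : Differentiable ℂ (fun σ => gammaInv (1 + σ)) :=
    differentiable_gammaInv.comp (by fun_prop)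
  have h2 : Differentiable ℂ (fun σ => gammaInv (1 - σ)) :=
    differentiable_gammaInv.comp (by fun_prop)
  exact (h1.pow 2).mul h2

/-- The derivative `∂_σ c(s, σ)`. -/
def dc (s σ : ℂ) : ℂ := gammaQuot s * (-deriv gammaInv (1 + s - σ) * gammaFactor σ +
  gammaInv (1 + s - σ) * deriv gammaFactor σ)

theorem hasDerivAt_c_right (s σ : ℂ) : HasDerivAt (c s) (dc s σ) σ := by
  have h1 : HasDerivAt (fun σ => gammaInv (1 + s - σ)) (-deriv gammaInv (1 + s - σ)) σ := by
    have h := (differentiable_gammaInv (1 + s - σ)).hasDerivAt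
    have h2 : HasDerivAt (fun σ : ℂ => 1 + s - σ) (-1) σ := (hasDerivAt_id σ).const_sub (1 + s)
    simpa using! h.comp σ h2
  have h2 := (h1.mul (differentiable_gammaFactor σ).hasDerivAt).const_mul (gammaQuot s)
  have h3 : c s = fun σ => gammaQuot s * (gammaInv (1 + s - σ) * gammaFactor σ) := by
    ext; exact c_eq _ _
  rw [h3]
  exact h2

theorem differentiableOn_c_left (σ : ℂ) : DifferentiableOn ℂ (fun s => c s σ) regularPlane := by
  intro s hs
  have h1 : DifferentiableAt ℂ (fun s => gammaInv (1 + s - σ)) s :=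
    (differentiable_gammaInv _).comp s (by fun_prop)
  have h2 := (differentiableAt_gammaQuot hs).mul (h1.mul_const (gammaFactor σ))
  have h3 : (fun s => c s σ) = fun s => gammaQuot s * (gammaInv (1 + s - σ) * gammaFactor σ) := by
    ext; exact c_eq _ _
  rw [h3]
  exact h2.differentiableWithinAt

theorem differentiableOn_dc_left (σ : ℂ) : DifferentiableOn ℂ (fun s => dc s σ) regularPlane := by
  intro s hs
  have h1 : DifferentiableAt ℂ (fun s => gammaInv (1 + s - σ)) s :=
    (differentiable_gammaInv _).comp s (by fun_prop)
  have h1' : DifferentiableAt ℂ (fun s => deriv gammaInv (1 + s - σ)) s :=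
    (differentiable_deriv_gammaInv _).comp s (by fun_prop)
  have h2 := (differentiableAt_gammaQuot hs).mul
    ((h1'.neg.mul_const (gammaFactor σ)).add (h1.mul_const (deriv gammaFactor σ)))
  exact h2.differentiableWithinAt

theorem dc_step_x {s : ℂ} (hs : s ∈ regularPlane) (σ : ℂ) :
    (s + 1) * (s + 1 - σ) * dc (s + 1) σ - (s + 1) * c (s + 1) σ =
      12 * (6 * s + 1) * (6 * s + 5) * dc s σ := by
  have h1 : HasDerivAt (fun σ => (s + 1) * (s + 1 - σ) * c (s + 1) σ)
      ((s + 1) * (s + 1 - σ) * dc (s + 1) σ - (s + 1) * c (s + 1) σ) σ := by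
    have h2 : HasDerivAt (fun σ : ℂ => (s + 1) * (s + 1 - σ)) ((s + 1) * -1) σ :=
      ((hasDerivAt_id σ).const_sub (s + 1)).const_mul (s + 1)
    convert! h2.mul (hasDerivAt_c_right (s + 1) σ) using 1
    ring
  have h3 := (hasDerivAt_c_right s σ).const_mul (12 * (6 * s + 1) * (6 * s + 5))
  refine h1.unique (h3.congr_of_eventuallyEq ?_)
  exact Filter.Eventually.of_forall fun σ => c_step_x hs σ

theorem dc_step_y (s σ : ℂ) :
    (σ + 1) ^ 2 * dc s (σ + 1) + 2 * (σ + 1) * c s (σ + 1) =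
      -(σ * (s - σ)) * dc s σ - (s - 2 * σ) * c s σ := by
  have h1 : HasDerivAt (fun σ => (σ + 1) ^ 2 * c s (σ + 1))
      ((σ + 1) ^ 2 * dc s (σ + 1) + 2 * (σ + 1) * c s (σ + 1)) σ := by
    have h2 : HasDerivAt (fun σ : ℂ => (σ + 1) ^ 2) (2 * (σ + 1)) σ := by
      simpa using! ((hasDerivAt_id σ).add_const 1).pow 2
    have h3 : HasDerivAt (fun σ => c s (σ + 1)) (dc s (σ + 1)) σ :=
      (hasDerivAt_c_right s (σ + 1)).comp_add_const σ 1
    convert! h2.mul h3 using 1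
    ring
  have h4 : HasDerivAt (fun σ => -(σ * (s - σ)) * c s σ)
      (-(σ * (s - σ)) * dc s σ - (s - 2 * σ) * c s σ) σ := by
    have h2 : HasDerivAt (fun σ : ℂ => -(σ * (s - σ))) (-(s - 2 * σ)) σ := by
      convert! ((hasDerivAt_id σ).mul ((hasDerivAt_id σ).const_sub s)).neg using 1
      simp; ring
    convert! h2.mul (hasDerivAt_c_right s σ) using 1
    ring
  refine h1.unique (h4.congr_of_eventuallyEq ?_)
  exact Filter.Eventually.of_forall fun σ => c_step_y s σ

theorem gammaFactor_natCast_succ (m : ℕ) : gammaFactor ((m : ℂ) + 1) = 0 := by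
  have : gammaInv (1 - ((m : ℂ) + 1)) = 0 := by
    rw [gammaInv, show 1 - ((m : ℂ) + 1) = -m by ring, Complex.Gamma_neg_nat_eq_zero, inv_zero]
  rw [gammaFactor, this, mul_zero]

/-- The factor 1/Γ(1 - σ) vanishes at the positive integers. This makes w₀ and its ρ₁-derivatives,
apart from logarithms, independent of y. -/
theorem c_natCast_succ (s : ℂ) (m : ℕ) : c s ((m : ℂ) + 1) = 0 := by
  rw [c_eq, gammaFactor_natCast_succ, mul_zero, mul_zero]

/-- The value at `s` and the derivatives of `c(s, 0)`. -/
def cDer (i : ℕ) (n : ℂ) : ℂ := iteratedDeriv i (fun s => c s 0) n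
/-- The values and the first derivatives of `∂_σ c(s, m)`. -/
def dcDer (m : ℕ) (n : ℂ) : ℂ := deriv (fun s => dc s m) n

/-- Moving the base point from 0 to the exponent lets the recursions of `c` be differentiated as
identities of functions on a half plane. -/
theorem jet_shift (i j : ℕ) (e : Fin 2 →₀ ℕ) : MvPowerSeries.coeff e (jet i j) =
    iteratedDeriv i (fun s => iteratedDeriv j (c s) (e 1 : ℂ)) (e 0 : ℂ) := by
  change iteratedDeriv i (fun r₁ : ℂ =>
    iteratedDeriv j (fun r₂ : ℂ => c ((e 0 : ℂ) + r₁) ((e 1 : ℂ) + r₂)) 0) 0 = _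
  have h1 (s : ℂ) : iteratedDeriv j (fun r₂ : ℂ => c s ((e 1 : ℂ) + r₂)) 0 =
      iteratedDeriv j (c s) (e 1 : ℂ) := by
    rw [iteratedDeriv_comp_const_add]; simp
  simp only [h1]
  rw [iteratedDeriv_comp_const_add i (fun s => iteratedDeriv j (c s) (e 1 : ℂ))]
  simp

theorem coeff_jet_zero (i : ℕ) (e : Fin 2 →₀ ℕ) : MvPowerSeries.coeff e (jet i 0) =
    if e 1 = 0 then cDer i (e 0 : ℂ) else 0 := by
  rw [jet_shift]
  simp only [iteratedDeriv_zero]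
  split_ifs with h
  · rw [h, Nat.cast_zero]; rfl
  · obtain ⟨m, hm⟩ := Nat.exists_eq_succ_of_ne_zero h
    rw [hm]
    push_cast
    simp only [c_natCast_succ]
    simp

theorem deriv_c_right (s σ : ℂ) : deriv (c s) σ = dc s σ := (hasDerivAt_c_right s σ).deriv

theorem coeff_jet_zero_one (e : Fin 2 →₀ ℕ) :
    MvPowerSeries.coeff e (jet 0 1) = dc (e 0 : ℂ) (e 1 : ℂ) := by
  rw [jet_shift]
  simp only [iteratedDeriv_zero, iteratedDeriv_one, deriv_c_right]

theorem coeff_jet_one_one (e : Fin 2 →₀ ℕ) :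
    MvPowerSeries.coeff e (jet 1 1) = dcDer (e 1) (e 0 : ℂ) := by
  rw [jet_shift]
  simp only [iteratedDeriv_one, deriv_c_right]
  rfl

/-! ### Recursions for the derivatives -/

theorem hasDerivAt_of_differentiableOn {f : ℂ → ℂ} (hf : DifferentiableOn ℂ f regularPlane) {s : ℂ}
    (hs : s ∈ regularPlane) : HasDerivAt f (deriv f s) s :=
  (hf.differentiableAt (isOpen_regularPlane.mem_nhds hs)).hasDerivAt

theorem hasDerivAt_shift {f : ℂ → ℂ} (hf : DifferentiableOn ℂ f regularPlane) {s : ℂ}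
    (hs : s ∈ regularPlane) : HasDerivAt (fun s => f (s + 1)) (deriv f (s + 1)) s :=
  (hasDerivAt_of_differentiableOn hf (add_one_mem_regularPlane hs)).comp_add_const s 1

/-- An identity on the open half plane may be differentiated; the recursions for the s-derivatives
below all arise in this way. -/
theorem hasDerivAt_unique_of_eqOn {f g : ℂ → ℂ} {f' g' s : ℂ} (hs : s ∈ regularPlane)
    (hf : HasDerivAt f f' s) (hg : HasDerivAt g g' s) (h : ∀ s ∈ regularPlane, f s = g s) :
    f' = g' := by
  refine hf.unique (hg.congr_of_eventuallyEq ?_)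
  filter_upwards [isOpen_regularPlane.mem_nhds hs] with s hs using h s hs

theorem hasDerivAt_sq_shift (s : ℂ) : HasDerivAt (fun s : ℂ => (s + 1) ^ 2) (2 * (s + 1)) s := by
  simpa using! ((hasDerivAt_id s).add_const 1).pow 2

/-- The polynomial `12 (6 s + 1) (6 s + 5)`. -/
def stepPoly (s : ℂ) : ℂ := 12 * (36 * s ^ 2 + 36 * s + 5)

theorem hasDerivAt_stepPoly (s : ℂ) : HasDerivAt stepPoly (12 * (72 * s + 36)) s := by
  have h := ((((hasDerivAt_id s).pow 2).const_mul 36).add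
    ((hasDerivAt_id s).const_mul 36)).add_const 5 |>.const_mul 12
  convert! h using 1
  simp; ring

theorem cDer_zero_step {s : ℂ} (hs : s ∈ regularPlane) :
    (s + 1) ^ 2 * cDer 0 (s + 1) = stepPoly s * cDer 0 s := by
  have h := c_step_x hs 0
  simp only [cDer, iteratedDeriv_zero, stepPoly]
  linear_combination h

theorem deriv_cDer (i : ℕ) : deriv (cDer i) = cDer (i + 1) := by
  ext s
  exact (congrFun (iteratedDeriv_succ (n := i) (f := fun s => c s 0)) s).symm

theorem differentiableOn_cDer (i : ℕ) : DifferentiableOn ℂ (cDer i) regularPlane := by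
  induction i with
  | zero => simpa [cDer] using! differentiableOn_c_left 0
  | succ i ih =>
    have := ih.deriv isOpen_regularPlane
    rwa [deriv_cDer] at this

theorem cDer_one_step {s : ℂ} (hs : s ∈ regularPlane) :
    2 * (s + 1) * cDer 0 (s + 1) + (s + 1) ^ 2 * cDer 1 (s + 1) =
      12 * (72 * s + 36) * cDer 0 s + stepPoly s * cDer 1 s := by
  have h1 := (hasDerivAt_sq_shift s).mul (hasDerivAt_shift (differentiableOn_cDer 0) hs)
  have h2 := (hasDerivAt_stepPoly s).mul (hasDerivAt_of_differentiableOn (differentiableOn_cDer 0) hs)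
  rw [deriv_cDer] at h1 h2
  exact hasDerivAt_unique_of_eqOn hs h1 h2 fun s hs => cDer_zero_step hs

theorem cDer_two_step {s : ℂ} (hs : s ∈ regularPlane) :
    2 * cDer 0 (s + 1) + 4 * (s + 1) * cDer 1 (s + 1) + (s + 1) ^ 2 * cDer 2 (s + 1) =
      864 * cDer 0 s + 24 * (72 * s + 36) * cDer 1 s + stepPoly s * cDer 2 s := by
  have p1 : HasDerivAt (fun s : ℂ => 2 * (s + 1)) 2 s := by
    simpa using! ((hasDerivAt_id s).add_const 1).const_mul 2
  have p2 : HasDerivAt (fun s : ℂ => 12 * (72 * s + 36)) 864 s := by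
    convert! (((hasDerivAt_id s).const_mul 72).add_const 36).const_mul 12 using 1
    norm_num
  have h1 := (p1.mul (hasDerivAt_shift (differentiableOn_cDer 0) hs)).add
    ((hasDerivAt_sq_shift s).mul (hasDerivAt_shift (differentiableOn_cDer 1) hs))
  have h2 := (p2.mul (hasDerivAt_of_differentiableOn (differentiableOn_cDer 0) hs)).add
    ((hasDerivAt_stepPoly s).mul (hasDerivAt_of_differentiableOn (differentiableOn_cDer 1) hs))
  rw [deriv_cDer, deriv_cDer] at h1 h2
  have := hasDerivAt_unique_of_eqOn hs h1 h2 fun s hs => cDer_one_step hs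
  linear_combination this

/-- The derivative in s of `dc_step_x`. The term with c itself survives only for m = 0, since c(s,
m) = 0 for m ≥ 1. -/
theorem dcDer_step_x {s : ℂ} (hs : s ∈ regularPlane) (m : ℕ) :
    (2 * (s + 1) - m) * dc (s + 1) m + (s + 1) * (s + 1 - m) * dcDer m (s + 1) -
      (if m = 0 then cDer 0 (s + 1) + (s + 1) * cDer 1 (s + 1) else 0) =
      12 * (72 * s + 36) * dc s m + stepPoly s * dcDer m s := by
  have p1 : HasDerivAt (fun s : ℂ => (s + 1) * (s + 1 - m)) (2 * (s + 1) - m) s := by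
    convert! ((hasDerivAt_id s).add_const 1).mul (((hasDerivAt_id s).add_const 1).sub_const (m : ℂ))
      using 1
    simp; ring
  have h1 := p1.mul (hasDerivAt_shift (differentiableOn_dc_left m) hs)
  have h2 := (hasDerivAt_stepPoly s).mul
    (hasDerivAt_of_differentiableOn (differentiableOn_dc_left m) hs)
  have p3 : HasDerivAt (fun s : ℂ => s + 1) 1 s := (hasDerivAt_id s).add_const 1
  cases m with
  | zero =>
    have h3 := p3.mul (hasDerivAt_shift (differentiableOn_cDer 0) hs)
    rw [deriv_cDer] at h3
    have := hasDerivAt_unique_of_eqOn hs (h1.sub h3) h2 fun s hs => by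
      have h := dc_step_x hs 0
      simp only [Pi.sub_apply, Pi.mul_apply, cDer, iteratedDeriv_zero, stepPoly, Nat.cast_zero]
      linear_combination h
    simp only [if_true, dcDer]
    linear_combination this
  | succ m =>
    have := hasDerivAt_unique_of_eqOn hs h1 h2 fun s hs => by
      have h := dc_step_x hs ((m : ℂ) + 1)
      rw [c_natCast_succ, mul_zero, sub_zero] at h
      simp only [Pi.mul_apply, stepPoly]
      push_cast
      linear_combination h
    simp only [Nat.succ_ne_zero, if_false, dcDer]
    linear_combination this

theorem dc_step_y_natCast (s : ℂ) (m : ℕ) :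
    ((m : ℂ) + 1) ^ 2 * dc s (m + 1 : ℕ) =
      -(m * (s - m)) * dc s m - (if m = 0 then s * cDer 0 s else 0) := by
  have h := dc_step_y s m
  rw [c_natCast_succ] at h
  cases m with
  | zero =>
    simp only [if_true, cDer, iteratedDeriv_zero, Nat.cast_zero, zero_add, Nat.cast_one] at h ⊢
    linear_combination h
  | succ m =>
    rw [Nat.cast_succ m, c_natCast_succ] at h
    rw [Nat.cast_succ (m + 1), Nat.cast_succ m]
    simp only [Nat.succ_ne_zero, if_false]
    linear_combination h

theorem dcDer_step_y {s : ℂ} (hs : s ∈ regularPlane) (m : ℕ) :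
    ((m : ℂ) + 1) ^ 2 * dcDer (m + 1) s =
      -m * dc s m - (m * (s - m)) * dcDer m s -
        (if m = 0 then cDer 0 s + s * cDer 1 s else 0) := by
  have h1 := (hasDerivAt_of_differentiableOn (differentiableOn_dc_left (m + 1 : ℕ)) hs).const_mul
    (((m : ℂ) + 1) ^ 2)
  have p2 : HasDerivAt (fun s : ℂ => -((m : ℂ) * (s - m))) (-m) s := by
    simpa using! (((hasDerivAt_id s).sub_const (m : ℂ)).const_mul (m : ℂ)).neg
  have h2 := p2.mul (hasDerivAt_of_differentiableOn (differentiableOn_dc_left m) hs)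
  by_cases hm : m = 0
  · have h3 := (hasDerivAt_id s).mul
      (hasDerivAt_of_differentiableOn (differentiableOn_cDer 0) hs)
    rw [deriv_cDer] at h3
    have := hasDerivAt_unique_of_eqOn hs h1 (h2.sub h3) fun s hs => by
      have h := dc_step_y_natCast s m
      rw [if_pos hm] at h
      exact h
    rw [if_pos hm]
    simp only [dcDer]
    simp only [id] at this
    linear_combination this
  · have := hasDerivAt_unique_of_eqOn hs h1 h2 fun s hs => by
      have h := dc_step_y_natCast s m
      rw [if_neg hm, sub_zero] at h
      exact h
    rw [if_neg hm]
    simp only [dcDer]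
    linear_combination this

theorem cDer_zero_zero : cDer 0 0 = 1 := by simp [cDer, c]

theorem deriv_gammaInv_comp (k : ℂ) :
    HasDerivAt (fun s => gammaInv (1 + k * s)) (k * deriv gammaInv 1) 0 := by
  have h1 : HasDerivAt (fun s : ℂ => 1 + k * s) k 0 := by
    simpa using! ((hasDerivAt_id (0 : ℂ)).const_mul k).const_add 1
  have h2 := (differentiable_gammaInv 1).hasDerivAt
  have h3 : HasDerivAt gammaInv (deriv gammaInv 1) (1 + k * 0) := by simpa using h2
  have := h3.comp (0 : ℂ) h1
  rw [mul_comm]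
  exact this

theorem gammaInv_one : gammaInv 1 = 1 := by simp [gammaInv]

theorem hasDerivAt_gammaQuot_zero : HasDerivAt gammaQuot (-(deriv gammaInv 1)) 0 := by
  have h6 := (deriv_gammaInv_comp 6).inv (by simp [gammaInv_one])
  have h := (h6.mul (deriv_gammaInv_comp 3)).mul (deriv_gammaInv_comp 2)
  convert! h using 1
  · ext s; simp [gammaQuot, gammaInv]
  · simp [gammaInv_one]; ring

/-- The derivative at 0 is a multiple of -6 + 3 + 2 + 1 = 0. Thus ∂_{ρ₁} w₀ has no constant term
apart from its logarithm, as the definition of q requires. -/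
theorem cDer_one_zero : cDer 1 0 = 0 := by
  have h := hasDerivAt_gammaQuot_zero.mul (deriv_gammaInv_comp 1)
  have h2 : cDer 1 0 = deriv (fun s => c s 0) 0 := by rw [cDer, iteratedDeriv_one]
  have h3 : (fun s => c s 0) = gammaQuot * fun s => gammaInv (1 + 1 * s) := by
    ext s; rw [c_eq]; simp [gammaFactor, gammaInv_one]
  rw [h2, h3, h.deriv]
  simp [gammaInv_one, gammaQuot]

/-- The three factors involving σ contribute -1, 2 and -1 times the derivative of 1/Γ at 1. -/
theorem dc_zero_zero : dc 0 0 = 0 := by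
  have h1 := ((deriv_gammaInv_comp 1).pow 2).mul (deriv_gammaInv_comp (-1))
  have h2 : gammaFactor = (fun s => gammaInv (1 + 1 * s)) ^ 2 * fun s => gammaInv (1 + -1 * s) := by
    ext s; simp [gammaFactor, sub_eq_add_neg]
  rw [dc, h2, h1.deriv]
  simp [gammaInv_one]
  right
  ring

/-! ### Differential equations for the derivatives of the hypergeometric series -/

/-- The exponent `(n, m)`. -/
def expo (n m : ℕ) : Fin 2 →₀ ℕ := Finsupp.single 0 n + Finsupp.single 1 m

theorem expo_zero (n m : ℕ) : expo n m 0 = n := by simp [expo]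
theorem expo_one (n m : ℕ) : expo n m 1 = m := by simp [expo]

theorem expo_eq (e : Fin 2 →₀ ℕ) : e = expo (e 0) (e 1) := by
  ext i; fin_cases i <;> simp [expo]

theorem ext_expo {f g : Series2}
    (h : ∀ n m, MvPowerSeries.coeff (expo n m) f = MvPowerSeries.coeff (expo n m) g) : f = g := by
  ext e; rw [expo_eq e]; exact h _ _

theorem coeff_X0_mul_succ (f : Series2) (n m : ℕ) :
    MvPowerSeries.coeff (expo (n + 1) m) (MvPowerSeries.X 0 * f) =
      MvPowerSeries.coeff (expo n m) f := by
  have : expo (n + 1) m = Finsupp.single 0 1 + expo n m := by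
    rw [expo, expo, ← add_assoc, ← Finsupp.single_add, add_comm 1 n]
  rw [this, MvPowerSeries.X, MvPowerSeries.coeff_add_monomial_mul, one_mul]

theorem coeff_X1_mul_succ (f : Series2) (n m : ℕ) :
    MvPowerSeries.coeff (expo n (m + 1)) (MvPowerSeries.X 1 * f) =
      MvPowerSeries.coeff (expo n m) f := by
  have : expo n (m + 1) = Finsupp.single 1 1 + expo n m := by
    rw [expo, expo, add_left_comm, ← Finsupp.single_add, add_comm 1 m]
  rw [this, MvPowerSeries.X, MvPowerSeries.coeff_add_monomial_mul, one_mul]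

theorem coeff_X0_mul_zero (f : Series2) (m : ℕ) :
    MvPowerSeries.coeff (expo 0 m) (MvPowerSeries.X 0 * f) = 0 := by
  rw [MvPowerSeries.X, MvPowerSeries.coeff_monomial_mul, if_neg]
  intro h
  have := h 0
  simp [expo] at this

theorem coeff_X1_mul_zero (f : Series2) (n : ℕ) :
    MvPowerSeries.coeff (expo n 0) (MvPowerSeries.X 1 * f) = 0 := by
  rw [MvPowerSeries.X, MvPowerSeries.coeff_monomial_mul, if_neg]
  intro h
  have := h 1
  simp [expo] at this

theorem coeff_ofNat_mul (k : ℕ) [k.AtLeastTwo] (f : Series2) (e : Fin 2 →₀ ℕ) :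
    MvPowerSeries.coeff e ((ofNat(k) : Series2) * f) =
      (ofNat(k) : ℂ) * MvPowerSeries.coeff e f := by
  have : (ofNat(k) : Series2) = MvPowerSeries.C (ofNat(k) : ℂ) :=
    (map_ofNat MvPowerSeries.C k).symm
  rw [this, MvPowerSeries.coeff_C_mul]

/-- The derivation `θ_x = x ∂_x`. -/
def thetaX : Derivation ℂ Series2 Series2 :=
  (MvPowerSeries.X 0 : Series2) • MvPowerSeries.pderiv ℂ 0

theorem thetaX_apply (f : Series2) :
    thetaX f = MvPowerSeries.X 0 * MvPowerSeries.pderiv ℂ 0 f := rfl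

theorem coeff_thetaX (f : Series2) (n m : ℕ) :
    MvPowerSeries.coeff (expo n m) (thetaX f) = n * MvPowerSeries.coeff (expo n m) f := by
  rw [thetaX_apply]
  cases n with
  | zero => rw [coeff_X0_mul_zero]; simp
  | succ n =>
    rw [coeff_X0_mul_succ, MvPowerSeries.coeff_pderiv]
    have : expo n m + Finsupp.single 0 1 = expo (n + 1) m := by
      rw [expo, expo, add_right_comm, ← Finsupp.single_add]
    rw [this, expo_zero]
    push_cast; ring

theorem coeff_thetaP_expo (f : Series2) (n m : ℕ) :
    MvPowerSeries.coeff (expo n m) (thetaP f) = m * MvPowerSeries.coeff (expo n m) f := by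
  rw [coeff_thetaP, expo_one]

theorem coeff_w0 (n m : ℕ) : MvPowerSeries.coeff (expo n m) w0 =
    if m = 0 then cDer 0 n else 0 := by
  rw [w0, coeff_jet_zero, expo_zero, expo_one]
theorem coeff_jet_one_zero (n m : ℕ) : MvPowerSeries.coeff (expo n m) (jet 1 0) =
    if m = 0 then cDer 1 n else 0 := by
  rw [coeff_jet_zero, expo_zero, expo_one]
theorem coeff_jet_two_zero (n m : ℕ) : MvPowerSeries.coeff (expo n m) (jet 2 0) =
    if m = 0 then cDer 2 n else 0 := by
  rw [coeff_jet_zero, expo_zero, expo_one]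
theorem coeff_jet_zero_one' (n m : ℕ) : MvPowerSeries.coeff (expo n m) (jet 0 1) = dc n m := by
  rw [coeff_jet_zero_one, expo_zero, expo_one]
theorem coeff_jet_one_one' (n m : ℕ) :
    MvPowerSeries.coeff (expo n m) (jet 1 1) = dcDer m n := by
  rw [coeff_jet_one_one, expo_zero, expo_one]

theorem thetaX_thetaX_w0 : thetaX (thetaX w0) =
    MvPowerSeries.X 0 * (12 * (36 * thetaX (thetaX w0) + 36 * thetaX w0 + 5 * w0)) := by
  apply ext_expo
  rintro (_ | n) m
  · rw [coeff_X0_mul_zero]; simp [coeff_thetaX]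
  · have h := cDer_zero_step (natCast_mem_regularPlane n)
    rw [coeff_X0_mul_succ]
    simp only [map_add, coeff_ofNat_mul, coeff_thetaX, coeff_w0]
    split_ifs
    · rw [stepPoly] at h; push_cast; linear_combination h
    · simp

theorem thetaX_thetaX_jet_one_zero : thetaX (thetaX (jet 1 0)) + 2 * thetaX w0 =
    MvPowerSeries.X 0 * (12 * (36 * thetaX (thetaX (jet 1 0)) + 36 * thetaX (jet 1 0) + 5 * jet 1 0 +
      72 * thetaX w0 + 36 * w0)) := by
  apply ext_expo
  rintro (_ | n) m
  · rw [coeff_X0_mul_zero]; simp [coeff_thetaX, coeff_ofNat_mul]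
  · have h := cDer_one_step (natCast_mem_regularPlane n)
    rw [coeff_X0_mul_succ]
    simp only [map_add, coeff_ofNat_mul, coeff_thetaX, coeff_w0, coeff_jet_one_zero]
    split_ifs
    · rw [stepPoly] at h; push_cast; linear_combination h
    · simp

theorem coeff_expo_one (n m : ℕ) : MvPowerSeries.coeff (expo n m) (1 : Series2) =
    if n = 0 ∧ m = 0 then 1 else 0 := by
  have h : expo n m = 0 ↔ n = 0 ∧ m = 0 := by
    refine ⟨fun h => ⟨?_, ?_⟩, by rintro ⟨rfl, rfl⟩; simp [expo]⟩
    · rw [← expo_zero n m, h]; rfl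
    · rw [← expo_one n m, h]; rfl
  rw [MvPowerSeries.coeff_one]
  simp only [h]

/-- The recursion relates n + 1 to n and says nothing about n = 0. There the second derivative of
the double zero ρ₁² leaves the inhomogeneous term 2. -/
theorem thetaX_thetaX_jet_two_zero : thetaX (thetaX (jet 2 0)) + 4 * thetaX (jet 1 0) + 2 * w0 =
    MvPowerSeries.X 0 * (12 * (36 * thetaX (thetaX (jet 2 0)) + 36 * thetaX (jet 2 0) + 5 * jet 2 0 +
      144 * thetaX (jet 1 0) + 72 * jet 1 0 + 72 * w0)) + 2 * 1 := by
  apply ext_expo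
  rintro (_ | n) m
  · rw [map_add _ (MvPowerSeries.X 0 * _), coeff_X0_mul_zero]
    simp only [map_add, coeff_thetaX, coeff_ofNat_mul, coeff_w0, coeff_expo_one, Nat.cast_zero,
      zero_mul, cDer_zero_zero]
    simp
  · have h := cDer_two_step (natCast_mem_regularPlane n)
    rw [map_add _ (MvPowerSeries.X 0 * _), coeff_X0_mul_succ]
    simp only [map_add, coeff_ofNat_mul, coeff_thetaX, coeff_w0, coeff_jet_one_zero,
      coeff_jet_two_zero, coeff_expo_one]
    split_ifs
    · simp_all
    · rw [stepPoly] at h; push_cast; linear_combination h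
    · simp_all
    · simp

theorem thetaX_thetaX_jet_zero_one :
    thetaX (thetaX (jet 0 1)) - thetaX (thetaP (jet 0 1)) - thetaX w0 =
    MvPowerSeries.X 0 * (12 * (36 * thetaX (thetaX (jet 0 1)) + 36 * thetaX (jet 0 1) +
      5 * jet 0 1)) := by
  apply ext_expo
  rintro (_ | n) m
  · rw [coeff_X0_mul_zero]; simp [coeff_thetaX]
  · have h := dc_step_x (natCast_mem_regularPlane n) m
    rw [coeff_X0_mul_succ]
    simp only [map_add, map_sub, coeff_ofNat_mul, coeff_thetaX, coeff_thetaP_expo, coeff_w0,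
      coeff_jet_zero_one']
    split_ifs with hm
    · subst hm
      simp only [cDer, iteratedDeriv_zero, Nat.cast_zero] at h ⊢
      push_cast; linear_combination h
    · obtain ⟨m, rfl⟩ := Nat.exists_eq_succ_of_ne_zero hm
      push_cast at h ⊢
      rw [c_natCast_succ] at h
      linear_combination h

theorem dc_zero_natCast (m : ℕ) : dc 0 m = 0 := by
  induction m with
  | zero => exact_mod_cast dc_zero_zero
  | succ m ih =>
    have h := dc_step_y_natCast 0 m
    rw [ih] at h
    have h2 : ((m : ℂ) + 1) ^ 2 ≠ 0 := pow_ne_zero 2 (by exact_mod_cast m.succ_ne_zero)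
    simpa [h2] using h

/-- The inhomogeneous term is now -1, the mixed derivative of ρ₁(ρ₁ - ρ₂). It cancels against the 2
of `jet 2 0` exactly in the combination 2 ∂_{ρ₁} ∂_{ρ₂} + ∂_{ρ₁}². -/
theorem thetaX_thetaX_jet_one_one :
    thetaX (thetaX (jet 1 1)) - thetaX (thetaP (jet 1 1)) + 2 * thetaX (jet 0 1) -
      thetaP (jet 0 1) - thetaX (jet 1 0) - w0 =
    MvPowerSeries.X 0 * (12 * (36 * thetaX (thetaX (jet 1 1)) + 36 * thetaX (jet 1 1) +
      5 * jet 1 1 + 72 * thetaX (jet 0 1) + 36 * jet 0 1)) - 1 := by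
  apply ext_expo
  rintro (_ | n) m
  · rw [map_sub _ (MvPowerSeries.X 0 * _), coeff_X0_mul_zero]
    simp only [map_add, map_sub, coeff_thetaX, coeff_thetaP_expo, coeff_ofNat_mul, coeff_w0,
      coeff_expo_one, Nat.cast_zero, zero_mul, cDer_zero_zero, coeff_jet_zero_one',
      dc_zero_natCast]
    simp
  · have h := dcDer_step_x (natCast_mem_regularPlane n) m
    rw [map_sub _ (MvPowerSeries.X 0 * _), coeff_X0_mul_succ]
    simp only [map_add, map_sub, coeff_ofNat_mul, coeff_thetaX, coeff_thetaP_expo, coeff_w0,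
      coeff_jet_zero_one', coeff_jet_one_one', coeff_jet_one_zero, coeff_expo_one, Nat.succ_ne_zero, false_and, if_false]
    rw [stepPoly] at h
    split_ifs at h ⊢ with hm
    · push_cast at h ⊢; linear_combination h
    · push_cast at h ⊢; linear_combination h

theorem thetaP_thetaP_jet_zero_one :
    thetaP (thetaP (jet 0 1)) + MvPowerSeries.X 1 * (thetaX (thetaP (jet 0 1)) -
      thetaP (thetaP (jet 0 1)) + thetaX w0) = 0 := by
  apply ext_expo
  rintro n (_ | m)
  · rw [map_add, coeff_X1_mul_zero]; simp [coeff_thetaP_expo]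
  · have h := dc_step_y_natCast n m
    rw [map_add, coeff_X1_mul_succ]
    simp only [map_add, map_sub, coeff_thetaX, coeff_thetaP_expo, coeff_w0, coeff_jet_zero_one',
      map_zero]
    split_ifs at h ⊢ <;> push_cast at h ⊢ <;> linear_combination h

theorem thetaP_thetaP_jet_one_one :
    thetaP (thetaP (jet 1 1)) + MvPowerSeries.X 1 * (thetaX (thetaP (jet 1 1)) -
      thetaP (thetaP (jet 1 1)) + thetaP (jet 0 1) + thetaX (jet 1 0) + w0) = 0 := by
  apply ext_expo
  rintro n (_ | m)
  · rw [map_add, coeff_X1_mul_zero]; simp [coeff_thetaP_expo]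
  · have h := dcDer_step_y (natCast_mem_regularPlane n) m
    rw [map_add, coeff_X1_mul_succ]
    simp only [map_add, map_sub, coeff_thetaX, coeff_thetaP_expo, coeff_w0, coeff_jet_zero_one',
      coeff_jet_one_one', coeff_jet_one_zero, map_zero]
    split_ifs at h ⊢ <;> push_cast at h ⊢ <;> linear_combination h

theorem thetaP_jet_zero (i : ℕ) : thetaP (jet i 0) = 0 := by
  apply ext_expo
  intro n m
  rw [coeff_thetaP_expo, coeff_jet_zero, expo_one, expo_zero, map_zero]
  split_ifs with h <;> simp [h]

theorem thetaP_w0 : thetaP w0 = 0 := thetaP_jet_zero 0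

/-! ### The functions of one variable -/

/-- `w₀` as a series in `x`. -/
def wSeries : PowerSeries ℂ := PowerSeries.mk fun n => cDer 0 n
/-- `∂_{ρ₁} w₀` without its logarithm, as a series in `x`. -/
def gSeries : PowerSeries ℂ := PowerSeries.mk fun n => cDer 1 n
/-- `∂_{ρ₂} w₀` without its logarithm at `y = 0`. -/
def phiSeries : PowerSeries ℂ := PowerSeries.mk fun n => dc n 0

theorem w0_eq : w0 = inFirst wSeries := by
  apply ext_expo
  intro n m
  rw [coeff_w0, coeff_inFirst, expo_zero, expo_one, wSeries, PowerSeries.coeff_mk]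

theorem jet_one_zero_eq : jet 1 0 = inFirst gSeries := by
  apply ext_expo
  intro n m
  rw [coeff_jet_one_zero, coeff_inFirst, expo_zero, expo_one, gSeries, PowerSeries.coeff_mk]

theorem restrictHom_jet_zero_one : restrictHom (jet 0 1) = phiSeries := by
  ext n
  rw [coeff_restrictHom, coeff_jet_zero_one, phiSeries, PowerSeries.coeff_mk]
  simp

theorem constantCoeff_wSeries : PowerSeries.constantCoeff wSeries = 1 := by
  rw [← PowerSeries.coeff_zero_eq_constantCoeff_apply, wSeries, PowerSeries.coeff_mk,
    Nat.cast_zero, cDer_zero_zero]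
theorem constantCoeff_gSeries : PowerSeries.constantCoeff gSeries = 0 := by
  rw [← PowerSeries.coeff_zero_eq_constantCoeff_apply, gSeries, PowerSeries.coeff_mk,
    Nat.cast_zero, cDer_one_zero]
theorem constantCoeff_phiSeries : PowerSeries.constantCoeff phiSeries = 0 := by
  rw [← PowerSeries.coeff_zero_eq_constantCoeff_apply, phiSeries, PowerSeries.coeff_mk,
    Nat.cast_zero, dc_zero_zero]

/-- The derivation `X d/dX` in one variable. -/
def theta1 : Derivation ℂ (PowerSeries ℂ) (PowerSeries ℂ) :=
  (PowerSeries.X : PowerSeries ℂ) • PowerSeries.derivative ℂ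

theorem theta1_apply (f : PowerSeries ℂ) :
    theta1 f = PowerSeries.X * PowerSeries.derivative ℂ f := rfl

theorem coeff_theta1 (f : PowerSeries ℂ) (n : ℕ) :
    PowerSeries.coeff n (theta1 f) = n * PowerSeries.coeff n f := coeff_X_mul_derivative f n

theorem theta1_X : theta1 PowerSeries.X = PowerSeries.X := by
  rw [theta1_apply, PowerSeries.derivative_X, mul_one]

theorem eq_of_theta1_eq {f g : PowerSeries ℂ} (h : theta1 f = theta1 g)
    (h0 : PowerSeries.constantCoeff f = PowerSeries.constantCoeff g) : f = g := by
  ext n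
  by_cases hn : n = 0
  · simpa [hn] using h0
  · have := congrArg (PowerSeries.coeff n) h
    rw [coeff_theta1, coeff_theta1] at this
    exact mul_left_cancel₀ (by exact_mod_cast hn) this

theorem coeff_ofNat_mul' (k : ℕ) [k.AtLeastTwo] (f : PowerSeries ℂ) (n : ℕ) :
    PowerSeries.coeff n ((ofNat(k) : PowerSeries ℂ) * f) =
      (ofNat(k) : ℂ) * PowerSeries.coeff n f := by
  have : (ofNat(k) : PowerSeries ℂ) = PowerSeries.C (ofNat(k) : ℂ) :=
    (map_ofNat PowerSeries.C k).symm
  rw [this, PowerSeries.coeff_C_mul]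

theorem wSeries_ode : theta1 (theta1 wSeries) =
    PowerSeries.X * (12 * (36 * theta1 (theta1 wSeries) + 36 * theta1 wSeries + 5 * wSeries)) := by
  ext (_ | n)
  · simp [theta1_apply]
  · have h := cDer_zero_step (natCast_mem_regularPlane n)
    rw [PowerSeries.coeff_succ_X_mul]
    simp only [map_add, coeff_ofNat_mul', coeff_theta1, wSeries, PowerSeries.coeff_mk]
    rw [stepPoly] at h; push_cast; linear_combination h

theorem gSeries_ode : theta1 (theta1 gSeries) + 2 * theta1 wSeries =
    PowerSeries.X * (12 * (36 * theta1 (theta1 gSeries) + 36 * theta1 gSeries + 5 * gSeries +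
      72 * theta1 wSeries + 36 * wSeries)) := by
  ext (_ | n)
  · simp [theta1_apply]
  · have h := cDer_one_step (natCast_mem_regularPlane n)
    rw [PowerSeries.coeff_succ_X_mul]
    simp only [map_add, coeff_ofNat_mul', coeff_theta1, wSeries, gSeries, PowerSeries.coeff_mk]
    rw [stepPoly] at h; push_cast; linear_combination h

theorem phiSeries_ode : theta1 (theta1 phiSeries) - theta1 wSeries =
    PowerSeries.X * (12 * (36 * theta1 (theta1 phiSeries) + 36 * theta1 phiSeries +
      5 * phiSeries)) := by
  ext (_ | n)
  · simp [theta1_apply]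
  · have h := dc_step_x (natCast_mem_regularPlane n) 0
    rw [PowerSeries.coeff_succ_X_mul]
    simp only [map_add, map_sub, coeff_ofNat_mul', coeff_theta1, wSeries, phiSeries,
      PowerSeries.coeff_mk, cDer, iteratedDeriv_zero]
    push_cast; linear_combination h

theorem theta1_ofNat (k : ℕ) [k.AtLeastTwo] : theta1 (ofNat(k) : PowerSeries ℂ) = 0 := by
  have : (ofNat(k) : PowerSeries ℂ) = PowerSeries.C (ofNat(k) : ℂ) :=
    (map_ofNat PowerSeries.C k).symm
  rw [this, theta1_apply, PowerSeries.derivative_C, mul_zero]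

/-- The Wronskian of the two periods. -/
theorem wronskian_g : (1 - 432 * PowerSeries.X) *
    (wSeries ^ 2 + wSeries * theta1 gSeries - gSeries * theta1 wSeries) = 1 := by
  apply eq_of_theta1_eq
  · have h1 := wSeries_ode
    have h2 := gSeries_ode
    simp only [Derivation.leibniz, Derivation.leibniz_pow, map_add, map_sub, smul_eq_mul,
      Derivation.map_one_eq_zero, theta1_ofNat, theta1_X, nsmul_eq_mul, pow_one,
      Nat.add_one_sub_one]
    push_cast
    linear_combination wSeries * h2 - gSeries * h1
  · simp [theta1_apply, constantCoeff_wSeries]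

/-- Abel's identity with source: the term θw in the equation of `phiSeries` makes the derivative of
the left-hand side equal to θ(w²), which integrates to w² - 1. -/
theorem wronskian_phi : 2 * ((1 - 432 * PowerSeries.X) *
    (wSeries * theta1 phiSeries - phiSeries * theta1 wSeries)) = wSeries ^ 2 - 1 := by
  apply eq_of_theta1_eq
  · have h1 := wSeries_ode
    have h2 := phiSeries_ode
    simp only [Derivation.leibniz, Derivation.leibniz_pow, map_sub, smul_eq_mul,
      Derivation.map_one_eq_zero, theta1_ofNat, theta1_X, nsmul_eq_mul, pow_one,
      Nat.add_one_sub_one]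
    push_cast
    linear_combination 2 * wSeries * h2 - 2 * phiSeries * h1
  · simp [theta1_apply, constantCoeff_wSeries]

/-! ### The action on logarithmic series -/

/-- The derivation `x_i ∂ / ∂x_i` of power series. -/
def thetaSeries (i : Fin 2) : Derivation ℂ Series2 Series2 :=
  (MvPowerSeries.X i : Series2) • MvPowerSeries.pderiv ℂ i

theorem thetaSeries_zero (f : Series2) : thetaSeries 0 f = thetaX f := rfl

theorem thetaSeries_one (f : Series2) : thetaSeries 1 f = thetaP f := rfl

theorem coeff_theta (i : Fin 2) (F : LogSeries) (k : Fin 2 →₀ ℕ) :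
    MvPolynomial.coeff k (theta i F) = thetaSeries i (MvPolynomial.coeff k F) +
      MvPolynomial.coeff k (MvPolynomial.pderiv i F) := by
  classical
  rw [theta, MvPolynomial.coeff_add, MvPolynomial.coeff_sum]
  congr 1
  rw [Finset.sum_eq_single k]
  · rw [MvPolynomial.coeff_monomial, if_pos rfl]; rfl
  · intro b _ hb; rw [MvPolynomial.coeff_monomial, if_neg hb]
  · intro h
    rw [MvPolynomial.notMem_support_iff.mp h]; simp

theorem theta_add (i : Fin 2) (F G : LogSeries) : theta i (F + G) = theta i F + theta i G := by
  ext1 k; simp only [coeff_theta, MvPolynomial.coeff_add, map_add]; ring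

/-- The operator is the sum of a coefficientwise derivation and ∂/∂(log x_i), each of which obeys
the product rule. -/
theorem theta_mul (i : Fin 2) (F G : LogSeries) :
    theta i (F * G) = F * theta i G + theta i F * G := by
  classical
  have h : ∀ F : LogSeries, ∃ F', theta i F = F' + MvPolynomial.pderiv i F ∧
      ∀ k, MvPolynomial.coeff k F' = thetaSeries i (MvPolynomial.coeff k F) := fun F =>
    ⟨theta i F - MvPolynomial.pderiv i F, by ring, fun k => by
      rw [MvPolynomial.coeff_sub, coeff_theta]; ring⟩
  obtain ⟨F', hF, hF'⟩ := h F
  obtain ⟨G', hG, hG'⟩ := h G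
  obtain ⟨H', hH, hH'⟩ := h (F * G)
  rw [hF, hG, hH]
  have : H' = F * G' + F' * G := by
    ext1 k
    rw [hH']
    simp only [MvPolynomial.coeff_add, MvPolynomial.coeff_mul, map_sum, Derivation.leibniz,
      smul_eq_mul, hF', hG', Finset.sum_add_distrib]
    congr 1
    exact Finset.sum_congr rfl fun _ _ => mul_comm _ _
  rw [this, Derivation.leibniz, smul_eq_mul, smul_eq_mul]
  ring

theorem theta_C (i : Fin 2) (f : Series2) :
    theta i (MvPolynomial.C f) = MvPolynomial.C (thetaSeries i f) := by
  classical
  ext1 k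
  rw [coeff_theta, MvPolynomial.pderiv_C, MvPolynomial.coeff_zero, add_zero,
    MvPolynomial.coeff_C, MvPolynomial.coeff_C]
  split_ifs <;> simp

theorem theta_X (i j : Fin 2) : theta i (MvPolynomial.X j) = if i = j then 1 else 0 := by
  classical
  ext1 k
  have h : thetaSeries i (MvPolynomial.coeff k (MvPolynomial.X j : LogSeries)) = 0 := by
    rw [MvPolynomial.coeff_X]; split_ifs <;> simp
  rw [coeff_theta, h, zero_add, MvPolynomial.pderiv_X]
  congr 1
  split_ifs with hij
  · subst hij; simp
  · rw [Pi.single_eq_of_ne (Ne.symm hij)]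

theorem theta_zero (i : Fin 2) : theta i 0 = 0 := by
  have := theta_C i 0
  simpa using this

theorem theta_neg (i : Fin 2) (F : LogSeries) : theta i (-F) = -theta i F := by
  have := theta_add i F (-F)
  rw [add_neg_cancel, theta_zero] at this
  linear_combination -this

theorem theta_sub (i : Fin 2) (F G : LogSeries) : theta i (F - G) = theta i F - theta i G := by
  rw [sub_eq_add_neg, theta_add, theta_neg]; ring

theorem theta_ofNat (i : Fin 2) (k : ℕ) [k.AtLeastTwo] : theta i (ofNat(k) : LogSeries) = 0 := by
  have := theta_C i (ofNat(k) : Series2)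
  rw [map_ofNat] at this
  rw [this]
  have h : (ofNat(k) : Series2) = algebraMap ℂ Series2 (ofNat(k)) := (map_ofNat _ k).symm
  rw [h, Derivation.map_algebraMap, map_zero]

theorem theta_comm (F : LogSeries) : theta 0 (theta 1 F) = theta 1 (theta 0 F) := by
  induction F using MvPolynomial.induction_on with
  | C f =>
    simp only [theta_C]
    congr 1
    apply ext_expo
    intro n m
    simp only [thetaSeries_zero, thetaSeries_one, coeff_thetaX, coeff_thetaP_expo]
    ring
  | add F G hF hG => simp only [theta_add, hF, hG]
  | mul_X F j hF =>
    have h0 : ∀ i k : Fin 2, theta i (if k = j then (1 : LogSeries) else 0) = 0 := by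
      intro i k
      have h1 : theta i (1 : LogSeries) = 0 := by
        have := theta_C i 1
        simpa using this
      split_ifs
      · exact h1
      · exact theta_zero i
    simp only [theta_mul, theta_add, theta_X, hF, h0]
    ring

/-! ### Differential operators -/

theorem act_eq_sum_of_subset (D : DiffOp) (F : LogSeries) {s : Finset (Fin 2 →₀ ℕ)}
    (hs : D.support ⊆ s) : D.act F = ∑ k ∈ s,
      MvPolynomial.C ((MvPolynomial.coeff k D : MvPolynomial (Fin 2) ℂ) : Series2) *
        (theta 0)^[k 0] ((theta 1)^[k 1] F) := by
  refine Finset.sum_subset hs fun k _ hk => ?_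
  rw [MvPolynomial.notMem_support_iff.mp hk, MvPolynomial.coe_zero, MvPolynomial.C_0, zero_mul]

theorem act_add (D E : DiffOp) (F : LogSeries) :
    DiffOp.act (D + E) F = DiffOp.act D F + DiffOp.act E F := by
  classical
  rw [act_eq_sum_of_subset D F Finset.subset_union_left (s := D.support ∪ E.support),
    act_eq_sum_of_subset E F Finset.subset_union_right (s := D.support ∪ E.support),
    act_eq_sum_of_subset (D + E) F MvPolynomial.support_add, ← Finset.sum_add_distrib]
  refine Finset.sum_congr rfl fun k _ => ?_
  rw [MvPolynomial.coeff_add, MvPolynomial.coe_add, map_add, add_mul]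

theorem act_monomial (k : Fin 2 →₀ ℕ) (a : MvPolynomial (Fin 2) ℂ) (F : LogSeries) :
    DiffOp.act (MvPolynomial.monomial k a) F = MvPolynomial.C (a : Series2) *
      (theta 0)^[k 0] ((theta 1)^[k 1] F) := by
  rw [act_eq_sum_of_subset _ F MvPolynomial.support_monomial_subset, Finset.sum_singleton,
    MvPolynomial.coeff_monomial, if_pos rfl]

theorem act_neg (D : DiffOp) (F : LogSeries) : DiffOp.act (-D) F = -DiffOp.act D F := by
  have h := act_add D (-D) F
  have h0 : DiffOp.act 0 F = 0 := by simp [DiffOp.act]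
  rw [add_neg_cancel, h0] at h
  linear_combination -h

theorem act_sub (D E : DiffOp) (F : LogSeries) :
    DiffOp.act (D - E) F = DiffOp.act D F - DiffOp.act E F := by
  rw [sub_eq_add_neg, act_add, act_neg]; ring

theorem act_C_mul (a : MvPolynomial (Fin 2) ℂ) (D : DiffOp) (F : LogSeries) :
    DiffOp.act (MvPolynomial.C a * D) F = MvPolynomial.C (a : Series2) * DiffOp.act D F := by
  induction D using MvPolynomial.induction_on' with
  | monomial k b =>
    rw [MvPolynomial.C_mul_monomial, act_monomial, act_monomial, MvPolynomial.coe_mul, map_mul,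
      mul_assoc]
  | add D E hD hE => rw [mul_add, act_add, act_add, hD, hE, mul_add]

/-- With coefficients written on the left, multiplication by a variable on the right of `D` really
is composition of operators, although the product of `DiffOp` in general is not. -/
theorem act_mul_X_one (D : DiffOp) (F : LogSeries) :
    DiffOp.act (D * MvPolynomial.X 1) F = DiffOp.act D (theta 1 F) := by
  induction D using MvPolynomial.induction_on' with
  | monomial k b =>
    rw [MvPolynomial.X, MvPolynomial.monomial_mul, act_monomial, act_monomial, mul_one]
    simp
  | add D E hD hE => rw [add_mul, act_add, act_add, hD, hE]

theorem iterate_theta_comm (n : ℕ) (F : LogSeries) :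
    (theta 1)^[n] (theta 0 F) = theta 0 ((theta 1)^[n] F) := by
  induction n generalizing F with
  | zero => rfl
  | succ n ih => rw [Function.iterate_succ_apply, ← theta_comm, ih, Function.iterate_succ_apply]

theorem act_mul_X_zero (D : DiffOp) (F : LogSeries) :
    DiffOp.act (D * MvPolynomial.X 0) F = DiffOp.act D (theta 0 F) := by
  induction D using MvPolynomial.induction_on' with
  | monomial k b =>
    rw [MvPolynomial.X, MvPolynomial.monomial_mul, act_monomial, act_monomial, mul_one,
      iterate_theta_comm, ← Function.iterate_succ_apply]
    simp
  | add D E hD hE => rw [add_mul, act_add, act_add, hD, hE]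

theorem act_C (a : MvPolynomial (Fin 2) ℂ) (F : LogSeries) :
    DiffOp.act (MvPolynomial.C a) F = MvPolynomial.C (a : Series2) * F := by
  have := act_monomial 0 a F
  simpa using this

theorem act_X (i : Fin 2) (F : LogSeries) : DiffOp.act (MvPolynomial.X i) F = theta i F := by
  have h1 : DiffOp.act 1 = id := by
    funext F
    have := act_C 1 F
    simpa using this
  fin_cases i
  · have := act_mul_X_zero 1 F
    simpa [h1] using this
  · have := act_mul_X_one 1 F
    simpa [h1] using this

theorem act_opX (F : LogSeries) : opX.act F = theta 0 (theta 0 F) - theta 0 (theta 1 F) -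
    MvPolynomial.C (MvPowerSeries.X 0) * (12 * (36 * theta 0 (theta 0 F) + 36 * theta 0 F + 5 * F)) := by
  have h : opX = MvPolynomial.X 0 * MvPolynomial.X 0 - MvPolynomial.X 0 * MvPolynomial.X 1 -
      (MvPolynomial.C (432 * MvPolynomial.X 0) * (MvPolynomial.X 0 * MvPolynomial.X 0) +
      MvPolynomial.C (432 * MvPolynomial.X 0) * MvPolynomial.X 0 +
      MvPolynomial.C (60 * MvPolynomial.X 0)) := by
    rw [opX]
    simp only [map_mul, map_ofNat]; ring
  have h2 : ∀ n : ℕ, [n.AtLeastTwo] → ((((ofNat(n) : MvPolynomial (Fin 2) ℂ) * MvPolynomial.X 0 :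
      MvPolynomial (Fin 2) ℂ)) : Series2) = (ofNat(n) : Series2) * MvPowerSeries.X 0 := by
    intro n _
    rw [MvPolynomial.coe_mul, MvPolynomial.coe_X]
    congr 1
    exact map_ofNat (MvPolynomial.coeToMvPowerSeries.ringHom (σ := Fin 2) (R := ℂ)) n
  rw [h]
  simp only [act_sub, act_add, act_C_mul, act_mul_X_zero, act_mul_X_one, act_X, act_C, h2, theta_comm]
  rw [map_mul, map_mul, map_ofNat, map_ofNat]
  ring

theorem act_opY (F : LogSeries) : opY.act F = theta 1 (theta 1 F) +
    MvPolynomial.C (MvPowerSeries.X 1) * (theta 0 (theta 1 F) - theta 1 (theta 1 F)) := by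
  have h : opY = MvPolynomial.X 1 * MvPolynomial.X 1 +
      MvPolynomial.C (MvPolynomial.X 1) * (MvPolynomial.X 0 * MvPolynomial.X 1 -
      MvPolynomial.X 1 * MvPolynomial.X 1) := by
    rw [opY]; ring
  rw [h]
  simp only [act_sub, act_add, act_C_mul, act_mul_X_one, act_X, MvPolynomial.coe_X]

theorem dw_zero_zero : dw 0 0 = MvPolynomial.C w0 := by simp [dw, w0]
theorem dw_one_zero : dw 1 0 = MvPolynomial.C (jet 1 0) + MvPolynomial.C w0 * MvPolynomial.X 0 := by
  simp [dw, Finset.sum_range_succ, w0]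
theorem dw_zero_one : dw 0 1 = MvPolynomial.C (jet 0 1) + MvPolynomial.C w0 * MvPolynomial.X 1 := by
  simp [dw, Finset.sum_range_succ, w0]
theorem dw_one_one : dw 1 1 = MvPolynomial.C (jet 1 1) + MvPolynomial.C (jet 1 0) * MvPolynomial.X 1 +
    MvPolynomial.C (jet 0 1) * MvPolynomial.X 0 +
    MvPolynomial.C w0 * (MvPolynomial.X 0 * MvPolynomial.X 1) := by
  simp [dw, Finset.sum_range_succ, w0]; ring
theorem dw_two_zero : dw 2 0 = MvPolynomial.C (jet 2 0) + 2 * MvPolynomial.C (jet 1 0) * MvPolynomial.X 0 +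
    MvPolynomial.C w0 * MvPolynomial.X 0 ^ 2 := by
  simp [dw, Finset.sum_range_succ, w0]; ring

/-- The part without logarithms of `w₀ ∂_{ρ₁} ∂_{ρ₂} w₀ - ∂_{ρ₁} w₀ ∂_{ρ₂} w₀`, over `w₀²`. -/
def hSeries : Series2 := w0⁻¹ * jet 1 1 - w0⁻¹ ^ 2 * (jet 1 0 * jet 0 1)

theorem logarithms_cancel :
    MvPolynomial.C w0⁻¹ * dw 1 1 - logT1 * logT2 = MvPolynomial.C hSeries := by
  have h := congrArg (MvPolynomial.C (σ := Fin 2)) w0_inv_mul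
  simp only [map_mul, map_one] at h
  rw [logT1_eq, logT2_eq, dw_one_one, hSeries]
  simp only [map_sub, map_mul, map_pow]
  linear_combination (MvPolynomial.X 0 * MvPolynomial.X 1) * h

/-- Sorting by powers of the logarithms leaves the equations of the jets. In the last case the
inhomogeneous terms 2 · (-1) and 2 cancel. -/
theorem hypergeometric_system (F : LogSeries)
    (hF : F ∈ ({dw 0 0, dw 1 0, dw 0 1, 2 • dw 1 1 + dw 2 0} : Set LogSeries)) :
    opX.act F = 0 ∧ opY.act F = 0 := by
  have e1 := congrArg (MvPolynomial.C (σ := Fin 2)) thetaX_thetaX_w0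
  have e2 := congrArg (MvPolynomial.C (σ := Fin 2)) thetaX_thetaX_jet_one_zero
  have e3 := congrArg (MvPolynomial.C (σ := Fin 2)) thetaX_thetaX_jet_two_zero
  have e4 := congrArg (MvPolynomial.C (σ := Fin 2)) thetaX_thetaX_jet_zero_one
  have e5 := congrArg (MvPolynomial.C (σ := Fin 2)) thetaX_thetaX_jet_one_one
  have e6 := congrArg (MvPolynomial.C (σ := Fin 2)) thetaP_thetaP_jet_zero_one
  have e7 := congrArg (MvPolynomial.C (σ := Fin 2)) thetaP_thetaP_jet_one_one
  have h1 : ∀ i, theta i (1 : LogSeries) = 0 := fun i => by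
    have := theta_C i 1
    simpa using this
  simp only [map_add, map_sub, map_mul, map_ofNat, map_one, map_zero] at e1 e2 e3 e4 e5 e6 e7
  simp only [Set.mem_insert_iff, Set.mem_singleton_iff] at hF
  rw [act_opX, act_opY]
  rcases hF with rfl | rfl | rfl | rfl
  · simp only [dw_zero_zero, theta_C, thetaSeries_zero, thetaSeries_one, thetaP_w0, map_zero, theta_zero]
    constructor
    · linear_combination e1
    · ring
  · simp only [dw_one_zero, theta_C, theta_X, theta_add, theta_mul, thetaSeries_zero,
      thetaSeries_one, thetaP_w0, thetaP_jet_zero, map_zero, theta_zero, h1, if_true, one_ne_zero,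
      if_false]
    constructor
    · linear_combination e2 + MvPolynomial.X 0 * e1
    · ring
  · simp only [dw_zero_one, theta_C, theta_X, theta_add, theta_mul, thetaSeries_zero,
      thetaSeries_one, thetaP_w0, map_zero, theta_zero, h1, if_true, zero_ne_one, if_false]
    constructor
    · linear_combination e4 + MvPolynomial.X 1 * e1
    · linear_combination e6
  · have hc : (2 • dw 1 1 + dw 2 0) = 2 * dw 1 1 + dw 2 0 := by rw [nsmul_eq_mul]; norm_cast
    rw [hc]
    simp only [dw_one_one, dw_two_zero, theta_C, theta_X, theta_add, theta_mul, thetaSeries_zero,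
      thetaSeries_one, thetaP_w0, thetaP_jet_zero, map_zero, theta_zero, h1, if_true, one_ne_zero,
      zero_ne_one, if_false, pow_two, theta_ofNat]
    constructor
    · linear_combination 2 * e5 + e3 + 2 * MvPolynomial.X 0 * e4 + 2 * MvPolynomial.X 1 * e2 +
        2 * MvPolynomial.X 0 * e2 + (2 * MvPolynomial.X 0 * MvPolynomial.X 1 + MvPolynomial.X 0 ^ 2) * e1
    · linear_combination 2 * e7 + 2 * MvPolynomial.X 0 * e6

/-! ### The transport equation and the derivatives along `y` -/

/-- The equation reads (m + 1) f_{n,m+1} + (n - m) f_{n,m} = 0, so the restriction to y = 0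
determines the solution. -/
theorem eq_of_transport {f g : Series2}
    (hf : thetaP f + MvPowerSeries.X 1 * (thetaX f - thetaP f) = 0)
    (hg : thetaP g + MvPowerSeries.X 1 * (thetaX g - thetaP g) = 0)
    (h0 : restrictHom f = restrictHom g) : f = g := by
  have h : thetaP (f - g) + MvPowerSeries.X 1 * (thetaX (f - g) - thetaP (f - g)) = 0 := by
    rw [map_sub, map_sub]; linear_combination hf - hg
  rw [← sub_eq_zero]
  apply ext_expo
  intro n m
  rw [map_zero]
  induction m with
  | zero =>
    rw [coeff_restrictHom_of_eq_zero _ (expo_one n 0), map_sub, h0, sub_self, map_zero]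
  | succ m ih =>
    have := congrArg (MvPowerSeries.coeff (expo n (m + 1))) h
    rw [map_add, coeff_X1_mul_succ, map_sub (MvPowerSeries.coeff _), coeff_thetaP_expo, coeff_thetaX, coeff_thetaP_expo, ih,
      map_zero] at this
    have h2 : ((m + 1 : ℕ) : ℂ) ≠ 0 := by exact_mod_cast m.succ_ne_zero
    exact (mul_eq_zero.mp (by simpa only [add_zero, mul_zero, sub_self] using this)).resolve_left h2

theorem thetaX_subst {a : Series2} (ha : MvPowerSeries.constantCoeff a = 0) (f : PowerSeries ℂ) :
    thetaX (f.subst a) = (PowerSeries.derivative ℂ f).subst a * thetaX a := by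
  rw [thetaX_apply, thetaX_apply, pderiv_powerSeries_subst ha]; ring

/-- The series `x (1 - y)`. -/
def xTwist : Series2 := MvPowerSeries.X 0 * (1 - MvPowerSeries.X 1)

theorem constantCoeff_xTwist : MvPowerSeries.constantCoeff xTwist = 0 := by simp [xTwist]

theorem thetaP_xTwist : thetaP xTwist = -(MvPowerSeries.X 0 * MvPowerSeries.X 1) := by
  have h : thetaP (MvPowerSeries.X 0) = 0 := by rw [← inFirst_X, thetaP_inFirst]
  rw [xTwist, Derivation.leibniz, h, map_sub, thetaP_X1, Derivation.map_one_eq_zero]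
  simp

theorem thetaX_X0 : thetaX (MvPowerSeries.X 0) = MvPowerSeries.X 0 := by
  rw [thetaX_apply, MvPowerSeries.pderiv_X_self, mul_one]

theorem thetaX_X1 : thetaX (MvPowerSeries.X 1) = 0 := by
  rw [thetaX_apply, MvPowerSeries.pderiv_X_of_ne (by simp), mul_zero]

theorem thetaX_xTwist : thetaX xTwist = xTwist := by
  rw [xTwist, Derivation.leibniz, thetaX_X0, map_sub, thetaX_X1, Derivation.map_one_eq_zero]
  simp [mul_comm]

theorem restrictHom_X0 : restrictHom (MvPowerSeries.X 0) = PowerSeries.X := by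
  rw [← inFirst_X, restrictHom_inFirst]

theorem restrictHom_xTwist : restrictHom xTwist = PowerSeries.X := by
  rw [xTwist, map_mul, map_sub, map_one, restrictHom_X0, restrictHom_X1, sub_zero, mul_one]

theorem subst_X_self (f : PowerSeries ℂ) : PowerSeries.subst (PowerSeries.X : PowerSeries ℂ) f = f := by
  rw [← PowerSeries.map_algebraMap_eq_subst_X]; simp

theorem restrictHom_subst_xTwist (f : PowerSeries ℂ) : restrictHom (f.subst xTwist) = f := by
  rw [restrictHom_subst constantCoeff_xTwist, restrictHom_xTwist, subst_X_self]

/-- The vector field of the transport equation annihilates x(1 - y), hence every series in it. -/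
theorem transport_subst_xTwist (f : PowerSeries ℂ) : thetaP (f.subst xTwist) +
    MvPowerSeries.X 1 * (thetaX (f.subst xTwist) - thetaP (f.subst xTwist)) = 0 := by
  rw [thetaP_subst constantCoeff_xTwist, thetaX_subst constantCoeff_xTwist, thetaP_xTwist,
    thetaX_xTwist, xTwist]
  ring

/-- After adding w₀, the equation in y is a transport equation with initial value w. -/
theorem thetaP_jet_zero_one : thetaP (jet 0 1) = wSeries.subst xTwist - w0 := by
  rw [eq_sub_iff_add_eq]
  apply eq_of_transport _ (transport_subst_xTwist _)
  · rw [map_add, restrictHom_thetaP, restrictHom_subst_xTwist, w0_eq, restrictHom_inFirst, zero_add]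
  · rw [map_add, map_add, thetaP_w0]
    linear_combination thetaP_thetaP_jet_zero_one

theorem constantCoeff_one_sub_X1 :
    MvPowerSeries.constantCoeff (1 - MvPowerSeries.X 1 : Series2) = 1 := by simp

theorem thetaX_flog {a : Series2} (ha : MvPowerSeries.constantCoeff a = 1) :
    a * thetaX (flog a) = thetaX a := by
  rw [thetaX_apply, thetaX_apply, flog, ← mul_pderiv_subst_log ha]; ring

theorem ne_zero_of_constantCoeff_eq_one {a : Series2} (ha : MvPowerSeries.constantCoeff a = 1) :
    a ≠ 0 := by rintro rfl; simp at ha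

theorem thetaX_flog_one_sub : thetaX (flog (1 - MvPowerSeries.X 1)) = 0 := by
  have h := thetaX_flog constantCoeff_one_sub_X1
  rw [map_sub, thetaX_X1, Derivation.map_one_eq_zero, sub_zero] at h
  exact (mul_eq_zero.mp h).resolve_left (ne_zero_of_constantCoeff_eq_one constantCoeff_one_sub_X1)

theorem subst_zero_eq (f : PowerSeries ℂ) :
    PowerSeries.subst (0 : PowerSeries ℂ) f = PowerSeries.C (PowerSeries.constantCoeff f) := by
  have hs : PowerSeries.HasSubst (0 : PowerSeries ℂ) := PowerSeries.HasSubst.of_constantCoeff_zero (by simp)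
  have h : f = PowerSeries.C (PowerSeries.constantCoeff f) +
      PowerSeries.X * PowerSeries.mk fun n => PowerSeries.coeff (n + 1) f := by
    ext (_ | n)
    · simp
    · simp [PowerSeries.coeff_succ_X_mul]
  conv_lhs => rw [h]
  rw [PowerSeries.subst_add hs, PowerSeries.subst_mul hs, PowerSeries.subst_X hs, zero_mul, add_zero,
    PowerSeries.subst_C]
  rfl

theorem restrictHom_flog_one_sub : restrictHom (flog (1 - MvPowerSeries.X 1)) = 0 := by
  rw [flog, restrictHom_subst (by simp)]
  simp only [map_sub, map_one, restrictHom_X1, sub_zero, sub_self]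
  rw [subst_zero_eq]
  simp

/-- The ρ₁-derivative of the preceding formula: (x(1 - y))^ρ₁ contains the factor (1 - y)^ρ₁, which
accounts for the term with log(1 - y). -/
theorem thetaP_jet_one_one : thetaP (jet 1 1) = gSeries.subst xTwist +
    wSeries.subst xTwist * flog (1 - MvPowerSeries.X 1) - jet 1 0 := by
  have h1 := mul_thetaP_flog constantCoeff_one_sub_X1
  rw [map_sub, thetaP_X1, Derivation.map_one_eq_zero, zero_sub] at h1
  have h2 := transport_subst_xTwist wSeries
  have h3 : thetaP (jet 1 1) + jet 1 0 - wSeries.subst xTwist * flog (1 - MvPowerSeries.X 1) =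
      gSeries.subst xTwist := by
    apply eq_of_transport _ (transport_subst_xTwist _)
    · rw [map_sub, map_add, restrictHom_thetaP, restrictHom_subst_xTwist, jet_one_zero_eq,
        restrictHom_inFirst, map_mul, restrictHom_flog_one_sub]
      simp
    · have h4 := thetaP_thetaP_jet_one_one
      have h5 := thetaP_jet_zero_one
      simp only [map_add, map_sub, Derivation.leibniz, smul_eq_mul, thetaP_jet_zero,
        thetaX_flog_one_sub] at h4 ⊢
      linear_combination h4 - MvPowerSeries.X 1 * h5 - wSeries.subst xTwist * h1 -
        flog (1 - MvPowerSeries.X 1) * h2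
  linear_combination h3

section

open PowerSeries (X C constantCoeff)

/-! ### The mirror map in one variable -/

theorem subst_X_pow_mul {f : PowerSeries ℂ} {n : ℕ} (h : constantCoeff f = 0)
    (hf : X ^ n ∣ theta1 f) : X ^ n ∣ f := by
  rw [PowerSeries.X_pow_dvd_iff] at hf ⊢
  intro m hm
  by_cases h0 : m = 0
  · rw [h0, PowerSeries.coeff_zero_eq_constantCoeff_apply, h]
  · have := hf m hm
    rw [coeff_theta1] at this
    exact (mul_eq_zero.mp this).resolve_left (by exact_mod_cast h0)

theorem eq_zero_of_X_pow_dvd {f : PowerSeries ℂ} (h : ∀ n, X ^ n ∣ f) : f = 0 := by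
  ext n
  exact PowerSeries.X_pow_dvd_iff.mp (h (n + 1)) n (Nat.lt_succ_self n)

theorem constantCoeff_theta1 (f : PowerSeries ℂ) : constantCoeff (theta1 f) = 0 := by
  rw [theta1_apply]; simp

theorem eq_of_theta1_log {f g : PowerSeries ℂ} (hf : constantCoeff f = 1) (hg : constantCoeff g = 1)
    (h : g * theta1 f = f * theta1 g) : f = g := by
  have hg0 : g ≠ 0 := ne_zero_of_constantCoeff hg
  have hi : g * g⁻¹ = 1 := PowerSeries.mul_inv_cancel _ (by rw [hg]; exact one_ne_zero)
  set k := f * g⁻¹ with hk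
  have hfk : f = k * g := by rw [hk, mul_assoc, mul_comm _ g, hi, mul_one]
  have : k = 1 := by
    apply eq_of_theta1_eq
    · rw [Derivation.map_one_eq_zero]
      rw [hfk, Derivation.leibniz, smul_eq_mul, smul_eq_mul] at h
      have h2 : g * (g * theta1 k) = 0 := by linear_combination h
      simpa [hg0] using h2
    · rw [hk, map_mul, hf, one_mul, PowerSeries.constantCoeff_inv, hg]; simp
  rw [hfk, this, one_mul]

theorem toComplex_mul (f g : PowerSeries ℚ) : toComplex (f * g) = toComplex f * toComplex g :=
  map_mul _ f g
theorem toComplex_sub (f g : PowerSeries ℚ) : toComplex (f - g) = toComplex f - toComplex g :=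
  map_sub _ f g
theorem toComplex_pow (f : PowerSeries ℚ) (n : ℕ) : toComplex (f ^ n) = toComplex f ^ n :=
  map_pow _ f n
theorem toComplex_one : toComplex 1 = 1 := map_one _
theorem toComplex_X : toComplex X = X := PowerSeries.map_X _
theorem toComplex_C (r : ℚ) : toComplex (C r) = C (r : ℂ) := PowerSeries.map_C _ r
theorem constantCoeff_toComplex (f : PowerSeries ℚ) :
    constantCoeff (toComplex f) = ((constantCoeff f : ℚ) : ℂ) := by
  rw [← PowerSeries.coeff_zero_eq_constantCoeff_apply, coeff_toComplex]; simp

theorem theta1_toComplex (f : PowerSeries ℚ) :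
    theta1 (toComplex f) = toComplex (X * PowerSeries.derivative ℚ f) := by
  rw [toComplex_mul, toComplex_X, toComplex_derivative]; rfl

theorem ofNat_mul_C_inv (k : ℕ) [k.AtLeastTwo] :
    (ofNat(k) : PowerSeries ℂ) * C (((1 / ofNat(k) : ℚ)) : ℂ) = 1 := by
  rw [← map_ofNat C k, ← map_mul]
  push_cast
  rw [mul_one_div_cancel (OfNat.ofNat_ne_zero k), map_one]

theorem theta1_exp_subst {a : PowerSeries ℂ} (ha : constantCoeff a = 0) :
    theta1 ((PowerSeries.exp ℂ).subst a : PowerSeries ℂ) =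
      (PowerSeries.exp ℂ).subst a * theta1 a := by
  rw [theta1_apply, theta1_apply,
    PowerSeries.derivative_subst (PowerSeries.HasSubst.of_constantCoeff_zero' ha),
    PowerSeries.derivative_exp]
  ring

theorem theta1_E2 : 12 * theta1 (toComplex E2) = toComplex E2 ^ 2 - toComplex E4 := by
  rw [theta1_toComplex, ramanujan_E2, toComplex_mul, toComplex_C, toComplex_sub, toComplex_pow]
  linear_combination (toComplex E2 ^ 2 - toComplex E4) * ofNat_mul_C_inv 12

theorem theta1_E4 : 3 * theta1 (toComplex E4) =
    toComplex E2 * toComplex E4 - toComplex E6 := by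
  rw [theta1_toComplex, ramanujan_E4, toComplex_mul, toComplex_C, toComplex_sub, toComplex_mul]
  linear_combination (toComplex E2 * toComplex E4 - toComplex E6) * ofNat_mul_C_inv 3

theorem theta1_E6 : 2 * theta1 (toComplex E6) =
    toComplex E2 * toComplex E6 - toComplex E4 ^ 2 := by
  rw [theta1_toComplex, ramanujan_E6, toComplex_mul, toComplex_C, toComplex_sub, toComplex_mul,
    toComplex_pow]
  linear_combination (toComplex E2 * toComplex E6 - toComplex E4 ^ 2) * ofNat_mul_C_inv 2

theorem theta1_etaProd : 24 * theta1 (toComplex etaProd) =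
    toComplex etaProd * (toComplex E2 - 1) := by
  rw [theta1_toComplex, theta_etaProd, toComplex_mul, toComplex_C, toComplex_mul, toComplex_sub,
    toComplex_one]
  linear_combination (toComplex etaProd * (toComplex E2 - 1)) * ofNat_mul_C_inv 24

theorem delta_toComplex : 1728 * (X * toComplex etaProd ^ 24) =
    toComplex E4 ^ 3 - toComplex E6 ^ 2 := by
  have := congrArg toComplex delta_identity
  rw [toComplex_mul, toComplex_C, toComplex_mul, toComplex_X, toComplex_sub, toComplex_pow,
    toComplex_pow, toComplex_pow] at this
  rw [← this]
  congr 1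

/-- `E₄ ^ (1/4)`. -/
def rootE4 : PowerSeries ℂ := (PowerSeries.binomialSeries ℂ (1 / 4 : ℂ)).subst (toComplex E4 - 1)

theorem constantCoeff_E4_sub_one : constantCoeff (toComplex E4 - 1) = 0 := by
  rw [map_sub, constantCoeff_toComplex, constantCoeff_E4]; simp

theorem fpow_E4 : fpow (inFirst (toComplex E4)) (1 / 4) = inFirst rootE4 := by
  rw [rootE4, inFirst_subst constantCoeff_E4_sub_one, fpow]
  congr 1
  rw [← inFirstHom_apply, ← inFirstHom_apply, map_sub, map_one]

theorem constantCoeff_rootE4 : constantCoeff rootE4 = 1 := by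
  have h := constantCoeff_powerSeries_subst (a := toComplex E4 - 1) constantCoeff_E4_sub_one
    (PowerSeries.binomialSeries ℂ (1 / 4 : ℂ))
  refine h.trans ?_
  simp

theorem theta1_subst {a : PowerSeries ℂ} (ha : constantCoeff a = 0) (f : PowerSeries ℂ) :
    theta1 (f.subst a : PowerSeries ℂ) = (PowerSeries.derivative ℂ f).subst a * theta1 a := by
  rw [theta1_apply, theta1_apply,
    PowerSeries.derivative_subst (PowerSeries.HasSubst.of_constantCoeff_zero' ha)]
  ring

theorem theta1_rootE4' : 4 * (toComplex E4 * theta1 rootE4) = rootE4 * theta1 (toComplex E4) := by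
  have hs := PowerSeries.HasSubst.of_constantCoeff_zero' constantCoeff_E4_sub_one
  have h := congrArg (fun f => (PowerSeries.subst (toComplex E4 - 1) f : PowerSeries ℂ))
    (one_add_X_mul_derivative_binomialSeries (1 / 4))
  have h1 : (PowerSeries.subst (toComplex E4 - 1) (1 : PowerSeries ℂ) : PowerSeries ℂ) = 1 := by
    rw [← PowerSeries.coe_substAlgHom hs, map_one]
  have h2 : (PowerSeries.subst (toComplex E4 - 1) (C (1 / 4 : ℂ)) : PowerSeries ℂ) = C (1 / 4) :=
    PowerSeries.subst_C _
  rw [PowerSeries.subst_mul hs, PowerSeries.subst_add hs, PowerSeries.subst_X hs,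
    PowerSeries.subst_mul hs, h1, h2] at h
  have h4 := ofNat_mul_C_inv 4
  push_cast at h4
  rw [rootE4, theta1_subst constantCoeff_E4_sub_one, map_sub, Derivation.map_one_eq_zero, sub_zero]
  linear_combination 4 * theta1 (toComplex E4) * h + theta1 (toComplex E4) *
    PowerSeries.subst (toComplex E4 - 1) (PowerSeries.binomialSeries ℂ (1 / 4 : ℂ)) * h4

theorem rootE4_pow : rootE4 ^ 4 = toComplex E4 := by
  apply eq_of_theta1_log
  · rw [map_pow, constantCoeff_rootE4, one_pow]
  · rw [constantCoeff_toComplex, constantCoeff_E4]; simp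
  · rw [Derivation.leibniz_pow, nsmul_eq_mul, smul_eq_mul]
    push_cast
    linear_combination rootE4 ^ 3 * theta1_rootE4'

theorem rootE4_mul_inv : rootE4 * rootE4⁻¹ = 1 :=
  PowerSeries.mul_inv_cancel _ (by rw [constantCoeff_rootE4]; exact one_ne_zero)

theorem rootE4_ne_zero : rootE4 ≠ 0 := ne_zero_of_constantCoeff constantCoeff_rootE4

/-- `E₆ / E₄ ^ (3/2)`. -/
def ratioE6 : PowerSeries ℂ := toComplex E6 * rootE4⁻¹ ^ 6

theorem E6_eq : toComplex E6 = ratioE6 * rootE4 ^ 6 := by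
  have h : rootE4⁻¹ ^ 6 * rootE4 ^ 6 = 1 := by
    rw [← mul_pow, mul_comm, rootE4_mul_inv, one_pow]
  rw [ratioE6, mul_assoc, h, mul_one]

theorem constantCoeff_ratioE6 : constantCoeff ratioE6 = 1 := by
  rw [ratioE6, map_mul, map_pow, PowerSeries.constantCoeff_inv, constantCoeff_rootE4,
    constantCoeff_toComplex, constantCoeff_E6]; simp

theorem theta1_rootE4 : 12 * theta1 rootE4 =
    rootE4 * toComplex E2 - ratioE6 * rootE4 ^ 3 := by
  have h1 := theta1_rootE4'
  have h2 := theta1_E4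
  rw [E6_eq, ← rootE4_pow] at h2
  rw [← rootE4_pow] at h1
  apply mul_left_cancel₀ (pow_ne_zero 4 rootE4_ne_zero)
  linear_combination 3 * h1 + rootE4 * h2

/-- The quotient E₆/E₄^(3/2) has weight 0, so E₂ drops out of its derivative. -/
theorem theta1_ratioE6 : 2 * theta1 ratioE6 = -(rootE4 ^ 2 * (1 - ratioE6 ^ 2)) := by
  have h2 := theta1_E6
  have h3 := theta1_rootE4
  rw [E6_eq, ← rootE4_pow, Derivation.leibniz, Derivation.leibniz_pow, nsmul_eq_mul,
    smul_eq_mul, smul_eq_mul, smul_eq_mul] at h2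
  push_cast at h2
  apply mul_left_cancel₀ (pow_ne_zero 6 rootE4_ne_zero)
  linear_combination h2 - ratioE6 * rootE4 ^ 5 * h3

/-- The mirror map `x(q)`. -/
def xQ : PowerSeries ℂ := C (1 / 864) * (1 - ratioE6)

theorem xQ_eq : 864 * xQ = 1 - ratioE6 := by
  have h4 := ofNat_mul_C_inv 864
  push_cast at h4
  rw [xQ]; linear_combination (1 - ratioE6) * h4

theorem constantCoeff_xQ : constantCoeff xQ = 0 := by
  rw [xQ, map_mul, map_sub, constantCoeff_ratioE6]; simp

theorem ofNat_ne_zero' (k : ℕ) [k.AtLeastTwo] : (ofNat(k) : PowerSeries ℂ) ≠ 0 := by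
  rw [← map_ofNat C k]
  intro h
  have := congrArg constantCoeff h
  rw [PowerSeries.constantCoeff_C, map_zero] at this
  exact OfNat.ofNat_ne_zero k this

theorem theta1_xQ : theta1 xQ = xQ * (rootE4 ^ 2 * (1 - 432 * xQ)) := by
  have h := congrArg theta1 xQ_eq
  rw [Derivation.leibniz, theta1_ofNat, map_sub, Derivation.map_one_eq_zero] at h
  simp only [smul_eq_mul, mul_zero, add_zero, zero_sub] at h
  have h2 := theta1_ratioE6
  have h3 := xQ_eq
  have h4 : ratioE6 = 1 - 864 * xQ := by linear_combination h3
  apply mul_left_cancel₀ (ofNat_ne_zero' 1728)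
  linear_combination 2 * h - h2 - rootE4 ^ 2 * (ratioE6 + 1 - 864 * xQ) * h4

/-- With E₆ = (1 - 864 x) E₄^(3/2), the left-hand side is E₄³ - E₆². -/
theorem xQ_mul_inv : 1728 * (xQ * (1 - 432 * xQ)) * rootE4 ^ 12 =
    1728 * (X * toComplex etaProd ^ 24) := by
  have h4 : ratioE6 = 1 - 864 * xQ := by linear_combination xQ_eq
  rw [delta_toComplex, E6_eq, ← rootE4_pow, h4]; ring

theorem xQ_mul_inv' : xQ * (1 - 432 * xQ) * rootE4 ^ 12 = X * toComplex etaProd ^ 24 :=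
  mul_left_cancel₀ (ofNat_ne_zero' 1728) (by linear_combination xQ_mul_inv)

theorem xQ_jInv : xQ * (1 - 432 * xQ) = toComplex jInv := by
  have h : E4 ^ 3 * (E4 ^ 3)⁻¹ = 1 :=
    PowerSeries.mul_inv_cancel _ (by rw [map_pow, constantCoeff_E4]; simp)
  have h2 := congrArg toComplex h
  rw [toComplex_mul, toComplex_pow, toComplex_one, ← rootE4_pow] at h2
  rw [jInv, toComplex_mul, toComplex_mul, toComplex_X, toComplex_pow]
  linear_combination (-(xQ * (1 - 432 * xQ))) * h2 + toComplex (E4 ^ 3)⁻¹ * xQ_mul_inv'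

theorem coeff_one_X_mul (f : PowerSeries ℂ) :
    PowerSeries.coeff 1 (X * f) = constantCoeff f := by
  rw [show (1 : ℕ) = 0 + 1 from rfl, PowerSeries.coeff_succ_X_mul]; simp

theorem coeff_one_xQ : PowerSeries.coeff 1 xQ = 1 := by
  have h := congrArg (PowerSeries.coeff 1) xQ_mul_inv'
  have hx : xQ = X * shift xQ := by
    rw [X_mul_shift, constantCoeff_xQ, map_zero, sub_zero]
  rw [hx, mul_assoc, mul_assoc, coeff_one_X_mul, coeff_one_X_mul, ← hx] at h
  simp only [map_mul, map_sub, map_pow, constantCoeff_rootE4, constantCoeff_xQ,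
    constantCoeff_toComplex, constantCoeff_etaProd, map_one] at h
  rw [hx, coeff_one_X_mul]
  simpa using h

theorem hasSubst_xQ : PowerSeries.HasSubst xQ :=
  PowerSeries.HasSubst.of_constantCoeff_zero' constantCoeff_xQ

/-- Composition of a series in one variable with `x(q)`. -/
def pull : PowerSeries ℂ →ₐ[ℂ] PowerSeries ℂ := PowerSeries.substAlgHom hasSubst_xQ

theorem pull_apply (f : PowerSeries ℂ) : pull f = f.subst xQ := by
  rw [pull, PowerSeries.coe_substAlgHom]

theorem pull_X : pull X = xQ := by rw [pull_apply, PowerSeries.subst_X hasSubst_xQ]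

theorem constantCoeff_pull (f : PowerSeries ℂ) : constantCoeff (pull f) = constantCoeff f := by
  rw [pull_apply]
  exact constantCoeff_powerSeries_subst (a := xQ) constantCoeff_xQ f

theorem theta1_pull (f : PowerSeries ℂ) :
    theta1 (pull f) = rootE4 ^ 2 * (1 - 432 * xQ) * pull (theta1 f) := by
  rw [theta1_apply f, map_mul, pull_X, pull_apply, pull_apply, theta1_subst constantCoeff_xQ,
    theta1_xQ]
  ring

/-- `w₀(x(q)) = E₄ ^ (1/4)`. -/
theorem pull_wSeries : pull wSeries = rootE4 := by
  set F := pull wSeries with hF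
  -- The second order equation becomes the system θF = E₄^(1/2) K, θK = 60 x(1 - 432x) E₄^(1/2) F.
  set K := pull ((1 - 432 * X) * theta1 wSeries) with hK
  have hFK : theta1 F = rootE4 ^ 2 * K := by
    rw [hF, theta1_pull, hK, map_mul, map_sub, map_one, map_mul, map_ofNat, pull_X]; ring
  have hKF : theta1 K = 60 * (xQ * (1 - 432 * xQ)) * rootE4 ^ 2 * F := by
    have h : theta1 ((1 - 432 * X) * theta1 wSeries) = 60 * (X * wSeries) := by
      have := wSeries_ode
      rw [Derivation.leibniz, map_sub, Derivation.map_one_eq_zero, Derivation.leibniz, theta1_ofNat,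
        theta1_X]
      simp only [smul_eq_mul]
      linear_combination this
    rw [hK, theta1_pull, h, map_mul, map_mul, pull_X, map_ofNat]; ring
  -- The only possible partner of E₄^(1/4) in this system, read off from the formula for
  -- θ(E₄^(1/4)). That it satisfies the second equation is Ramanujan's identity for E₂.
  set K' := C (1 / 12) * (rootE4⁻¹ * (toComplex E2 - ratioE6 * rootE4 ^ 2)) with hK'
  have h12 := ofNat_mul_C_inv 12
  push_cast at h12
  have hi := rootE4_mul_inv
  have hWK : 12 * (rootE4 * K') = toComplex E2 - ratioE6 * rootE4 ^ 2 := by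
    rw [hK']
    linear_combination 12 * C (1 / 12 : ℂ) * (toComplex E2 - ratioE6 * rootE4 ^ 2) * hi +
      (toComplex E2 - ratioE6 * rootE4 ^ 2) * h12
  have hFK' : theta1 rootE4 = rootE4 ^ 2 * K' := by
    apply mul_left_cancel₀ (ofNat_ne_zero' 12)
    linear_combination theta1_rootE4 - rootE4 * hWK
  have hr : ratioE6 = 1 - 864 * xQ := by linear_combination xQ_eq
  have hKF' : theta1 K' = 60 * (xQ * (1 - 432 * xQ)) * rootE4 ^ 2 * rootE4 := by
    have h := congrArg theta1 hWK
    have h2 := theta1_E2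
    have h3 := theta1_ratioE6
    rw [← rootE4_pow] at h2
    simp only [Derivation.leibniz, Derivation.leibniz_pow, map_sub, theta1_ofNat, smul_eq_mul,
      nsmul_eq_mul, mul_zero, add_zero, Nat.add_one_sub_one, pow_one] at h
    push_cast at h
    rw [hFK'] at h
    apply mul_left_cancel₀ (mul_ne_zero (ofNat_ne_zero' 144) rootE4_ne_zero)
    have hr2 : xQ * (1 - 432 * xQ) * 1728 = 1 - ratioE6 ^ 2 := by rw [hr]; ring
    linear_combination 12 * h + h2 - 6 * rootE4 ^ 2 * h3 -
      (12 * rootE4 * K' + (toComplex E2 - ratioE6 * rootE4 ^ 2) + 2 * ratioE6 * rootE4 ^ 2) * hWK -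
      5 * rootE4 ^ 4 * hr2
  have hJ : X ∣ xQ := PowerSeries.X_dvd_iff.mpr constantCoeff_xQ
  rw [← sub_eq_zero]
  have hf0 : constantCoeff (F - rootE4) = 0 := by
    rw [map_sub, hF, constantCoeff_pull, constantCoeff_wSeries, constantCoeff_rootE4, sub_self]
  have e1 : theta1 (F - rootE4) = rootE4 ^ 2 * (K - K') := by rw [map_sub, hFK, hFK']; ring
  have e2 : theta1 (K - K') = 60 * (xQ * (1 - 432 * xQ)) * rootE4 ^ 2 * (F - rootE4) := by
    rw [map_sub, hKF, hKF']; ring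
  have hk0 : constantCoeff (K - K') = 0 := by
    have := congrArg constantCoeff e1
    rw [constantCoeff_theta1, map_mul, map_pow, constantCoeff_rootE4] at this
    rw [this]; ring
  -- The second equation carries a factor x(q), divisible by q. If q^n divides the difference of the
  -- first components, then q^(n+1) divides that of the second and hence that of the first.
  apply eq_zero_of_X_pow_dvd
  intro n
  induction n with
  | zero => simp
  | succ n ih =>
    apply subst_X_pow_mul hf0
    rw [e1]
    apply Dvd.dvd.mul_left
    apply subst_X_pow_mul hk0
    rw [e2, pow_succ]
    obtain ⟨a, ha⟩ := hJ
    obtain ⟨b, hb⟩ := ih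
    rw [hb]
    nth_rewrite 1 [ha]
    exact ⟨60 * (a * (1 - 432 * xQ)) * rootE4 ^ 2 * b, by ring⟩

theorem wSeries_mul_inv : wSeries * wSeries⁻¹ = 1 :=
  PowerSeries.mul_inv_cancel _ (by rw [constantCoeff_wSeries]; exact one_ne_zero)

/-- The quotients `∂_{ρ₁} w₀ / w₀` and `∂_{ρ₂} w₀ / w₀` without logarithms at `y = 0`. -/
def gRatio : PowerSeries ℂ := gSeries * wSeries⁻¹
def phiRatio : PowerSeries ℂ := phiSeries * wSeries⁻¹

theorem gRatio_mul : gRatio * wSeries = gSeries := by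
  rw [gRatio, mul_assoc, mul_comm _ wSeries, wSeries_mul_inv, mul_one]
theorem phiRatio_mul : phiRatio * wSeries = phiSeries := by
  rw [phiRatio, mul_assoc, mul_comm _ wSeries, wSeries_mul_inv, mul_one]
theorem constantCoeff_gRatio : constantCoeff gRatio = 0 := by
  rw [gRatio, map_mul, constantCoeff_gSeries, zero_mul]
theorem constantCoeff_phiRatio : constantCoeff phiRatio = 0 := by
  rw [phiRatio, map_mul, constantCoeff_phiSeries, zero_mul]

theorem theta1_gRatio : (1 - 432 * X) * wSeries ^ 2 * (1 + theta1 gRatio) = 1 := by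
  have h := wronskian_g
  rw [← gRatio_mul, Derivation.leibniz, smul_eq_mul, smul_eq_mul] at h
  linear_combination h

theorem theta1_phiRatio : 2 * ((1 - 432 * X) * wSeries ^ 2 * theta1 phiRatio) =
    wSeries ^ 2 - 1 := by
  have h := wronskian_phi
  rw [← phiRatio_mul, Derivation.leibniz, smul_eq_mul, smul_eq_mul] at h
  linear_combination h

theorem theta1_pull_gRatio : theta1 (pull gRatio) = 1 - rootE4 ^ 2 * (1 - 432 * xQ) := by
  have h := congrArg pull theta1_gRatio
  simp only [map_mul, map_sub, map_one, map_pow, map_add, map_ofNat, pull_X, pull_wSeries] at h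
  rw [theta1_pull]; linear_combination h

theorem theta1_pull_phiRatio : 2 * theta1 (pull phiRatio) = rootE4 ^ 2 - 1 := by
  have h := congrArg pull theta1_phiRatio
  simp only [map_mul, map_sub, map_one, map_pow, map_ofNat, pull_X, pull_wSeries] at h
  rw [theta1_pull]; linear_combination h

theorem constantCoeff_pull_gRatio : constantCoeff (pull gRatio) = 0 := by
  rw [constantCoeff_pull, constantCoeff_gRatio]
theorem constantCoeff_pull_phiRatio : constantCoeff (pull phiRatio) = 0 := by
  rw [constantCoeff_pull, constantCoeff_phiRatio]

theorem constantCoeff_exp_subst {a : PowerSeries ℂ} (ha : constantCoeff a = 0) :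
    constantCoeff ((PowerSeries.exp ℂ).subst a : PowerSeries ℂ) = 1 := by
  have h := constantCoeff_powerSeries_subst (a := a) ha (PowerSeries.exp ℂ)
  refine h.trans ?_
  simp

/-- `x(q) exp ((∂_{ρ₁} w₀ / w₀)(x(q))) = q`. -/
theorem xQ_mul_exp : xQ * (PowerSeries.exp ℂ).subst (pull gRatio) = X := by
  have hx : xQ = X * shift xQ := by
    rw [X_mul_shift, constantCoeff_xQ, map_zero, sub_zero]
  -- A solution of θf = f is a multiple of q, and the leading coefficient is 1.
  have h1 : theta1 (xQ * (PowerSeries.exp ℂ).subst (pull gRatio)) =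
      xQ * (PowerSeries.exp ℂ).subst (pull gRatio) := by
    rw [Derivation.leibniz, theta1_exp_subst constantCoeff_pull_gRatio, theta1_pull_gRatio, theta1_xQ,
      smul_eq_mul, smul_eq_mul]
    ring
  ext n
  by_cases hn : n = 1
  · subst hn
    rw [hx, mul_assoc, coeff_one_X_mul, map_mul, constantCoeff_exp_subst constantCoeff_pull_gRatio,
      mul_one, PowerSeries.coeff_one_X, ← coeff_one_X_mul, ← hx, coeff_one_xQ]
  · have h2 := congrArg (PowerSeries.coeff n) h1
    rw [coeff_theta1] at h2
    rw [PowerSeries.coeff_X, if_neg hn]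
    have h3 : (n : ℂ) - 1 ≠ 0 := sub_ne_zero.mpr (by exact_mod_cast hn)
    exact (mul_eq_zero.mp (by linear_combination h2)).resolve_left h3

theorem one_sub_ne_zero : (1 - 432 * xQ : PowerSeries ℂ) ≠ 0 :=
  ne_zero_of_constantCoeff (by simp [constantCoeff_xQ])

/-- `exp ((∂_{ρ₂} w₀ / w₀)(x(q), 0)) E₄ ^ (3/2) (1 - 432 x(q)) = ∏ (1 - q ^ m) ^ 12`. -/
theorem exp_pull_phiRatio : (PowerSeries.exp ℂ).subst (pull phiRatio) *
    (rootE4 ^ 6 * (1 - 432 * xQ)) = toComplex etaProd ^ 12 := by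
  have he : toComplex etaProd ≠ 0 := ne_zero_of_constantCoeff (by
    rw [constantCoeff_toComplex, constantCoeff_etaProd]; simp)
  apply eq_of_theta1_log
  · simp [constantCoeff_exp_subst constantCoeff_pull_phiRatio, constantCoeff_rootE4, constantCoeff_xQ]
  · rw [map_pow, constantCoeff_toComplex, constantCoeff_etaProd]; simp
  · have h1 := theta1_pull_phiRatio
    have h2 := theta1_rootE4
    have h3 := theta1_xQ
    have h4 := theta1_etaProd
    have h5 := xQ_eq
    simp only [Derivation.leibniz, Derivation.leibniz_pow, map_sub, theta1_ofNat, smul_eq_mul,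
      nsmul_eq_mul, mul_zero, add_zero, Nat.add_one_sub_one,
      theta1_exp_subst constantCoeff_pull_phiRatio, Derivation.map_one_eq_zero, zero_sub]
    push_cast
    apply mul_left_cancel₀ (mul_ne_zero (ofNat_ne_zero' 2) rootE4_ne_zero)
    set e : PowerSeries ℂ := (PowerSeries.exp ℂ).subst (pull phiRatio)
    set η := toComplex etaProd
    linear_combination η ^ 12 * e * rootE4 ^ 7 * (1 - 432 * xQ) * h1 +
      η ^ 12 * e * rootE4 ^ 6 * (1 - 432 * xQ) * h2 - 2 * 432 * η ^ 12 * e * rootE4 ^ 7 * h3 -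
      e * rootE4 ^ 7 * (1 - 432 * xQ) * η ^ 11 * h4 -
      η ^ 12 * e * rootE4 ^ 9 * (1 - 432 * xQ) * h5

end

section

open PowerSeries (X C constantCoeff)
local notation "ι" => inFirstHom
local notation "𝕡" => (MvPowerSeries.X 1 : Series2)

/-! ### Evaluation of series with quasi-modular coefficients -/

/-- A power series in `p` over power series in `q`, as a series in two variables. -/
def joinFun (f : PowerSeries (PowerSeries ℂ)) : Series2 :=
  fun e => PowerSeries.coeff (e 0) (PowerSeries.coeff (e 1) f)

theorem coeff_joinFun (f : PowerSeries (PowerSeries ℂ)) (e : Fin 2 →₀ ℕ) :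
    MvPowerSeries.coeff e (joinFun f) = PowerSeries.coeff (e 0) (PowerSeries.coeff (e 1) f) := rfl

/-- `joinFun` as a ring homomorphism. -/
def joinHom : PowerSeries (PowerSeries ℂ) →+* Series2 where
  toFun := joinFun
  map_zero' := by ext e; simp only [coeff_joinFun, map_zero]
  map_add' f g := by ext e; simp only [coeff_joinFun, map_add]
  map_one' := by
    apply ext_expo
    intro n m
    rw [coeff_expo_one, coeff_joinFun, expo_zero, expo_one, PowerSeries.coeff_one]
    by_cases hm : m = 0
    · simp [hm, PowerSeries.coeff_one]
    · simp [hm]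
  map_mul' f g := by
    apply ext_expo
    intro n m
    rw [MvPowerSeries.coeff_mul, coeff_joinFun]
    simp only [coeff_joinFun]
    rw [expo_zero, expo_one, PowerSeries.coeff_mul, map_sum]
    simp only [PowerSeries.coeff_mul]
    rw [← Finset.sum_product']
    refine Finset.sum_bij' (fun a _ => (expo a.2.1 a.1.1, expo a.2.2 a.1.2))
      (fun a _ => ((a.1 1, a.2 1), (a.1 0, a.2 0))) ?_ ?_ ?_ ?_ ?_
    · rintro ⟨⟨a, b⟩, ⟨c, d⟩⟩ h
      simp only [Finset.mem_product, Finset.HasAntidiagonal.mem_antidiagonal] at h ⊢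
      rw [← h.1, ← h.2]
      ext i; fin_cases i <;> simp [expo]
    · rintro ⟨a, b⟩ h
      simp only [Finset.mem_product, Finset.HasAntidiagonal.mem_antidiagonal] at h ⊢
      rw [← Finsupp.add_apply, ← Finsupp.add_apply, h, expo_zero, expo_one]
      exact ⟨rfl, rfl⟩
    · rintro ⟨⟨a, b⟩, ⟨c, d⟩⟩ h
      simp [expo_zero, expo_one]
    · rintro ⟨a, b⟩ h
      simp [← expo_eq]
    · rintro ⟨⟨a, b⟩, ⟨c, d⟩⟩ h
      simp [expo_zero, expo_one]

theorem coeff_joinHom (f : PowerSeries (PowerSeries ℂ)) (e : Fin 2 →₀ ℕ) :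
    MvPowerSeries.coeff e (joinHom f) = PowerSeries.coeff (e 0) (PowerSeries.coeff (e 1) f) := rfl

theorem joinHom_C (f : PowerSeries ℂ) : joinHom (C f) = ι f := by
  ext e
  rw [coeff_joinHom, inFirstHom_apply, coeff_inFirst, PowerSeries.coeff_C]
  split_ifs <;> simp

theorem joinHom_X : joinHom X = 𝕡 := by
  apply ext_expo
  intro n m
  have := coeff_X1_mul_zero 1 n
  rw [coeff_joinHom, expo_zero, expo_one]
  cases m with
  | zero => rw [← mul_one 𝕡, coeff_X1_mul_zero]; simp
  | succ m =>
    rw [← mul_one 𝕡, coeff_X1_mul_succ, coeff_expo_one, PowerSeries.coeff_X]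
    by_cases hm : m = 0
    · simp [hm, PowerSeries.coeff_one]
    · simp [hm]

theorem thetaP_joinHom (f : PowerSeries (PowerSeries ℂ)) :
    thetaP (joinHom f) = joinHom (X * PowerSeries.derivative _ f) := by
  ext e
  rw [coeff_thetaP, coeff_joinHom, coeff_joinHom, coeff_X_mul_derivative]
  have : ((e 1 : ℕ) : PowerSeries ℂ) = C (e 1 : ℂ) := (map_natCast C _).symm
  rw [this, PowerSeries.coeff_C_mul]

theorem restrictHom_joinHom (f : PowerSeries (PowerSeries ℂ)) :
    restrictHom (joinHom f) = constantCoeff f := by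
  ext n
  rw [coeff_restrictHom, coeff_joinHom]
  simp

/-- Evaluation of polynomials in `E₂, E₄, E₆` as complex `q`-series. -/
def evalC : QMod →+* PowerSeries ℂ :=
  (PowerSeries.map (algebraMap ℚ ℂ)).comp (MvPolynomial.aeval ![E2, E4, E6]).toRingHom

theorem evalC_apply (P : QMod) : evalC P = toComplex (evalE P) := rfl

theorem evalC_X_zero : evalC (MvPolynomial.X 0) = toComplex E2 := by simp [evalC_apply, evalE]
theorem evalC_X_one : evalC (MvPolynomial.X 1) = toComplex E4 := by simp [evalC_apply, evalE]
theorem evalC_X_two : evalC (MvPolynomial.X 2) = toComplex E6 := by simp [evalC_apply, evalE]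

/-- The series `η(q) ^ {-12} q ^ (1/2)`. -/
def etaInv : PowerSeries ℂ := toComplex (etaProd⁻¹ ^ 12)

theorem etaInv_mul : etaInv * toComplex etaProd ^ 12 = 1 := by
  have h : etaProd * etaProd⁻¹ = 1 :=
    PowerSeries.mul_inv_cancel _ (by rw [constantCoeff_etaProd]; exact one_ne_zero)
  rw [etaInv, ← toComplex_pow, ← toComplex_mul, ← mul_pow, mul_comm, h, one_pow, toComplex_one]

/-- Substitution of `E₂, E₄, E₆` in the coefficients and of `p / ∏ (1 - q ^ m) ^ 12` for the
variable. -/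
def evalT : PowerSeries QMod →+* Series2 :=
  joinHom.comp ((PowerSeries.rescale etaInv).comp (PowerSeries.map evalC))

theorem coeff_evalT (f : PowerSeries QMod) (e : Fin 2 →₀ ℕ) : MvPowerSeries.coeff e (evalT f) =
    ((PowerSeries.coeff (e 0) (evalE (PowerSeries.coeff (e 1) f) *
      etaProd⁻¹ ^ (12 * e 1)) : ℚ) : ℂ) := by
  rw [evalT, RingHom.comp_apply, RingHom.comp_apply, coeff_joinHom, PowerSeries.coeff_rescale,
    PowerSeries.coeff_map, evalC_apply, etaInv, ← toComplex_pow, ← toComplex_mul, coeff_toComplex,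
    mul_comm, ← pow_mul]

theorem rescale_C {R : Type*} [CommSemiring R] (a r : R) :
    PowerSeries.rescale a (C r) = C r := by
  ext n
  rw [PowerSeries.coeff_rescale, PowerSeries.coeff_C]
  split_ifs with h <;> simp [h]

theorem evalT_C (r : QMod) : evalT (C r) = ι (evalC r) := by
  rw [evalT, RingHom.comp_apply, RingHom.comp_apply, PowerSeries.map_C, rescale_C, joinHom_C]

theorem evalT_X : evalT X = ι etaInv * 𝕡 := by
  rw [evalT, RingHom.comp_apply, RingHom.comp_apply, PowerSeries.map_X, PowerSeries.rescale_X,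
    map_mul, joinHom_C, joinHom_X]

theorem thetaP_evalT (f : PowerSeries QMod) :
    thetaP (evalT f) = evalT (X * PowerSeries.derivative QMod f) := by
  rw [evalT, RingHom.comp_apply, RingHom.comp_apply, thetaP_joinHom, RingHom.comp_apply,
    RingHom.comp_apply]
  congr 1
  ext1 n
  rw [coeff_X_mul_derivative, PowerSeries.coeff_rescale, PowerSeries.coeff_rescale,
    PowerSeries.coeff_map, PowerSeries.coeff_map, coeff_X_mul_derivative, map_mul, map_natCast]
  ring

theorem restrictHom_evalT (f : PowerSeries QMod) :
    restrictHom (evalT f) = evalC (constantCoeff f) := by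
  rw [evalT, RingHom.comp_apply, RingHom.comp_apply, restrictHom_joinHom,
    ← PowerSeries.coeff_zero_eq_constantCoeff_apply, PowerSeries.coeff_rescale,
    PowerSeries.coeff_map]
  simp

/-- The same evaluation in the coordinate of the curve. -/
def evalV : PowerSeries QMod →+* Series2 :=
  evalT.comp (PowerSeries.substAlgHom hasSubst_tInv).toRingHom

theorem evalV_apply (f : PowerSeries QMod) : evalV f = evalT (f.subst tInv) := by
  rw [evalV, RingHom.comp_apply, ← PowerSeries.coe_substAlgHom hasSubst_tInv]; rfl

theorem evalV_subst_t (f : PowerSeries QMod) : evalV (f.subst tSeries) = evalT f := by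
  rw [evalV_apply, subst_t_subst_tInv]

theorem evalV_C (r : QMod) : evalV (C r) = ι (evalC r) := by
  have h : PowerSeries.subst tInv (C r) = (C r : PowerSeries QMod) :=  by
    rw [← PowerSeries.coe_substAlgHom hasSubst_tInv]
    exact (PowerSeries.substAlgHom hasSubst_tInv).commutes r
  rw [evalV_apply, h, evalT_C]

theorem evalV_t : evalV tSeries = ι etaInv * 𝕡 := by
  rw [evalV_apply, t_subst_tInv, evalT_X]

/-- The relation θ_X = period · θ_t after evaluation: t becomes p times a series in q, so θ_t
becomes p ∂/∂p. -/
theorem thetaP_evalV (f : PowerSeries QMod) :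
    thetaP (evalV f) * evalV period = evalV (X * PowerSeries.derivative QMod f) := by
  have h := theta_subst_t (f.subst tInv)
  rw [subst_tInv_subst_t] at h
  rw [h, map_mul, evalV_subst_t, ← thetaP_evalT, ← evalV_apply]

theorem restrictHom_evalV (f : PowerSeries QMod) :
    restrictHom (evalV f) = evalC (constantCoeff f) := by
  rw [evalV_apply, restrictHom_evalT]
  congr 1
  exact constantCoeff_powerSeries_subst (a := tInv) constantCoeff_tInv f

/-! ### The mirror map in two variables -/

theorem X1_ne_zero : 𝕡 ≠ 0 := by
  intro h; have := congrArg (MvPowerSeries.coeff (Finsupp.single 1 1)) h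
  simp at this

theorem thetaP_iota (f : PowerSeries ℂ) : thetaP (ι f) = 0 := by
  rw [inFirstHom_apply, thetaP_inFirst]

theorem restrictHom_iota (f : PowerSeries ℂ) : restrictHom (ι f) = f := by
  rw [inFirstHom_apply, restrictHom_inFirst]

theorem constantCoeff_iota (f : PowerSeries ℂ) :
    MvPowerSeries.constantCoeff (ι f) = constantCoeff f := by
  rw [inFirstHom_apply, constantCoeff_inFirst]

theorem constantCoeff_of_restrictHom_eq_zero {f : Series2} (h : restrictHom f = 0) :
    MvPowerSeries.constantCoeff f = 0 := by
  rw [← constantCoeff_restrictHom, h, map_zero]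

theorem iota_ne_zero {f : PowerSeries ℂ} (h : f ≠ 0) : ι f ≠ 0 := by
  intro h0; apply h; rw [← restrictHom_iota f, h0, map_zero]

/-- The coordinate of the curve. -/
def vQ : Series2 := evalV X
/-- The ratio of `y` and the coordinate of the curve. -/
def yScale : PowerSeries ℂ := rootE4 ^ 6 * (1 - 432 * xQ)
/-- The mirror map `y(q, p)`. -/
def yQ : Series2 := ι yScale * vQ

theorem restrictHom_vQ : restrictHom vQ = 0 := by
  rw [vQ, restrictHom_evalV, PowerSeries.constantCoeff_X, map_zero]
theorem restrictHom_yQ : restrictHom yQ = 0 := by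
  rw [yQ, map_mul, restrictHom_vQ, mul_zero]
theorem constantCoeff_yQ : MvPowerSeries.constantCoeff yQ = 0 :=
  constantCoeff_of_restrictHom_eq_zero restrictHom_yQ
theorem constantCoeff_inFirst_xQ : MvPowerSeries.constantCoeff (inFirst xQ) = 0 := by
  rw [constantCoeff_inFirst, constantCoeff_xQ]

/-- The derivation `v ∂ / ∂v` at constant `q`, for the coordinate `v` of the curve. -/
def nabla : Derivation ℂ Series2 Series2 := (evalV period) • thetaP

theorem nabla_apply (f : Series2) : nabla f = evalV period * thetaP f := rfl

theorem nabla_evalV (f : PowerSeries QMod) :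
    nabla (evalV f) = evalV (X * PowerSeries.derivative QMod f) := by
  rw [nabla_apply, mul_comm, thetaP_evalV]

theorem nabla_iota (f : PowerSeries ℂ) : nabla (ι f) = 0 := by
  rw [nabla_apply, thetaP_iota, mul_zero]

theorem nabla_vQ : nabla vQ = vQ := by
  rw [vQ, nabla_evalV, PowerSeries.derivative_X, mul_one]

theorem nabla_yQ : nabla yQ = yQ := by
  rw [yQ, Derivation.leibniz, nabla_iota, nabla_vQ, smul_zero, add_zero, smul_eq_mul]

/-- Composition with the mirror map. -/
def pull2 : Series2 →ₐ[ℂ] Series2 :=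
  compHom (inFirst xQ) yQ constantCoeff_inFirst_xQ constantCoeff_yQ

theorem pull2_apply (f : Series2) : pull2 f = comp f (inFirst xQ) yQ := compHom_apply _ _ f
theorem pull2_X0 : pull2 (MvPowerSeries.X 0) = ι xQ := by
  rw [inFirstHom_apply]; exact compHom_X0 _ _
theorem pull2_X1 : pull2 𝕡 = yQ := compHom_X1 _ _
theorem pull2_iota (f : PowerSeries ℂ) : pull2 (ι f) = ι (pull f) := by
  rw [inFirstHom_apply, inFirstHom_apply, pull2, compHom_inFirst, pull_apply,
    inFirst_subst constantCoeff_xQ]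
theorem constantCoeff_pull2 (f : Series2) :
    MvPowerSeries.constantCoeff (pull2 f) = MvPowerSeries.constantCoeff f :=
  constantCoeff_compHom _ _ f
theorem pull2_subst {a : Series2} (ha : MvPowerSeries.constantCoeff a = 0) (f : PowerSeries ℂ) :
    pull2 (PowerSeries.subst a f) = PowerSeries.subst (pull2 a) f := compHom_subst _ _ ha f

theorem restrictHom_pull2 (f : Series2) : restrictHom (pull2 f) = pull (restrictHom f) := by
  have h : 𝕡 ∣ f - ι (restrictHom f) := by
    rw [X1_dvd_iff, map_sub, restrictHom_iota, sub_self]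
  obtain ⟨g, hg⟩ := h
  have h2 := congrArg (fun f => restrictHom (pull2 f)) hg
  simp only [map_sub, map_mul, pull2_X1, restrictHom_yQ, pull2_iota, restrictHom_iota,
    zero_mul] at h2
  linear_combination h2

/-- Since x(q) does not involve p, only the derivative in y contributes. -/
theorem thetaP_pull2 (f : Series2) : yQ * thetaP (pull2 f) = pull2 (thetaP f) * thetaP yQ := by
  have h : MvPowerSeries.pderiv ℂ 1 (inFirst xQ) = 0 := pderiv_one_inFirst _
  rw [thetaP_apply, pull2, pderiv_compHom, h, thetaP_apply f, map_mul, compHom_X1, thetaP_apply yQ]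
  ring

theorem nabla_pull2 (f : Series2) : nabla (pull2 f) * yQ = pull2 (thetaP f) * yQ := by
  have h := thetaP_pull2 f
  have h2 := nabla_yQ
  rw [nabla_apply] at h2 ⊢
  linear_combination evalV period * h + pull2 (thetaP f) * h2

theorem vQ_ne_zero : vQ ≠ 0 := by
  intro h
  have h1 : evalT X = 0 := by
    rw [← evalV_subst_t, PowerSeries.subst_X hasSubst_t, tSeries, map_mul]
    change vQ * _ = 0
    rw [h, zero_mul]
  rw [evalT_X] at h1
  refine (mul_ne_zero (iota_ne_zero ?_) X1_ne_zero) h1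
  rintro h0
  have := etaInv_mul
  rw [h0, zero_mul] at this
  exact zero_ne_one this

theorem yScale_ne_zero : yScale ≠ 0 :=
  mul_ne_zero (pow_ne_zero 6 rootE4_ne_zero) one_sub_ne_zero

theorem yQ_ne_zero : yQ ≠ 0 := mul_ne_zero (iota_ne_zero yScale_ne_zero) vQ_ne_zero

/-- The coordinates y and X differ by a factor depending on q alone, so `nabla` is y ∂/∂y at fixed x
after the change of variables. -/
theorem nabla_pull2' (f : Series2) : nabla (pull2 f) = pull2 (thetaP f) :=
  mul_right_cancel₀ yQ_ne_zero (nabla_pull2 f)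

/-- The series `x (1 - y)` in `(q, p)`. -/
def xTwistQ : Series2 := pull2 xTwist

theorem xTwistQ_eq : xTwistQ = ι xQ * (1 - yQ) := by
  rw [xTwistQ, xTwist, map_mul, map_sub, map_one, pull2_X0, pull2_X1]

theorem nabla_pull2_xTwist (f : PowerSeries ℂ) : (1 - yQ) * nabla (pull2 (f.subst xTwist)) =
    -(yQ * pull2 ((theta1 f).subst xTwist)) := by
  have hs := PowerSeries.HasSubst.of_constantCoeff_zero constantCoeff_xTwist
  rw [nabla_pull2', thetaP_subst constantCoeff_xTwist, thetaP_xTwist, theta1_apply,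
    PowerSeries.subst_mul hs, PowerSeries.subst_X hs, map_mul, map_mul, map_neg, map_mul, pull2_X0,
    pull2_X1]
  change _ = -(yQ * (xTwistQ * _))
  rw [xTwistQ_eq]
  ring

theorem ofNat_subst_xTwist (k : ℕ) [k.AtLeastTwo] :
    PowerSeries.subst xTwist (ofNat(k) : PowerSeries ℂ) = (ofNat(k) : Series2) := by
  rw [← PowerSeries.coe_substAlgHom (PowerSeries.HasSubst.of_constantCoeff_zero constantCoeff_xTwist),
    map_ofNat]

theorem one_subst_xTwist : PowerSeries.subst xTwist (1 : PowerSeries ℂ) = (1 : Series2) := by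
  rw [← PowerSeries.coe_substAlgHom (PowerSeries.HasSubst.of_constantCoeff_zero constantCoeff_xTwist),
    map_one]

/-- The period of the curve with parameter `x (1 - y)`. -/
def wTwistQ : Series2 := pull2 (wSeries.subst xTwist)
/-- The discriminant `dis₀` in `(q, p)`. -/
def disQ : Series2 := (1 - 432 * xTwistQ) * (1 - yQ)

/-- The hypergeometric equation of w in the argument x(1 - y), at fixed x, written with y ∂/∂y. -/
theorem wTwistQ_ode : disQ * (nabla (nabla wTwistQ) - nabla wTwistQ) + nabla disQ * nabla wTwistQ =
    60 * (ι xQ * yQ ^ 2) * wTwistQ := by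
  have hs := PowerSeries.HasSubst.of_constantCoeff_zero constantCoeff_xTwist
  set K := pull2 (((1 - 432 * X) * theta1 wSeries).subst xTwist) with hK
  have h1 := nabla_pull2_xTwist wSeries
  have h2 := nabla_pull2_xTwist ((1 - 432 * X) * theta1 wSeries)
  have h3 : theta1 ((1 - 432 * X) * theta1 wSeries) = 60 * (X * wSeries) := by
    have := wSeries_ode
    rw [Derivation.leibniz, map_sub, Derivation.map_one_eq_zero, Derivation.leibniz, theta1_ofNat,
      theta1_X]
    simp only [smul_eq_mul]
    linear_combination this
  have hK' : K = (1 - 432 * xTwistQ) * pull2 ((theta1 wSeries).subst xTwist) := by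
    have : PowerSeries.subst xTwist (1 - 432 * X : PowerSeries ℂ) = 1 - 432 * xTwist := by
      rw [← PowerSeries.coe_substAlgHom hs, map_sub, map_mul, PowerSeries.coe_substAlgHom hs,
        ofNat_subst_xTwist, one_subst_xTwist, PowerSeries.subst_X hs]
    rw [hK, PowerSeries.subst_mul hs, map_mul, this, map_sub, map_mul, map_one, map_ofNat, xTwistQ]
  rw [← hK, h3, PowerSeries.subst_mul hs, PowerSeries.subst_mul hs, PowerSeries.subst_X hs,
    ofNat_subst_xTwist, map_mul, map_mul, map_ofNat] at h2
  change (1 - yQ) * nabla K = -(yQ * (60 * (xTwistQ * wTwistQ))) at h2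
  change (1 - yQ) * nabla wTwistQ = _ at h1
  have hy : (1 - yQ) ≠ 0 := ne_zero_of_constantCoeff_eq_one (by simp [constantCoeff_yQ])
  have h4 : nabla K = -(60 * (ι xQ * yQ) * wTwistQ) := by
    apply mul_left_cancel₀ hy
    rw [h2, xTwistQ_eq]; ring
  have h5 : disQ * nabla wTwistQ = -(yQ * K) := by
    rw [disQ, hK']; linear_combination (1 - 432 * xTwistQ) * h1
  have h6 := congrArg nabla h5
  rw [map_neg, Derivation.leibniz, Derivation.leibniz, nabla_yQ, h4] at h6
  simp only [smul_eq_mul] at h6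
  linear_combination h6 - h5

theorem evalC_ofNat (k : ℕ) [k.AtLeastTwo] : evalC (ofNat(k)) = ofNat(k) := map_ofNat _ k

theorem evalC_disc_mul : evalC disc = X * toComplex etaProd ^ 24 := by
  apply mul_left_cancel₀ (ofNat_ne_zero' 1728)
  have h : (1728 : PowerSeries ℂ) = evalC 1728 := (evalC_ofNat 1728).symm
  have h2 : (1728 : QMod) * disc = MvPolynomial.X 1 ^ 3 - MvPolynomial.X 2 ^ 2 := by
    have : (1728 : QMod) * MvPolynomial.C (1 / 1728) = 1 := by
      rw [← map_ofNat MvPolynomial.C 1728, ← map_mul]; norm_num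
    rw [disc, ← mul_assoc, this, one_mul]
  rw [delta_toComplex]
  nth_rewrite 1 [h]
  rw [← map_mul, h2, map_sub, map_pow, map_pow, evalC_X_one, evalC_X_two]

theorem evalC_disc : evalC disc = xQ * (1 - 432 * xQ) * rootE4 ^ 12 := by
  rw [evalC_disc_mul, xQ_mul_inv']

/-- Writing E₆ = (1 - 864x) E₄^(3/2) and Δ = x(1 - 432x) E₄³, the quadratic discriminant of the
pencil factors as dis₀ in the variable y = `yScale` · X, which explains the choice of `yScale`. -/
theorem evalV_curveDisc : ι (1 - 432 * xQ) * evalV curveDisc = disQ := by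
  have h1 : toComplex E6 = (1 - 864 * xQ) * rootE4 ^ 6 := by
    rw [E6_eq]; linear_combination rootE4 ^ 6 * xQ_eq
  have h2 : evalV curveDisc = 1 - ι (toComplex E6) * vQ -
      ι (432 * (xQ * (1 - 432 * xQ) * rootE4 ^ 12)) * vQ ^ 2 := by
    rw [curveDisc, map_sub, map_sub, map_mul, map_mul evalV (C (432 * disc)), map_pow, map_one,
      evalV_C, evalV_C, map_mul evalC, evalC_disc, evalC_X_two, evalC_ofNat, vQ]
  rw [h2, h1, disQ, xTwistQ_eq, yQ, yScale]
  simp only [map_mul, map_sub, map_pow, map_one, map_ofNat]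
  ring

theorem evalV_period_ode : disQ * (nabla (nabla (evalV period)) - nabla (evalV period)) +
    nabla disQ * nabla (evalV period) = 60 * (ι xQ * yQ ^ 2) * evalV period := by
  have h1 : nabla disQ = ι (1 - 432 * xQ) * nabla (evalV curveDisc) := by
    rw [← evalV_curveDisc, Derivation.leibniz, nabla_iota, smul_zero, add_zero, smul_eq_mul]
  have h2 : curveDisc * (X * PowerSeries.derivative QMod (X * PowerSeries.derivative QMod period) -
      X * PowerSeries.derivative QMod period) + (X * PowerSeries.derivative QMod curveDisc) *
      (X * PowerSeries.derivative QMod period) = C (60 * disc) * X ^ 2 * period := by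
    have := period_ode
    rw [Derivation.leibniz] at this
    rw [Derivation.leibniz, PowerSeries.derivative_X]
    simp only [smul_eq_mul] at this ⊢
    linear_combination X ^ 2 * this
  have h3 := congrArg evalV h2
  rw [map_add, map_mul, map_sub, map_mul evalV (X * _) (X * _), map_mul evalV (C _ * _),
    map_mul evalV (C _), ← nabla_evalV,
    ← nabla_evalV, ← nabla_evalV, map_pow, evalV_C, map_mul, evalC_ofNat, evalC_disc] at h3
  change _ = _ * vQ ^ 2 * _ at h3
  rw [h1, ← evalV_curveDisc, yQ, yScale]
  simp only [map_mul, map_sub, map_pow, map_one, map_ofNat] at h3 ⊢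
  linear_combination (1 - 432 * ι xQ) * h3

theorem restrictHom_evalV_period : restrictHom (evalV period) = 1 := by
  rw [restrictHom_evalV, constantCoeff_period, map_one]

theorem restrictHom_nabla (f : Series2) : restrictHom (nabla f) = 0 := by
  rw [nabla_apply, map_mul, restrictHom_thetaP, mul_zero]

theorem eq_zero_of_X1_pow_dvd {f : Series2} (h : ∀ n, 𝕡 ^ n ∣ f) : f = 0 := by
  apply ext_expo
  intro n m
  rw [map_zero]
  exact MvPowerSeries.X_pow_dvd_iff.mp (h (m + 1)) _ (by rw [expo_one]; exact Nat.lt_succ_self m)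

theorem restrictHom_disQ : restrictHom disQ = 1 - 432 * xQ := by
  rw [disQ, xTwistQ_eq]
  simp only [map_mul, map_sub, map_one, map_ofNat, restrictHom_yQ, restrictHom_iota]
  ring

/-- At p = 0 the exponents of the equation are 0 and 1: a solution divisible by p^(n+2) has leading
coefficient killed by (n + 2)(n + 1)(1 - 432x), hence is divisible by one more power of p. -/
theorem eq_zero_of_twisted_ode {f : Series2} (h : disQ * (nabla (nabla f) - nabla f) +
    nabla disQ * nabla f = 60 * (ι xQ * yQ ^ 2) * f) (h0 : 𝕡 ^ 2 ∣ f) : f = 0 := by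
  apply eq_zero_of_X1_pow_dvd
  have key : ∀ n, 𝕡 ^ (n + 2) ∣ f := by
    intro n
    induction n with
    | zero => exact h0
    | succ n ih =>
      obtain ⟨g, hg⟩ := ih
      have h1 : ∀ g, nabla (𝕡 ^ (n + 2) * g) =
          𝕡 ^ (n + 2) * ((n + 2 : ℕ) * evalV period * g + nabla g) := by
        intro g
        rw [nabla_apply, nabla_apply, Derivation.leibniz, Derivation.leibniz_pow, thetaP_X1,
          nsmul_eq_mul, smul_eq_mul, smul_eq_mul, smul_eq_mul]
        have : (𝕡 ^ (n + 2 - 1) * 𝕡) = 𝕡 ^ (n + 2) := by rw [← pow_succ]; rfl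
        rw [this]; ring
      rw [hg, h1, h1] at h
      have h2 : disQ * ((n + 2 : ℕ) * evalV period * ((n + 2 : ℕ) * evalV period * g + nabla g) +
          nabla ((n + 2 : ℕ) * evalV period * g + nabla g) -
          ((n + 2 : ℕ) * evalV period * g + nabla g)) + nabla disQ *
          ((n + 2 : ℕ) * evalV period * g + nabla g) = 60 * (ι xQ * yQ ^ 2) * g := by
        apply mul_left_cancel₀ (pow_ne_zero (n + 2) X1_ne_zero)
        linear_combination h
      have h3 := congrArg restrictHom h2
      simp only [map_mul, map_add, map_sub, map_natCast, restrictHom_evalV_period,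
        restrictHom_nabla, restrictHom_yQ, restrictHom_disQ, map_pow] at h3
      have h4 : restrictHom g = 0 := by
        have h5 : (((n + 2) * (n + 1) : ℕ) : PowerSeries ℂ) ≠ 0 := by
          have h6 : (((n + 2) * (n + 1) : ℕ) : PowerSeries ℂ) = C (((n + 2) * (n + 1) : ℕ) : ℂ) :=
            (map_natCast C _).symm
          rw [h6]
          intro h7
          have := congrArg constantCoeff h7
          rw [PowerSeries.constantCoeff_C, map_zero] at this
          exact (Nat.cast_ne_zero.mpr (by positivity)) this
        apply mul_left_cancel₀ (mul_ne_zero h5 one_sub_ne_zero)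
        push_cast at h3 ⊢
        linear_combination h3
      obtain ⟨k, hk⟩ := X1_dvd_iff.mpr h4
      rw [hg, hk]
      exact ⟨k, by ring⟩
  intro n
  exact (pow_dvd_pow _ (Nat.le_add_right n 2)).trans (key n)

theorem evalC_periodCoeff_one : 12 * evalC (PowerSeries.coeff 1 period) =
    -(toComplex E2 * toComplex E4 - toComplex E6) := by
  have h : (12 : QMod) * PowerSeries.coeff 1 period =
      -(MvPolynomial.X 0 * MvPolynomial.X 1 - MvPolynomial.X 2) := by
    have : (12 : QMod) * MvPolynomial.C (1 / 12) = 1 := by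
      rw [← map_ofNat MvPolynomial.C 12, ← map_mul]; norm_num
    rw [period, PowerSeries.coeff_mk, periodCoeff]
    linear_combination (-(MvPolynomial.X 0 * MvPolynomial.X 1 - MvPolynomial.X 2)) * this
  have h2 := congrArg evalC h
  simpa only [map_mul, map_neg, map_sub, evalC_ofNat, evalC_X_zero, evalC_X_one, evalC_X_two] using h2

theorem restrictHom_pull2_subst_xTwist (f : PowerSeries ℂ) :
    restrictHom (pull2 (f.subst xTwist)) = pull f := by
  rw [restrictHom_pull2, restrictHom_subst_xTwist]

/-- The period of the curve is the hypergeometric period. -/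
theorem evalV_period : ι rootE4 * evalV period = wTwistQ := by
  have hi : ι rootE4 * ι rootE4⁻¹ = 1 := by rw [← map_mul, rootE4_mul_inv, map_one]
  set f := evalV period - ι rootE4⁻¹ * wTwistQ with hf
  have hn : ∀ g, nabla (ι rootE4⁻¹ * g) = ι rootE4⁻¹ * nabla g := fun g => by
    rw [Derivation.leibniz, nabla_iota, smul_zero, add_zero, smul_eq_mul]
  suffices h : f = 0 by
    rw [hf] at h
    linear_combination ι rootE4 * h + wTwistQ * hi
  -- Both series satisfy the same equation; it remains to compare the coefficients of 1 and p.
  apply eq_zero_of_twisted_ode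
  · rw [hf]
    simp only [map_sub, hn]
    linear_combination evalV_period_ode - ι rootE4⁻¹ * wTwistQ_ode
  · have h0 : restrictHom f = 0 := by
      rw [hf, map_sub, map_mul, restrictHom_evalV_period, restrictHom_iota, wTwistQ,
        restrictHom_pull2_subst_xTwist, pull_wSeries, mul_comm, rootE4_mul_inv, sub_self]
    obtain ⟨g, hg⟩ := X1_dvd_iff.mpr h0
    obtain ⟨v, hv⟩ := X1_dvd_iff.mpr restrictHom_vQ
    have h1 : nabla f = 𝕡 * (evalV period * (g + thetaP g)) := by
      rw [nabla_apply, hg, Derivation.leibniz, thetaP_X1, smul_eq_mul, smul_eq_mul]; ring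
    have h2 : nabla (evalV period) = vQ * evalV (PowerSeries.derivative QMod period) := by
      rw [nabla_evalV, map_mul]; rfl
    have h3 := nabla_pull2_xTwist wSeries
    have h4 : (1 - yQ) * (evalV period * (g + thetaP g)) =
        v * ((1 - yQ) * evalV (PowerSeries.derivative QMod period) +
          ι (yScale * rootE4⁻¹) * pull2 ((theta1 wSeries).subst xTwist)) := by
      apply mul_left_cancel₀ X1_ne_zero
      have h5 : nabla f = nabla (evalV period) - ι rootE4⁻¹ * nabla wTwistQ := by
        rw [hf, map_sub, hn]
      change (1 - yQ) * nabla wTwistQ = _ at h3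
      have hy : yQ = ι yScale * (𝕡 * v) := by rw [← hv, yQ]
      rw [h1, h2, hv] at h5
      rw [map_mul]
      linear_combination (1 - yQ) * h5 - ι rootE4⁻¹ * h3 +
        ι rootE4⁻¹ * pull2 ((theta1 wSeries).subst xTwist) * hy
    have h6 := congrArg restrictHom h4
    have h7 : constantCoeff (PowerSeries.derivative QMod period) = PowerSeries.coeff 1 period := by
      rw [← PowerSeries.coeff_zero_eq_constantCoeff_apply, PowerSeries.coeff_derivative]; simp
    simp only [map_mul, map_add, map_sub, map_one, restrictHom_yQ, restrictHom_thetaP,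
      restrictHom_pull2_subst_xTwist, restrictHom_evalV, h7, constantCoeff_period,
      restrictHom_iota] at h6
    -- Agreement to first order in p amounts to Ramanujan's formula for the derivative of E₄^(1/4);
    -- it is the reason for the initial value -(E₂E₄ - E₆)/12.
    have h8 : evalC (PowerSeries.coeff 1 period) +
        yScale * rootE4⁻¹ * pull (theta1 wSeries) = 0 := by
      have h9 := theta1_pull wSeries
      have h10 := theta1_rootE4
      have h11 := evalC_periodCoeff_one
      rw [pull_wSeries] at h9
      rw [E6_eq, ← rootE4_pow] at h11
      apply mul_left_cancel₀ (ofNat_ne_zero' 12)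
      rw [yScale]
      linear_combination h11 - 12 * rootE4⁻¹ * rootE4 ^ 4 * h9 + rootE4⁻¹ * rootE4 ^ 4 * h10 +
        (rootE4 ^ 4 * toComplex E2 - ratioE6 * rootE4 ^ 6) * rootE4_mul_inv
    have h12 : restrictHom g = 0 := by
      linear_combination h6 + restrictHom v * h8
    obtain ⟨k, hk⟩ := X1_dvd_iff.mpr h12
    exact ⟨k, by rw [hg, hk]; ring⟩

/-! ### The mirror map is inverse to `(q(x, y), p(x, y))` -/

theorem w0_inv_eq : w0⁻¹ = ι wSeries⁻¹ := by
  have h : w0 ≠ 0 := ne_zero_of_constantCoeff_eq_one constantCoeff_w0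
  apply mul_right_cancel₀ h
  rw [w0_inv_mul, w0_eq, ← inFirstHom_apply, ← map_mul, mul_comm, wSeries_mul_inv, map_one]

theorem pull2_w0 : pull2 w0 = ι rootE4 := by
  rw [w0_eq, ← inFirstHom_apply, pull2_iota, pull_wSeries]

theorem pull2_fexp {a : Series2} (ha : MvPowerSeries.constantCoeff a = 0) :
    pull2 (fexp a) = fexp (pull2 a) := pull2_subst ha _

theorem pull2_qSeries : pull2 qSeries = MvPowerSeries.X 0 := by
  have h : w0⁻¹ * jet 1 0 = ι gRatio := by
    rw [w0_inv_eq, jet_one_zero_eq, ← inFirstHom_apply, ← map_mul, gRatio, mul_comm]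
  have h0 : MvPowerSeries.constantCoeff (ι gRatio) = 0 := by
    rw [constantCoeff_iota, constantCoeff_gRatio]
  rw [qSeries, h, map_mul, pull2_X0, pull2_fexp h0, pull2_iota, fexp, inFirstHom_apply (pull _),
    ← inFirst_subst constantCoeff_pull_gRatio, ← inFirstHom_apply, ← map_mul, xQ_mul_exp,
    inFirstHom_apply, inFirst_X]

/-- The logarithm of `p(x, y) / y`. -/
def chiSeries : Series2 := w0⁻¹ * jet 0 1

theorem restrictHom_chiSeries : restrictHom chiSeries = phiRatio := by
  rw [chiSeries, map_mul, w0_inv_eq, restrictHom_iota, restrictHom_jet_zero_one, phiRatio, mul_comm]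

theorem constantCoeff_chiSeries : MvPowerSeries.constantCoeff chiSeries = 0 := by
  rw [← constantCoeff_restrictHom, restrictHom_chiSeries, constantCoeff_phiRatio]

theorem w0_mul_chiSeries : w0 * chiSeries = jet 0 1 := by
  rw [chiSeries, ← mul_assoc, mul_comm w0, w0_inv_mul, one_mul]

theorem iota_rootE4_ne_zero : ι rootE4 ≠ 0 := iota_ne_zero rootE4_ne_zero

theorem evalV_period_ne_zero : evalV period ≠ 0 := by
  intro h
  have := restrictHom_evalV_period
  rw [h, map_zero] at this
  exact zero_ne_one this

/-- The derivative of log(p/y) along y is w(x(1 - y))/w(x) - 1, and the quotient is the period of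
the curve. -/
theorem nabla_pull2_chiSeries : nabla (pull2 chiSeries) = evalV period - 1 := by
  have h := congrArg (fun f => pull2 (thetaP f)) w0_mul_chiSeries
  simp only [Derivation.leibniz, thetaP_w0, smul_eq_mul, mul_zero, add_zero, map_mul,
    thetaP_jet_zero_one, map_sub, pull2_w0] at h
  rw [nabla_pull2']
  apply mul_left_cancel₀ iota_rootE4_ne_zero
  rw [h, mul_sub, evalV_period, wTwistQ, mul_one]

theorem restrictHom_X1_vQ {v : Series2} (hv : vQ = 𝕡 * v) : restrictHom v = etaInv := by
  have h2 : ι etaInv * 𝕡 = evalV tSeries := evalV_t.symm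
  rw [tSeries, map_mul] at h2
  change _ = vQ * _ at h2
  rw [hv] at h2
  have h3 : ι etaInv = v * evalV ((PowerSeries.exp QMod).subst ellSeries) := by
    apply mul_left_cancel₀ X1_ne_zero
    linear_combination h2
  have h4 : constantCoeff ((PowerSeries.exp QMod).subst ellSeries : PowerSeries QMod) = 1 := by
    have := constantCoeff_powerSeries_subst (a := ellSeries) constantCoeff_ell (PowerSeries.exp QMod)
    refine this.trans ?_
    simp
  have h5 := congrArg restrictHom h3
  rw [restrictHom_iota, map_mul, restrictHom_evalV, h4, map_one, mul_one] at h5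
  exact h5.symm

/-- The series satisfies p ∂f/∂p = f and is thus linear in p. Its coefficient is 1 by the product
formula `exp_pull_phiRatio`, where the powers of the eta product cancel. -/
theorem pull2_pSeries : pull2 pSeries = 𝕡 := by
  have hc : MvPowerSeries.constantCoeff (pull2 chiSeries) = 0 := by
    rw [constantCoeff_pull2, constantCoeff_chiSeries]
  have hZ : pull2 pSeries = yQ * fexp (pull2 chiSeries) := by
    rw [pSeries, map_mul, pull2_X1]
    congr 1
    exact pull2_fexp constantCoeff_chiSeries
  obtain ⟨Y, hY⟩ := X1_dvd_iff.mpr restrictHom_yQ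
  obtain ⟨v, hv⟩ := X1_dvd_iff.mpr restrictHom_vQ
  have h1 : thetaP (pull2 pSeries) = pull2 pSeries := by
    apply mul_left_cancel₀ evalV_period_ne_zero
    have h2 := nabla_yQ
    have h3 := nabla_pull2_chiSeries
    rw [nabla_apply] at h2 h3
    rw [hZ, Derivation.leibniz, thetaP_fexp hc, smul_eq_mul, smul_eq_mul]
    linear_combination fexp (pull2 chiSeries) * h2 + yQ * fexp (pull2 chiSeries) * h3
  have hV0 := restrictHom_X1_vQ hv
  have hY0 : restrictHom Y = yScale * etaInv := by
    have h2 : Y = ι yScale * v := by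
      apply mul_left_cancel₀ X1_ne_zero
      rw [← hY, yQ, hv]; ring
    rw [h2, map_mul, restrictHom_iota, hV0]
  have h4 : restrictHom (Y * fexp (pull2 chiSeries)) = 1 := by
    rw [map_mul, hY0, fexp, restrictHom_subst hc, restrictHom_pull2, restrictHom_chiSeries]
    have h5 := exp_pull_phiRatio
    have h6 := etaInv_mul
    rw [← h5] at h6
    rw [yScale]
    linear_combination h6
  have h5 := eq_X1_mul_of_thetaP_eq_self h1 (g := Y * fexp (pull2 chiSeries))
    (by rw [hZ, hY]; ring) h4
  rw [h5, ← inFirstHom_apply, map_one, mul_one]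

theorem isInverseMirrorMap : IsInverseMirrorMap (inFirst xQ) yQ :=
  ⟨constantCoeff_inFirst_xQ, constantCoeff_yQ, by rw [← pull2_apply, pull2_qSeries],
    by rw [← pull2_apply, pull2_pSeries]⟩

theorem pull_injective {f : PowerSeries ℂ} (h : pull f = 0) : f = 0 := by
  have hx : xQ ≠ 0 := by
    intro h0
    have := coeff_one_xQ
    rw [h0, map_zero] at this
    exact zero_ne_one this
  apply eq_zero_of_X_pow_dvd
  intro n
  induction n generalizing f with
  | zero => simp
  | succ n ih =>
    have h0 : constantCoeff f = 0 := by rw [← constantCoeff_pull, h, map_zero]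
    obtain ⟨g, rfl⟩ := PowerSeries.X_dvd_iff.mpr h0
    rw [map_mul, pull_X] at h
    rw [pow_succ']
    exact mul_dvd_mul_left _ (ih ((mul_eq_zero.mp h).resolve_left hx))

/-- A series in the kernel is divisible by y because `pull` is injective; division by y stays in the
kernel, so the series is divisible by every power of y. -/
theorem pull2_injective {f : Series2} (h : pull2 f = 0) : f = 0 := by
  apply eq_zero_of_X1_pow_dvd
  intro n
  induction n generalizing f with
  | zero => simp
  | succ n ih =>
    have h0 : restrictHom f = 0 := by
      apply pull_injective
      rw [← restrictHom_pull2, h, map_zero]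
    obtain ⟨g, rfl⟩ := X1_dvd_iff.mpr h0
    rw [map_mul, pull2_X1] at h
    rw [pow_succ']
    exact mul_dvd_mul_left _ (ih ((mul_eq_zero.mp h).resolve_left yQ_ne_zero))

theorem compHom_comp {x y a b : Series2} (hx : MvPowerSeries.constantCoeff x = 0)
    (hy : MvPowerSeries.constantCoeff y = 0) (ha : MvPowerSeries.constantCoeff a = 0)
    (hb : MvPowerSeries.constantCoeff b = 0) (f : Series2) :
    compHom x y hx hy (comp f a b) = comp f (compHom x y hx hy a) (compHom x y hx hy b) := by
  simp only [compHom_apply, comp]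
  rw [MvPowerSeries.subst_comp_subst_apply (hasSubst_pair ha hb) (hasSubst_pair hx hy)]
  congr 1
  funext i
  fin_cases i <;> rfl

theorem comp_X0_X1 (f : Series2) : comp f (MvPowerSeries.X 0) (MvPowerSeries.X 1) = f := by
  have h : ![(MvPowerSeries.X 0 : Series2), MvPowerSeries.X 1] = MvPowerSeries.X := by
    funext i; fin_cases i <;> rfl
  rw [comp, h, MvPowerSeries.subst_self]; rfl

theorem constantCoeff_qSeries : MvPowerSeries.constantCoeff qSeries = 0 := by simp [qSeries]
theorem constantCoeff_pSeries : MvPowerSeries.constantCoeff pSeries = 0 := by simp [pSeries]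

/-- Injectivity of `pull2` turns the one-sided inverse into a two-sided one, which gives uniqueness
of the inverse mirror map. -/
theorem comp_inverse (f : Series2) : comp (pull2 f) qSeries pSeries = f := by
  rw [← sub_eq_zero]
  apply pull2_injective
  rw [map_sub, sub_eq_zero, pull2, compHom_comp _ _ constantCoeff_qSeries constantCoeff_pSeries]
  change comp (pull2 f) (pull2 qSeries) (pull2 pSeries) = pull2 f
  rw [pull2_qSeries, pull2_pSeries, comp_X0_X1]

theorem inverseMirrorMap_unique {x' y' : Series2} (h : IsInverseMirrorMap x' y') :
    x' = inFirst xQ ∧ y' = yQ := by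
  obtain ⟨hx, hy, hq, hp⟩ := h
  have key : ∀ f : Series2, compHom x' y' hx hy f = pull2 f := by
    intro f
    conv_lhs => rw [← comp_inverse f]
    rw [compHom_comp _ _ constantCoeff_qSeries constantCoeff_pSeries, compHom_apply, compHom_apply,
      hq, hp, comp_X0_X1]
  constructor
  · rw [← compHom_X0 hx hy, key, pull2_X0, inFirstHom_apply]
  · rw [← compHom_X1 hx hy, key, pull2_X1]

/-! ### The potentials in terms of hypergeometric series -/

theorem thetaP_evalT_potT_zero : thetaP (evalT (potT 0)) = evalV fSeries := by
  rw [thetaP_evalT, ← evalV_subst_t, theta_potT_zero]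

theorem evalT_potT_one : evalT (potT 1) = evalV pot1 := by
  rw [← evalV_subst_t, potT_one_subst_t]

theorem thetaP_evalV_f : thetaP (evalV fSeries) = -evalV uSeries := by
  have h := thetaP_evalV fSeries
  rw [f_ode, map_neg, map_mul, ← neg_mul] at h
  exact mul_right_cancel₀ evalV_period_ne_zero h

/-- The logarithm of `1 - y` in `(q, p)`. -/
def logQ : Series2 := pull2 (flog (1 - 𝕡))

/-- The difference of the values of `log q` at `(x (1 - y), 0)` and `(x, 0)`. -/
def uQ : Series2 := pull2 (gRatio.subst xTwist) + logQ - ι (pull gRatio)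

theorem nabla_logQ : (1 - yQ) * nabla logQ = -yQ := by
  have h1 := mul_thetaP_flog constantCoeff_one_sub_X1
  rw [map_sub, thetaP_X1, Derivation.map_one_eq_zero, zero_sub] at h1
  have h2 := congrArg pull2 h1
  rw [map_mul, map_sub, map_one, map_neg, pull2_X1] at h2
  rw [logQ, nabla_pull2', h2]

theorem wTwistQ_gRatio : (1 - 432 * xTwistQ) * wTwistQ ^ 2 *
    (1 + pull2 ((theta1 gRatio).subst xTwist)) = 1 := by
  have hs := PowerSeries.HasSubst.of_constantCoeff_zero constantCoeff_xTwist
  have h := congrArg (fun f => pull2 (PowerSeries.substAlgHom hs f)) theta1_gRatio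
  simp only [map_mul, map_sub, map_one, map_add, map_pow, map_ofNat] at h
  simp only [PowerSeries.coe_substAlgHom, PowerSeries.subst_X hs] at h
  exact h

/-- By the Wronskian, the logarithmic derivative of q in x is 1/((1 - 432x) w²), evaluated here at
x(1 - y). -/
theorem nabla_uQ : disQ * wTwistQ ^ 2 * nabla uQ = -yQ := by
  have h1 := nabla_pull2_xTwist gRatio
  have h2 := nabla_logQ
  have h3 := wTwistQ_gRatio
  rw [uQ, map_sub, map_add, nabla_iota, disQ]
  linear_combination (1 - 432 * xTwistQ) * wTwistQ ^ 2 * (h1 + h2) - yQ * h3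

theorem restrictHom_uQ : restrictHom uQ = 0 := by
  rw [uQ, map_sub, map_add, restrictHom_pull2_subst_xTwist, logQ, restrictHom_pull2,
    restrictHom_flog_one_sub, restrictHom_iota, map_zero]
  ring

theorem disQ_ne_zero : disQ ≠ 0 := by
  intro h
  have := restrictHom_disQ
  rw [h, map_zero] at this
  exact one_sub_ne_zero this.symm

theorem wTwistQ_ne_zero : wTwistQ ≠ 0 := by
  rw [← evalV_period]
  exact mul_ne_zero iota_rootE4_ne_zero evalV_period_ne_zero

theorem eq_of_nabla_eq {f g : Series2} (h : nabla f = nabla g) (h0 : restrictHom f = restrictHom g) :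
    f = g := by
  apply eq_of_thetaP_eq _ h0
  rw [nabla_apply, nabla_apply] at h
  exact mul_left_cancel₀ evalV_period_ne_zero h

/-- Both sides vanish at p = 0 and have derivative -y/(dis₀ w(x(1 - y))²) along y: on the left by
reduction of order, on the right by the hypergeometric Wronskian. -/
theorem evalV_u : evalV uSeries = uQ := by
  apply eq_of_nabla_eq
  · apply mul_left_cancel₀ (mul_ne_zero disQ_ne_zero (pow_ne_zero 2 wTwistQ_ne_zero))
    rw [nabla_uQ, nabla_evalV, ← evalV_curveDisc, ← evalV_period]
    have h : (X * PowerSeries.derivative QMod uSeries) * period ^ 2 * curveDisc =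
        -C (MvPolynomial.X 1) * X := by
      linear_combination X * u_ode
    have h2 := congrArg evalV h
    rw [map_mul, map_mul, map_pow, map_mul evalV (-_), map_neg, evalV_C, evalC_X_one,
      ← rootE4_pow] at h2
    change _ = _ * vQ at h2
    rw [yQ, yScale]
    simp only [map_mul, map_pow] at h2 ⊢
    linear_combination ι (1 - 432 * xQ) * ι rootE4 ^ 2 * h2
  · rw [restrictHom_uQ, restrictHom_evalV, constantCoeff_u, map_zero]

theorem w0_sq_mul_hSeries : w0 ^ 2 * hSeries = w0 * jet 1 1 - jet 1 0 * jet 0 1 := by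
  rw [hSeries]
  linear_combination (w0 * jet 1 1 - (w0 * w0⁻¹ + 1) * (jet 1 0 * jet 0 1)) * w0_inv_mul

theorem thetaP_hSeries : w0 ^ 2 * thetaP hSeries = w0 * (gSeries.subst xTwist +
    wSeries.subst xTwist * flog (1 - 𝕡)) - jet 1 0 * wSeries.subst xTwist := by
  have h := congrArg thetaP w0_sq_mul_hSeries
  simp only [Derivation.leibniz, Derivation.leibniz_pow, thetaP_w0, map_sub, smul_eq_mul,
    thetaP_jet_zero, thetaP_jet_zero_one, thetaP_jet_one_one, mul_zero, add_zero, smul_zero] at h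
  linear_combination h

/-- Since w₀ does not depend on y, differentiating h gives w(x(1 - y))/w(x) times the difference of
log q at x(1 - y) and at x. -/
theorem pull2_thetaP_hSeries : pull2 (thetaP hSeries) = evalV period * uQ := by
  have hs := PowerSeries.HasSubst.of_constantCoeff_zero constantCoeff_xTwist
  have h := congrArg pull2 thetaP_hSeries
  have hg : pull2 (gSeries.subst xTwist) = pull2 (gRatio.subst xTwist) * wTwistQ := by
    rw [← gRatio_mul, PowerSeries.subst_mul hs, map_mul]; rfl
  have hg2 : pull2 (jet 1 0) = ι (pull gRatio) * ι rootE4 := by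
    rw [jet_one_zero_eq, ← gRatio_mul, ← inFirstHom_apply, pull2_iota, map_mul, map_mul, pull_wSeries]
  have hw : pull2 (wSeries.subst xTwist) = ι rootE4 * evalV period := evalV_period.symm
  rw [map_mul, map_pow, map_sub, map_mul, map_add, map_mul pull2 (wSeries.subst xTwist), hg,
    map_mul pull2 (jet 1 0), hg2, hw, pull2_w0, ← evalV_period] at h
  change _ = _ * (_ + _ * logQ) - _ at h
  apply mul_left_cancel₀ (pow_ne_zero 2 iota_rootE4_ne_zero)
  rw [h, uQ]
  ring

/-- The genus zero potential. -/
theorem thetaP_potential_zero : thetaP (evalT (potT 0)) = -posPart (pull2 hSeries) := by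
  rw [thetaP_evalT_potT_zero]
  apply eq_of_thetaP_eq
  · rw [thetaP_evalV_f, map_neg, thetaP_posPart, evalV_u, neg_inj]
    apply mul_left_cancel₀ evalV_period_ne_zero
    rw [← pull2_thetaP_hSeries, ← nabla_pull2', nabla_apply]
  · rw [map_neg, restrictHom_posPart, restrictHom_evalV, constantCoeff_f, map_zero, neg_zero]

theorem dis0_eq : dis0 (inFirst xQ) yQ = disQ := by
  rw [dis0, disQ, xTwistQ_eq, inFirstHom_apply]; ring

theorem constantCoeff_disQ : MvPowerSeries.constantCoeff disQ = 1 := by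
  rw [← constantCoeff_restrictHom, restrictHom_disQ]; simp [constantCoeff_xQ]

theorem X1_mul_pderiv_yQ : evalV period * (𝕡 * MvPowerSeries.pderiv ℂ 1 yQ) = yQ := nabla_yQ

theorem restrictHom_of_X1_mul {f g : Series2} (h : 𝕡 * f = g) :
    restrictHom f = restrictHom (MvPowerSeries.pderiv ℂ 1 g) := by
  rw [← h, Derivation.leibniz, MvPowerSeries.pderiv_X_self, smul_eq_mul, smul_eq_mul, map_add,
    map_mul, restrictHom_X1]
  simp

/-- The logarithmic derivative of D^(-1/6) P with all denominators cleared, to be compared with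
`pot1_ode`. -/
theorem log_potential_ode {D P : Series2} (hD : MvPowerSeries.constantCoeff D = 1)
    (hP : MvPowerSeries.constantCoeff P = 1) :
    6 * (D * P * thetaP (flog (fpow D (-1 / 6) * P))) = 6 * (D * thetaP P) - P * thetaP D := by
  have hN : MvPowerSeries.constantCoeff (fpow D (-1 / 6) * P) = 1 := by
    rw [map_mul, constantCoeff_fpow hD, hP, one_mul]
  have h1 := mul_thetaP_flog hN
  have h2 := mul_thetaP_fpow hD (-1 / 6)
  have h3 : (6 : Series2) * ((-1 / 6 : ℂ) • (fpow D (-1 / 6) * thetaP D)) =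
      -(fpow D (-1 / 6) * thetaP D) := by
    have : (6 : Series2) = MvPowerSeries.C (6 : ℂ) := (map_ofNat MvPowerSeries.C 6).symm
    rw [this, ← MvPowerSeries.smul_eq_C_mul, smul_smul]
    norm_num
  rw [Derivation.leibniz, smul_eq_mul, smul_eq_mul] at h1
  apply mul_left_cancel₀ (ne_zero_of_constantCoeff_eq_one (constantCoeff_fpow hD (-1 / 6)))
  rw [← h2] at h3
  linear_combination 6 * D * h1 + P * h3

theorem pot1_ode : 12 * (curveDisc * period * (X * PowerSeries.derivative QMod pot1)) =
    -(period * (X * PowerSeries.derivative QMod curveDisc)) -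
      6 * (curveDisc * period * (period - 1)) -
      6 * (curveDisc * (X * PowerSeries.derivative QMod period)) := by
  have h1 := logCurveDisc_ode
  have h2 := logPeriod_ode
  have h3 := ell_ode
  have e1 : (12 : PowerSeries QMod) * C (MvPolynomial.C (-1 / 12)) = -1 := by
    have := rat_mul_eq (-1 / 12) (-1) 12 (by norm_num)
    rw [mul_comm]; simpa using this
  have e2 : (12 : PowerSeries QMod) * C (MvPolynomial.C (1 / 2)) = 6 := by
    have h6 := rat_C_ofNat 6
    have h12 := rat_mul_eq (1 / 2) 6 12 (by norm_num)
    push_cast at h6 h12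
    rw [mul_comm, h12, h6]
  rw [pot1, map_sub, map_sub, derivative_rat_mul, derivative_rat_mul, derivative_rat_mul]
  linear_combination curveDisc * period * X * PowerSeries.derivative QMod logCurveDisc * e1 -
    curveDisc * period * (X * PowerSeries.derivative QMod ellSeries +
      X * PowerSeries.derivative QMod logPeriod) * e2 - period * X * h1 - 6 * curveDisc * X * h2 -
    6 * curveDisc * period * h3

theorem restrictHom_pderiv_yQ : restrictHom (MvPowerSeries.pderiv ℂ 1 yQ) = yScale * etaInv := by
  obtain ⟨v, hv⟩ := X1_dvd_iff.mpr restrictHom_vQ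
  have h := restrictHom_X1_vQ hv
  rw [← restrictHom_of_X1_mul (f := ι yScale * v) (by rw [yQ, hv]; ring), map_mul, restrictHom_iota, h]

theorem constantCoeff_etaInv : constantCoeff etaInv = 1 := by
  rw [etaInv, constantCoeff_toComplex, map_pow, PowerSeries.constantCoeff_inv, constantCoeff_etaProd]
  simp

theorem constantCoeff_pderiv_yQ :
    MvPowerSeries.constantCoeff (MvPowerSeries.pderiv ℂ 1 yQ) = 1 := by
  rw [← constantCoeff_restrictHom, restrictHom_pderiv_yQ, map_mul, constantCoeff_etaInv, yScale]
  simp [constantCoeff_rootE4, constantCoeff_xQ]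

/-- The genus one potential. -/
theorem potential_one : evalT (potT 1) = posPart ((1 / 2 : ℂ) • flog
    (fpow (dis0 (inFirst xQ) yQ) (-1 / 6) * MvPowerSeries.pderiv ℂ 1 yQ)) := by
  rw [dis0_eq, evalT_potT_one]
  set P := MvPowerSeries.pderiv ℂ 1 yQ with hP
  apply eq_of_thetaP_eq
  · rw [thetaP_posPart, Derivation.map_smul]
    have h1 := log_potential_ode constantCoeff_disQ constantCoeff_pderiv_yQ
    set t := thetaP (flog (fpow disQ (-1 / 6) * P)) with ht
    have h2 := congrArg evalV pot1_ode
    generalize ha : X * PowerSeries.derivative QMod pot1 = a at h2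
    generalize hb : X * PowerSeries.derivative QMod curveDisc = b at h2
    generalize hc : X * PowerSeries.derivative QMod period = c at h2
    simp only [map_mul, map_sub, map_neg, map_ofNat, map_one] at h2
    rw [← ha, ← hb, ← hc, ← nabla_evalV, ← nabla_evalV, ← nabla_evalV] at h2
    simp only [nabla_apply] at h2
    set B := evalV period with hB
    -- Differentiating B p ∂y/∂p = y. It shows that the logarithm of P = ∂y/∂p absorbs both the
    -- logarithm of t/X and that of the period.
    have h3 : B * P + thetaP B * P + B * thetaP P = P := by
      have h4 := congrArg thetaP X1_mul_pderiv_yQ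
      rw [Derivation.leibniz, Derivation.leibniz, thetaP_X1, thetaP_apply yQ] at h4
      simp only [smul_eq_mul] at h4
      apply mul_left_cancel₀ X1_ne_zero
      linear_combination h4
    have hP0 : P ≠ 0 := ne_zero_of_constantCoeff_eq_one constantCoeff_pderiv_yQ
    have hD : disQ = ι (1 - 432 * xQ) * evalV curveDisc := evalV_curveDisc.symm
    have hD' : thetaP disQ = ι (1 - 432 * xQ) * thetaP (evalV curveDisc) := by
      rw [hD, Derivation.leibniz, thetaP_iota]; simp
    have hι : ι (1 - 432 * xQ) ≠ 0 := iota_ne_zero one_sub_ne_zero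
    have hB0 : B ≠ 0 := evalV_period_ne_zero
    have key : 12 * thetaP (evalV pot1) = 6 * t := by
      apply mul_left_cancel₀ (mul_ne_zero (mul_ne_zero disQ_ne_zero hP0) (pow_ne_zero 2 hB0))
      rw [hD'] at h1
      rw [hD] at h1 ⊢
      linear_combination P * ι (1 - 432 * xQ) * h2 - B ^ 2 * h1 -
        6 * ι (1 - 432 * xQ) * evalV curveDisc * B * h3
    have h12 : (12 : Series2) = MvPowerSeries.C (12 : ℂ) := (map_ofNat MvPowerSeries.C 12).symm
    have h6 : (6 : Series2) = MvPowerSeries.C (6 : ℂ) := (map_ofNat MvPowerSeries.C 6).symm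
    rw [h12, h6, ← MvPowerSeries.smul_eq_C_mul, ← MvPowerSeries.smul_eq_C_mul] at key
    have h7 := congrArg (fun f => (1 / 12 : ℂ) • f) key
    simp only [smul_smul] at h7
    norm_num at h7
    rw [h7]
  · rw [restrictHom_posPart, restrictHom_evalV, constantCoeff_pot1, map_zero]

/-! ### Series with a gap -/

/-- The series in which the exponent of the second variable does not exceed that of the first one,
as long as it is less than `N`. -/
def gapped (N : ℕ) : Subalgebra ℂ Series2 where
  carrier := {f | ∀ e : Fin 2 →₀ ℕ, e 1 < N → e 0 < e 1 → MvPowerSeries.coeff e f = 0}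
  mul_mem' := by
    intro f g hf hg e h1 h2
    rw [MvPowerSeries.coeff_mul]
    refine Finset.sum_eq_zero fun a ha => ?_
    rw [Finset.HasAntidiagonal.mem_antidiagonal] at ha
    have h3 := DFunLike.congr_fun ha 0
    have h4 := DFunLike.congr_fun ha 1
    rw [Finsupp.add_apply] at h3 h4
    by_cases h : a.1 0 < a.1 1
    · rw [hf _ (by omega) h, zero_mul]
    · rw [hg a.2 (by omega) (by omega), mul_zero]
  add_mem' := by
    intro f g hf hg e h1 h2
    rw [map_add, hf e h1 h2, hg e h1 h2, add_zero]
  algebraMap_mem' := by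
    intro r e h1 h2
    rw [MvPowerSeries.algebraMap_apply, MvPowerSeries.coeff_C, if_neg]
    rintro rfl
    simp at h2

theorem iota_mem_gapped (N : ℕ) (f : PowerSeries ℂ) : ι f ∈ gapped N := by
  intro e h1 h2
  rw [inFirstHom_apply, coeff_inFirst, if_neg (by omega)]

theorem X0_mem_gapped (N : ℕ) : (MvPowerSeries.X 0 : Series2) ∈ gapped N := by
  rw [← inFirst_X, ← inFirstHom_apply]; exact iota_mem_gapped N X

theorem subst_mem_gapped {N : ℕ} {a : Series2} (ha : MvPowerSeries.constantCoeff a = 0)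
    (h : a ∈ gapped N) (f : PowerSeries ℂ) : f.subst a ∈ gapped N := by
  intro e h1 h2
  rw [PowerSeries.coeff_subst (PowerSeries.HasSubst.of_constantCoeff_zero ha)]
  refine finsum_eq_zero_of_forall_eq_zero fun d => ?_
  rw [pow_mem h d e h1 h2, smul_zero]

/-- The monomial qp shifts both exponents equally, so the bound on the p-degree improves by one. -/
theorem X0_mul_X1_mul_mem_gapped {N : ℕ} {f : Series2} (h : f ∈ gapped N) :
    MvPowerSeries.X 0 * (𝕡 * f) ∈ gapped (N + 1) := by
  intro e h1 h2
  rw [expo_eq e]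
  rcases h0 : e 0 with _ | n
  · rw [coeff_X0_mul_zero]
  · rw [coeff_X0_mul_succ]
    rcases h3 : e 1 with _ | m
    · rw [coeff_X1_mul_zero]
    · rw [coeff_X1_mul_succ]
      exact h _ (by rw [expo_one]; omega) (by rw [expo_zero, expo_one]; omega)

theorem gapped_mono {N M : ℕ} (h : N ≤ M) : gapped M ≤ gapped N :=
  fun _ hf e h1 h2 => hf e (by omega) h2

/-- Each monomial with a ≥ b is x^(a-b) (xy)^b, and xy contains the factor qp. The gain of one in
`N` drives the induction of `exists_yQ`. -/
theorem comp_mem_gapped {N : ℕ} {f y : Series2} (hf : ∀ M, f ∈ gapped M) {x : PowerSeries ℂ}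
    (hx : constantCoeff x = 0) (hy : y ∈ gapped N) :
    comp f (inFirst x) (𝕡 * y) ∈ gapped (N + 1) := by
  have h0 : MvPowerSeries.constantCoeff (inFirst x) = 0 := by rw [constantCoeff_inFirst, hx]
  have h1 : MvPowerSeries.constantCoeff (𝕡 * y) = 0 := by simp
  intro e he1 he2
  rw [comp, MvPowerSeries.coeff_subst (hasSubst_pair h0 h1)]
  refine finsum_eq_zero_of_forall_eq_zero fun d => ?_
  by_cases hd : d 0 < d 1
  · rw [hf (d 1 + 1) d (by omega) hd, zero_smul]
  · rw [Finsupp.prod_fintype _ _ (by simp), Fin.prod_univ_two]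
    have hxX : inFirst x = MvPowerSeries.X 0 * ι (shift x) := by
      rw [← inFirst_X, ← inFirstHom_apply, ← inFirstHom_apply, ← map_mul, X_mul_shift, hx, map_zero,
        sub_zero]
    have h2 : inFirst x ^ d 0 * (𝕡 * y) ^ d 1 =
        inFirst x ^ (d 0 - d 1) * (MvPowerSeries.X 0 * (𝕡 * (ι (shift x) * y))) ^ d 1 := by
      have : inFirst x ^ d 0 = inFirst x ^ (d 0 - d 1) * inFirst x ^ d 1 := by
        rw [← pow_add]; congr 1; omega
      rw [this, mul_assoc, ← mul_pow]
      congr 2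
      rw [hxX]; ring
    have h3 : inFirst x ^ d 0 * (𝕡 * y) ^ d 1 ∈ gapped (N + 1) := by
      rw [h2]
      refine mul_mem (pow_mem ?_ _) (pow_mem (X0_mul_X1_mul_mem_gapped
        (mul_mem (iota_mem_gapped N _) hy)) _)
      rw [← inFirstHom_apply]; exact iota_mem_gapped _ _
    have h4 := h3 e he1 he2
    simp only [Matrix.cons_val_zero, Matrix.cons_val_one]
    rw [h4, smul_zero]

theorem inv_mem_gapped {N : ℕ} {f g : Series2} (hf : MvPowerSeries.constantCoeff f = 1)
    (hfN : f ∈ gapped N) (h : f * g = 1) : g ∈ gapped N := by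
  have h0 : MvPowerSeries.constantCoeff (f - 1) = 0 := by rw [map_sub, hf, map_one, sub_self]
  have hs := PowerSeries.HasSubst.of_constantCoeff_zero h0
  have h1 : (1 + X : PowerSeries ℂ) * (1 + X)⁻¹ = 1 := PowerSeries.mul_inv_cancel _ (by simp)
  have h2 := congrArg (PowerSeries.substAlgHom hs) h1
  rw [map_mul, map_add, map_one, PowerSeries.coe_substAlgHom, PowerSeries.subst_X hs] at h2
  have h3 : g = PowerSeries.subst (f - 1) (1 + X : PowerSeries ℂ)⁻¹ := by
    linear_combination (-g) * h2 + PowerSeries.subst (f - 1) (1 + X : PowerSeries ℂ)⁻¹ * h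
  rw [h3]
  exact subst_mem_gapped h0 (sub_mem hfN (one_mem _)) _

/-! ### Partial sums of the coefficients of `∂_{ρ₂} w₀` -/

/-- `m d(n, m)` for `m ≥ 1` and `c(n, 0)` for `m = 0`. -/
def mulDc (n m : ℕ) : ℂ := m * dc n m + if m = 0 then cDer 0 n else 0

/-- Adding c(n, 0) at m = 0 absorbs the exceptional term of the recursion. The factor n - m makes
the coefficients vanish beyond m = n and the partial sums telescope. -/
theorem mulDc_succ (n m : ℕ) : ((m : ℂ) + 1) * mulDc n (m + 1) = -((n - m) * mulDc n m) := by
  have h := dc_step_y_natCast n m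
  rw [mulDc, mulDc, if_neg (Nat.succ_ne_zero m)]
  split_ifs at h ⊢ with hm
  · subst hm; push_cast at h ⊢; linear_combination h
  · push_cast at h ⊢; linear_combination h

theorem sum_mulDc (n M : ℕ) : (n : ℂ) * ∑ j ∈ Finset.range (M + 1), mulDc n j =
    (n - M) * mulDc n M := by
  induction M with
  | zero => simp
  | succ M ih =>
    rw [Finset.sum_range_succ, mul_add, ih]
    have := mulDc_succ n M
    push_cast
    linear_combination this

theorem mulDc_eq_zero {n m : ℕ} (h : n < m) : mulDc n m = 0 := by
  obtain ⟨k, rfl⟩ := Nat.exists_eq_add_of_lt h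
  induction k with
  | zero =>
    have h1 := mulDc_succ n n
    rw [sub_self, zero_mul, neg_zero] at h1
    exact (mul_eq_zero.mp h1).resolve_left (by exact_mod_cast n.succ_ne_zero)
  | succ k ih =>
    have h1 := mulDc_succ n (n + k + 1)
    rw [ih (by omega), mul_zero, neg_zero] at h1
    exact (mul_eq_zero.mp h1).resolve_left (by exact_mod_cast (n + k + 1).succ_ne_zero)

theorem dc_eq_zero {n m : ℕ} (h : n < m) : dc n m = 0 := by
  have h1 := mulDc_eq_zero h
  have h2 : m ≠ 0 := by omega
  rw [mulDc, if_neg h2, add_zero] at h1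
  exact (mul_eq_zero.mp h1).resolve_left (by exact_mod_cast h2)

/-- This is the vanishing of ∂_{ρ₂} w₀, without its logarithm, at y = 1. The recursion in n reduces
it to the previous n, since the sum of the terms `mulDc` vanishes. -/
theorem sum_dc_self (n : ℕ) : ∑ j ∈ Finset.range (n + 1), dc n j = 0 := by
  induction n with
  | zero => simp [dc_zero_zero]
  | succ n ih =>
    have h1 : ∑ j ∈ Finset.range (n + 2), mulDc (n + 1) j = 0 := by
      have h2 := sum_mulDc (n + 1) (n + 1)
      rw [sub_self, zero_mul] at h2
      exact (mul_eq_zero.mp h2).resolve_left (by exact_mod_cast n.succ_ne_zero)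
    have h3 : ∀ j ∈ Finset.range (n + 2), ((n : ℂ) + 1) ^ 2 * dc (n + 1 : ℕ) j =
        ((n : ℂ) + 1) * mulDc (n + 1) j + 12 * (6 * n + 1) * (6 * n + 5) * dc n j := by
      intro j _
      have h4 := dc_step_x (natCast_mem_regularPlane n) j
      rw [mulDc]
      split_ifs with hj
      · subst hj
        rw [cDer, iteratedDeriv_zero]
        push_cast at h4 ⊢; linear_combination h4
      · obtain ⟨j, rfl⟩ := Nat.exists_eq_succ_of_ne_zero hj
        push_cast at h4 ⊢
        rw [c_natCast_succ] at h4
        linear_combination h4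
    have h5 := Finset.sum_congr rfl h3
    rw [← Finset.mul_sum, Finset.sum_add_distrib, ← Finset.mul_sum, ← Finset.mul_sum, h1,
      Finset.sum_range_succ _ (n + 1), Finset.sum_range_succ (fun j : ℕ => dc n j) (n + 1), ih,
      dc_eq_zero (Nat.lt_succ_self n), mul_zero, add_zero, mul_zero, add_zero,
      ← Finset.sum_range_succ] at h5
    exact (mul_eq_zero.mp h5).resolve_left (pow_ne_zero 2 (by exact_mod_cast n.succ_ne_zero))

/-- `∂_{ρ₂} w₀` divided by `1 - y`. -/
def jetQuot : Series2 := fun e => ∑ j ∈ Finset.range (e 1 + 1), dc (e 0 : ℂ) (j : ℂ)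

theorem coeff_jetQuot (n m : ℕ) : MvPowerSeries.coeff (expo n m) jetQuot =
    ∑ j ∈ Finset.range (m + 1), dc n j := by
  change ∑ j ∈ Finset.range (expo n m 1 + 1), dc (expo n m 0 : ℂ) (j : ℂ) = _
  rw [expo_zero, expo_one]

theorem jet_zero_one_eq_mul : jet 0 1 = (1 - 𝕡) * jetQuot := by
  apply ext_expo
  intro n m
  rw [sub_mul, one_mul, map_sub, coeff_jet_zero_one', coeff_jetQuot]
  cases m with
  | zero => rw [coeff_X1_mul_zero]; simp
  | succ m => rw [coeff_X1_mul_succ, coeff_jetQuot, Finset.sum_range_succ]; ring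

theorem coeff_jetQuot_eq_zero {n m : ℕ} (h : n ≤ m) :
    MvPowerSeries.coeff (expo n m) jetQuot = 0 := by
  rw [coeff_jetQuot]
  induction m, h using Nat.le_induction with
  | base => exact sum_dc_self n
  | succ m hm ih => rw [Finset.sum_range_succ, ih, dc_eq_zero (by omega), add_zero]

theorem X1_mul_jetQuot_mem (N : ℕ) : 𝕡 * jetQuot ∈ gapped N := by
  intro e h1 h2
  rw [expo_eq e]
  rcases h3 : e 1 with _ | m
  · rw [coeff_X1_mul_zero]
  · rw [coeff_X1_mul_succ, coeff_jetQuot_eq_zero (by omega)]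

theorem jet_zero_one_mem (N : ℕ) : jet 0 1 ∈ gapped N := by
  intro e h1 h2
  rw [coeff_jet_zero_one, dc_eq_zero h2]

theorem chiSeries_mem (N : ℕ) : chiSeries ∈ gapped N := by
  rw [chiSeries, w0_inv_eq]
  exact mul_mem (iota_mem_gapped N _) (jet_zero_one_mem N)

/-! ### The mirror map modulo series with a gap -/

/-- The factor Y is the inverse of exp(χ(x(q), pY)) with χ = log(p/y), so knowing the gap of Y below
p-degree `N` gives it below `N + 1`. -/
theorem exists_yQ : ∃ Y : Series2, yQ = 𝕡 * Y ∧ MvPowerSeries.constantCoeff Y = 1 ∧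
    ∀ N, Y ∈ gapped N := by
  obtain ⟨Y, hY⟩ := X1_dvd_iff.mpr restrictHom_yQ
  have h0 : MvPowerSeries.constantCoeff Y = 1 := by
    rw [← constantCoeff_restrictHom, restrictHom_of_X1_mul hY.symm, constantCoeff_restrictHom,
      constantCoeff_pderiv_yQ]
  refine ⟨Y, hY, h0, fun N => ?_⟩
  induction N with
  | zero => intro e h; omega
  | succ N ih =>
    have h1 : 𝕡 * (fexp (pull2 chiSeries) * Y) = 𝕡 * 1 := by
      have h2 := pull2_pSeries
      rw [pSeries, map_mul, pull2_X1] at h2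
      change yQ * pull2 (fexp chiSeries) = _ at h2
      rw [pull2_fexp constantCoeff_chiSeries, hY] at h2
      linear_combination h2
    have hc : MvPowerSeries.constantCoeff (pull2 chiSeries) = 0 := by
      rw [constantCoeff_pull2, constantCoeff_chiSeries]
    refine inv_mem_gapped (constantCoeff_fexp hc) (subst_mem_gapped hc ?_ _)
      (mul_left_cancel₀ X1_ne_zero h1)
    rw [pull2_apply, hY]
    exact comp_mem_gapped chiSeries_mem constantCoeff_xQ ih

theorem pull2_mem_gapped {f : Series2} (hf : ∀ N, f ∈ gapped N) (N : ℕ) : pull2 f ∈ gapped N := by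
  obtain ⟨Y, hY, -, hN⟩ := exists_yQ
  rw [pull2_apply, hY]
  exact gapped_mono (Nat.le_succ N) (comp_mem_gapped hf constantCoeff_xQ (hN N))

theorem eq_zero_of_thetas {f : Series2} (h0 : MvPowerSeries.constantCoeff f = 0) (h1 : thetaX f = 0)
    (h2 : thetaP f = 0) : f = 0 := by
  apply ext_expo
  intro n m
  rw [map_zero]
  have h3 := congrArg (MvPowerSeries.coeff (expo n m)) h1
  have h4 := congrArg (MvPowerSeries.coeff (expo n m)) h2
  rw [coeff_thetaX, map_zero] at h3
  rw [coeff_thetaP_expo, map_zero] at h4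
  by_cases hn : n = 0
  · by_cases hm : m = 0
    · subst hn; subst hm
      have : expo 0 0 = 0 := by simp [expo]
      rw [this, MvPowerSeries.coeff_zero_eq_constantCoeff_apply, h0]
    · exact (mul_eq_zero.mp h4).resolve_left (by exact_mod_cast hm)
  · exact (mul_eq_zero.mp h3).resolve_left (by exact_mod_cast hn)

theorem flog_mul {a b : Series2} (ha : MvPowerSeries.constantCoeff a = 1)
    (hb : MvPowerSeries.constantCoeff b = 1) : flog (a * b) = flog a + flog b := by
  have hab : MvPowerSeries.constantCoeff (a * b) = 1 := by rw [map_mul, ha, hb, one_mul]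
  have h0 := ne_zero_of_constantCoeff_eq_one hab
  rw [← sub_eq_zero]
  apply eq_zero_of_thetas
  · rw [map_sub, map_add, constantCoeff_flog ha, constantCoeff_flog hb, constantCoeff_flog hab]; ring
  · have h1 := thetaX_flog ha
    have h2 := thetaX_flog hb
    have h3 := thetaX_flog hab
    rw [Derivation.leibniz, smul_eq_mul, smul_eq_mul] at h3
    rw [map_sub, map_add]
    apply mul_left_cancel₀ h0
    linear_combination h3 - b * h1 - a * h2
  · have h1 := mul_thetaP_flog ha
    have h2 := mul_thetaP_flog hb
    have h3 := mul_thetaP_flog hab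
    rw [Derivation.leibniz, smul_eq_mul, smul_eq_mul] at h3
    rw [map_sub, map_add]
    apply mul_left_cancel₀ h0
    linear_combination h3 - b * h1 - a * h2

theorem mul_thetaX_fpow {a : Series2} (ha : MvPowerSeries.constantCoeff a = 1) (r : ℂ) :
    a * thetaX (fpow a r) = r • (fpow a r * thetaX a) := by
  rw [thetaX_apply, thetaX_apply, fpow, mul_left_comm, mul_pderiv_subst_binomialSeries ha,
    mul_smul_comm]
  congr 1; ring

theorem flog_fpow {a : Series2} (ha : MvPowerSeries.constantCoeff a = 1) (r : ℂ) :
    flog (fpow a r) = r • flog a := by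
  have hb := constantCoeff_fpow ha r
  have h0 := ne_zero_of_constantCoeff_eq_one ha
  have h0' := ne_zero_of_constantCoeff_eq_one hb
  rw [← sub_eq_zero]
  apply eq_zero_of_thetas
  · rw [map_sub, MvPowerSeries.smul_eq_C_mul, map_mul, constantCoeff_flog ha,
      constantCoeff_flog hb]; ring
  · have h1 := thetaX_flog ha
    have h2 := thetaX_flog hb
    have h3 := mul_thetaX_fpow ha r
    rw [map_sub, Derivation.map_smul]
    rw [MvPowerSeries.smul_eq_C_mul] at h3 ⊢
    apply mul_left_cancel₀ (mul_ne_zero h0 h0')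
    linear_combination a * h2 + h3 - fpow a r * MvPowerSeries.C r * h1
  · have h1 := mul_thetaP_flog ha
    have h2 := mul_thetaP_flog hb
    have h3 := mul_thetaP_fpow ha r
    rw [map_sub, Derivation.map_smul]
    rw [MvPowerSeries.smul_eq_C_mul] at h3 ⊢
    apply mul_left_cancel₀ (mul_ne_zero h0 h0')
    linear_combination a * h2 + h3 - fpow a r * MvPowerSeries.C r * h1

theorem pull2_flog {a : Series2} (ha : MvPowerSeries.constantCoeff a = 1) :
    pull2 (flog a) = flog (pull2 a) := by
  rw [flog, pull2_subst (by simp [ha]), map_sub, map_one]; rfl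

theorem flog_mem_gapped {a : Series2} (ha : MvPowerSeries.constantCoeff a = 1) {N : ℕ}
    (h : a ∈ gapped N) : flog a ∈ gapped N :=
  subst_mem_gapped (by simp [ha]) (sub_mem h (one_mem _)) _

/-- The factor relating `1 - p` and `1 - y`. -/
theorem exists_one_sub_pSeries : ∃ U : Series2, 1 - pSeries = (1 - 𝕡) * U ∧
    MvPowerSeries.constantCoeff U = 1 ∧ ∀ N, U ∈ gapped N := by
  have hs := PowerSeries.HasSubst.of_constantCoeff_zero constantCoeff_chiSeries
  have h1 : fexp chiSeries = 1 + chiSeries * (shift (PowerSeries.exp ℂ)).subst chiSeries := by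
    have h2 := congrArg (PowerSeries.substAlgHom hs) (X_mul_shift (PowerSeries.exp ℂ))
    rw [PowerSeries.constantCoeff_exp, map_one, map_mul, map_sub, map_one] at h2
    simp only [PowerSeries.coe_substAlgHom, PowerSeries.subst_X hs] at h2
    rw [fexp]; linear_combination -h2
  have h3 : chiSeries = (1 - 𝕡) * (w0⁻¹ * jetQuot) := by
    rw [chiSeries, jet_zero_one_eq_mul]; ring
  -- From p = y exp χ, exp χ = 1 + χ · (exp χ - 1)/χ, and the divisibility of χ by 1 - y.
  refine ⟨1 - w0⁻¹ * (𝕡 * jetQuot) * (shift (PowerSeries.exp ℂ)).subst chiSeries, ?_, ?_, ?_⟩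
  · have h4 : pSeries = 𝕡 * fexp chiSeries := rfl
    rw [h4, h1]
    linear_combination (-𝕡 * (shift (PowerSeries.exp ℂ)).subst chiSeries) * h3
  · simp
  · intro N
    refine sub_mem (one_mem _) (mul_mem (mul_mem ?_ (X1_mul_jetQuot_mem N)) (subst_mem_gapped
      constantCoeff_chiSeries (chiSeries_mem N) _))
    rw [w0_inv_eq]; exact iota_mem_gapped N _

/-- After the change of variables, 1 - p = (1 - y) U with U in the gapped subalgebra, so all terms
of log(1 - y) violating the gap are those of log(1 - p). -/
theorem logQ_sub_mem (N : ℕ) : logQ - flog (1 - 𝕡) ∈ gapped N := by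
  obtain ⟨U, hU, hU0, hUN⟩ := exists_one_sub_pSeries
  have h1 := congrArg pull2 hU
  rw [map_sub, map_one, pull2_pSeries, map_mul] at h1
  have h2 : MvPowerSeries.constantCoeff (pull2 (1 - 𝕡)) = 1 := by
    rw [constantCoeff_pull2, constantCoeff_one_sub_X1]
  have h3 : MvPowerSeries.constantCoeff (pull2 U) = 1 := by rw [constantCoeff_pull2, hU0]
  have h4 : logQ - flog (1 - 𝕡) = -flog (pull2 U) := by
    rw [h1, flog_mul h2 h3, logQ, pull2_flog constantCoeff_one_sub_X1]; ring
  rw [h4]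
  exact neg_mem (flog_mem_gapped h3 (pull2_mem_gapped hUN N))

theorem xTwist_mem (N : ℕ) : xTwist ∈ gapped N := by
  have h1 : MvPowerSeries.X 0 * (𝕡 * 1) ∈ gapped (N + 1) := X0_mul_X1_mul_mem_gapped (one_mem _)
  have h2 : xTwist = MvPowerSeries.X 0 - MvPowerSeries.X 0 * (𝕡 * 1) := by rw [xTwist]; ring
  rw [h2]
  exact sub_mem (X0_mem_gapped N) (gapped_mono (Nat.le_succ N) h1)

theorem uQ_sub_mem (N : ℕ) : uQ - flog (1 - 𝕡) ∈ gapped N := by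
  have h : uQ - flog (1 - 𝕡) = (logQ - flog (1 - 𝕡)) +
      (pull2 (gRatio.subst xTwist) - ι (pull gRatio)) := by rw [uQ]; ring
  rw [h]
  exact add_mem (logQ_sub_mem N) (sub_mem (pull2_mem_gapped
    (fun M => subst_mem_gapped constantCoeff_xTwist (xTwist_mem M) _) N) (iota_mem_gapped N _))

theorem pderiv_yQ_mem (N : ℕ) : MvPowerSeries.pderiv ℂ 1 yQ ∈ gapped N := by
  obtain ⟨Y, hY, -, hN⟩ := exists_yQ
  have h : MvPowerSeries.pderiv ℂ 1 yQ = Y + thetaP Y := by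
    rw [hY, Derivation.leibniz, MvPowerSeries.pderiv_X_self, thetaP_apply]
    simp; ring
  rw [h]
  refine add_mem (hN N) fun e h1 h2 => ?_
  rw [coeff_thetaP, hN N e h1 h2, mul_zero]

/-- Among the factors only (1 - y)^(-1/6) violates the gap; x(1 - y) and ∂y/∂p lie in the
subalgebra. -/
theorem potential_one_mem (N : ℕ) : flog (fpow disQ (-1 / 6) * MvPowerSeries.pderiv ℂ 1 yQ) +
    (1 / 6 : ℂ) • flog (1 - 𝕡) ∈ gapped N := by
  have h1 : MvPowerSeries.constantCoeff (1 - 432 * xTwistQ) = 1 := by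
    rw [xTwistQ, map_sub, map_mul, constantCoeff_pull2, constantCoeff_xTwist]; simp
  have h2 : MvPowerSeries.constantCoeff (1 - yQ) = 1 := by simp [constantCoeff_yQ]
  have h3 : flog (1 - yQ) = logQ := by
    rw [logQ, pull2_flog constantCoeff_one_sub_X1, map_sub, map_one, pull2_X1]
  have h4 : flog disQ = flog (1 - 432 * xTwistQ) + logQ := by rw [disQ, flog_mul h1 h2, h3]
  rw [flog_mul (constantCoeff_fpow constantCoeff_disQ _) constantCoeff_pderiv_yQ,
    flog_fpow constantCoeff_disQ, h4]
  have h5 : (-1 / 6 : ℂ) • (flog (1 - 432 * xTwistQ) + logQ) +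
      flog (MvPowerSeries.pderiv ℂ 1 yQ) + (1 / 6 : ℂ) • flog (1 - 𝕡) =
      (-1 / 6 : ℂ) • (flog (1 - 432 * xTwistQ) + (logQ - flog (1 - 𝕡))) +
      flog (MvPowerSeries.pderiv ℂ 1 yQ) := by module
  rw [h5]
  refine add_mem (Subalgebra.smul_mem _ (add_mem (flog_mem_gapped h1 ?_) (logQ_sub_mem N)) _)
    (flog_mem_gapped constantCoeff_pderiv_yQ (pderiv_yQ_mem N))
  exact sub_mem (one_mem _) (mul_mem (ofNat_mem _ 432) (pull2_mem_gapped xTwist_mem N))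

/-- At m = 0 the convention 0⁻¹ = 0 gives the correct constant term. -/
theorem coeff_flog_one_sub (n m : ℕ) : MvPowerSeries.coeff (expo n m) (flog (1 - 𝕡)) =
    if n = 0 then -(m : ℂ)⁻¹ else 0 := by
  set L : Series2 := fun e => if e 0 = 0 then -(e 1 : ℂ)⁻¹ else 0 with hL
  have hLc : ∀ n m, MvPowerSeries.coeff (expo n m) L = if n = 0 then -(m : ℂ)⁻¹ else 0 := by
    intro n m
    change (if expo n m 0 = 0 then -(expo n m 1 : ℂ)⁻¹ else 0) = _
    rw [expo_zero, expo_one]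
  have h : flog (1 - 𝕡) = L := by
    apply eq_of_thetaP_eq
    · have h1 := mul_thetaP_flog constantCoeff_one_sub_X1
      rw [map_sub, thetaP_X1, Derivation.map_one_eq_zero, zero_sub] at h1
      apply mul_left_cancel₀ (ne_zero_of_constantCoeff_eq_one constantCoeff_one_sub_X1)
      rw [h1]
      apply ext_expo
      intro n m
      rw [sub_mul, one_mul, map_sub, coeff_thetaP_expo, hLc, ← mul_one 𝕡, ← mul_neg, mul_one 𝕡]
      cases m with
      | zero => rw [coeff_X1_mul_zero, coeff_X1_mul_zero]; simp
      | succ m =>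
        have hm : ((m : ℂ) + 1) * ((m : ℂ) + 1)⁻¹ = 1 :=
          mul_inv_cancel₀ (by exact_mod_cast m.succ_ne_zero)
        rw [coeff_X1_mul_succ, coeff_X1_mul_succ, coeff_thetaP_expo, hLc, map_neg, coeff_expo_one]
        by_cases hn : n = 0
        · rw [if_pos hn, if_pos hn]
          by_cases hm0 : m = 0
          · subst hm0; simp [hn]
          · have hm1 : (m : ℂ) * (m : ℂ)⁻¹ = 1 := mul_inv_cancel₀ (by exact_mod_cast hm0)
            rw [if_neg (by tauto)]
            push_cast
            linear_combination hm - hm1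
        · simp [hn]
    · rw [restrictHom_flog_one_sub]
      ext n
      rw [coeff_restrictHom]
      have : Finsupp.single 0 n = expo n 0 := by simp [expo]
      rw [this, hLc]
      simp
  rw [h, hLc]

/-- The low order terms of the genus zero potential. -/
theorem coeff_potential_zero {d n : ℕ} (h : d < n) :
    MvPowerSeries.coeff (expo d n) (evalT (potT 0)) = if d = 0 then ((n : ℂ) ^ 3)⁻¹ else 0 := by
  -- Modulo gapped series u is log(1 - p), so n² times the coefficient is 1/n for q-degree zero and
  -- vanishes for 0 < d < n.
  have h1 : thetaP (thetaP (evalT (potT 0))) = -uQ := by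
    rw [thetaP_evalT_potT_zero, thetaP_evalV_f, evalV_u]
  have h2 := congrArg (MvPowerSeries.coeff (expo d n)) h1
  rw [coeff_thetaP_expo, coeff_thetaP_expo, map_neg] at h2
  have h3 := uQ_sub_mem (n + 1) (expo d n) (by rw [expo_one]; omega)
    (by rw [expo_zero, expo_one]; exact h)
  rw [map_sub, coeff_flog_one_sub, sub_eq_zero] at h3
  rw [h3] at h2
  have hn : (n : ℂ) ≠ 0 := by exact_mod_cast (by omega : n ≠ 0)
  have h4 : (n : ℂ) * (n : ℂ)⁻¹ = 1 := mul_inv_cancel₀ hn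
  apply mul_left_cancel₀ (pow_ne_zero 2 hn)
  split_ifs at h2 ⊢
  · rw [pow_succ _ 2, mul_inv, ← mul_assoc _ _ (n : ℂ)⁻¹, mul_inv_cancel₀ (pow_ne_zero 2 hn),
      one_mul]
    linear_combination h2
  · linear_combination h2

/-- The low order terms of the genus one potential. -/
theorem coeff_potential_one {d n : ℕ} (h : d < n) :
    MvPowerSeries.coeff (expo d n) (evalT (potT 1)) = if d = 0 then (12 * (n : ℂ))⁻¹ else 0 := by
  have h3 := potential_one_mem (n + 1) (expo d n) (by rw [expo_one]; omega)
    (by rw [expo_zero, expo_one]; exact h)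
  rw [map_add, MvPowerSeries.coeff_smul, coeff_flog_one_sub] at h3
  rw [potential_one, dis0_eq]
  have h4 : ∀ f : Series2, MvPowerSeries.coeff (expo d n) (posPart f) =
      MvPowerSeries.coeff (expo d n) f := by
    intro f
    change (if expo d n 1 = 0 then 0 else _) = _
    rw [expo_one, if_neg (by omega)]
  rw [h4, MvPowerSeries.coeff_smul, eq_neg_of_add_eq_zero_left h3]
  split_ifs
  · rw [mul_inv]; ring
  · simp

/-! ### The multiple cover formula -/

/-- `∑_{k ∣ n} k ^ s B(n / k)(q ^ k)`. -/
def multiCover (s : ℤ) (B : ℕ → PowerSeries ℚ) (n : ℕ) : PowerSeries ℚ :=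
  ∑ k ∈ n.divisors, ((k : ℚ) ^ s) • PowerSeries.subst ((X : PowerSeries ℚ) ^ k) (B (n / k))

theorem coeff_multiCover (s : ℤ) (B : ℕ → PowerSeries ℚ) (n d : ℕ) :
    PowerSeries.coeff d (multiCover s B n) = ∑ k ∈ n.divisors,
      (k : ℚ) ^ s * if k ∣ d then PowerSeries.coeff (d / k) (B (n / k)) else 0 := by
  rw [multiCover, map_sum]
  refine Finset.sum_congr rfl fun k hk => ?_
  have hk0 : k ≠ 0 := by rintro rfl; simp at hk
  rw [PowerSeries.coeff_smul, PowerSeries.coeff_subst_X_pow hk0, smul_eq_mul]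
  rfl

theorem subst_X_pow_one (f : PowerSeries ℚ) : PowerSeries.subst ((X : PowerSeries ℚ) ^ 1) f = f := by
  rw [pow_one]; exact PowerSeries.X_subst f

theorem multiCover_eq (s : ℤ) (B : ℕ → PowerSeries ℚ) {n : ℕ} (hn : n ≠ 0) : multiCover s B n =
    B n + ∑ k ∈ n.divisors.erase 1,
      ((k : ℚ) ^ s) • PowerSeries.subst ((X : PowerSeries ℚ) ^ k) (B (n / k)) := by
  rw [multiCover, ← Finset.add_sum_erase _ _ (Nat.one_mem_divisors.mpr hn), subst_X_pow_one]
  simp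

theorem div_lt_of_mem_erase {n k : ℕ} (hk : k ∈ n.divisors.erase 1) : n / k < n := by
  rw [Finset.mem_erase, Nat.mem_divisors] at hk
  obtain ⟨h1, h2, h3⟩ := hk
  have : k ≠ 0 := by rintro rfl; exact h3 (zero_dvd_iff.mp h2)
  exact Nat.div_lt_self (Nat.pos_of_ne_zero h3) (by omega)

/-- The inverse of `multiCover`. -/
def unCover (s : ℤ) (Z : ℕ → PowerSeries ℚ) (n : ℕ) : PowerSeries ℚ :=
  Z n - ∑ k : {k // k ∈ n.divisors.erase 1},
    ((k.1 : ℚ) ^ s) • PowerSeries.subst ((X : PowerSeries ℚ) ^ k.1) (unCover s Z (n / k.1))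
termination_by n
decreasing_by exact div_lt_of_mem_erase k.2

theorem multiCover_unCover (s : ℤ) (Z : ℕ → PowerSeries ℚ) {n : ℕ} (hn : n ≠ 0) :
    multiCover s (unCover s Z) n = Z n := by
  rw [multiCover_eq s _ hn]
  nth_rewrite 1 [unCover]
  rw [Finset.sum_coe_sort (n.divisors.erase 1) (fun k => ((k : ℚ) ^ s) •
    PowerSeries.subst ((X : PowerSeries ℚ) ^ k) (unCover s Z (n / k)))]
  ring

/-- In degree less than n, the summand of a proper divisor k reads a coefficient of B_{n/k} of
degree less than n/k, which is zero. Only n-fold covers of B₁ remain. -/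
theorem coeff_multiCover_of_gap {s : ℤ} {B : ℕ → PowerSeries ℚ} {n d : ℕ} (hd : d < n)
    (h : ∀ m, 2 ≤ m → m ≤ n → ∀ d < m, PowerSeries.coeff d (B m) = 0) :
    PowerSeries.coeff d (multiCover s B n) =
      if d = 0 then (n : ℚ) ^ s * PowerSeries.coeff 0 (B 1) else 0 := by
  have hn : n ≠ 0 := by omega
  rw [coeff_multiCover, Finset.sum_eq_single n]
  · rw [Nat.div_self (Nat.pos_of_ne_zero hn)]
    by_cases h0 : d = 0
    · subst h0; simp
    · rw [if_neg (fun h => h0 (Nat.eq_zero_of_dvd_of_lt h hd)), if_neg h0, mul_zero]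
  · intro k hk hkn
    rw [Nat.mem_divisors] at hk
    split_ifs with hkd
    · obtain ⟨m, rfl⟩ := hk.1
      obtain ⟨j, rfl⟩ := hkd
      have hk0 : 0 < k := Nat.pos_of_ne_zero (by rintro rfl; simp at hn)
      have hm : m ≠ 1 := by rintro rfl; simp at hkn
      have hm0 : m ≠ 0 := by rintro rfl; simp at hn
      rw [Nat.mul_div_cancel_left _ hk0, Nat.mul_div_cancel_left _ hk0,
        h m (by omega) (Nat.le_mul_of_pos_left m hk0) j (Nat.lt_of_mul_lt_mul_left hd), mul_zero]
    · rw [mul_zero]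
  · intro h; exact absurd (Nat.mem_divisors_self n hn) h

/-- Converse by induction on n, since B_n enters its own multiple cover sum additively with
coefficient 1. -/
theorem gap_of_coeff_multiCover {s : ℤ} {B : ℕ → PowerSeries ℚ}
    (h : ∀ n d, d < n → PowerSeries.coeff d (multiCover s B n) =
      if d = 0 then (n : ℚ) ^ s * PowerSeries.coeff 0 (B 1) else 0) (n : ℕ) (hn : 2 ≤ n) :
    ∀ d < n, PowerSeries.coeff d (B n) = 0 := by
  induction n using Nat.strong_induction_on with
  | _ n ih =>
    intro d hd
    -- With B_n replaced by zero the gap holds up to n, and the low coefficients of the sum are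
    -- already the prescribed ones; so B_n contributes nothing to them.
    set B' : ℕ → PowerSeries ℚ := fun m => if m = n then 0 else B m with hB'
    have h1 : ∀ m, 2 ≤ m → m ≤ n → ∀ d < m, PowerSeries.coeff d (B' m) = 0 := by
      intro m h2 h3 d hd
      simp only [hB']
      split_ifs with h4
      · rw [map_zero]
      · exact ih m (by omega) h2 d hd
    have h2 := coeff_multiCover_of_gap (s := s) hd h1
    have h3 : multiCover s B n = multiCover s B' n + B n := by
      rw [multiCover_eq s B (by omega), multiCover_eq s B' (by omega)]
      have h4 : B' n = 0 := by simp [hB']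
      rw [h4, zero_add, add_comm]
      congr 1
      refine Finset.sum_congr rfl fun k hk => ?_
      have h5 := div_lt_of_mem_erase hk
      have h6 : B' (n / k) = B (n / k) := by simp only [hB']; rw [if_neg (by omega)]
      rw [h6]
    have h4 : B' 1 = B 1 := by simp only [hB']; rw [if_neg (by omega)]
    have h5 := h n d hd
    rw [h3, map_add, h2, h4] at h5
    linarith

theorem coeff_sincHalf (n : ℕ) : PowerSeries.coeff n sincHalf =
    PowerSeries.coeff (n + 1) (PowerSeries.sin ℚ) * (1 / 2) ^ n := by
  rw [sincHalf, PowerSeries.coeff_mk]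

theorem coeff_sincHalf_zero : PowerSeries.coeff 0 sincHalf = 1 := by
  rw [coeff_sincHalf, PowerSeries.sin, PowerSeries.coeff_mk]; simp
theorem coeff_sincHalf_one : PowerSeries.coeff 1 sincHalf = 0 := by
  rw [coeff_sincHalf, PowerSeries.sin, PowerSeries.coeff_mk]; simp
theorem coeff_sincHalf_two : PowerSeries.coeff 2 sincHalf = -1 / 24 := by
  rw [coeff_sincHalf, PowerSeries.sin, PowerSeries.coeff_mk]
  norm_num [Nat.factorial, show ¬ Even 3 by decide]

theorem constantCoeff_sincHalf : constantCoeff sincHalf = 1 := by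
  rw [← PowerSeries.coeff_zero_eq_constantCoeff_apply, coeff_sincHalf_zero]

theorem gvCoeff_zero_zero : gvCoeff 0 0 = 1 := by
  rw [gvCoeff]; simp [constantCoeff_sincHalf]
theorem gvCoeff_one_zero : gvCoeff 1 0 = 1 := by
  rw [gvCoeff]; simp [constantCoeff_sincHalf]

/-- From sin(t/2)/(t/2) = 1 - t²/24 + ⋯, whose inverse square is 1 + t²/12 + ⋯. -/
theorem gvCoeff_zero_one : gvCoeff 0 1 = 1 / 12 := by
  have h : sincHalf * sincHalf⁻¹ = 1 :=
    PowerSeries.mul_inv_cancel _ (by rw [constantCoeff_sincHalf]; exact one_ne_zero)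
  set b := sincHalf⁻¹ with hb
  have h0 : PowerSeries.coeff 0 b = 1 := by
    rw [PowerSeries.coeff_zero_eq_constantCoeff_apply, hb, PowerSeries.constantCoeff_inv,
      constantCoeff_sincHalf, inv_one]
  have h1 := congrArg (PowerSeries.coeff 1) h
  have h2 := congrArg (PowerSeries.coeff 2) h
  rw [PowerSeries.coeff_mul] at h1 h2
  simp only [Finset.Nat.antidiagonal_succ, Finset.Nat.antidiagonal_zero, Finset.sum_cons,
    Finset.map_singleton, Finset.sum_singleton, Function.Embedding.prodMap, Finset.map_cons,
    Function.Embedding.coeFn_mk, Prod.map, Function.Embedding.refl_apply, PowerSeries.coeff_one,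
    Nat.succ_eq_add_one, coeff_sincHalf_zero, coeff_sincHalf_one, coeff_sincHalf_two, h0,
    zero_add, Nat.reduceAdd] at h1 h2
  rw [gvCoeff, ← hb, mul_zero, pow_zero, one_mul, mul_one, pow_two, PowerSeries.coeff_mul]
  simp only [Finset.Nat.antidiagonal_succ, Finset.Nat.antidiagonal_zero, Finset.sum_cons,
    Finset.map_singleton, Finset.sum_singleton, Function.Embedding.prodMap, Finset.map_cons,
    Function.Embedding.coeFn_mk, Prod.map, Function.Embedding.refl_apply,
    Nat.succ_eq_add_one, h0, zero_add, Nat.reduceAdd]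
  norm_num at h1 h2
  rw [h1]
  linarith

theorem isBPS_one_iff {Z B : ℕ → ℕ → PowerSeries ℚ} : IsBPS 1 Z B ↔ ∀ n ≥ 1,
    Z 0 n = multiCover (-3) (B 0) n ∧
    Z 1 n = multiCover (-1) (fun m => (1 / 12 : ℚ) • B 0 m + B 1 m) n := by
  have e0 : ∀ n : ℕ, ∑ k ∈ n.divisors, ((k : ℚ) ^ (2 * ((0 : ℕ) : ℤ) - 3)) •
      ∑ h ∈ Finset.range (0 + 1), gvCoeff h (0 - h) •
        PowerSeries.subst ((X : PowerSeries ℚ) ^ k) (B h (n / k)) = multiCover (-3) (B 0) n := by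
    intro n
    refine Finset.sum_congr rfl fun k _ => ?_
    rw [Finset.sum_range_one, gvCoeff_zero_zero, one_smul]
    rfl
  have e1 : ∀ n : ℕ, ∑ k ∈ n.divisors, ((k : ℚ) ^ (2 * ((1 : ℕ) : ℤ) - 3)) •
      ∑ h ∈ Finset.range (1 + 1), gvCoeff h (1 - h) •
        PowerSeries.subst ((X : PowerSeries ℚ) ^ k) (B h (n / k)) =
      multiCover (-1) (fun m => (1 / 12 : ℚ) • B 0 m + B 1 m) n := by
    intro n
    refine Finset.sum_congr rfl fun k hk => ?_
    have hk0 : k ≠ 0 := by rintro rfl; simp at hk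
    have hs : PowerSeries.HasSubst ((X : PowerSeries ℚ) ^ k) := PowerSeries.HasSubst.X_pow hk0
    rw [Finset.sum_range_succ, Finset.sum_range_one, Nat.sub_zero, Nat.sub_self, gvCoeff_zero_one,
      gvCoeff_one_zero, one_smul, PowerSeries.subst_add hs, PowerSeries.subst_smul hs]
    rfl
  constructor
  · intro h n hn
    exact ⟨(h 0 zero_le_one n hn).trans (e0 n), (h 1 le_rfl n hn).trans (e1 n)⟩
  · intro h g hg n hn
    interval_cases g
    · exact (h n hn).1.trans (e0 n).symm
    · exact (h n hn).2.trans (e1 n).symm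

/-- The low order coefficients forced by the gap conditions. -/
def HasLowTerms (Z : ℕ → ℕ → PowerSeries ℚ) : Prop :=
  ∀ n d, d < n → PowerSeries.coeff d (Z 0 n) = (if d = 0 then ((n : ℚ) ^ 3)⁻¹ else 0) ∧
    PowerSeries.coeff d (Z 1 n) = if d = 0 then (12 * (n : ℚ))⁻¹ else 0

/-- The constant terms of B_{0;1} and B_{1;1} are 1 and 0, by the initial value and the gap. In
genus one the combination B₁ + B₀/12 therefore starts with 1/12. -/
theorem hasLowTerms_of_gap {Z B : ℕ → ℕ → PowerSeries ℚ} (h01 : PowerSeries.coeff 0 (Z 0 1) = 1)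
    (hB : IsBPS 1 Z B) (hG : HasGap 1 B) : HasLowTerms Z := by
  rw [isBPS_one_iff] at hB
  intro n d hd
  obtain ⟨h0, h1⟩ := hB n (by omega)
  have hB1 : PowerSeries.coeff 0 (B 0 1) = 1 := by
    have := (hB 1 le_rfl).1
    rw [← h01, this, multiCover_eq _ _ one_ne_zero]
    simp
  have hB2 : PowerSeries.coeff 0 (B 1 1) = 0 := hG.2 1 le_rfl 0 zero_lt_one
  rw [h0, h1, coeff_multiCover_of_gap hd (fun m hm _ => hG.1 0 zero_le_one m hm),
    coeff_multiCover_of_gap hd]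
  · refine ⟨?_, ?_⟩
    · rw [hB1, mul_one, zpow_neg]; rfl
    · rw [map_add, PowerSeries.coeff_smul, hB1, hB2, zpow_neg, zpow_one, mul_inv]
      split_ifs
      · simp; ring
      · rfl
  · intro m hm _ d hd
    rw [map_add, PowerSeries.coeff_smul, hG.1 0 zero_le_one m hm d hd, hG.1 1 le_rfl m hm d hd]
    simp

theorem exists_gap {Z : ℕ → ℕ → PowerSeries ℚ} (h : HasLowTerms Z) :
    ∃ B, IsBPS 1 Z B ∧ HasGap 1 B := by
  set A0 := unCover (-3) (Z 0) with hA0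
  set A1 := unCover (-1) (Z 1) with hA1
  have c0 : ∀ n, n ≠ 0 → multiCover (-3) A0 n = Z 0 n := fun n hn => multiCover_unCover _ _ hn
  have c1 : ∀ n, n ≠ 0 → multiCover (-1) A1 n = Z 1 n := fun n hn => multiCover_unCover _ _ hn
  have a0 : PowerSeries.coeff 0 (A0 1) = 1 := by
    have h1 := c0 1 one_ne_zero
    rw [multiCover_eq _ _ one_ne_zero] at h1
    simp only [Nat.divisors_one, Finset.erase_singleton, Finset.sum_empty, add_zero] at h1
    rw [h1, (h 1 0 zero_lt_one).1]; simp
  have a1 : PowerSeries.coeff 0 (A1 1) = 1 / 12 := by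
    have h1 := c1 1 one_ne_zero
    rw [multiCover_eq _ _ one_ne_zero] at h1
    simp only [Nat.divisors_one, Finset.erase_singleton, Finset.sum_empty, add_zero] at h1
    rw [h1, (h 1 0 zero_lt_one).2]; simp
  have g0 := gap_of_coeff_multiCover (s := -3) (B := A0) (fun n d hd => by
    rw [c0 n (by omega), (h n d hd).1, a0, mul_one, zpow_neg]; rfl)
  have g1 := gap_of_coeff_multiCover (s := -1) (B := A1) (fun n d hd => by
    rw [c1 n (by omega), (h n d hd).2, a1, zpow_neg, zpow_one, mul_inv]
    split_ifs
    · ring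
    · rfl)
  -- The inverted cover in genus one yields B₁ + B₀/12; subtracting the genus zero part also cancels
  -- the constant term 1/12 for n = 1.
  refine ⟨fun g n => if g = 0 then A0 n else A1 n - (1 / 12 : ℚ) • A0 n, ?_, ?_, ?_⟩
  · rw [isBPS_one_iff]
    intro n hn
    refine ⟨(c0 n (by omega)).symm, ?_⟩
    rw [← c1 n (by omega)]
    congr 1
    funext m
    simp
  · intro g hg n hn d hd
    interval_cases g
    · exact g0 n hn d hd
    · simp only [one_ne_zero, if_false, map_sub, PowerSeries.coeff_smul, g0 n hn d hd, g1 n hn d hd]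
      simp
  · intro g hg d hd
    interval_cases g
    · omega
    · interval_cases d
      simp only [one_ne_zero, if_false, map_sub, PowerSeries.coeff_smul, a0, a1]
      simp

end

section

open PowerSeries (X C constantCoeff)

/-! ### Existence and uniqueness of the solution of the anomaly equation -/

/-- The solution of the anomaly equation. -/
def zPot (g n : ℕ) : PowerSeries ℚ := evalE (potCoeff g n) * etaProd⁻¹ ^ (12 * n)

theorem coeff_evalT_potT (g : ℕ) (e : Fin 2 →₀ ℕ) : MvPowerSeries.coeff e (evalT (potT g)) =
    ((PowerSeries.coeff (e 0) (zPot g (e 1)) : ℚ) : ℂ) := coeff_evalT _ _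

theorem hasLowTerms_zPot : HasLowTerms zPot := by
  intro n d h
  have e0 : (expo d n) 0 = d := by simp [expo]
  have e1 : (expo d n) 1 = n := by simp [expo]
  have h0 := coeff_potential_zero h
  have h1 := coeff_potential_one h
  rw [coeff_evalT_potT, e0, e1] at h0 h1
  constructor
  · apply Rat.cast_injective (α := ℂ)
    rw [h0]; split_ifs <;> push_cast <;> rfl
  · apply Rat.cast_injective (α := ℂ)
    rw [h1]; split_ifs <;> push_cast <;> rfl

theorem evalE_mul (P R : QMod) : evalE (P * R) = evalE P * evalE R := map_mul _ _ _
theorem evalE_add (P R : QMod) : evalE (P + R) = evalE P + evalE R := map_add _ _ _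
theorem evalE_sub (P R : QMod) : evalE (P - R) = evalE P - evalE R := map_sub _ _ _
theorem evalE_C_mul (a : ℚ) (P : QMod) : evalE (MvPolynomial.C a * P) = a • evalE P := by
  rw [evalE, evalE, ← MvPolynomial.smul_eq_C_mul, map_smul]
theorem evalE_natCast_mul (m : ℕ) (P : QMod) : evalE ((m : QMod) * P) = m • evalE P := by
  rw [evalE, evalE, map_mul, map_natCast, nsmul_eq_mul]
theorem evalE_sum (s : Finset ℕ) (f : ℕ → QMod) : evalE (∑ i ∈ s, f i) = ∑ i ∈ s, evalE (f i) :=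
  map_sum _ _ _

theorem smul_zPot_mul_zPot (g h : ℕ) {n s : ℕ} (hs : s ∈ Finset.Ico 1 n) :
    evalE ((s : QMod) * ((n - s : ℕ) : QMod) * (potCoeff g s * potCoeff h (n - s))) *
      etaProd⁻¹ ^ (12 * n) = (s * (n - s) : ℕ) • (zPot g s * zPot h (n - s)) := by
  rw [Finset.mem_Ico] at hs
  have h1 : 12 * n = 12 * s + 12 * (n - s) := by omega
  rw [h1, ← Nat.cast_mul, evalE_natCast_mul, evalE_mul, pow_add, zPot, zPot, smul_mul_assoc]
  congr 1
  ring

theorem sum_flip (Z W : ℕ → PowerSeries ℚ) (n : ℕ) :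
    ∑ s ∈ Finset.Ico 1 n, (s * (n - s) : ℕ) • (Z s * W (n - s)) =
      ∑ s ∈ Finset.Ico 1 n, (s * (n - s) : ℕ) • (W s * Z (n - s)) := by
  refine Finset.sum_nbij' (fun s => n - s) (fun s => n - s) ?_ ?_ ?_ ?_ ?_
  · intro s hs; rw [Finset.mem_Ico] at hs ⊢; omega
  · intro s hs; rw [Finset.mem_Ico] at hs ⊢; omega
  · intro s hs; rw [Finset.mem_Ico] at hs; omega
  · intro s hs; rw [Finset.mem_Ico] at hs; omega
  · intro s hs
    rw [Finset.mem_Ico] at hs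
    have h : n - (n - s) = s := by omega
    rw [h, mul_comm s, mul_comm (Z s)]

/-- The right hand side of the anomaly equation. -/
def anomalySum (Z : ℕ → ℕ → PowerSeries ℚ) (g n : ℕ) : PowerSeries ℚ :=
  (1 / 24 : ℚ) • (∑ a ∈ Finset.HasAntidiagonal.antidiagonal g, ∑ s ∈ Finset.Ico 1 n,
    (s * (n - s) : ℕ) • (Z a.1 s * Z a.2 (n - s))) +
  ((n * (n + 1) : ℚ) / 24) • (if g = 0 then 0 else Z (g - 1) n)

theorem anomaly_zPot {g : ℕ} (hg : g ≤ 1) (n : ℕ) :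
    evalE (MvPolynomial.pderiv 0 (potCoeff g n)) * etaProd⁻¹ ^ (12 * n) = anomalySum zPot g n := by
  have key : ∀ g h : ℕ, evalE (∑ s ∈ Finset.Ico 1 n,
      (s : QMod) * ((n - s : ℕ) : QMod) * (potCoeff g s * potCoeff h (n - s))) *
      etaProd⁻¹ ^ (12 * n) = ∑ s ∈ Finset.Ico 1 n, (s * (n - s) : ℕ) •
        (zPot g s * zPot h (n - s)) := by
    intro g h
    rw [evalE_sum, Finset.sum_mul]
    exact Finset.sum_congr rfl fun s hs => smul_zPot_mul_zPot g h hs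
  interval_cases g
  · have h := delE2_potCoeff_zero n
    rw [delE2] at h
    rw [h, evalE_C_mul, smul_mul_assoc, key, anomalySum, if_pos rfl, smul_zero, add_zero,
      Finset.Nat.antidiagonal_zero, Finset.sum_singleton]
  · have h := delE2_potCoeff_one n
    rw [delE2] at h
    have h2 : (n : QMod) * ((n : QMod) + 1) * potCoeff 0 n =
        MvPolynomial.C ((n : ℚ) * (n + 1)) * potCoeff 0 n := by simp
    rw [h, evalE_add, add_mul, evalE_C_mul, smul_mul_assoc, key, h2, evalE_C_mul, evalE_C_mul,
      smul_smul, smul_mul_assoc, anomalySum, if_neg one_ne_zero, Finset.Nat.antidiagonal_succ,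
      Finset.sum_cons, Finset.Nat.antidiagonal_zero, Finset.map_singleton, Finset.sum_singleton]
    simp only [Function.Embedding.prodMap, Function.Embedding.coeFn_mk, Prod.map,
      Function.Embedding.refl_apply, Nat.succ_eq_add_one, zero_add, Nat.sub_self]
    rw [sum_flip (zPot 1) (zPot 0), ← zPot, ← two_smul ℚ, smul_smul]
    congr 2 <;> ring

theorem zPot_zero_one : zPot 0 1 = E4 * etaProd⁻¹ ^ 12 := by
  rw [zPot, potCoeff_zero_one, evalE, MvPolynomial.aeval_X]; rfl

theorem isAnomalySolution_zPot : IsAnomalySolution 1 zPot :=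
  ⟨potCoeff, {
    weight := fun g hg n hn => isWeightedHomogeneous_potCoeff g hg n hn
    form := fun _ _ _ _ => rfl
    initial := zPot_zero_one
    anomaly := fun _ hg n _ => anomaly_zPot hg n
    gap := exists_gap hasLowTerms_zPot }⟩

theorem etaProd_inv_ne_zero : etaProd⁻¹ ≠ 0 := by
  intro h
  have h1 := congrArg constantCoeff h
  rw [PowerSeries.constantCoeff_inv, constantCoeff_etaProd] at h1
  simp at h1

/-- The difference of the numerators has zero derivative in E₂, hence is modular of weight 2g + 6n -
2, and it vanishes below degree n. This exceeds the Sturm bound because (2g + 6n - 2)/12 < n. -/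
theorem eq_zPot_of_anomaly {g n : ℕ} (hg : g ≤ 1) (hn : 1 ≤ n) {P : QMod} {Z : ℕ → ℕ → PowerSeries ℚ}
    (hP : MvPolynomial.IsWeightedHomogeneous ![2, 4, 6] P (2 * g + 6 * n - 2))
    (hZ : Z g n = evalE P * etaProd⁻¹ ^ (12 * n))
    (ha : evalE (MvPolynomial.pderiv 0 P) * etaProd⁻¹ ^ (12 * n) = anomalySum zPot g n)
    (hl : ∀ d < n, PowerSeries.coeff d (Z g n) = PowerSeries.coeff d (zPot g n)) :
    Z g n = zPot g n := by
  have hη : etaProd⁻¹ ^ (12 * n) ≠ 0 := pow_ne_zero _ etaProd_inv_ne_zero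
  have hR : MvPolynomial.IsWeightedHomogeneous ![2, 4, 6] (P - potCoeff g n) (2 * g + 6 * n - 2) :=
    (MvPolynomial.weightedHomogeneousSubmodule ℚ ![2, 4, 6] _).sub_mem hP
      (isWeightedHomogeneous_potCoeff g hg n hn)
  have hd : MvPolynomial.IsWeightedHomogeneous ![2, 4, 6]
      (MvPolynomial.pderiv 0 (P - potCoeff g n)) (2 * g + 6 * n - 4) :=
    hR.pderiv (by simp; omega)
  have h0 : evalE (MvPolynomial.pderiv 0 (P - potCoeff g n)) = 0 := by
    rw [map_sub, evalE_sub, sub_eq_zero]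
    exact mul_right_cancel₀ hη (ha.trans (anomaly_zPot hg n).symm)
  have he : evalE (P - potCoeff g n) * etaProd⁻¹ ^ (12 * n) = Z g n - zPot g n := by
    rw [evalE_sub, sub_mul, ← hZ, zPot]
  have hc : evalE (P - potCoeff g n) = (Z g n - zPot g n) * etaProd ^ (12 * n) := by
    rw [← he, mul_assoc, ← mul_pow, PowerSeries.inv_mul_cancel _ (by
      rw [constantCoeff_etaProd]; exact one_ne_zero), one_pow, mul_one]
  have h2 : evalE (P - potCoeff g n) = 0 := by
    refine evalE_eq_zero hR hd h0 fun d hd => ?_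
    have hdn : d < n := by omega
    rw [hc, PowerSeries.coeff_mul]
    refine Finset.sum_eq_zero fun a ha => ?_
    rw [Finset.HasAntidiagonal.mem_antidiagonal] at ha
    rw [map_sub, hl a.1 (by omega), sub_self, zero_mul]
  rw [h2, zero_mul] at he
  exact (sub_eq_zero.mp he.symm)

theorem anomalySum_congr {Z W : ℕ → ℕ → PowerSeries ℚ} {g n : ℕ}
    (h : ∀ h ≤ g, ∀ s, 1 ≤ s → (h < g ∨ s < n) → Z h s = W h s) (hn : 1 ≤ n) :
    anomalySum Z g n = anomalySum W g n := by
  rw [anomalySum, anomalySum]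
  congr 2
  · refine Finset.sum_congr rfl fun a ha => Finset.sum_congr rfl fun s hs => ?_
    rw [Finset.HasAntidiagonal.mem_antidiagonal] at ha
    rw [Finset.mem_Ico] at hs
    rw [h a.1 (by omega) s hs.1 (Or.inr hs.2),
      h a.2 (by omega) (n - s) (by omega) (Or.inr (by omega))]
  · split_ifs with hg
    · rfl
    · exact h _ (by omega) n hn (Or.inl (by omega))

/-- Induction on the genus and then on n: the anomaly equation fixes the derivative in E₂ from
earlier terms, and the gap conditions fix the low coefficients. -/
theorem IsAnomalySolution.eq_zPot {Z : ℕ → ℕ → PowerSeries ℚ} (hZ : IsAnomalySolution 1 Z) :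
    ∀ g ≤ 1, ∀ n, 1 ≤ n → Z g n = zPot g n := by
  obtain ⟨P, hP⟩ := hZ
  obtain ⟨B, hB, hG⟩ := hP.gap
  have h01 : PowerSeries.coeff 0 (Z 0 1) = 1 := by
    rw [hP.initial, ← zPot_zero_one, (hasLowTerms_zPot 1 0 zero_lt_one).1]; simp
  have hL := hasLowTerms_of_gap h01 hB hG
  have hl : ∀ g ≤ 1, ∀ n, ∀ d < n,
      PowerSeries.coeff d (Z g n) = PowerSeries.coeff d (zPot g n) := by
    intro g hg n d hd
    interval_cases g
    · rw [(hL n d hd).1, (hasLowTerms_zPot n d hd).1]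
    · rw [(hL n d hd).2, (hasLowTerms_zPot n d hd).2]
  intro g
  induction g using Nat.strong_induction_on with
  | _ g ihg =>
    intro hg n
    induction n using Nat.strong_induction_on with
    | _ n ihn =>
      intro hn
      refine eq_zPot_of_anomaly hg hn (hP.weight g hg n hn) (hP.form g hg n hn)
        ((hP.anomaly g hg n hn).trans (anomalySum_congr ?_ hn)) (hl g hg n)
      intro h hh s hs hlt
      rcases hh.lt_or_eq with h1 | rfl
      · exact ihg h h1 (by omega) s hs
      · exact ihn s (by omega) hs

theorem genF_eq_evalT {Z : ℕ → ℕ → PowerSeries ℚ} (hZ : IsAnomalySolution 1 Z) {g : ℕ}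
    (hg : g ≤ 1) : genF Z g = evalT (potT g) := by
  ext e
  rw [coeff_evalT_potT]
  change (if e 1 = 0 then 0 else ((PowerSeries.coeff (e 0) (Z g (e 1)) : ℚ) : ℂ)) = _
  split_ifs with h
  · have h0 : evalE 0 = 0 := map_zero _
    rw [h, zPot, potCoeff_zero_right, h0, zero_mul, map_zero (PowerSeries.coeff (e 0)), Rat.cast_zero]
  · rw [hZ.eq_zPot g hg _ (by omega)]

end

section

open MvPolynomial (X C coeff monomial)

/-! ### The symbol calculus for differential operators -/

/-- The operator has order less than `n`. -/
def OrderLT (n : ℕ) (D : DiffOp) : Prop := ∀ k : Fin 2 →₀ ℕ, n ≤ k.degree → coeff k D = 0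

theorem OrderLT.add {n : ℕ} {D E : DiffOp} (hD : OrderLT n D) (hE : OrderLT n E) :
    OrderLT n (D + E) := fun k hk => by rw [MvPolynomial.coeff_add, hD k hk, hE k hk, add_zero]

theorem OrderLT.neg {n : ℕ} {D : DiffOp} (hD : OrderLT n D) : OrderLT n (-D) :=
  fun k hk => by rw [MvPolynomial.coeff_neg, hD k hk, neg_zero]

theorem OrderLT.of_isHomogeneous {m n : ℕ} {D : DiffOp} (hD : D.IsHomogeneous m) (h : m < n) :
    OrderLT n D := fun k hk => hD.coeff_eq_zero (by omega)

theorem OrderLT.mono {m n : ℕ} {D : DiffOp} (hD : OrderLT m D) (h : m ≤ n) : OrderLT n D :=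
  fun k hk => hD k (h.trans hk)

theorem OrderLT.C_mul {n : ℕ} {D : DiffOp} (hD : OrderLT n D) (a : MvPolynomial (Fin 2) ℂ) :
    OrderLT n (C a * D) := fun k hk => by rw [MvPolynomial.coeff_C_mul, hD k hk, mul_zero]

theorem OrderLT.X_mul {n : ℕ} {D : DiffOp} (hD : OrderLT n D) (i : Fin 2) :
    OrderLT (n + 1) (X i * D) := by
  classical
  intro k hk
  rw [MvPolynomial.coeff_X_mul']
  split_ifs with h
  · refine hD _ ?_
    have h1 : (k - Finsupp.single i 1).degree + (Finsupp.single i 1).degree = k.degree := by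
      rw [← map_add]
      congr 1
      refine tsub_add_cancel_of_le (Finsupp.single_le_iff.mpr ?_)
      exact Nat.one_le_iff_ne_zero.mpr (Finsupp.mem_support_iff.mp h)
    rw [Finsupp.degree_single] at h1
    omega
  · rfl

/-- Moving θ_i past the coefficients produces one extra operator, whose coefficients are derivatives
of those of `D`, so its order is not larger than that of `D`. -/
theorem theta_act (i : Fin 2) (D : DiffOp) : ∃ D' : DiffOp,
    (∀ k, coeff k D' = X i * MvPolynomial.pderiv i (coeff k D)) ∧
    ∀ F, theta i (D.act F) = DiffOp.act (X i * D + D') F := by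
  classical
  induction D using MvPolynomial.induction_on' with
  | monomial k a =>
    refine ⟨monomial k (X i * MvPolynomial.pderiv i a), fun l => ?_, fun F => ?_⟩
    · rw [MvPolynomial.coeff_monomial, MvPolynomial.coeff_monomial]
      split_ifs <;> simp
    · rw [act_monomial, theta_mul, theta_C, act_add, act_monomial, mul_comm (X i), add_comm]
      have h1 : thetaSeries i (a : Series2) =
          ((X i * MvPolynomial.pderiv i a : MvPolynomial (Fin 2) ℂ) : Series2) := by
        rw [MvPolynomial.coe_mul, MvPolynomial.coe_X, ← MvPowerSeries.pderiv_coe]; rfl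
      have h2 : DiffOp.act (monomial k a * X i) F = C (a : Series2) *
          theta i ((theta 0)^[k 0] ((theta 1)^[k 1] F)) := by
        have hc : ∀ n F, (theta 0)^[n] (theta 1 F) = theta 1 ((theta 0)^[n] F) := by
          intro n
          induction n with
          | zero => exact fun _ => rfl
          | succ n ih =>
            intro F
            rw [Function.iterate_succ_apply, theta_comm, ih, Function.iterate_succ_apply]
        fin_cases i
        · change DiffOp.act (monomial k a * X 0) F = _ * theta 0 _
          rw [act_mul_X_zero, act_monomial, iterate_theta_comm, ← Function.iterate_succ_apply,
            Function.iterate_succ_apply']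
        · change DiffOp.act (monomial k a * X 1) F = _ * theta 1 _
          rw [act_mul_X_one, act_monomial, ← Function.iterate_succ_apply,
            Function.iterate_succ_apply', hc]
      rw [h1, h2, add_comm]
  | add D E hD hE =>
    obtain ⟨D', hD1, hD2⟩ := hD
    obtain ⟨E', hE1, hE2⟩ := hE
    refine ⟨D' + E', fun k => ?_, fun F => ?_⟩
    · rw [MvPolynomial.coeff_add, MvPolynomial.coeff_add, hD1, hE1, map_add, mul_add]
    · rw [act_add, theta_add, hD2, hE2, ← act_add]
      congr 1; ring

/-- The transformation `T` of logarithmic series is given by a differential operator of order at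
most `n` whose part of order `n` is `s`. -/
def HasSymbol (n : ℕ) (s : DiffOp) (T : LogSeries → LogSeries) : Prop :=
  s.IsHomogeneous n ∧ ∃ E : DiffOp, OrderLT n E ∧ ∀ F, T F = DiffOp.act (s + E) F

variable {m n : ℕ} {s t : DiffOp} {T U : LogSeries → LogSeries}

theorem HasSymbol.add (hT : HasSymbol n s T) (hU : HasSymbol n t U) :
    HasSymbol n (s + t) fun F => T F + U F := by
  obtain ⟨hs, D, hD, h1⟩ := hT
  obtain ⟨ht, E, hE, h2⟩ := hU
  exact ⟨hs.add ht, D + E, hD.add hE, fun F => by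
    change T F + U F = _
    rw [h1, h2, ← act_add]; congr 1; ring⟩

theorem HasSymbol.neg (hT : HasSymbol n s T) : HasSymbol n (-s) fun F => -T F := by
  obtain ⟨hs, D, hD, h1⟩ := hT
  exact ⟨hs.neg, -D, hD.neg, fun F => by
    change -T F = _
    rw [h1, ← act_neg]; congr 1; ring⟩

theorem HasSymbol.sub (hT : HasSymbol n s T) (hU : HasSymbol n t U) :
    HasSymbol n (s - t) fun F => T F - U F := by
  have := hT.add hU.neg
  simpa only [← sub_eq_add_neg] using this

theorem HasSymbol.congr (hT : HasSymbol n s T) (h : ∀ F, U F = T F) : HasSymbol n s U :=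
  ⟨hT.1, hT.2.choose, hT.2.choose_spec.1, fun F => (h F).trans (hT.2.choose_spec.2 F)⟩

theorem HasSymbol.zero (n : ℕ) : HasSymbol n 0 fun _ => 0 :=
  ⟨MvPolynomial.isHomogeneous_zero _ _ _, 0, fun _ _ => rfl, fun F => by
    rw [add_zero]; simp [DiffOp.act]⟩

theorem HasSymbol.weaken (hT : HasSymbol m s T) (h : m < n) : HasSymbol n 0 T := by
  obtain ⟨hs, D, hD, h1⟩ := hT
  exact ⟨MvPolynomial.isHomogeneous_zero _ _ _, s + D,
    (OrderLT.of_isHomogeneous hs h).add (hD.mono h.le), fun F => by rw [h1, zero_add]⟩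

theorem HasSymbol.sum {J : Type*} (S : Finset J) {s : J → DiffOp} {T : J → LogSeries → LogSeries}
    (h : ∀ j ∈ S, HasSymbol n (s j) (T j)) :
    HasSymbol n (∑ j ∈ S, s j) fun F => ∑ j ∈ S, T j F := by
  classical
  induction S using Finset.induction_on with
  | empty => exact HasSymbol.zero n
  | insert a S ha ih =>
    simp only [Finset.sum_insert ha]
    exact (h a (Finset.mem_insert_self _ _)).add
      (ih fun j hj => h j (Finset.mem_insert_of_mem hj))

theorem HasSymbol.id : HasSymbol 0 1 fun F => F :=
  ⟨MvPolynomial.isHomogeneous_one _ _, 0, fun _ _ => rfl, fun F => by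
    have := act_C 1 F
    rw [add_zero]; simpa using this.symm⟩

theorem HasSymbol.C_mul (hT : HasSymbol n s T) (a : MvPolynomial (Fin 2) ℂ) :
    HasSymbol n (C a * s) fun F => C (a : Series2) * T F := by
  obtain ⟨hs, D, hD, h1⟩ := hT
  refine ⟨by simpa using hs.C_mul a, C a * D, hD.C_mul a, fun F => ?_⟩
  change C (a : Series2) * T F = _
  rw [h1, ← act_C_mul, mul_add]

theorem HasSymbol.theta (hT : HasSymbol n s T) (i : Fin 2) :
    HasSymbol (n + 1) (X i * s) fun F => theta i (T F) := by
  obtain ⟨hs, D, hD, h1⟩ := hT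
  obtain ⟨D', h2, h3⟩ := theta_act i (s + D)
  refine ⟨by simpa [add_comm] using (MvPolynomial.isHomogeneous_X _ i).mul hs, X i * D + D',
    (hD.X_mul i).add fun k hk => ?_, fun F => ?_⟩
  · rw [h2, MvPolynomial.coeff_add, hD k (by omega), hs.coeff_eq_zero (by omega)]
    simp
  · change HalfK3.theta i (T F) = _
    rw [h1, h3]
    have h4 : X i * (s + D) + D' = X i * s + (X i * D + D') := by ring
    rw [h4]

theorem HasSymbol.iterate_theta (hT : HasSymbol n s T) (i : Fin 2) (j : ℕ) :
    HasSymbol (n + j) (X i ^ j * s) fun F => (HalfK3.theta i)^[j] (T F) := by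
  induction j with
  | zero => rw [pow_zero, one_mul]; exact hT
  | succ j ih =>
    rw [pow_succ', mul_assoc]
    exact (ih.theta i).congr fun F => Function.iterate_succ_apply' _ _ _

theorem HasSymbol.act_monomial (hT : HasSymbol n s T) (k : Fin 2 →₀ ℕ)
    (a : MvPolynomial (Fin 2) ℂ) : HasSymbol (n + k.degree) (monomial k a * s)
      fun F => DiffOp.act (monomial k a) (T F) := by
  have h := ((hT.iterate_theta 1 (k 1)).iterate_theta 0 (k 0)).C_mul a
  have hd : k.degree = k 1 + k 0 := by
    rw [Finsupp.degree_eq_sum, Fin.sum_univ_two, add_comm]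
  have hm : (monomial k a * s : DiffOp) = C a * (X 0 ^ k 0 * (X 1 ^ k 1 * s)) := by
    rw [MvPolynomial.monomial_eq, Finsupp.prod_fintype _ _ (by simp), Fin.prod_univ_two]
    ring
  rw [hd, hm, ← add_assoc]
  exact h.congr fun F => HalfK3.act_monomial k a (T F)

theorem act_sum {J : Type*} (S : Finset J) (f : J → DiffOp) (F : LogSeries) :
    DiffOp.act (∑ j ∈ S, f j) F = ∑ j ∈ S, DiffOp.act (f j) F := by
  classical
  induction S using Finset.induction_on with
  | empty => simp [DiffOp.act]
  | insert a S ha ih => rw [Finset.sum_insert ha, Finset.sum_insert ha, act_add, ih]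

theorem HasSymbol.act_orderLT (hT : HasSymbol n s T) {D : DiffOp} (hD : OrderLT m D) :
    HasSymbol (n + m) 0 fun F => D.act (T F) := by
  have h := HasSymbol.sum (n := n + m) D.support (s := fun _ => 0)
    (T := fun k F => DiffOp.act (monomial k (coeff k D)) (T F)) fun k hk => by
      refine (hT.act_monomial k (coeff k D)).weaken ?_
      have : k.degree < m := by
        by_contra h
        exact (MvPolynomial.mem_support_iff.mp hk) (hD k (by omega))
      omega
  rw [Finset.sum_const_zero] at h
  exact h.congr fun F => by rw [← act_sum, MvPolynomial.support_sum_monomial_coeff]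

theorem HasSymbol.act_isHomogeneous (hT : HasSymbol n s T) {D : DiffOp} (hD : D.IsHomogeneous m) :
    HasSymbol (n + m) (D * s) fun F => D.act (T F) := by
  have h := HasSymbol.sum (n := n + m) D.support (s := fun k => monomial k (coeff k D) * s)
    (T := fun k F => DiffOp.act (monomial k (coeff k D)) (T F)) fun k hk => by
      have : k.degree = m := by
        by_contra h
        exact (MvPolynomial.mem_support_iff.mp hk) (hD.coeff_eq_zero h)
      rw [← this]
      exact hT.act_monomial k (coeff k D)
  rw [← Finset.sum_mul, MvPolynomial.support_sum_monomial_coeff] at h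
  exact h.congr fun F => by rw [← act_sum, MvPolynomial.support_sum_monomial_coeff]

/-- Symbols multiply under composition because commutators of θ_i with the coefficients lower the
order. -/
theorem HasSymbol.comp (hT : HasSymbol m t T) (hU : HasSymbol n s U) :
    HasSymbol (n + m) (t * s) fun F => T (U F) := by
  obtain ⟨ht, D, hD, h1⟩ := hT
  have h := (hU.act_isHomogeneous ht).add (hU.act_orderLT hD)
  rw [add_zero] at h
  exact h.congr fun F => by rw [h1, act_add]

/-! ### Faithfulness -/

theorem iterate_theta_X_pow (i : Fin 2) (a b j : ℕ) : (theta i)^[j]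
    (C (MvPowerSeries.X 0 ^ a * MvPowerSeries.X 1 ^ b : Series2)) =
    C ((MvPowerSeries.C ((![(a : ℂ), b] i) ^ j) : Series2) *
      (MvPowerSeries.X 0 ^ a * MvPowerSeries.X 1 ^ b : Series2)) := by
  have hx : ∀ (i l : Fin 2) (a : ℕ), thetaSeries i ((MvPowerSeries.X l : Series2) ^ a) =
      if i = l then (a : Series2) * MvPowerSeries.X l ^ a else 0 := by
    intro i l a
    rw [Derivation.leibniz_pow]
    have : thetaSeries i (MvPowerSeries.X l : Series2) = if i = l then MvPowerSeries.X l else 0 := by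
      change (MvPowerSeries.X i : Series2) • MvPowerSeries.pderiv ℂ i (MvPowerSeries.X l) = _
      rw [MvPowerSeries.pderiv_X, smul_eq_mul]
      split_ifs with h
      · subst h; simp
      · have : l ≠ i := fun h' => h h'.symm
        simp [this]
    rw [this]
    split_ifs
    · cases a with
      | zero => simp
      | succ a => simp [pow_succ]
    · simp
  induction j with
  | zero => simp
  | succ j ih =>
    rw [Function.iterate_succ_apply', ih, theta_C]
    congr 1
    have hC : ∀ c : ℂ, thetaSeries i (MvPowerSeries.C c : Series2) = 0 := fun c =>
      (thetaSeries i).map_algebraMap c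
    rw [Derivation.leibniz, hC, smul_zero, add_zero, Derivation.leibniz, hx, hx, pow_succ, map_mul]
    fin_cases i
    · simp; ring
    · simp; ring

theorem act_X_pow (D : DiffOp) (a b : ℕ) :
    D.act (C (MvPowerSeries.X 0 ^ a * MvPowerSeries.X 1 ^ b : Series2)) =
      C (((MvPolynomial.eval (fun i => C (![(a : ℂ), b] i)) D : MvPolynomial (Fin 2) ℂ) : Series2) *
        (MvPowerSeries.X 0 ^ a * MvPowerSeries.X 1 ^ b : Series2)) := by
  induction D using MvPolynomial.induction_on' with
  | monomial k c =>
    have hC : ∀ (c : ℂ) (f : Series2) i j, (theta i)^[j] (C (MvPowerSeries.C c * f)) =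
        C (MvPowerSeries.C c) * (theta i)^[j] (C f) := by
      intro c f i j
      induction j with
      | zero => simp
      | succ j ih =>
        have h0 : thetaSeries i (MvPowerSeries.C c : Series2) = 0 := (thetaSeries i).map_algebraMap c
        rw [Function.iterate_succ_apply', ih, Function.iterate_succ_apply', theta_mul, theta_C, h0,
          map_zero, zero_mul, add_zero]
    rw [HalfK3.act_monomial, iterate_theta_X_pow, hC, iterate_theta_X_pow, MvPolynomial.eval_monomial,
      Finsupp.prod_fintype _ _ (by simp), Fin.prod_univ_two, ← map_pow, ← map_pow,
      MvPolynomial.coe_mul, MvPolynomial.coe_mul, MvPolynomial.coe_C, MvPolynomial.coe_C,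
      ← map_mul, ← map_mul]
    congr 1
    ring
  | add D E hD hE =>
    rw [act_add, hD, hE, map_add, MvPolynomial.coe_add, add_mul, map_add]

/-- On x^a y^b the operator acts as multiplication by its polynomial evaluated at (a, b), and a
polynomial vanishing on ℕ × ℕ is zero. This makes symbols well defined. -/
theorem eq_zero_of_act (D : DiffOp) (h : ∀ F, D.act F = 0) : D = 0 := by
  refine MvPolynomial.funext_set (fun _ : Fin 2 => Set.range fun a : ℕ => (C (a : ℂ) : MvPolynomial (Fin 2) ℂ))
    (fun _ => Set.infinite_range_of_injective fun a b hab => ?_) fun v hv => ?_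
  · exact_mod_cast MvPolynomial.C_injective _ _ hab
  · obtain ⟨a, ha⟩ := hv 0 trivial
    obtain ⟨b, hb⟩ := hv 1 trivial
    have hv' : v = fun i => C (![(a : ℂ), b] i) := by
      funext i
      fin_cases i
      · exact ha.symm
      · exact hb.symm
    have h1 := h (C (MvPowerSeries.X 0 ^ a * MvPowerSeries.X 1 ^ b : Series2))
    rw [act_X_pow, ← hv', map_eq_zero_iff _ (MvPolynomial.C_injective _ _), mul_eq_zero] at h1
    have hX : ∀ i : Fin 2, (MvPowerSeries.X i : Series2) ≠ 0 := fun i h => by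
      have := congrArg (MvPowerSeries.coeff (Finsupp.single i 1)) h
      simp at this
    rw [map_zero]
    rcases h1 with h1 | h1
    · exact MvPolynomial.coe_eq_zero_iff.mp h1
    · exact absurd h1 (mul_ne_zero (pow_ne_zero _ (hX _))
        (pow_ne_zero _ (hX _)))

theorem HasSymbol.unique (h : HasSymbol n s T) (h' : HasSymbol n t T) : s = t := by
  obtain ⟨hs, D, hD, h1⟩ := h
  obtain ⟨ht, E, hE, h2⟩ := h'
  have h3 : s + D - (t + E) = 0 := eq_zero_of_act _ fun F => by
    rw [HalfK3.act_sub, ← h1, ← h2, sub_self]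
  ext1 k
  by_cases hk : k.degree = n
  · have h4 := congrArg (coeff k) h3
    rw [MvPolynomial.coeff_sub, MvPolynomial.coeff_add, MvPolynomial.coeff_add, hD k hk.ge,
      hE k hk.ge, MvPolynomial.coeff_zero] at h4
    linear_combination h4
  · rw [hs.coeff_eq_zero hk, ht.coeff_eq_zero hk]

theorem HasSymbol.exists_pred (h : HasSymbol (n + 1) 0 T) : ∃ s, HasSymbol n s T := by
  obtain ⟨-, E, hE, h1⟩ := h
  refine ⟨MvPolynomial.homogeneousComponent n E,
    MvPolynomial.homogeneousComponent_isHomogeneous _ _,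
    E - MvPolynomial.homogeneousComponent n E, fun k hk => ?_, fun F => ?_⟩
  · rw [MvPolynomial.coeff_sub, MvPolynomial.coeff_homogeneousComponent]
    split_ifs with h
    · rw [sub_self]
    · rw [hE k (by omega), sub_zero]
  · rw [h1, zero_add, add_sub_cancel]

theorem HasSymbol.eq_zero (h : HasSymbol 0 0 T) (F : LogSeries) : T F = 0 := by
  obtain ⟨-, E, hE, h1⟩ := h
  have : E = 0 := by
    ext1 k; exact hE k (Nat.zero_le _)
  rw [h1, this, add_zero]; simp [DiffOp.act]

theorem hasSymbol_act (D : DiffOp) {n : ℕ} (hn : D.totalDegree ≤ n) :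
    HasSymbol n (MvPolynomial.homogeneousComponent n D) D.act := by
  refine ⟨MvPolynomial.homogeneousComponent_isHomogeneous _ _,
    D - MvPolynomial.homogeneousComponent n D, fun k hk => ?_, fun F => ?_⟩
  · rw [MvPolynomial.coeff_sub, MvPolynomial.coeff_homogeneousComponent]
    split_ifs with h
    · rw [sub_self]
    · rw [sub_zero]
      refine MvPolynomial.coeff_eq_zero_of_totalDegree_lt ?_
      have : k.degree = ∑ i ∈ k.support, k i := rfl
      omega
  · rw [add_sub_cancel]

theorem HasSymbol.homogeneousComponent_totalDegree {D : DiffOp} (h : HasSymbol n s D.act)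
    (hs : s ≠ 0) : MvPolynomial.homogeneousComponent D.totalDegree D = s := by
  have h1 : D.totalDegree = n := by
    rcases lt_trichotomy D.totalDegree n with h1 | h1 | h1
    · exact absurd (h.unique ((hasSymbol_act D le_rfl).weaken h1)) hs
    · exact h1
    · have h2 := (hasSymbol_act D le_rfl).unique (h.weaken h1)
      have h3 : D.support.Nonempty := by
        rw [MvPolynomial.support_nonempty]
        rintro rfl
        simp at h1
      obtain ⟨k, hk, hk'⟩ := Finset.exists_mem_eq_sup _ h3 fun k => k.sum fun _ e => e
      have h4 : k.degree = D.totalDegree := hk'.symm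
      have h5 := congrArg (coeff k) h2
      rw [MvPolynomial.coeff_homogeneousComponent, if_pos h4, MvPolynomial.coeff_zero] at h5
      exact absurd h5 (MvPolynomial.mem_support_iff.mp hk)
  have h2 := hasSymbol_act D le_rfl
  rw [h1] at h2 ⊢
  exact h2.unique h

/-! ### The characteristic variety of the hypergeometric system -/

/-- The principal symbol of `opX`. -/
def symX : DiffOp := X 0 * X 0 - X 0 * X 1 - C (432 * X 0) * (X 0 * X 0)

/-- The principal symbol of `opY`. -/
def symY : DiffOp := X 1 * X 1 + C (X 1) * (X 0 * X 1 - X 1 * X 1)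

theorem coe_ofNat_mul_X (n : ℕ) [n.AtLeastTwo] (i : Fin 2) :
    ((((ofNat(n) : MvPolynomial (Fin 2) ℂ) * X i : MvPolynomial (Fin 2) ℂ)) : Series2) =
      (ofNat(n) : Series2) * MvPowerSeries.X i := by
  rw [MvPolynomial.coe_mul, MvPolynomial.coe_X]
  congr 1
  exact map_ofNat (MvPolynomial.coeToMvPowerSeries.ringHom (σ := Fin 2) (R := ℂ)) n

theorem HasSymbol.theta_id (i : Fin 2) : HasSymbol 1 (X i) (HalfK3.theta i) := by
  have := HasSymbol.id.theta i
  rw [mul_one] at this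
  exact this

theorem HasSymbol.theta_theta (i j : Fin 2) :
    HasSymbol 2 (X i * X j) fun F => HalfK3.theta i (HalfK3.theta j F) :=
  (HasSymbol.theta_id j).theta i

theorem hasSymbol_opX : HasSymbol 2 symX opX.act := by
  have h := (((HasSymbol.theta_theta 0 0).sub (HasSymbol.theta_theta 0 1)).sub
    ((HasSymbol.theta_theta 0 0).C_mul (432 * X 0))).sub
    ((((HasSymbol.theta_id 0).C_mul (432 * X 0)).weaken (n := 2) one_lt_two).add
      ((HasSymbol.id.C_mul (60 * X 0)).weaken (n := 2) two_pos))
  rw [add_zero, sub_zero] at h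
  refine h.congr fun F => ?_
  rw [act_opX, coe_ofNat_mul_X, coe_ofNat_mul_X, map_mul, map_mul, map_ofNat, map_ofNat]
  ring

theorem hasSymbol_opY : HasSymbol 2 symY opY.act := by
  have h := (HasSymbol.theta_theta 1 1).add
    (((HasSymbol.theta_theta 0 1).sub (HasSymbol.theta_theta 1 1)).C_mul (X 1))
  refine h.congr fun F => ?_
  rw [act_opY, MvPolynomial.coe_X]

/-- The operator `opY - y θ_y`. -/
def twistY (F : LogSeries) : LogSeries := opY.act F - C (MvPowerSeries.X 1) * theta 1 F

theorem hasSymbol_twistY : HasSymbol 2 symY twistY := by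
  have h := hasSymbol_opY.sub (((HasSymbol.theta_id 1).C_mul (X 1)).weaken (n := 2) one_lt_two)
  rw [sub_zero] at h
  refine h.congr fun F => ?_
  rw [twistY, MvPolynomial.coe_X]

theorem thetaSeries_X (i j : Fin 2) : thetaSeries i (MvPowerSeries.X j : Series2) =
    if i = j then MvPowerSeries.X j else 0 := by
  change (MvPowerSeries.X i : Series2) • MvPowerSeries.pderiv ℂ i (MvPowerSeries.X j) = _
  split_ifs with h
  · subst h; simp
  · have : j ≠ i := fun h' => h h'.symm
    simp [this]

/-- The trivial syzygy of the two symbols lifts to an exact relation between operators. It plays the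
role of the criterion for a Gröbner basis of the left ideal. -/
theorem twistY_opX (F : LogSeries) : twistY (opX.act F) = opX.act (opY.act F) := by
  have h00 : thetaSeries 0 (MvPowerSeries.X 0 : Series2) = MvPowerSeries.X 0 := thetaSeries_X 0 0
  have h01 : thetaSeries 0 (MvPowerSeries.X 1 : Series2) = 0 := thetaSeries_X 0 1
  have h10 : thetaSeries 1 (MvPowerSeries.X 0 : Series2) = 0 := thetaSeries_X 1 0
  have h11 : thetaSeries 1 (MvPowerSeries.X 1 : Series2) = MvPowerSeries.X 1 := thetaSeries_X 1 1
  simp only [twistY, act_opX, act_opY, theta_add, theta_sub, theta_mul, theta_C, h00, h01, h10, h11,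
    theta_ofNat, map_zero, ← theta_comm, zero_mul, add_zero]
  ring

/-! ### The symbols have no common factor -/

theorem prime_X (i : Fin 2) : Prime (X i : DiffOp) := MvPolynomial.X_prime

/-- The factor `η + y (ξ - η)` of the symbol of `opY`. -/
def linY : DiffOp := X 1 + C (X 1) * (X 0 - X 1)

theorem symY_eq : symY = X 1 * linY := by rw [symY, linY]; ring

theorem aeval_linY (v : Fin 2 → DiffOp) :
    MvPolynomial.aeval (R := MvPolynomial (Fin 2) ℂ) v linY = v 1 + C (X 1) * (v 0 - v 1) := by
  rw [linY, map_add, map_mul, map_sub, MvPolynomial.aeval_X, MvPolynomial.aeval_X,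
    MvPolynomial.aeval_C]
  rfl

/-- A linear change of coordinates which takes `linY` to a coordinate. -/
def shear : DiffOp ≃ₐ[MvPolynomial (Fin 2) ℂ] DiffOp :=
  AlgEquiv.ofAlgHom
    (MvPolynomial.aeval ![X 0 + C (1 - X 1) * X 1, X 0 - C (X 1) * X 1])
    (MvPolynomial.aeval ![linY, X 0 - X 1])
    (by
      ext1 i
      rw [AlgHom.comp_apply, AlgHom.id_apply, MvPolynomial.aeval_X]
      fin_cases i
      · refine (aeval_linY _).trans ?_
        simp; ring
      · simp; ring)
    (by
      ext1 i
      rw [AlgHom.comp_apply, AlgHom.id_apply, MvPolynomial.aeval_X]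
      fin_cases i
      · simp [linY, MvPolynomial.algebraMap_eq]; ring
      · simp [linY, MvPolynomial.algebraMap_eq])

theorem shear_linY : shear linY = X 0 := by
  refine (aeval_linY _).trans ?_
  simp; ring

theorem prime_linY : Prime linY := by
  rw [← MulEquiv.prime_iff (shear : DiffOp ≃* DiffOp)]
  change Prime (shear linY)
  rw [shear_linY]
  exact prime_X 0

theorem symY_ne_zero : symY ≠ 0 := by
  rw [symY_eq]; exact mul_ne_zero (prime_X 1).ne_zero prime_linY.ne_zero

/-- Evaluation at `x = y = 0`. -/
def evalZero (v : Fin 2 → ℂ) : DiffOp →+* ℂ :=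
  (MvPolynomial.eval v).comp (MvPolynomial.map (MvPolynomial.eval 0))

theorem not_dvd_symX {L : DiffOp} (h : evalZero ![1, 0] L = 0) : ¬ L ∣ symX := by
  rintro ⟨M, hM⟩
  have h1 := congrArg (evalZero ![1, 0]) hM
  rw [map_mul, h, zero_mul] at h1
  simp [evalZero, symX] at h1

/-- The symbol of `opY` is a product of two primes, both zero at x = y = 0 on the covector (1, 0),
where the symbol of `opX` equals 1. -/
theorem dvd_of_symY_dvd {A : DiffOp} (h : symY ∣ symX * A) : symY ∣ A := by
  rw [symY_eq] at h ⊢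
  have h1 : ¬ (X 1 : DiffOp) ∣ symX := not_dvd_symX (by simp [evalZero])
  have h2 : ¬ linY ∣ symX := not_dvd_symX (by simp [evalZero, linY])
  obtain ⟨A, rfl⟩ := ((prime_X 1).dvd_or_dvd (dvd_of_mul_right_dvd h)).resolve_left h1
  rw [mul_left_comm] at h
  have h3 := (mul_dvd_mul_iff_left (prime_X 1).ne_zero).mp h
  exact mul_dvd_mul_left _ ((prime_linY.dvd_or_dvd h3).resolve_left h2)

theorem homogeneousComponent_mul (c : DiffOp) {q : DiffOp} {n : ℕ} (hq : q.IsHomogeneous n) (m : ℕ) :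
    MvPolynomial.homogeneousComponent m (c * q) =
      if n ≤ m then MvPolynomial.homogeneousComponent (m - n) c * q else 0 := by
  have h : ∀ i, MvPolynomial.homogeneousComponent m (MvPolynomial.homogeneousComponent i c * q) =
      if m = i + n then MvPolynomial.homogeneousComponent i c * q else 0 := fun i =>
    MvPolynomial.homogeneousComponent_of_mem
      ((MvPolynomial.homogeneousComponent_isHomogeneous i c).mul hq)
  conv_lhs => rw [← MvPolynomial.sum_homogeneousComponent c]
  rw [Finset.sum_mul, map_sum, Finset.sum_congr rfl fun i _ => h i]
  split_ifs with hnm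
  · have h2 : ∀ i, m = i + n ↔ m - n = i := fun i => by omega
    simp only [h2, Finset.sum_ite_eq]
    split_ifs with h3
    · rfl
    · rw [MvPolynomial.homogeneousComponent_eq_zero _ _ (by
        rw [Finset.mem_range] at h3; omega), zero_mul]
  · exact Finset.sum_eq_zero fun i _ => if_neg (by omega)

/-- The syzygies of the two symbols in a given degree. -/
theorem exists_syzygy {a b : DiffOp} {N : ℕ} (ha : a.IsHomogeneous N)
    (h : a * symX + b * symY = 0) : (a = 0 ∧ b = 0) ∨ ∃ c : DiffOp, ∃ M, N = 2 + M ∧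
      c.IsHomogeneous M ∧ a = c * symY ∧ b = -(c * symX) := by
  obtain ⟨c, hc⟩ : symY ∣ a := dvd_of_symY_dvd ⟨-b, by linear_combination h⟩
  have h1 := homogeneousComponent_mul c hasSymbol_opY.1 N
  rw [mul_comm c, ← hc, MvPolynomial.homogeneousComponent_eq_self ha] at h1
  split_ifs at h1 with h2
  · refine Or.inr ⟨MvPolynomial.homogeneousComponent (N - 2) c, N - 2, by omega,
      MvPolynomial.homogeneousComponent_isHomogeneous _ _, h1, ?_⟩
    refine mul_right_cancel₀ symY_ne_zero ?_
    rw [h1] at h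
    linear_combination h
  · refine Or.inl ⟨h1, ?_⟩
    rw [h1, zero_mul, zero_add] at h
    exact (mul_eq_zero.mp h).resolve_right symY_ne_zero

/-! ### The symbols of the left ideal -/

/-- Descent on the order of A and B in T = A opX + B opY. If the leading parts do not cancel, the
symbol of T lies in the ideal of the two symbols; if they cancel, they form a syzygy and can be
lowered without changing T. -/
theorem map_symbol_eq_zero (φ : DiffOp →+* ℂ) (hX : φ symX = 0) (hY : φ symY = 0) {d : ℕ}
    {s : DiffOp} {T : LogSeries → LogSeries} (hT : HasSymbol d s T) (N : ℕ) :
    ∀ (a b : DiffOp) (A B : LogSeries → LogSeries), HasSymbol N a A → HasSymbol N b B →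
      (∀ F, T F = A (opX.act F) + B (opY.act F)) → φ s = 0 := by
  have key : ∀ {N : ℕ} {a b : DiffOp} {A B : LogSeries → LogSeries}, HasSymbol N a A →
      HasSymbol N b B → (∀ F, T F = A (opX.act F) + B (opY.act F)) →
      HasSymbol (2 + N) (a * symX + b * symY) T := fun hA hB h =>
    ((hA.comp hasSymbol_opX).add (hB.comp hasSymbol_opY)).congr h
  induction N with
  | zero =>
    intro a b A B hA hB h
    have h1 := key hA hB h
    rcases lt_trichotomy d (2 + 0) with hd | rfl | hd
    · rcases exists_syzygy hA.1 (h1.unique (hT.weaken hd)) with ⟨rfl, rfl⟩ | ⟨c, M, hM, -⟩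
      · have h3 : HasSymbol d 0 T := (HasSymbol.zero d).congr fun F => by
          rw [h, hA.eq_zero, hB.eq_zero, add_zero]
        rw [hT.unique h3, map_zero]
      · omega
    · rw [hT.unique h1, map_add, map_mul, map_mul, hX, hY, mul_zero, mul_zero, add_zero]
    · rw [hT.unique (h1.weaken hd), map_zero]
  | succ N ih =>
    intro a b A B hA hB h
    have h1 := key hA hB h
    rcases lt_trichotomy d (2 + (N + 1)) with hd | rfl | hd
    · rcases exists_syzygy hA.1 (h1.unique (hT.weaken hd)) with
        ⟨rfl, rfl⟩ | ⟨c, M, hM, hc, rfl, rfl⟩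
      · obtain ⟨a', hA'⟩ := hA.exists_pred
        obtain ⟨b', hB'⟩ := hB.exists_pred
        exact ih a' b' A B hA' hB' h
      · have hA2 := hA
        have hB2 := hB
        rw [hM] at hA2 hB2
        -- The leading parts are c · symY and -c · symX. Subtracting c ∘ `twistY` from A and adding
        -- c ∘ `opX` to B leaves T unchanged, by `twistY_opX`, and lowers both orders.
        have hA3 := hA2.sub (hasSymbol_twistY.act_isHomogeneous hc)
        have hB3 := hB2.add (hasSymbol_opX.act_isHomogeneous hc)
        rw [sub_self, ← hM] at hA3
        rw [neg_add_cancel, ← hM] at hB3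
        obtain ⟨a', hA'⟩ := hA3.exists_pred
        obtain ⟨b', hB'⟩ := hB3.exists_pred
        refine ih a' b' _ _ hA' hB' fun F => ?_
        rw [h, twistY_opX]
        ring
    · rw [hT.unique h1, map_add, map_mul, map_mul, hX, hY, mul_zero, mul_zero, add_zero]
    · rw [hT.unique (h1.weaken hd), map_zero]

/-- Evaluation of a symbol at a point and a covector. -/
def evalSymbol (z v : Fin 2 → ℂ) : DiffOp →+* ℂ :=
  (MvPolynomial.eval v).comp (MvPolynomial.map (MvPolynomial.eval z))

theorem act_zero_apply (F : LogSeries) : DiffOp.act 0 F = 0 := by simp [DiffOp.act]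

theorem symbol_eq {D s : DiffOp} {n : ℕ} (h : HasSymbol n s D.act) {z v : Fin 2 → ℂ}
    (hs : s ≠ 0) : D.symbol z v = evalSymbol z v s := by
  rw [DiffOp.symbol, h.homogeneousComponent_totalDegree hs]; rfl

theorem evalSymbol_symX (z v : Fin 2 → ℂ) :
    evalSymbol z v symX = v 0 * v 0 - v 0 * v 1 - 432 * z 0 * (v 0 * v 0) := by
  simp [evalSymbol, symX]

theorem evalSymbol_symY (z v : Fin 2 → ℂ) :
    evalSymbol z v symY = v 1 * v 1 + z 1 * (v 0 * v 1 - v 1 * v 1) := by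
  simp [evalSymbol, symY]

theorem symX_ne_zero : symX ≠ 0 := by
  intro h
  have := evalSymbol_symX 0 ![1, 0]
  rw [h, map_zero] at this
  simp at this

/-- The characteristic variety is cut out by the two principal symbols. -/
theorem inCharVariety_iff (z v : Fin 2 → ℂ) : InCharVariety z v ↔
    evalSymbol z v symX = 0 ∧ evalSymbol z v symY = 0 := by
  have h1 : ∀ F, DiffOp.act 1 F = F := fun F => by
    have := act_C 1 F
    simpa using this
  constructor
  · intro h
    constructor
    · rw [← symbol_eq hasSymbol_opX symX_ne_zero]
      exact h opX ⟨1, 0, fun F => by rw [h1, act_zero_apply, add_zero]⟩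
    · rw [← symbol_eq hasSymbol_opY symY_ne_zero]
      exact h opY ⟨0, 1, fun F => by rw [h1, act_zero_apply, zero_add]⟩
  · rintro ⟨hX, hY⟩ D ⟨A, B, hD⟩
    exact map_symbol_eq_zero (evalSymbol z v) hX hY (hasSymbol_act D le_rfl)
      (max A.totalDegree B.totalDegree) _ _ _ _ (hasSymbol_act A (le_max_left _ _))
      (hasSymbol_act B (le_max_right _ _)) hD

/-- The symbol of `opX` forces v₀ = 0 or v₁ = (1 - 432x) v₀. In the first case the symbol of `opY`
gives y = 1; in the second it gives (1 - 432x)(1 - 432x(1 - y)) = 0. -/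
theorem mem_discriminantLocus_iff {z : Fin 2 → ℂ} (h0 : z 0 ≠ 0) (h1 : z 1 ≠ 0) :
    z ∈ discriminantLocus ↔ (1 - 432 * z 0) * dis0 (z 0) (z 1) = 0 := by
  rw [discriminantLocus, Set.mem_ofPred_eq, dis0]
  simp only [h0, h1, ne_eq, not_false_eq_true, true_and, inCharVariety_iff, evalSymbol_symX,
    evalSymbol_symY]
  constructor
  · rintro ⟨v, hv, hX, hY⟩
    by_cases hv0 : v 0 = 0
    · have hv1 : v 1 ≠ 0 := fun hv1 => hv (by
        funext i; fin_cases i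
        · exact hv0
        · exact hv1)
      have h2 : (1 - z 1) = 0 := by
        have : v 1 * v 1 * (1 - z 1) = 0 := by rw [hv0] at hY; linear_combination hY
        exact (mul_eq_zero.mp this).resolve_left (mul_ne_zero hv1 hv1)
      rw [h2]; ring
    · have h2 : v 1 = (1 - 432 * z 0) * v 0 := by
        refine mul_left_cancel₀ hv0 ?_
        linear_combination -hX
      rw [h2] at hY
      have h3 : v 0 * v 0 * ((1 - 432 * z 0) * (1 - 432 * z 0 * (1 - z 1))) = 0 := by
        linear_combination hY
      rw [← mul_assoc (1 - 432 * z 0),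
        (mul_eq_zero.mp h3).resolve_left (mul_ne_zero hv0 hv0), zero_mul]
  · intro h
    -- Each component has its own covector: (1, 0) over 432x = 1, (1, 1 - 432x) over 432x(1 - y) =
    -- 1, and (0, 1) over y = 1.
    rcases mul_eq_zero.mp h with h | h
    · refine ⟨![1, 0], fun h => by simpa using congrFun h 0, ?_, by simp⟩
      simp; linear_combination h
    rcases mul_eq_zero.mp h with h | h
    · refine ⟨![1, 1 - 432 * z 0], fun h => by simpa using congrFun h 0, ?_, ?_⟩
      · simp
      · simp; linear_combination (1 - 432 * z 0) * h
    · refine ⟨![0, 1], fun h => by simpa using congrFun h 1, by simp, ?_⟩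
      simp; linear_combination h

end

end HalfK3

end

/-! ### The proposition. -/

theorem proposition4p2 :
    ∃ (x : PowerSeries ℂ) (y h : HalfK3.Series2),
      -- the mirror map: the inverse relation exists, is unique, and is lower triangular
      HalfK3.IsInverseMirrorMap (HalfK3.inFirst x) y ∧
      (∀ x' y' : HalfK3.Series2, HalfK3.IsInverseMirrorMap x' y' →
        x' = HalfK3.inFirst x ∧ y' = y) ∧
      x * (1 - 432 * x) = HalfK3.toComplex HalfK3.jInv ∧
      -- `w₀(x, y) = w₀(x)` and `w₀ = E₄ ^ (1/4)`
      MvPowerSeries.pderiv ℂ 1 HalfK3.w0 = 0 ∧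
      HalfK3.comp HalfK3.w0 (HalfK3.inFirst x) y =
        HalfK3.fpow (HalfK3.inFirst (HalfK3.toComplex HalfK3.E4)) (1 / 4) ∧
      -- the logarithms cancel in `∂_{ρ₁} ∂_{ρ₂} w₀ / w₀ - (2 π √-1 t₁) (2 π √-1 t₂)`
      MvPolynomial.C HalfK3.w0⁻¹ * HalfK3.dw 1 1 - HalfK3.logT1 * HalfK3.logT2 =
        MvPolynomial.C h ∧
      -- the solution `Z_{0;n}`, `Z_{1;n}` of the holomorphic anomaly equation exists
      (∃ Z, HalfK3.IsAnomalySolution 1 Z) ∧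
      (∀ Z, HalfK3.IsAnomalySolution 1 Z →
        -- `p ∂F₀/∂p = (2 π √-1)⁻¹ ∂F₀/∂t₂`
        MvPowerSeries.X 1 * MvPowerSeries.pderiv ℂ 1 (HalfK3.genF Z 0) =
          -HalfK3.posPart (HalfK3.comp h (HalfK3.inFirst x) y) ∧
        -- `∂y/∂p = (2 π √-1 p)⁻¹ ∂y/∂t₂`
        HalfK3.genF Z 1 = HalfK3.posPart ((1 / 2 : ℂ) • HalfK3.flog
          (HalfK3.fpow (HalfK3.dis0 (HalfK3.inFirst x) y) (-1 / 6) *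
            MvPowerSeries.pderiv ℂ 1 y))) ∧
      -- the differential equations satisfied by the hypergeometric series
      (∀ F ∈ ({HalfK3.dw 0 0, HalfK3.dw 1 0, HalfK3.dw 0 1,
          2 • HalfK3.dw 1 1 + HalfK3.dw 2 0} : Set HalfK3.LogSeries),
        HalfK3.opX.act F = 0 ∧ HalfK3.opY.act F = 0) ∧
      -- `dis₀` is a component of the discriminant
      (∀ z : Fin 2 → ℂ, z 0 ≠ 0 → z 1 ≠ 0 →
        (z ∈ HalfK3.discriminantLocus ↔
          (1 - 432 * z 0) * HalfK3.dis0 (z 0) (z 1) = 0)) := by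
  refine ⟨HalfK3.xQ, HalfK3.yQ, HalfK3.hSeries, HalfK3.isInverseMirrorMap,
    fun _ _ h => HalfK3.inverseMirrorMap_unique h, HalfK3.xQ_jInv, ?_, ?_,
    HalfK3.logarithms_cancel, ⟨_, HalfK3.isAnomalySolution_zPot⟩, fun Z hZ => ⟨?_, ?_⟩,
    HalfK3.hypergeometric_system, fun z h0 h1 => HalfK3.mem_discriminantLocus_iff h0 h1⟩
  · rw [HalfK3.w0_eq, HalfK3.pderiv_one_inFirst]
  · rw [← HalfK3.pull2_apply, HalfK3.pull2_w0, HalfK3.fpow_E4, HalfK3.inFirstHom_apply]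
  · rw [HalfK3.genF_eq_evalT hZ zero_le_one, ← HalfK3.pull2_apply, ← HalfK3.thetaP_potential_zero]
    rfl
  · rw [HalfK3.genF_eq_evalT hZ le_rfl, HalfK3.potential_one]
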